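/- Setting. Let $\eta_{ab}=\mathrm{diag}(\pm1,\pm1)$ $(a,b\in\{0,1\})$ have arbitrary signature and put $\eta=\det(\eta_{ab})=\pm1$. Let $\gamma_a$ be complex $2\times2$ matrices with $\gamma_a\gamma_b+\gamma_b\gamma_a=2\eta_{ab}\mathbb I$, and put $\gamma=\gamma_0\gamma_1$, $\gamma_{ab}=\gamma_{[a}\gamma_{b]}$. Let $M$ be a connected paracompact 2-dimensional spin manifold: there is a $\mathrm{Spin}(\eta)$-principal bundle over $M$ with a global spin frame, locally $e_a=e_a^\mu\partial_\mu$ with inverse $e^a_\mu$. The frame induces the metric $g_{\mu\nu}=e^a_\mu\eta_{ab}e^b_\nu$, its Levi-Civita covariant derivative $\nabla$ (with $\nabla_a=e_a^\mu\nabla_\mu$, $\nabla_{ab}=\nabla_a\nabla_b$ on functions), the spin connection $\Gamma^{ab}_\mu=e^a_\alpha(\Gamma^\alpha_{\beta\mu}e^{b\beta}+\partial_\mu e^{b\alpha})$, and the scalar curvature $R=R^{ab}{}_{ab}$, where $[\nabla_\mu,\nabla_\nu]v^a=R^a{}_{b\mu\nu}v^b$. Frame indices are raised and lowered with $\eta_{ab}$,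 also those of $\epsilon_{ab}$, $\epsilon_{01}=1$. Let $A_\mu$ be an electromagnetic potential (a connection on a $U(1)$-bundle), $q\in\mathbb R$ the charge, $F_{\mu\nu}=\partial_\mu A_\nu-\partial_\nu A_\mu$, and let $F=F_{01}$ be its frame component, so $F_{ab}=F\epsilon_{ab}$. Let $V,\hat V:M\to\mathbb C$ be smooth scalar and pseudoscalar potentials. On smooth spinor fields put $$D_\mu\psi=\partial_\mu\psi+\tfrac14\Gamma^{ab}_\mu\gamma_{ab}\psi-iqA_\mu\psi,\qquad D_a=e_a^\mu D_\mu,\qquad D_{ab}=\tfrac12(D_aD_b+D_bD_a)$$ (second covariant derivatives), and $\mathbb D\psi=i\gamma^aD_a\psi-(V\mathbb I+\hat V\gamma)\psi$. Statement. Let $\mathbb K=\mathbb E^{ab}D_{ab}+\mathbb F^aD_a+\mathbb G$, where $\mathbb E^{ab}=\mathbb E^{ba}$, $\mathbb F^a$, $\mathbb G$ are smooth matrix-valued tensor fields. Then $\mathbb K$ is a second order symmetry operator, that is, $\mathbb K\mathbb D\psi=\mathbb D\mathbb K\psi$ for all smooth spinor fields $\psi$, if and only if there are smooth complex tensor fields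 $e^{ab}=e^{ba}$, $\alpha^a$, $\zeta^a$ and smooth functions $\alpha,g':M\to\mathbb C$ such that (A), (B), (C) hold everywhere. Here $$\omega_c=2i(qF\epsilon_{cd}\alpha^d+e_c{}^d\nabla_dV),\qquad \Lambda^{ca}=4i\big(qF\epsilon^{(c}{}_be^{a)b}+\alpha^{(a}\nabla^{c)}V+\alpha^b\nabla_bV\,\eta^{ac}\big),\qquad \Lambda=\eta_{ca}\Lambda^{ca},$$ $$\Lambda_c=iqF\epsilon_{ca}\zeta^a-\tfrac14\nabla_a(Re^a{}_c)-i\omega_cV+\eta\Big(i\alpha^a\nabla_{ab}\hat V\,\epsilon^b{}_c-\tfrac i2R\,\alpha_a\hat V\epsilon^a{}_c+e_c{}^b\nabla_b(\hat V^2)\Big).$$ (A) Explicit form of the coefficients: $$\mathbb E^{ab}=e^{ab}\mathbb I+2\alpha^{(a}\gamma^{b)},$$ $$\mathbb F^a=(\zeta^a+\nabla_be^{ab})\mathbb I+(\alpha\delta^a_c+\nabla_c\alpha^a)\gamma^c+\big(\tfrac13\epsilon_{cb}\nabla^ce^{ab}+2i\alpha^a\hat V\big)\gamma,$$ $$\mathbb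 G=(g'+3i\alpha^a\nabla_aV+i\alpha V)\mathbb I+\big(iqF\epsilon_{ab}\alpha^b+ie_a{}^b\nabla_bV-\tfrac14R\alpha_a-i\eta\,e^{cb}\nabla_b\hat V\,\epsilon_{ac}\big)\gamma^a$$ $$\qquad+\big(\tfrac14(\nabla^c\zeta^a-2iqF\epsilon^c{}_be^{ab}-2i\alpha^a\nabla^cV)\epsilon_{ca}+i\alpha^a\nabla_a\hat V+i\alpha\hat V\big)\gamma.$$ (B) Determining equations: $\nabla^{(c}e^{ab)}=0$ ($e^{ab}$ is a Killing tensor), $\nabla^{(a}\alpha^{b)}=0$ ($\alpha^a$ is a Killing vector), $\nabla_a\alpha=\omega_a$, $\nabla^{(c}\zeta^{a)}=\tfrac12\Lambda^{ca}$, $\nabla_ag'=\Lambda_a$. (C) Integrability conditions: $$\epsilon^{bc}\nabla_b\omega_c=0,\quad\text{and hence}\quad q\,\alpha^c\nabla_cF=-\eta\,\epsilon^{ac}\nabla_c(e_a{}^b\nabla_bV),$$ $$\epsilon^{dc}\nabla_d\Lambda_c=0,$$ $$\zeta^a\nabla_aR=\eta\,\nabla_c(\nabla^b\Lambda^{da})\,\epsilon^c{}_d\,\epsilon_{ab}-\tfrac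 R2\Lambda,$$ $$\zeta^a\nabla_aV=-\eta\big(\tfrac23\nabla_ae^{bc}\nabla_c\hat V\,\epsilon^a{}_b+e^{bc}\nabla_{ac}\hat V\,\epsilon^a{}_b-i\alpha^a\nabla_a(\hat V^2)\big),$$ $$\zeta^a\nabla_a\hat V=\tfrac23\epsilon_{cb}\nabla^ce^{ab}\nabla_aV+\epsilon^c{}_be^{ab}\nabla_{ca}V-2i\alpha^a(\nabla_aV)\hat V.$$ -/

import Mathlib

open scoped Manifold ContDiff Matrix

noncomputable section

namespace SpinSurface

/-! ### Signature, Levi-Civita symbol, Dirac matrices -/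

/-- The model space `ℝ²` of the coordinate charts. -/
abbrev Plane := EuclideanSpace ℝ (Fin 2)

/-- A nondegenerate signature in dimension two: `η_{ab} = diag(s 0, s 1)` with `s a = ±1`. The
inverse matrix `η^{ab}` has the same entries, so raising or lowering the frame index `a` is
multiplication by `s a`. -/
structure Signature where
  s : Fin 2 → ℝ
  sq : ∀ a, s a = 1 ∨ s a = -1

/-- `s a` as a complex number. -/
def Signature.sgn (σ : Signature) (a : Fin 2) : ℂ := (σ.s a : ℂ)

/-- The components `η_{ab} = η^{ab}`. -/
def Signature.eta (σ : Signature) (a b : Fin 2) : ℂ := if a = b then σ.sgn a else 0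

/-- The determinant `η = ±1` of `η_{ab}`. -/
def Signature.det (σ : Signature) : ℂ := σ.sgn 0 * σ.sgn 1

/-- The Levi-Civita tensor `ε_{ab}` in an orthonormal frame, `ε_{01} = 1`. -/
def eps (a b : Fin 2) : ℂ := !![0, 1; -1, 0] a b

/-- `ε^a{}_b = η^{ac} ε_{cb}`. -/
def Signature.epsMixed (σ : Signature) (a b : Fin 2) : ℂ := σ.sgn a * eps a b

/-- `ε^{ab} = η^{ac} η^{bd} ε_{cd}`. -/
def Signature.epsUp (σ : Signature) (a b : Fin 2) : ℂ := σ.sgn a * σ.sgn b * eps a b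

/-- Dirac matrices `γ_a`: `γ_a γ_b + γ_b γ_a = 2 η_{ab} 𝕀`. -/
structure DiracMatrices (σ : Signature) where
  low : Fin 2 → Matrix (Fin 2) (Fin 2) ℂ
  clifford : ∀ a b, low a * low b + low b * low a =
    (2 * σ.eta a b) • (1 : Matrix (Fin 2) (Fin 2) ℂ)

/-- `γ^a = η^{ab} γ_b`. -/
def DiracMatrices.up {σ : Signature} (γ : DiracMatrices σ) (a : Fin 2) :
    Matrix (Fin 2) (Fin 2) ℂ := σ.sgn a • γ.low a

/-- `γ = γ_0 γ_1`. -/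
def DiracMatrices.vol {σ : Signature} (γ : DiracMatrices σ) : Matrix (Fin 2) (Fin 2) ℂ :=
  γ.low 0 * γ.low 1

/-- `γ_{ab} = γ_{[a} γ_{b]}`. -/
def DiracMatrices.bi {σ : Signature} (γ : DiracMatrices σ) (a b : Fin 2) :
    Matrix (Fin 2) (Fin 2) ℂ :=
  (1 / 2 : ℂ) • (γ.low a * γ.low b - γ.low b * γ.low a)

/-- The matrix `v 𝕀 + w_c γ^c + u γ`. -/
def DiracMatrices.expand {σ : Signature} (γ : DiracMatrices σ) (v : ℂ) (w : Fin 2 → ℂ) (u : ℂ) :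
    Matrix (Fin 2) (Fin 2) ℂ :=
  v • (1 : Matrix (Fin 2) (Fin 2) ℂ) + ∑ c, w c • γ.up c + u • γ.vol

/-- Membership in `Spin(η)`, the group of products of an even number of vectors of square `±1` of
the Clifford algebra. In dimension two these products are the even elements `x + y γ`
(`x`, `y` real) with `(x + y γ) (x - y γ) = x² + η y² = ±1`. -/
def DiracMatrices.IsSpin {σ : Signature} (γ : DiracMatrices σ) (S : Matrix (Fin 2) (Fin 2) ℂ) :
    Prop :=
  ∃ x y : ℝ, (x ^ 2 + σ.s 0 * σ.s 1 * y ^ 2 = 1 ∨ x ^ 2 + σ.s 0 * σ.s 1 * y ^ 2 = -1) ∧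
    S = (x : ℂ) • (1 : Matrix (Fin 2) (Fin 2) ℂ) + (y : ℂ) • γ.vol

/-! ### Spin manifolds, electromagnetic potentials, spinor and tensor fields

Principal bundles are given by local trivialisations, indexed by `ι`, with their transition
functions. Each trivialisation lives over the domain of a coordinate chart. Local quantities are
functions on `M`; only their restriction to that domain matters. -/

section Bundles

variable {M : Type*} [TopologicalSpace M]

/-- The partial derivative `∂_μ f` at `p` in the coordinate chart `φ`. -/
def pd (φ : OpenPartialHomeomorph M Plane) (μ : Fin 2) {W : Type*} [NormedAddCommGroup W]
    [NormedSpace ℝ W] (f : M → W) (p : M) : W :=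
  fderiv ℝ (fun x => f (φ.symm x)) (φ p) (EuclideanSpace.single μ (1 : ℝ))

/-- The `(ν, μ)` entry `∂y^ν/∂x^μ` of the Jacobian matrix of the coordinate change from the chart
`φ`, with coordinates `x`, to the chart `χ`, with coordinates `y`. -/
def jac (φ χ : OpenPartialHomeomorph M Plane) (ν μ : Fin 2) (p : M) : ℝ :=
  pd φ μ (fun r => χ r ν) p

variable [ChartedSpace Plane M]

/-- A spin manifold structure on the surface `M` with Dirac matrices `γ`: a `Spin(η)`-principal
bundle `P → M` (transition functions `spinT i j`) with a global spin frame `P → L(M)`, whose local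
expression is `e_a = e_a^μ ∂_μ`, `e_a^μ = frame i a μ`. -/
structure SpinManifold (M : Type*) [TopologicalSpace M] [ChartedSpace Plane M] {σ : Signature}
    (γ : DiracMatrices σ) (ι : Type*) where
  /-- the coordinates of the `i`-th trivialisation -/
  chart : ι → OpenPartialHomeomorph M Plane
  chart_mem : ∀ i, chart i ∈ IsManifold.maximalAtlas (𝓡 2) ∞ M
  cover : ∀ p, ∃ i, p ∈ (chart i).source
  /-- the local spin frame `e_a^μ` -/
  frame : ι → Fin 2 → Fin 2 → M → ℝ
  frame_smooth : ∀ i a μ, ContMDiffOn (𝓡 2) 𝓘(ℝ, ℝ) ∞ (frame i a μ) (chart i).source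
  frame_det : ∀ i, ∀ p ∈ (chart i).source, (Matrix.of fun a μ => frame i a μ p).det ≠ 0
  /-- the transition functions `S` of the spin bundle -/
  spinT : ι → ι → M → Matrix (Fin 2) (Fin 2) ℂ
  spinT_smooth : ∀ i j k l, ContMDiffOn (𝓡 2) 𝓘(ℝ, ℂ) ∞ (fun p => spinT i j p k l)
    ((chart i).source ∩ (chart j).source)
  spinT_mem : ∀ i j, ∀ p ∈ (chart i).source ∩ (chart j).source, γ.IsSpin (spinT i j p)
  spinT_self : ∀ i, ∀ p ∈ (chart i).source, spinT i i p = 1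
  spinT_cocycle : ∀ i j k, ∀ p ∈ (chart i).source ∩ (chart j).source ∩ (chart k).source,
    spinT i j p * spinT j k p = spinT i k p
  /-- the image `ℓ_a{}^b` of `S` in the special orthogonal group: `S⁻¹ γ_a S = ℓ_a{}^b γ_b` -/
  rot : ι → ι → M → Fin 2 → Fin 2 → ℝ
  rot_spec : ∀ i j, ∀ p ∈ (chart i).source ∩ (chart j).source, ∀ a,
    (spinT i j p)⁻¹ * γ.low a * spinT i j p = ∑ b, (rot i j p a b : ℂ) • γ.low b
  /-- the frames of two trivialisations are related by `ℓ` -/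
  frame_trans : ∀ i j, ∀ p ∈ (chart i).source ∩ (chart j).source, ∀ a μ,
    frame i a μ p =
      ∑ b, rot i j p a b * ∑ ν, jac (chart j) (chart i) μ ν p * frame j b ν p

namespace SpinManifold

variable {σ : Signature} {γ : DiracMatrices σ} {ι : Type*}

/-- The domain of the `i`-th trivialisation. -/
def dom (𝒮 : SpinManifold M γ ι) (i : ι) : Set M := (𝒮.chart i).source

/-- An electromagnetic potential for particles of charge `q`: local covectors `A_μ`, and the
`U(1)`-valued transition functions `u` of the line bundle in which charged fields take their values,
with `i q A_μ` as its connection form: `∂_μ u = i q (A_μ - A'_μ) u`. -/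
structure Potential (𝒮 : SpinManifold M γ ι) (q : ℝ) where
  A : ι → Fin 2 → M → ℝ
  A_smooth : ∀ i μ, ContMDiffOn (𝓡 2) 𝓘(ℝ, ℝ) ∞ (A i μ) (𝒮.dom i)
  phase : ι → ι → M → ℂ
  phase_smooth : ∀ i j, ContMDiffOn (𝓡 2) 𝓘(ℝ, ℂ) ∞ (phase i j) (𝒮.dom i ∩ 𝒮.dom j)
  phase_norm : ∀ i j, ∀ p ∈ 𝒮.dom i ∩ 𝒮.dom j, ‖phase i j p‖ = 1
  phase_self : ∀ i, ∀ p ∈ 𝒮.dom i, phase i i p = 1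
  phase_cocycle : ∀ i j k, ∀ p ∈ 𝒮.dom i ∩ 𝒮.dom j ∩ 𝒮.dom k,
    phase i j p * phase j k p = phase i k p
  A_trans : ∀ i j, ∀ p ∈ 𝒮.dom i ∩ 𝒮.dom j, ∀ μ,
    pd (𝒮.chart i) μ (phase i j) p =
      Complex.I * q *
        ((A i μ p - ∑ ν, A j ν p * jac (𝒮.chart i) (𝒮.chart j) ν μ p : ℝ) : ℂ) * phase i j p

/-- A smooth spinor field: a section of the bundle `Σ` associated to `P ×_M Q`. -/
structure SpinorField (𝒮 : SpinManifold M γ ι) {q : ℝ} (𝒜 : 𝒮.Potential q) where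
  val : ι → M → Fin 2 → ℂ
  smooth : ∀ i, ContMDiffOn (𝓡 2) 𝓘(ℝ, Fin 2 → ℂ) ∞ (val i) (𝒮.dom i)
  trans : ∀ i j, ∀ p ∈ 𝒮.dom i ∩ 𝒮.dom j,
    val i p = 𝒜.phase i j p • (𝒮.spinT i j p *ᵥ val j p)

/-- A smooth complex vector field on `M`, by its frame components `v^a`. -/
structure VectorField (𝒮 : SpinManifold M γ ι) where
  val : ι → Fin 2 → M → ℂ
  smooth : ∀ i a, ContMDiffOn (𝓡 2) 𝓘(ℝ, ℂ) ∞ (val i a) (𝒮.dom i)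
  trans : ∀ i j, ∀ p ∈ 𝒮.dom i ∩ 𝒮.dom j, ∀ b,
    val j b p = ∑ a, (𝒮.rot i j p a b : ℂ) * val i a p

/-- A smooth complex symmetric contravariant 2-tensor field on `M`, by its frame components
`e^{ab}`. -/
structure SymTensorField (𝒮 : SpinManifold M γ ι) where
  val : ι → Fin 2 → Fin 2 → M → ℂ
  smooth : ∀ i a b, ContMDiffOn (𝓡 2) 𝓘(ℝ, ℂ) ∞ (val i a b) (𝒮.dom i)
  symm : ∀ i a b, ∀ p ∈ 𝒮.dom i, val i a b p = val i b a p
  trans : ∀ i j, ∀ p ∈ 𝒮.dom i ∩ 𝒮.dom j, ∀ c d,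
    val j c d p = ∑ a, ∑ b, (𝒮.rot i j p a c : ℂ) * (𝒮.rot i j p b d : ℂ) * val i a b p

/-- The coefficients of a second order operator `𝕂 = 𝔼^{ab} D_{ab} + 𝔽^a D_a + 𝔾` on spinor fields:
smooth matrix-valued tensor fields, with `𝔼^{ab}` symmetric. -/
structure Operator2 (𝒮 : SpinManifold M γ ι) where
  E : ι → Fin 2 → Fin 2 → M → Matrix (Fin 2) (Fin 2) ℂ
  F : ι → Fin 2 → M → Matrix (Fin 2) (Fin 2) ℂ
  G : ι → M → Matrix (Fin 2) (Fin 2) ℂ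
  E_smooth : ∀ i a b k l, ContMDiffOn (𝓡 2) 𝓘(ℝ, ℂ) ∞ (fun p => E i a b p k l) (𝒮.dom i)
  F_smooth : ∀ i a k l, ContMDiffOn (𝓡 2) 𝓘(ℝ, ℂ) ∞ (fun p => F i a p k l) (𝒮.dom i)
  G_smooth : ∀ i k l, ContMDiffOn (𝓡 2) 𝓘(ℝ, ℂ) ∞ (fun p => G i p k l) (𝒮.dom i)
  E_symm : ∀ i a b, ∀ p ∈ 𝒮.dom i, E i a b p = E i b a p
  E_trans : ∀ i j, ∀ p ∈ 𝒮.dom i ∩ 𝒮.dom j, ∀ c d,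
    𝒮.spinT i j p * E j c d p =
      (∑ a, ∑ b, ((𝒮.rot i j p a c : ℂ) * (𝒮.rot i j p b d : ℂ)) • E i a b p) * 𝒮.spinT i j p
  F_trans : ∀ i j, ∀ p ∈ 𝒮.dom i ∩ 𝒮.dom j, ∀ c,
    𝒮.spinT i j p * F j c p = (∑ a, (𝒮.rot i j p a c : ℂ) • F i a p) * 𝒮.spinT i j p
  G_trans : ∀ i j, ∀ p ∈ 𝒮.dom i ∩ 𝒮.dom j,
    𝒮.spinT i j p * G j p = G i p * 𝒮.spinT i j p

/-! ### Metric, connection, curvature, field strength -/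

variable (𝒮 : SpinManifold M γ ι)

/-- The inverse `e^a_μ` of the frame matrix `e_a^μ`. -/
def coframe (i : ι) (a μ : Fin 2) (p : M) : ℝ :=
  (Matrix.of fun b ν => 𝒮.frame i b ν p)⁻¹ μ a

/-- The induced metric `g_{μν} = e^a_μ η_{ab} e^b_ν`. -/
def metric (i : ι) (μ ν : Fin 2) (p : M) : ℝ :=
  ∑ a, σ.s a * 𝒮.coframe i a μ p * 𝒮.coframe i a ν p

/-- The inverse metric `g^{μν}`. -/
def metricInv (i : ι) (μ ν : Fin 2) (p : M) : ℝ :=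
  (Matrix.of fun ρ τ => 𝒮.metric i ρ τ p)⁻¹ μ ν

/-- The Christoffel symbols `Γ^α_{βμ}` of the induced metric. -/
def christoffel (i : ι) (α β μ : Fin 2) (p : M) : ℝ :=
  (1 / 2) * ∑ l, 𝒮.metricInv i α l p *
    (pd (𝒮.chart i) μ (𝒮.metric i l β) p + pd (𝒮.chart i) β (𝒮.metric i l μ) p
      - pd (𝒮.chart i) l (𝒮.metric i β μ) p)

/-- The spin connection `Γ^{ab}_μ = e^a_α (Γ^α_{βμ} e^{bβ} + ∂_μ e^{bα})`. -/
def spinConn (i : ι) (a b μ : Fin 2) (p : M) : ℝ :=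
  ∑ α, 𝒮.coframe i a α p *
    (∑ β, 𝒮.christoffel i α β μ p * (σ.s b * 𝒮.frame i b β p)
      + σ.s b * pd (𝒮.chart i) μ (𝒮.frame i b α) p)

/-- The curvature `R^{ab}{}_{μν}` of the spin connection, so that
`[∇_μ, ∇_ν] v^a = R^a{}_{bμν} v^b`. -/
def curvature (i : ι) (a b μ ν : Fin 2) (p : M) : ℝ :=
  pd (𝒮.chart i) μ (𝒮.spinConn i a b ν) p - pd (𝒮.chart i) ν (𝒮.spinConn i a b μ) p
    + ∑ c, (𝒮.spinConn i a c μ p * σ.s c * 𝒮.spinConn i c b ν p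
      - 𝒮.spinConn i a c ν p * σ.s c * 𝒮.spinConn i c b μ p)

/-- The scalar curvature `R = R^{ab}{}_{ab}`. -/
def scalarCurv (i : ι) (p : M) : ℂ :=
  ((∑ a, ∑ b, ∑ μ, ∑ ν,
    𝒮.curvature i a b μ ν p * 𝒮.frame i a μ p * 𝒮.frame i b ν p : ℝ) : ℂ)

/-- The function `F = F_{01} = e_0^μ e_1^ν (∂_μ A_ν - ∂_ν A_μ)`, so that `F_{ab} = F ε_{ab}`. -/
def fieldStrength {q : ℝ} (𝒜 : 𝒮.Potential q) (i : ι) (p : M) : ℂ :=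
  ((∑ μ, ∑ ν, 𝒮.frame i 0 μ p * 𝒮.frame i 1 ν p *
    (pd (𝒮.chart i) μ (𝒜.A i ν) p - pd (𝒮.chart i) ν (𝒜.A i μ) p) : ℝ) : ℂ)

/-! ### Frame covariant derivatives `∇_a = e_a^μ ∇_μ` of tensors -/

/-- `∇_a f = e_a^μ ∂_μ f` for a function `f`. -/
def grad (i : ι) (a : Fin 2) (f : M → ℂ) (p : M) : ℂ :=
  ∑ μ, (𝒮.frame i a μ p : ℂ) * pd (𝒮.chart i) μ f p

/-- The frame connection coefficients `Γ^b{}_{ca} = e_a^μ Γ^{bd}_μ η_{dc}`. -/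
def conn (i : ι) (b c a : Fin 2) (p : M) : ℂ :=
  ((∑ μ, 𝒮.frame i a μ p * 𝒮.spinConn i b c μ p * σ.s c : ℝ) : ℂ)

/-- `∇_a w_b` for a covector `w_b`. -/
def nablaCo (i : ι) (a : Fin 2) (w : Fin 2 → M → ℂ) (b : Fin 2) (p : M) : ℂ :=
  𝒮.grad i a (w b) p - ∑ d, 𝒮.conn i d b a p * w d p

/-- `∇_a v^b` for a vector `v^b`. -/
def nabla1 (i : ι) (a : Fin 2) (v : Fin 2 → M → ℂ) (b : Fin 2) (p : M) : ℂ :=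
  𝒮.grad i a (v b) p + ∑ d, 𝒮.conn i b d a p * v d p

/-- `∇_a T^{bc}`. -/
def nabla2 (i : ι) (a : Fin 2) (T : Fin 2 → Fin 2 → M → ℂ) (b c : Fin 2) (p : M) : ℂ :=
  𝒮.grad i a (T b c) p + ∑ d, (𝒮.conn i b d a p * T d c p + 𝒮.conn i c d a p * T b d p)

/-- `∇_a U^{bcd}`. -/
def nabla3 (i : ι) (a : Fin 2) (U : Fin 2 → Fin 2 → Fin 2 → M → ℂ) (b c d : Fin 2) (p : M) : ℂ :=
  𝒮.grad i a (U b c d) p + ∑ k, (𝒮.conn i b k a p * U k c d p + 𝒮.conn i c k a p * U b k d p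
    + 𝒮.conn i d k a p * U b c k p)

/-- The second covariant derivative `∇_{ab} f = ∇_a ∇_b f` of a function. -/
def hess (i : ι) (a b : Fin 2) (f : M → ℂ) (p : M) : ℂ :=
  𝒮.nablaCo i a (fun c => 𝒮.grad i c f) b p

/-- `∇^a v^b`. -/
def nabla1Up (i : ι) (a : Fin 2) (v : Fin 2 → M → ℂ) (b : Fin 2) (p : M) : ℂ :=
  σ.sgn a * 𝒮.nabla1 i a v b p

/-- `∇^a T^{bc}`. -/
def nabla2Up (i : ι) (a : Fin 2) (T : Fin 2 → Fin 2 → M → ℂ) (b c : Fin 2) (p : M) : ℂ :=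
  σ.sgn a * 𝒮.nabla2 i a T b c p

/-- `v` is a Killing vector: `∇^{(a} v^{b)} = 0`. -/
def IsKillingVector (v : 𝒮.VectorField) : Prop :=
  ∀ i, ∀ p ∈ 𝒮.dom i, ∀ a b,
    (1 / 2) * (𝒮.nabla1Up i a (v.val i) b p + 𝒮.nabla1Up i b (v.val i) a p) = 0

/-- `e` is a Killing tensor: `∇^{(c} e^{ab)} = 0`. -/
def IsKillingTensor (e : 𝒮.SymTensorField) : Prop :=
  ∀ i, ∀ p ∈ 𝒮.dom i, ∀ a b c,
    (1 / 3) * (𝒮.nabla2Up i c (e.val i) a b p + 𝒮.nabla2Up i a (e.val i) b c p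
      + 𝒮.nabla2Up i b (e.val i) c a p) = 0

/-! ### Covariant derivatives of spinors, the Dirac operator, second order operators -/

section Operators

variable {q : ℝ} (𝒜 : 𝒮.Potential q)

/-- `D_μ ψ = ∂_μ ψ + ¼ Γ^{ab}_μ γ_{ab} ψ - i q A_μ ψ`. -/
def Dcoord (i : ι) (μ : Fin 2) (ψ : M → Fin 2 → ℂ) (p : M) : Fin 2 → ℂ :=
  pd (𝒮.chart i) μ ψ p
    + ((1 / 4 : ℂ) • ∑ a, ∑ b, (𝒮.spinConn i a b μ p : ℂ) • γ.bi a b) *ᵥ ψ p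
    - (Complex.I * q * (𝒜.A i μ p : ℂ)) • ψ p

/-- `D_a ψ = e_a^μ D_μ ψ`. -/
def Dframe (i : ι) (a : Fin 2) (ψ : M → Fin 2 → ℂ) (p : M) : Fin 2 → ℂ :=
  ∑ μ, (𝒮.frame i a μ p : ℂ) • 𝒮.Dcoord 𝒜 i μ ψ p

/-- The second covariant derivative `D_a D_b ψ = e_a^μ e_b^ν D_μ D_ν ψ`, in which the outer
derivative also acts on the frame index of `D_b ψ`. -/
def Dsecond (i : ι) (a b : Fin 2) (ψ : M → Fin 2 → ℂ) (p : M) : Fin 2 → ℂ :=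
  𝒮.Dframe 𝒜 i a (𝒮.Dframe 𝒜 i b ψ) p - ∑ c, 𝒮.conn i c b a p • 𝒮.Dframe 𝒜 i c ψ p

/-- `D_{ab} = ½ (D_a D_b + D_b D_a)`. -/
def Dsym (i : ι) (a b : Fin 2) (ψ : M → Fin 2 → ℂ) (p : M) : Fin 2 → ℂ :=
  (1 / 2 : ℂ) • (𝒮.Dsecond 𝒜 i a b ψ p + 𝒮.Dsecond 𝒜 i b a ψ p)

/-- The Dirac operator `𝔻 ψ = i γ^a D_a ψ - (V 𝕀 + V̂ γ) ψ`. -/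
def dirac (V Vh : M → ℂ) (i : ι) (ψ : M → Fin 2 → ℂ) (p : M) : Fin 2 → ℂ :=
  Complex.I • ∑ a, γ.up a *ᵥ 𝒮.Dframe 𝒜 i a ψ p - γ.expand (V p) 0 (Vh p) *ᵥ ψ p

variable {𝒮} in
/-- `𝕂 ψ = 𝔼^{ab} D_{ab} ψ + 𝔽^a D_a ψ + 𝔾 ψ`. -/
def Operator2.apply (K : 𝒮.Operator2) (i : ι) (ψ : M → Fin 2 → ℂ) (p : M) : Fin 2 → ℂ :=
  ∑ a, ∑ b, K.E i a b p *ᵥ 𝒮.Dsym 𝒜 i a b ψ p + ∑ a, K.F i a p *ᵥ 𝒮.Dframe 𝒜 i a ψ p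
    + K.G i p *ᵥ ψ p

variable {𝒮} in
/-- `𝕂` is a second order symmetry operator: `𝕂 𝔻 ψ = 𝔻 𝕂 ψ` for every smooth spinor field `ψ`. -/
def Operator2.IsSymmetryOperator (K : 𝒮.Operator2) (V Vh : M → ℂ) : Prop :=
  ∀ ψ : 𝒮.SpinorField 𝒜, ∀ i, ∀ p ∈ 𝒮.dom i,
    K.apply 𝒜 i (𝒮.dirac 𝒜 V Vh i (ψ.val i)) p = 𝒮.dirac 𝒜 V Vh i (K.apply 𝒜 i (ψ.val i)) p

/-! ### The right-hand sides of the determining equations -/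

/-- `ω_c = 2 i (q F ε_{cd} α^d + e_c{}^d ∇_d V)`. -/
def omega (V : M → ℂ) (e : 𝒮.SymTensorField) (α : 𝒮.VectorField) (i : ι) (c : Fin 2) (p : M) : ℂ :=
  2 * Complex.I * (∑ d, q * 𝒮.fieldStrength 𝒜 i p * eps c d * α.val i d p
    + ∑ d, σ.sgn c * e.val i c d p * 𝒮.grad i d V p)

/-- `Λ^{ca} = 4 i (q F ε^{(c}{}_b e^{a)b} + α^{(a} ∇^{c)} V + α^b ∇_b V η^{ac})`. -/
def LambdaUp (V : M → ℂ) (e : 𝒮.SymTensorField) (α : 𝒮.VectorField) (i : ι) (c a : Fin 2)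
    (p : M) : ℂ :=
  4 * Complex.I *
    (q * 𝒮.fieldStrength 𝒜 i p *
        ((1 / 2) * ∑ b, (σ.epsMixed c b * e.val i a b p + σ.epsMixed a b * e.val i c b p))
      + (1 / 2) * (α.val i a p * (σ.sgn c * 𝒮.grad i c V p)
        + α.val i c p * (σ.sgn a * 𝒮.grad i a V p))
      + (∑ b, α.val i b p * 𝒮.grad i b V p) * σ.eta a c)

/-- `Λ_c = i q F ε_{ca} ζ^a - ¼ ∇_a (R e^a{}_c) - i ω_c V
  + η (i α^a ∇_{ab} V̂ ε^b{}_c - (i/2) R α_a V̂ ε^a{}_c + e_c{}^b ∇_b (V̂²))`. -/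
def LambdaDown (V Vh : M → ℂ) (e : 𝒮.SymTensorField) (α ζ : 𝒮.VectorField) (i : ι) (c : Fin 2)
    (p : M) : ℂ :=
  Complex.I * q * 𝒮.fieldStrength 𝒜 i p * ∑ a, eps c a * ζ.val i a p
    - (1 / 4) * ∑ a, σ.sgn c *
        𝒮.nabla2 i a (fun b d r => 𝒮.scalarCurv i r * e.val i b d r) a c p
    - Complex.I * 𝒮.omega 𝒜 V e α i c p * V p
    + σ.det * (Complex.I * ∑ a, ∑ b, α.val i a p * 𝒮.hess i a b Vh p * σ.epsMixed b c
      - Complex.I / 2 * 𝒮.scalarCurv i p *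
          ∑ a, σ.sgn a * α.val i a p * Vh p * σ.epsMixed a c
      + ∑ b, σ.sgn c * e.val i c b p * 𝒮.grad i b (fun r => Vh r ^ 2) p)

/-! ### The explicit form of the coefficients, the determining and integrability conditions -/

/-- The explicit expression of the coefficients of `𝕂` in terms of the tensors `e^{ab}`, `α^a`,
`ζ^a` (`e`, `α`, `ζ`) and the functions `α`, `g'` (`α₀`, `g'`). -/
structure HasExplicitForm (V Vh : M → ℂ) (K : 𝒮.Operator2) (e : 𝒮.SymTensorField)
    (α ζ : 𝒮.VectorField) (α₀ g' : M → ℂ) : Prop where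
  /-- `𝔼^{ab} = e^{ab} 𝕀 + 2 α^{(a} γ^{b)}` -/
  E_eq : ∀ i, ∀ p ∈ 𝒮.dom i, ∀ a b,
    K.E i a b p = e.val i a b p • (1 : Matrix (Fin 2) (Fin 2) ℂ)
      + (α.val i a p • γ.up b + α.val i b p • γ.up a)
  /-- `𝔽^a = (ζ^a + ∇_b e^{ab}) 𝕀 + (α δ^a_c + ∇_c α^a) γ^c
    + (⅓ ε_{cb} ∇^c e^{ab} + 2 i α^a V̂) γ` -/
  F_eq : ∀ i, ∀ p ∈ 𝒮.dom i, ∀ a,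
    K.F i a p = γ.expand
      (ζ.val i a p + ∑ b, 𝒮.nabla2 i b (e.val i) a b p)
      (fun c => (if a = c then α₀ p else 0) + 𝒮.nabla1 i c (α.val i) a p)
      ((1 / 3) * ∑ c, ∑ b, eps c b * 𝒮.nabla2Up i c (e.val i) a b p
        + 2 * Complex.I * α.val i a p * Vh p)
  /-- `𝔾 = (g' + 3 i α^a ∇_a V + i α V) 𝕀
    + (i q F ε_{ab} α^b + i e_a{}^b ∇_b V - ¼ R α_a - i η e^{cb} ∇_b V̂ ε_{ac}) γ^a
    + (¼ (∇^c ζ^a - 2 i q F ε^c{}_b e^{ab} - 2 i α^a ∇^c V) ε_{ca} + i α^a ∇_a V̂ + i α V̂) γ` -/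
  G_eq : ∀ i, ∀ p ∈ 𝒮.dom i,
    K.G i p = γ.expand
      (g' p + 3 * Complex.I * ∑ a, α.val i a p * 𝒮.grad i a V p + Complex.I * α₀ p * V p)
      (fun a => Complex.I * q * 𝒮.fieldStrength 𝒜 i p * ∑ b, eps a b * α.val i b p
        + Complex.I * ∑ b, σ.sgn a * e.val i a b p * 𝒮.grad i b V p
        - (1 / 4) * 𝒮.scalarCurv i p * (σ.sgn a * α.val i a p)
        - Complex.I * σ.det * ∑ c, ∑ b, e.val i c b p * 𝒮.grad i b Vh p * eps a c)
      ((1 / 4) * ∑ c, ∑ a,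
          (𝒮.nabla1Up i c (ζ.val i) a p
            - 2 * Complex.I * q * 𝒮.fieldStrength 𝒜 i p * ∑ b, σ.epsMixed c b * e.val i a b p
            - 2 * Complex.I * α.val i a p * (σ.sgn c * 𝒮.grad i c V p)) * eps c a
        + Complex.I * ∑ a, α.val i a p * 𝒮.grad i a Vh p + Complex.I * α₀ p * Vh p)

/-- The determining equations. -/
structure DeterminingEquations (V Vh : M → ℂ) (e : 𝒮.SymTensorField) (α ζ : 𝒮.VectorField)
    (α₀ g' : M → ℂ) : Prop where
  /-- `∇^{(c} e^{ab)} = 0` -/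
  killing_tensor : 𝒮.IsKillingTensor e
  /-- `∇^{(a} α^{b)} = 0` -/
  killing_vector : 𝒮.IsKillingVector α
  /-- `∇_a α = ω_a` -/
  grad_α₀ : ∀ i, ∀ p ∈ 𝒮.dom i, ∀ a, 𝒮.grad i a α₀ p = 𝒮.omega 𝒜 V e α i a p
  /-- `∇^{(c} ζ^{a)} = ½ Λ^{ca}` -/
  sym_grad_ζ : ∀ i, ∀ p ∈ 𝒮.dom i, ∀ c a,
    (1 / 2) * (𝒮.nabla1Up i c (ζ.val i) a p + 𝒮.nabla1Up i a (ζ.val i) c p)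
      = (1 / 2) * 𝒮.LambdaUp 𝒜 V e α i c a p
  /-- `∇_a g' = Λ_a` -/
  grad_g' : ∀ i, ∀ p ∈ 𝒮.dom i, ∀ a, 𝒮.grad i a g' p = 𝒮.LambdaDown 𝒜 V Vh e α ζ i a p

/-- The integrability conditions. -/
structure IntegrabilityConditions (V Vh : M → ℂ) (e : 𝒮.SymTensorField) (α ζ : 𝒮.VectorField) :
    Prop where
  /-- `ε^{bc} ∇_b ω_c = 0` -/
  curl_omega : ∀ i, ∀ p ∈ 𝒮.dom i,
    ∑ b, ∑ c, σ.epsUp b c * 𝒮.nablaCo i b (𝒮.omega 𝒜 V e α i) c p = 0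
  /-- the preceding condition in expanded form: `q α^c ∇_c F = - η ε^{ac} ∇_c (e_a{}^b ∇_b V)` -/
  grad_F : ∀ i, ∀ p ∈ 𝒮.dom i,
    q * ∑ c, α.val i c p * 𝒮.grad i c (𝒮.fieldStrength 𝒜 i) p =
      -(σ.det * ∑ a, ∑ c, σ.epsUp a c *
        𝒮.nablaCo i c (fun d r => ∑ b, σ.sgn d * e.val i d b r * 𝒮.grad i b V r) a p)
  /-- `ε^{dc} ∇_d Λ_c = 0` -/
  curl_Lambda : ∀ i, ∀ p ∈ 𝒮.dom i,
    ∑ d, ∑ c, σ.epsUp d c * 𝒮.nablaCo i d (𝒮.LambdaDown 𝒜 V Vh e α ζ i) c p = 0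
  /-- `ζ^a ∇_a R = η ∇_c (∇^b Λ^{da}) ε^c{}_d ε_{ab} - (R/2) Λ`, where `Λ = η_{ca} Λ^{ca}` -/
  grad_R : ∀ i, ∀ p ∈ 𝒮.dom i,
    ∑ a, ζ.val i a p * 𝒮.grad i a (𝒮.scalarCurv i) p =
      σ.det * (∑ c, ∑ b, ∑ d, ∑ a,
        𝒮.nabla3 i c (fun b' d' a' => 𝒮.nabla2Up i b' (𝒮.LambdaUp 𝒜 V e α i) d' a') b d a p *
          σ.epsMixed c d * eps a b)
      - 𝒮.scalarCurv i p / 2 * ∑ c, ∑ a, σ.eta c a * 𝒮.LambdaUp 𝒜 V e α i c a p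
  /-- `ζ^a ∇_a V = - η (⅔ ∇_a e^{bc} ∇_c V̂ ε^a{}_b + e^{bc} ∇_{ac} V̂ ε^a{}_b
    - i α^a ∇_a (V̂²))` -/
  grad_V : ∀ i, ∀ p ∈ 𝒮.dom i,
    ∑ a, ζ.val i a p * 𝒮.grad i a V p =
      -(σ.det *
        ((2 / 3) * ∑ a, ∑ b, ∑ c,
            𝒮.nabla2 i a (e.val i) b c p * 𝒮.grad i c Vh p * σ.epsMixed a b
          + ∑ a, ∑ b, ∑ c, e.val i b c p * 𝒮.hess i a c Vh p * σ.epsMixed a b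
          - Complex.I * ∑ a, α.val i a p * 𝒮.grad i a (fun r => Vh r ^ 2) p))
  /-- `ζ^a ∇_a V̂ = ⅔ ε_{cb} ∇^c e^{ab} ∇_a V + ε^c{}_b e^{ab} ∇_{ca} V - 2 i α^a ∇_a V V̂` -/
  grad_Vh : ∀ i, ∀ p ∈ 𝒮.dom i,
    ∑ a, ζ.val i a p * 𝒮.grad i a Vh p =
      (2 / 3) * ∑ c, ∑ b, ∑ a, eps c b * 𝒮.nabla2Up i c (e.val i) a b p * 𝒮.grad i a V p
        + ∑ c, ∑ b, ∑ a, σ.epsMixed c b * e.val i a b p * 𝒮.hess i c a V p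
        - 2 * Complex.I * ∑ a, α.val i a p * 𝒮.grad i a V p * Vh p

end Operators

end SpinManifold

end Bundles

end SpinSurface

end

open scoped Manifold ContDiff Matrix

noncomputable section

namespace SpinSurface

/-! ### Weighted null derivatives -/

/-! Over `ℂ` the plane spanned by the frame has two null directions, whatever the signature: with
`c² = -η` the vectors `X = ∂^0 + c ∂^1` and `Y = ∂_0 - η c ∂_1` are null and satisfy `⟨X, Y⟩ = 2`.
In the basis where `γ` is diagonal the Dirac operator becomes `i` times the matrix with rows `(u,
X)` and `(Y, v)`, where `u` and `v` are `i V ∓ i s₀ c V̂` and `s₀ = η_{00}`. The Levi-Civita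
connection preserves the null directions, so every tensor or spinor component is a scalar with a
spin weight and a charge, and all geometry is contained in the one relation `[X, Y] = R H + Φ N`:
`H` and `N` read off the weight and the charge, `R` is half the scalar curvature, and `Φ` is
proportional to `q F`. The calculation therefore takes place in a commutative algebra with
derivations (`NullCalculus`), independently of signature, charts and manifold.

There the commutator `[𝕂, 𝔻]` is written in normal order as a matrix of third order operators
(`commutatorEntry_eq_op3`). It annihilates all spinors exactly when every coefficient vanishes,
because locally supported spinors with arbitrary Taylor coefficients at a point exist
(`op3_coeff_eq_zero`, `isSymmetryOperator_iff`). The coefficients are analysed order by order. Order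
three is purely algebraic and gives the shape of `𝔼`. Order two fixes most of `𝔽` and gives the
Killing equations for `e^{ab}` and `α^a`. Order one fixes `𝔾` up to a function `g'` and gives the
equations for `∇α` and for the symmetrized derivative of `ζ^a`. Order zero leaves four equations:
the two off-diagonal entries are the components of `∇g' = Λ`, the two diagonal ones are combinations
of the conditions on `ζ^a ∇_a V` and `ζ^a ∇_a V̂`. Both directions rest on the same coefficient
table (`commutatorCoeff_eq_zero`, `explicit_of_commutatorCoeff_eq_zero`).

The bridge to geometry is the algebra `C[ℤ × ℤ]` over the smooth functions `C` of a chart, whose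
degrees are spin weight and charge. The null derivatives act on it through the connection, and their
commutator follows from the vanishing torsion of the spin connection (`FrameCalculus.nullX_nullY`).
Each tensor equation is then compared pointwise with its null form; since homogeneous elements are
determined by their values, pointwise equality suffices.

Of the integrability conditions only the last two are independent. The curls of `ω` and `Λ` vanish
because these are gradients, the equation for `∇F` is the first curl simplified by the Killing
equation, and the one for `∇R` is the identity expressing the derivative of the curvature along a
vector field by its deformation tensor (`sum_mul_δ_curl`).

For the fields to be global they are defined by traces of the coefficients of `𝕂`, which transform
correctly under changes of trivialisation; `nullFields_eq` identifies them with the fields found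
algebraically in each chart. -/

/-- A commutative algebra with two commuting gradings (twice the spin weight, measured by the derivation
`H`, and the charge, measured by `N`) and null derivatives `X`, `Y` of spin weight `-1` and `1` with
curvature `[X, Y] = R H + Φ N`. The characters `ev` separate homogeneous elements. -/
structure NullCalculus (B : Type*) [CommRing B] [Algebra ℂ B] (ι : Type*) where
  X : Derivation ℂ B B
  Y : Derivation ℂ B B
  H : Derivation ℂ B B
  N : Derivation ℂ B B
  R : B
  Φ : B
  comm : ∀ f, X (Y f) = Y (X f) + R * H f + Φ * N f
  HX : ∀ f, H (X f) = X (H f) - 2 * X f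
  HY : ∀ f, H (Y f) = Y (H f) + 2 * Y f
  NX : ∀ f, N (X f) = X (N f)
  NY : ∀ f, N (Y f) = Y (N f)
  HR : H R = 0
  NR : N R = 0
  HΦ : H Φ = 0
  NΦ : N Φ = 0
  ev : ι → B →ₐ[ℂ] ℂ
  sep : ∀ (b : B) (k : ℤ), H b = k * b → N b = 0 → (∀ p, ev p b = 0) → b = 0

namespace NullCalculus

variable {B : Type*} [CommRing B] [Algebra ℂ B] {ι : Type*} (𝒩 : NullCalculus B ι)

/-- A homogeneous element of spin weight `k / 2` and charge `0`. -/
def Tensor (k : ℤ) (b : B) : Prop := 𝒩.H b = k * b ∧ 𝒩.N b = 0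

/-- The third order operator with the given coefficients, in normal order. -/
def op3 (c : Fin 4 → Fin 4 → B) (s : B) : B :=
  c 3 0 * 𝒩.X (𝒩.X (𝒩.X s)) + c 2 1 * 𝒩.Y (𝒩.X (𝒩.X s)) + c 1 2 * 𝒩.Y (𝒩.Y (𝒩.X s))
    + c 0 3 * 𝒩.Y (𝒩.Y (𝒩.Y s)) + c 2 0 * 𝒩.X (𝒩.X s) + c 1 1 * 𝒩.Y (𝒩.X s)
    + c 0 2 * 𝒩.Y (𝒩.Y s) + c 1 0 * 𝒩.X s + c 0 1 * 𝒩.Y s + c 0 0 * s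

variable {𝒩}

/-- The coefficients of a third order operator vanish at `p` if it annihilates sufficiently many
elements. -/
theorem op3_coeff_eq_zero {c : Fin 4 → Fin 4 → B} {p : ι} {x y χ : B} {S : Submonoid B}
    (hxS : x ∈ S) (hyS : y ∈ S)
    (hx : 𝒩.ev p x = 0) (hy : 𝒩.ev p y = 0)
    (hXx : 𝒩.ev p (𝒩.X x) = 1) (hYx : 𝒩.ev p (𝒩.Y x) = 0)
    (hXy : 𝒩.ev p (𝒩.X y) = 0) (hYy : 𝒩.ev p (𝒩.Y y) = 1) (hχ : 𝒩.ev p χ = 1)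
    (h : ∀ f ∈ S, 𝒩.op3 c (f * χ) = 0) (i j : Fin 4) (hij : (i : ℕ) + j ≤ 3) :
    𝒩.ev p (c i j) = 0 := by
  have key : ∀ f ∈ S, 𝒩.ev p (𝒩.op3 c (f * χ)) = 0 := fun f hf => by
    rw [h f hf, map_zero]
  -- Since `x` and `y` vanish at `p` and are dual there to `X` and `Y`, each cubic monomial isolates
  -- one leading coefficient, up to a factorial factor.
  have e30 := key _ (S.mul_mem (S.mul_mem hxS hxS) hxS)
  have e21 := key _ (S.mul_mem (S.mul_mem hxS hxS) hyS)
  have e12 := key _ (S.mul_mem (S.mul_mem hxS hyS) hyS)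
  have e03 := key _ (S.mul_mem (S.mul_mem hyS hyS) hyS)
  simp only [op3, Derivation.leibniz, smul_eq_mul, map_add, map_mul, hx, hy, hXx, hYx, hXy, hYy, hχ,
    zero_mul, mul_zero, add_zero, zero_add, mul_one, one_mul] at e30 e21 e12 e03
  ring_nf at e30 e21 e12 e03
  simp only [mul_eq_zero, OfNat.ofNat_ne_zero, or_false] at e30 e21 e12 e03
  -- On quadratic monomials the third order terms contain uncontrolled higher derivatives of `x`,
  -- `y` and `χ`, but their coefficients are already known to vanish. The descent continues in this
  -- way down to order zero.
  have e20 := key _ (S.mul_mem hxS hxS)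
  have e11 := key _ (S.mul_mem hxS hyS)
  have e02 := key _ (S.mul_mem hyS hyS)
  simp only [op3, Derivation.leibniz, smul_eq_mul, map_add, map_mul, hx, hy, hXx, hYx, hXy, hYy, hχ,
    e30, e21, e12, e03, zero_mul, mul_zero, add_zero, zero_add, mul_one, one_mul] at e20 e11 e02
  ring_nf at e20 e11 e02
  simp only [mul_eq_zero, OfNat.ofNat_ne_zero, or_false] at e20 e11 e02
  have e10 := key _ hxS
  have e01 := key _ hyS
  have e00 := key _ S.one_mem
  simp only [op3, Derivation.leibniz, smul_eq_mul, map_add, map_mul, hx, hy, hXx, hYx, hXy, hYy, hχ,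
    e30, e21, e12, e03, e20, e11, e02, zero_mul, mul_zero, add_zero, zero_add, mul_one, one_mul]
    at e10 e01 e00
  simp only [e10, e01, zero_mul, zero_add] at e00
  fin_cases i <;> fin_cases j <;> first | assumption | (exfalso; revert hij; decide)

end NullCalculus

/-! ### The commutator with the Dirac operator in null form. -/

namespace NullCalculus

variable {B : Type*} [CommRing B] [Algebra ℂ B] {ι : Type*} (𝒩 : NullCalculus B ι)

/-- The coefficients of a second order operator on two-component spinors, with respect to the null
derivatives `X` and `Y`. -/
structure Coeffs (B : Type*) where
  a : Fin 2 → Fin 2 → B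
  b : Fin 2 → Fin 2 → B
  d : Fin 2 → Fin 2 → B
  f : Fin 2 → Fin 2 → B
  h : Fin 2 → Fin 2 → B
  g : Fin 2 → Fin 2 → B

/-- The spin weight (times two) of the entries of an invariant matrix. -/
def entryWeight : Matrix (Fin 2) (Fin 2) ℤ := !![0, -2; 2, 0]

/-- The coefficients have the spin weights of tensor fields. -/
structure Coeffs.IsTensor (K : Coeffs B) : Prop where
  a : ∀ k l, 𝒩.Tensor (entryWeight k l + 4) (K.a k l)
  b : ∀ k l, 𝒩.Tensor (entryWeight k l) (K.b k l)
  d : ∀ k l, 𝒩.Tensor (entryWeight k l - 4) (K.d k l)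
  f : ∀ k l, 𝒩.Tensor (entryWeight k l + 2) (K.f k l)
  h : ∀ k l, 𝒩.Tensor (entryWeight k l - 2) (K.h k l)
  g : ∀ k l, 𝒩.Tensor (entryWeight k l) (K.g k l)

/-- The `(k, l)` entry of the operator with coefficients `K`. -/
def entry (K : Coeffs B) (k l : Fin 2) (s : B) : B :=
  K.a k l * 𝒩.X (𝒩.X s) + K.b k l * (𝒩.X (𝒩.Y s) + 𝒩.Y (𝒩.X s)) + K.d k l * 𝒩.Y (𝒩.Y s)
    + K.f k l * 𝒩.X s + K.h k l * 𝒩.Y s + K.g k l * s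

/-- The `(k, l)` entry of the Dirac operator (divided by `i`) with potentials `u`, `v`. -/
def diracEntry (u v : B) (k l : Fin 2) (s : B) : B :=
  !![u * s, 𝒩.X s; 𝒩.Y s, v * s] k l

/-- The `(k, l)` entry of the commutator of a second order operator with the Dirac operator. -/
def commutatorEntry (K : Coeffs B) (u v : B) (k l : Fin 2) (s : B) : B :=
  ∑ j, (𝒩.entry K k j (𝒩.diracEntry u v j l s) - 𝒩.diracEntry u v k j (𝒩.entry K j l s))

/-- The coefficients of the commutator, in normal order. -/
def commutatorCoeff (K : Coeffs B) (u v : B) : Fin 2 → Fin 2 → Fin 4 → Fin 4 → B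
  | 0, 0, 0, 0 => K.a 0 0 * 𝒩.X (𝒩.X u) + K.a 0 1 * 𝒩.X 𝒩.Φ - K.a 0 1 * 𝒩.X 𝒩.R +
      2 * K.b 0 0 * 𝒩.Y (𝒩.X u) + 2 * K.b 0 1 * 𝒩.Y 𝒩.Φ - 2 * K.b 0 1 * 𝒩.Y 𝒩.R -
      K.b 1 0 * 𝒩.X 𝒩.Φ + K.b 1 0 * 𝒩.X 𝒩.R - 𝒩.X (K.b 1 0) * 𝒩.Φ + 𝒩.X (K.b 1 0) * 𝒩.R +
      K.d 0 0 * 𝒩.Y (𝒩.Y u) - K.d 1 0 * 𝒩.Y 𝒩.Φ + K.d 1 0 * 𝒩.Y 𝒩.R + K.f 0 0 * 𝒩.X u +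
      K.f 0 1 * 𝒩.Φ - K.f 0 1 * 𝒩.R - 𝒩.X (K.g 1 0) + K.h 0 0 * 𝒩.Y u - K.h 1 0 * 𝒩.Φ +
      K.h 1 0 * 𝒩.R
  | 0, 0, 0, 1 => 2 * K.b 0 0 * 𝒩.X u + 3 * K.b 0 1 * 𝒩.Φ - K.b 0 1 * 𝒩.R + 2 * K.d 0 0 * 𝒩.Y u -
      2 * K.d 1 0 * 𝒩.Φ + K.g 0 1 - 𝒩.X (K.h 1 0)
  | 0, 0, 0, 2 => -𝒩.X (K.d 1 0) + K.h 0 1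
  | 0, 0, 0, 3 => K.d 0 1
  | 0, 0, 1, 0 => 2 * K.a 0 0 * 𝒩.X u + 2 * K.a 0 1 * 𝒩.Φ - 4 * K.a 0 1 * 𝒩.R +
      2 * K.b 0 0 * 𝒩.Y u - 3 * K.b 1 0 * 𝒩.Φ + 7 * K.b 1 0 * 𝒩.R - 𝒩.X (K.f 1 0) - K.g 1 0
  | 0, 0, 1, 1 => -2 * 𝒩.X (K.b 1 0) + K.f 0 1 - K.h 1 0
  | 0, 0, 1, 2 => 2 * K.b 0 1 - K.d 1 0
  | 0, 0, 2, 0 => -𝒩.X (K.a 1 0) - K.f 1 0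
  | 0, 0, 2, 1 => K.a 0 1 - 2 * K.b 1 0
  | 0, 0, 3, 0 => -K.a 1 0
  | 0, 1, 0, 0 => K.a 0 1 * 𝒩.X (𝒩.X v) - K.b 0 1 * 𝒩.Φ * u + K.b 0 1 * 𝒩.Φ * v -
      K.b 0 1 * 𝒩.R * u + K.b 0 1 * 𝒩.R * v + 2 * K.b 0 1 * 𝒩.Y (𝒩.X v) - K.b 1 1 * 𝒩.X 𝒩.Φ -
      K.b 1 1 * 𝒩.X 𝒩.R - 𝒩.X (K.b 1 1) * 𝒩.Φ - 𝒩.X (K.b 1 1) * 𝒩.R + K.d 0 1 * 𝒩.Y (𝒩.Y v) -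
      K.d 1 1 * 𝒩.Y 𝒩.Φ - K.d 1 1 * 𝒩.Y 𝒩.R + K.f 0 1 * 𝒩.X v - K.g 0 1 * u + K.g 0 1 * v -
      𝒩.X (K.g 1 1) + K.h 0 1 * 𝒩.Y v - K.h 1 1 * 𝒩.Φ - K.h 1 1 * 𝒩.R
  | 0, 1, 0, 1 => 2 * K.b 0 1 * 𝒩.X v + 2 * K.d 0 1 * 𝒩.Y v - 2 * K.d 1 1 * 𝒩.Φ -
      4 * K.d 1 1 * 𝒩.R - K.h 0 1 * u + K.h 0 1 * v - 𝒩.X (K.h 1 1)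
  | 0, 1, 0, 2 => -K.d 0 1 * u + K.d 0 1 * v - 𝒩.X (K.d 1 1)
  | 0, 1, 1, 0 => 2 * K.a 0 1 * 𝒩.X v + K.b 0 0 * 𝒩.Φ - K.b 0 0 * 𝒩.R + 2 * K.b 0 1 * 𝒩.Y v -
      3 * K.b 1 1 * 𝒩.Φ + K.b 1 1 * 𝒩.R - K.f 0 1 * u + K.f 0 1 * v - 𝒩.X (K.f 1 1) + K.g 0 0 -
      K.g 1 1
  | 0, 1, 1, 1 => -2 * K.b 0 1 * u + 2 * K.b 0 1 * v - 2 * 𝒩.X (K.b 1 1) + K.h 0 0 - K.h 1 1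
  | 0, 1, 1, 2 => K.d 0 0 - K.d 1 1
  | 0, 1, 2, 0 => -K.a 0 1 * u + K.a 0 1 * v - 𝒩.X (K.a 1 1) + K.f 0 0 - K.f 1 1
  | 0, 1, 2, 1 => 2 * K.b 0 0 - 2 * K.b 1 1
  | 0, 1, 3, 0 => K.a 0 0 - K.a 1 1
  | 1, 0, 0, 0 => K.a 1 0 * 𝒩.X (𝒩.X u) + K.a 1 1 * 𝒩.X 𝒩.Φ - K.a 1 1 * 𝒩.X 𝒩.R -
      K.b 0 0 * 𝒩.Y 𝒩.Φ + K.b 0 0 * 𝒩.Y 𝒩.R - 𝒩.Y (K.b 0 0) * 𝒩.Φ + 𝒩.Y (K.b 0 0) * 𝒩.R +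
      K.b 1 0 * 𝒩.Φ * u - K.b 1 0 * 𝒩.Φ * v - K.b 1 0 * 𝒩.R * u + K.b 1 0 * 𝒩.R * v +
      2 * K.b 1 0 * 𝒩.Y (𝒩.X u) + 2 * K.b 1 1 * 𝒩.Y 𝒩.Φ - 2 * K.b 1 1 * 𝒩.Y 𝒩.R +
      K.d 1 0 * 𝒩.Y (𝒩.Y u) + K.f 1 0 * 𝒩.X u + K.f 1 1 * 𝒩.Φ - K.f 1 1 * 𝒩.R - 𝒩.Y (K.g 0 0) +
      K.g 1 0 * u - K.g 1 0 * v + K.h 1 0 * 𝒩.Y u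
  | 1, 0, 0, 1 => -K.b 0 0 * 𝒩.Φ + K.b 0 0 * 𝒩.R + 2 * K.b 1 0 * 𝒩.X u + 3 * K.b 1 1 * 𝒩.Φ -
      K.b 1 1 * 𝒩.R + 2 * K.d 1 0 * 𝒩.Y u - K.g 0 0 + K.g 1 1 - 𝒩.Y (K.h 0 0) + K.h 1 0 * u -
      K.h 1 0 * v
  | 1, 0, 0, 2 => -𝒩.Y (K.d 0 0) + K.d 1 0 * u - K.d 1 0 * v - K.h 0 0 + K.h 1 1
  | 1, 0, 0, 3 => -K.d 0 0 + K.d 1 1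
  | 1, 0, 1, 0 => 2 * K.a 1 0 * 𝒩.X u + 2 * K.a 1 1 * 𝒩.Φ - 4 * K.a 1 1 * 𝒩.R +
      2 * K.b 1 0 * 𝒩.Y u - 𝒩.Y (K.f 0 0) + K.f 1 0 * u - K.f 1 0 * v
  | 1, 0, 1, 1 => -2 * 𝒩.Y (K.b 0 0) + 2 * K.b 1 0 * u - 2 * K.b 1 0 * v - K.f 0 0 + K.f 1 1
  | 1, 0, 1, 2 => -2 * K.b 0 0 + 2 * K.b 1 1
  | 1, 0, 2, 0 => -𝒩.Y (K.a 0 0) + K.a 1 0 * u - K.a 1 0 * v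
  | 1, 0, 2, 1 => -K.a 0 0 + K.a 1 1
  | 1, 1, 0, 0 => K.a 1 1 * 𝒩.X (𝒩.X v) - K.b 0 1 * 𝒩.Y 𝒩.Φ - K.b 0 1 * 𝒩.Y 𝒩.R -
      𝒩.Y (K.b 0 1) * 𝒩.Φ - 𝒩.Y (K.b 0 1) * 𝒩.R + 2 * K.b 1 1 * 𝒩.Y (𝒩.X v) +
      K.d 1 1 * 𝒩.Y (𝒩.Y v) + K.f 1 1 * 𝒩.X v - 𝒩.Y (K.g 0 1) + K.h 1 1 * 𝒩.Y v
  | 1, 1, 0, 1 => -K.b 0 1 * 𝒩.Φ - K.b 0 1 * 𝒩.R + 2 * K.b 1 1 * 𝒩.X v + 2 * K.d 1 1 * 𝒩.Y v -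
      K.g 0 1 - 𝒩.Y (K.h 0 1)
  | 1, 1, 0, 2 => -𝒩.Y (K.d 0 1) - K.h 0 1
  | 1, 1, 0, 3 => -K.d 0 1
  | 1, 1, 1, 0 => 2 * K.a 1 1 * 𝒩.X v + K.b 1 0 * 𝒩.Φ - K.b 1 0 * 𝒩.R + 2 * K.b 1 1 * 𝒩.Y v -
      𝒩.Y (K.f 0 1) + K.g 1 0
  | 1, 1, 1, 1 => -2 * 𝒩.Y (K.b 0 1) - K.f 0 1 + K.h 1 0
  | 1, 1, 1, 2 => -2 * K.b 0 1 + K.d 1 0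
  | 1, 1, 2, 0 => -𝒩.Y (K.a 0 1) + K.f 1 0
  | 1, 1, 2, 1 => -K.a 0 1 + 2 * K.b 1 0
  | 1, 1, 3, 0 => K.a 1 0
  | _, _, _, _ => 0

variable {𝒩}

/-- Moving every `Y` to the left of every `X` by `comm` produces curvature terms, which are
multiplication operators once the weight and the charge of the argument are known. The weights `-1`,
`1` and the charge `1` are those of the two components of a spinor. -/
theorem commutatorEntry_eq_op3 (K : Coeffs B) {u v : B} (hu : 𝒩.Tensor 0 u) (hv : 𝒩.Tensor 0 v)
    (k l : Fin 2) {s : B} (hs : 𝒩.H s = (![-1, 1] l : ℤ) * s) (hN : 𝒩.N s = s) :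
    𝒩.commutatorEntry K u v k l s = 𝒩.op3 (𝒩.commutatorCoeff K u v k l) s := by
  obtain ⟨hu, hu'⟩ := hu
  obtain ⟨hv, hv'⟩ := hv
  fin_cases k <;> fin_cases l <;>
  · simp [commutatorEntry, entry, diracEntry, op3, commutatorCoeff, 𝒩.comm, 𝒩.HX, 𝒩.HY,
      𝒩.NX, 𝒩.NY, hu, hu', hv, hv', hN, Fin.sum_univ_two] at hs ⊢
    simp [hs]
    ring

end NullCalculus

/-! ### Explicit form, determining equations and the coefficients of positive order. -/

namespace NullCalculus

variable {B : Type*} [CommRing B] [Algebra ℂ B] {ι : Type*} (𝒩 : NullCalculus B ι)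

/-- Null components of a symmetric tensor `e^{ab}`, two vectors `α^a`, `ζ^a` and two functions. -/
structure Fields (B : Type*) where
  a : B
  b : B
  d : B
  P : B
  Q : B
  t₁ : B
  t₂ : B
  al : B
  g : B

/-- The components have the spin weights of tensor fields. -/
structure Fields.IsTensor (T : Fields B) : Prop where
  a : 𝒩.Tensor 4 T.a
  b : 𝒩.Tensor 0 T.b
  d : 𝒩.Tensor (-4) T.d
  P : 𝒩.Tensor 2 T.P
  Q : 𝒩.Tensor (-2) T.Q
  t₁ : 𝒩.Tensor 2 T.t₁
  t₂ : 𝒩.Tensor (-2) T.t₂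
  al : 𝒩.Tensor 0 T.al
  g : 𝒩.Tensor 0 T.g

/-- The coefficients of a symmetry operator in terms of the tensor fields. -/
structure Explicit (K : Coeffs B) (u v : B) (T : Fields B) : Prop where
  a00 : K.a 0 0 = T.a
  a11 : K.a 1 1 = T.a
  b00 : K.b 0 0 = T.b
  b11 : K.b 1 1 = T.b
  d00 : K.d 0 0 = T.d
  d11 : K.d 1 1 = T.d
  a01 : K.a 0 1 = 2 * T.P
  b01 : K.b 0 1 = T.Q
  d01 : K.d 0 1 = 0
  a10 : K.a 1 0 = 0
  b10 : K.b 1 0 = T.P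
  d10 : K.d 1 0 = 2 * T.Q
  f00 : K.f 0 0 = T.t₁ + 𝒩.X T.a + T.P * (u - v)
  f11 : K.f 1 1 = T.t₁ - T.P * (u - v)
  h00 : K.h 0 0 = T.t₂ + T.Q * (u - v)
  h11 : K.h 1 1 = T.t₂ + 𝒩.Y T.d - T.Q * (u - v)
  f01 : K.f 0 1 = T.al + 𝒩.X T.P
  h01 : K.h 0 1 = 0
  f10 : K.f 1 0 = 0
  h10 : K.h 1 0 = T.al - 𝒩.X T.P
  g01 : K.g 0 1 = -𝒩.Φ * T.Q - 𝒩.R * T.Q + 2 * T.b * 𝒩.X v + 2 * T.d * 𝒩.Y v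
  g10 : K.g 1 0 = 𝒩.Φ * T.P - 𝒩.R * T.P + 2 * T.a * 𝒩.X u + 2 * T.b * 𝒩.Y u
  g00 : 2 * K.g 0 0 = 2 * T.g + 3 * (T.P * 𝒩.X (u + v) + T.Q * 𝒩.Y (u + v)) + T.al * (u + v)
    + (𝒩.X T.t₁ - T.P * 𝒩.X u - 3 * T.P * 𝒩.X v + 2 * 𝒩.Φ * T.b - 2 * T.Q * 𝒩.Y v
      + T.al * (u - v))
  g11 : 2 * K.g 1 1 = 2 * T.g + 3 * (T.P * 𝒩.X (u + v) + T.Q * 𝒩.Y (u + v)) + T.al * (u + v)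
    - (𝒩.X T.t₁ - T.P * 𝒩.X u - 3 * T.P * 𝒩.X v + 2 * 𝒩.Φ * T.b - 2 * T.Q * 𝒩.Y v
      + T.al * (u - v))

/-- The Killing equations, and the equations for the derivatives of `α` and `ζ^a`. -/
structure Determining (u v : B) (T : Fields B) : Prop where
  Ya : 𝒩.Y T.a = 0
  Xd : 𝒩.X T.d = 0
  Xb : 2 * 𝒩.X T.b + 𝒩.Y T.d = 0
  Yb : 2 * 𝒩.Y T.b + 𝒩.X T.a = 0
  YP : 𝒩.Y T.P = 0
  XQ : 𝒩.X T.Q = 0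
  div : 𝒩.X T.P + 𝒩.Y T.Q = 0
  Xal : 𝒩.X T.al = -2 * 𝒩.Φ * T.Q + 2 * T.b * 𝒩.X (u + v) + 2 * T.d * 𝒩.Y (u + v)
  Yal : 𝒩.Y T.al = 2 * 𝒩.Φ * T.P + 2 * T.a * 𝒩.X (u + v) + 2 * T.b * 𝒩.Y (u + v)
  Yt₁ : 𝒩.Y T.t₁ = 2 * 𝒩.Φ * T.a + T.P * 𝒩.Y (u + v)
  Xt₂ : 𝒩.X T.t₂ = -2 * 𝒩.Φ * T.d + T.Q * 𝒩.X (u + v)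
  Xt₁ : 𝒩.X T.t₁ + 𝒩.Y T.t₂ = 3 * (T.P * 𝒩.X (u + v) + T.Q * 𝒩.Y (u + v))

/-- The equations for the derivatives of `g'`, and the conditions on `ζ^a ∇_a V` and
`ζ^a ∇_a V̂`. -/
structure Final (u v : B) (T : Fields B) : Prop where
  Xg : 2 * 𝒩.X T.g = -T.P * 𝒩.X (𝒩.X (u - v)) - T.Q * 𝒩.Y (𝒩.X (u - v)) + 2 * 𝒩.Φ * T.Q * (u + v)
    - 2 * 𝒩.Φ * T.t₂ + 2 * 𝒩.R * T.Q * (u - v) - 𝒩.R * 𝒩.Y T.d - 2 * T.d * 𝒩.Y 𝒩.R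
    - 2 * T.b * 𝒩.X 𝒩.R - 4 * T.b * 𝒩.X (u * v) - 4 * T.d * 𝒩.Y (u * v)
  Yg : 2 * 𝒩.Y T.g = T.P * 𝒩.Y (𝒩.X (u - v)) + T.Q * 𝒩.Y (𝒩.Y (u - v)) - 2 * 𝒩.Φ * T.P * (u + v)
    + 2 * 𝒩.Φ * T.t₁ - 2 * 𝒩.R * T.P * (u - v) - 𝒩.R * 𝒩.X T.a - 2 * T.b * 𝒩.Y 𝒩.R
    - 2 * T.a * 𝒩.X 𝒩.R - 4 * T.a * 𝒩.X (u * v) - 4 * T.b * 𝒩.Y (u * v)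
  C₁ : (T.t₁ - 𝒩.X T.a + T.P * (u - v)) * 𝒩.X u + (T.t₂ + 𝒩.Y T.d + T.Q * (u - v)) * 𝒩.Y u
    - T.a * 𝒩.X (𝒩.X u) + T.d * 𝒩.Y (𝒩.Y u) = 0
  C₂ : (T.t₁ + 𝒩.X T.a - T.P * (u - v)) * 𝒩.X v + (T.t₂ - 𝒩.Y T.d - T.Q * (u - v)) * 𝒩.Y v
    + T.a * 𝒩.X (𝒩.X v) - T.d * 𝒩.Y (𝒩.Y v) = 0

variable {𝒩}

theorem two_mul_eq_zero {x : B} (h : 2 * x = 0) : x = 0 := by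
  rw [two_mul, ← two_smul ℂ x] at h
  exact (smul_eq_zero_iff_right two_ne_zero).1 h

theorem two_mul_cancel {x y : B} (h : 2 * x = 2 * y) : x = y :=
  sub_eq_zero.1 (two_mul_eq_zero (by rw [mul_sub, h, sub_self]))

/-- When one null derivative annihilates a component, `comm` turns the mixed second derivative into
weight times curvature; `Φ` does not enter because the charge is zero. The last identity comes from
applying `X` to `div`. -/
theorem Fields.IsTensor.second_derivatives {T : Fields B} (hT : T.IsTensor 𝒩) (Ya : 𝒩.Y T.a = 0)
    (Xd : 𝒩.X T.d = 0) (YP : 𝒩.Y T.P = 0) (XQ : 𝒩.X T.Q = 0) (div : 𝒩.X T.P + 𝒩.Y T.Q = 0) :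
    𝒩.Y (𝒩.X T.a) = -4 * 𝒩.R * T.a ∧ 𝒩.X (𝒩.Y T.d) = -4 * 𝒩.R * T.d ∧
    𝒩.Y (𝒩.X T.P) = -2 * 𝒩.R * T.P ∧ 𝒩.X (𝒩.Y T.Q) = -2 * 𝒩.R * T.Q ∧
    𝒩.X (𝒩.X T.P) = 2 * 𝒩.R * T.Q := by
  have XYa := 𝒩.comm T.a
  have XYd := 𝒩.comm T.d
  have XYP := 𝒩.comm T.P
  have XYQ := 𝒩.comm T.Q
  have XXP := congrArg 𝒩.X div
  simp only [Ya, Xd, YP, XQ, hT.a.1, hT.a.2, hT.d.1, hT.d.2, hT.P.1, hT.P.2, hT.Q.1,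
    hT.Q.2, map_zero, mul_zero, add_zero, zero_add, map_add] at XYa XYd XYP XYQ XXP
  push_cast at XYa XYd XYP XYQ
  refine ⟨?_, ?_, ?_, ?_, ?_⟩
  · linear_combination -XYa
  · linear_combination XYd
  · linear_combination -XYP
  · linear_combination XYQ
  · linear_combination XXP - XYQ

theorem two_mul_half_smul (x : B) : 2 * ((1 / 2 : ℂ) • x) = x := by
  rw [two_mul, ← add_smul]
  norm_num

theorem derivation_two (D : Derivation ℂ B B) : D 2 = 0 := by
  simpa using D.map_natCast 2

theorem derivation_three (D : Derivation ℂ B B) : D 3 = 0 := by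
  simpa using D.map_natCast 3

section

variable {K : Coeffs B} {u v : B} {T : Fields B}

-- The half of sufficiency that needs only the explicit form and the determining equations. Each
-- coefficient of positive order vanishes identically, or is a multiple of one of those equations,
-- corrected where necessary by a curvature identity or by `div`.
set_option maxHeartbeats 1000000 in
theorem commutatorCoeff_eq_zero_of_pos (hT : T.IsTensor 𝒩) (hK : 𝒩.Explicit K u v T)
    (hD : 𝒩.Determining u v T) (k l : Fin 2) (i j : Fin 4) (hij : (i : ℕ) + j ≠ 0) :
    𝒩.commutatorCoeff K u v k l i j = 0 := by
  obtain ⟨YXa, XYd, YXP, XYQ, XXP⟩ := hT.second_derivatives hD.Ya hD.Xd hD.YP hD.XQ hD.div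
  obtain ⟨-, -, Xb, Yb, -, -, div, Xal, Yal, Yt₁, Xt₂, Xt₁⟩ := id hD
  simp only [map_add] at Xal Yal Yt₁ Xt₂ Xt₁
  have g00 := hK.g00
  have g11 := hK.g11
  simp only [map_add] at g00 g11
  fin_cases k <;> fin_cases l <;> fin_cases i <;> fin_cases j <;>
    first
    | rfl
    | (exfalso; exact hij rfl)
    | skip
  all_goals
    -- `g00` and `g11` are available only in doubled form, so every coefficient is doubled first.
    apply two_mul_eq_zero
    simp [commutatorCoeff, hK.a00, hK.a11, hK.b00, hK.b11, hK.d00, hK.d11, hK.a01, hK.b01,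
      hK.d01, hK.a10, hK.b10, hK.d10, hK.f00, hK.f11, hK.h00, hK.h11, hK.f01, hK.h01, hK.f10,
      hK.h10, hK.g01, hK.g10, hD.Ya, hD.Xd, hD.YP, hD.XQ, derivation_two]
    try first
      | ring1
      | linear_combination 2 * XXP - 2 * Xal
      | linear_combination -2 * Xt₂ - 2 * XYd
      | linear_combination g00 - g11
      | linear_combination -2 * Yt₁ - 2 * YXa
      | linear_combination -2 * Yal - 2 * YXP
      | linear_combination -4 * div
      | linear_combination -2 * Xb
      | linear_combination -2 * Yb
      | linear_combination g11 - g00 - 2 * Xt₁ - 2 * (u - v) * div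

end

end NullCalculus

/-! ### The coefficients of order zero, and the fields recovered from a symmetry operator. -/

namespace NullCalculus

variable {B : Type*} [CommRing B] [Algebra ℂ B] {ι : Type*} {𝒩 : NullCalculus B ι}

section

variable {K : Coeffs B} {u v : B} {T : Fields B}

-- Modulo the explicit form and the determining equations, the order zero coefficients are precisely
-- the defects of the four equations of `Final`. Since this is an identity, it serves both
-- directions of the equivalence. The off-diagonal entries contain derivatives of `K.g 0 0` and `K.g
-- 1 1`, hence second derivatives of `t₁`, which have to be eliminated.
set_option maxHeartbeats 1000000 in
theorem two_mul_commutatorCoeff_zero (hT : T.IsTensor 𝒩) (hu : 𝒩.Tensor 0 u) (hv : 𝒩.Tensor 0 v)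
    (hK : 𝒩.Explicit K u v T) (hD : 𝒩.Determining u v T) :
    𝒩.commutatorCoeff K u v 0 0 0 0 = 
      (T.t₁ - 𝒩.X T.a + T.P * (u - v)) * 𝒩.X u + (T.t₂ + 𝒩.Y T.d + T.Q * (u - v)) * 𝒩.Y u
        - T.a * 𝒩.X (𝒩.X u) + T.d * 𝒩.Y (𝒩.Y u) ∧
    𝒩.commutatorCoeff K u v 1 1 0 0 = 
      (T.t₁ + 𝒩.X T.a - T.P * (u - v)) * 𝒩.X v + (T.t₂ - 𝒩.Y T.d - T.Q * (u - v)) * 𝒩.Y v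
        + T.a * 𝒩.X (𝒩.X v) - T.d * 𝒩.Y (𝒩.Y v) ∧
    2 * 𝒩.commutatorCoeff K u v 0 1 0 0 = -T.P * 𝒩.X (𝒩.X (u - v)) - T.Q * 𝒩.Y (𝒩.X (u - v)) + 2 * 𝒩.Φ * T.Q * (u + v)
    - 2 * 𝒩.Φ * T.t₂ + 2 * 𝒩.R * T.Q * (u - v) - 𝒩.R * 𝒩.Y T.d - 2 * T.d * 𝒩.Y 𝒩.R
    - 2 * T.b * 𝒩.X 𝒩.R - 4 * T.b * 𝒩.X (u * v) - 4 * T.d * 𝒩.Y (u * v) - 2 * 𝒩.X T.g ∧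
    2 * 𝒩.commutatorCoeff K u v 1 0 0 0 =
      T.P * 𝒩.Y (𝒩.X (u - v)) + T.Q * 𝒩.Y (𝒩.Y (u - v)) - 2 * 𝒩.Φ * T.P * (u + v)
    + 2 * 𝒩.Φ * T.t₁ - 2 * 𝒩.R * T.P * (u - v) - 𝒩.R * 𝒩.X T.a - 2 * T.b * 𝒩.Y 𝒩.R
    - 2 * T.a * 𝒩.X 𝒩.R - 4 * T.a * 𝒩.X (u * v) - 4 * T.b * 𝒩.Y (u * v) - 2 * 𝒩.Y T.g := by
  obtain ⟨YXa, XYd, YXP, XYQ, XXP⟩ := hT.second_derivatives hD.Ya hD.Xd hD.YP hD.XQ hD.div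
  have XYu := 𝒩.comm u
  have XYv := 𝒩.comm v
  -- Only `Y t₁`, `X t₂` and the sum `X t₁ + Y t₂` are prescribed. `X X t₁` is reached by applying
  -- `X` to the sum and commuting `X Y t₂`; `Y X t₁` is reached by commuting `X Y t₁`.
  have XYt₂ := 𝒩.comm T.t₂
  have XYt₁ := 𝒩.comm T.t₁
  have XXt₁ := congrArg 𝒩.X hD.Xt₁
  have YYt₂ := congrArg 𝒩.Y hD.Xt₁
  obtain ⟨-, -, Xb, Yb, -, -, div, Xal, Yal, Yt₁, Xt₂, Xt₁⟩ := id hD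
  have Xg00 := congrArg 𝒩.X hK.g00
  have Xg11 := congrArg 𝒩.X hK.g11
  have Yg00 := congrArg 𝒩.Y hK.g00
  have Yg11 := congrArg 𝒩.Y hK.g11
  have g00 := hK.g00
  have g11 := hK.g11
  simp only [Yt₁, Xt₂] at XYt₁ XYt₂
  simp [hu.1, hu.2, hv.1, hv.2, hT.t₁.1, hT.t₁.2, hT.t₂.1, hT.t₂.2, derivation_two, derivation_three, hD.YP, hD.XQ] at XYu XYv XYt₂ XYt₁ XXt₁ YYt₂ Xg00 Xg11 Yg00 Yg11 g00 g11 Xal Yal Xt₁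
  simp [commutatorCoeff, hK.a00, hK.a11, hK.b00, hK.b11, hK.d00, hK.d11, hK.a01, hK.b01,
      hK.d01, hK.a10, hK.b10, hK.d10, hK.f00, hK.f11, hK.h00, hK.h11, hK.f01, hK.h01, hK.f10,
      hK.h10, hK.g01, hK.g10, derivation_two]
  refine ⟨?_, ?_, ?_, ?_⟩
  · linear_combination (-𝒩.Y u) * Xb - 2*T.b * XYu
  · linear_combination (-𝒩.X v) * Yb
  · linear_combination -Xg11 + XXt₁ - XYt₂ - 2 * v * Xal - 𝒩.R * Xb - (𝒩.X u + 𝒩.X v) * div - 2 * T.Q * XYv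
  · linear_combination -Yg00 + XYt₁ - 2 * u * Yal + (𝒩.R - 2 * 𝒩.Φ) * Yb - T.P * XYu
      - T.P * XYv - (3 * 𝒩.Y u + 𝒩.Y v) * div


/-- The operator with explicit coefficients commutes with the Dirac operator. -/
theorem commutatorCoeff_eq_zero (hT : T.IsTensor 𝒩) (hu : 𝒩.Tensor 0 u) (hv : 𝒩.Tensor 0 v)
    (hK : 𝒩.Explicit K u v T) (hD : 𝒩.Determining u v T) (hF : 𝒩.Final u v T)
    (k l : Fin 2) (i j : Fin 4) : 𝒩.commutatorCoeff K u v k l i j = 0 := by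
  by_cases hij : (i : ℕ) + j = 0
  · obtain ⟨h00, h11, h01, h10⟩ := two_mul_commutatorCoeff_zero hT hu hv hK hD
    obtain rfl : i = 0 := Fin.ext (by simpa using (Nat.add_eq_zero_iff.1 hij).1)
    obtain rfl : j = 0 := Fin.ext (by simpa using (Nat.add_eq_zero_iff.1 hij).2)
    fin_cases k <;> fin_cases l
    · exact h00.trans hF.C₁
    · exact two_mul_eq_zero (h01.trans (sub_eq_zero.2 hF.Xg.symm))
    · exact two_mul_eq_zero (h10.trans (sub_eq_zero.2 hF.Yg.symm))
    · exact h11.trans hF.C₂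
  · exact commutatorCoeff_eq_zero_of_pos hT hK hD k l i j hij

/-- The tensor fields of a symmetry operator. -/
def Coeffs.fields (𝒩 : NullCalculus B ι) (K : Coeffs B) (u v : B) : Fields B where
  a := K.a 0 0
  b := K.b 0 0
  d := K.d 0 0
  P := K.b 1 0
  Q := K.b 0 1
  t₁ := K.f 1 1 + K.b 1 0 * (u - v)
  t₂ := K.h 0 0 - K.b 0 1 * (u - v)
  al := K.f 0 1 - 𝒩.X (K.b 1 0)
  -- The sum of the equations `g00` and `g11` of `Explicit`, solved for `g`.
  g := (1 / 2 : ℂ) • (K.g 0 0 + K.g 1 1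
    - 3 * (K.b 1 0 * 𝒩.X (u + v) + K.b 0 1 * 𝒩.Y (u + v))
    - (K.f 0 1 - 𝒩.X (K.b 1 0)) * (u + v))

theorem Coeffs.IsTensor.fields (hK : K.IsTensor 𝒩) (hu : 𝒩.Tensor 0 u) (hv : 𝒩.Tensor 0 v) :
    (K.fields 𝒩 u v).IsTensor 𝒩 := by
  have e : entryWeight 0 0 = 0 ∧ entryWeight 0 1 = -2 ∧ entryWeight 1 0 = 2 ∧ entryWeight 1 1 = 0 :=
    ⟨rfl, rfl, rfl, rfl⟩
  obtain ⟨e00, e01, e10, e11⟩ := e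
  have a00 := hK.a 0 0
  have b00 := hK.b 0 0
  have d00 := hK.d 0 0
  have b10 := hK.b 1 0
  have b01 := hK.b 0 1
  have f11 := hK.f 1 1
  have h00 := hK.h 0 0
  have f01 := hK.f 0 1
  have g00 := hK.g 0 0
  have g11 := hK.g 1 1
  simp only [Tensor, e00, e01, e10, e11] at a00 b00 d00 b10 b01 f11 h00 f01 g00 g11 hu hv
  norm_num at a00 b00 d00 b10 b01 f11 h00 f01 g00 g11 hu hv
  constructor <;> simp only [Tensor, Coeffs.fields] <;> push_cast
  · exact a00
  · simpa using b00
  · exact ⟨by linear_combination d00.1, d00.2⟩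
  · exact ⟨by linear_combination b10.1, b10.2⟩
  · exact ⟨by linear_combination b01.1, b01.2⟩
  · simp [f11, b10, hu, hv]; ring
  · simp [h00, b01, hu, hv]; ring
  · simp [f01, b10, hu, hv, 𝒩.HX, 𝒩.NX, derivation_two]
  · simp [f01, b10, b01, hu, hv, g00, g11, 𝒩.HX, 𝒩.NX, 𝒩.HY, 𝒩.NY, derivation_two,
      derivation_three]
    ring

/-- If the commutator with the Dirac operator vanishes, then the coefficients have the explicit
form, and the tensor fields satisfy the determining equations. -/
theorem explicit_of_commutatorCoeff_eq_zero (hK : K.IsTensor 𝒩) (hu : 𝒩.Tensor 0 u)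
    (hv : 𝒩.Tensor 0 v) (h : ∀ k l i j, 𝒩.commutatorCoeff K u v k l i j = 0) :
    𝒩.Explicit K u v (K.fields 𝒩 u v) ∧ 𝒩.Determining u v (K.fields 𝒩 u v) ∧
      𝒩.Final u v (K.fields 𝒩 u v) := by
  have hT := hK.fields hu hv
  have hg := two_mul_half_smul (K.g 0 0 + K.g 1 1
    - 3 * (K.b 1 0 * 𝒩.X (u + v) + K.b 0 1 * 𝒩.Y (u + v))
    - (K.f 0 1 - 𝒩.X (K.b 1 0)) * (u + v))
  change 2 * (K.fields 𝒩 u v).g = _ at hg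
  set T := K.fields 𝒩 u v with hTdef
  have a00 : K.a 0 0 = T.a := rfl
  have b00 : K.b 0 0 = T.b := rfl
  have d00 : K.d 0 0 = T.d := rfl
  have b10 : K.b 1 0 = T.P := rfl
  have b01 : K.b 0 1 = T.Q := rfl
  have f11 : K.f 1 1 = T.t₁ - T.P * (u - v) := by simp [hTdef, Coeffs.fields]
  have h00 : K.h 0 0 = T.t₂ + T.Q * (u - v) := by simp [hTdef, Coeffs.fields]
  have f01 : K.f 0 1 = T.al + 𝒩.X T.P := by simp [hTdef, Coeffs.fields]
  -- Order three is purely algebraic: it forces the principal part to be that of `e^{ab} 𝕀 + 2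
  -- α^{(a} γ^{b)}`.
  have a10 : K.a 1 0 = 0 := h 1 1 3 0
  have d01 : K.d 0 1 = 0 := h 0 0 0 3
  have a11 : K.a 1 1 = T.a := (sub_eq_zero.1 (h 0 1 3 0)).symm
  have d11 : K.d 1 1 = T.d := (sub_eq_zero.1 (h 0 1 1 2)).symm
  have a01 : K.a 0 1 = 2 * T.P := sub_eq_zero.1 (h 0 0 2 1)
  have d10 : K.d 1 0 = 2 * T.Q := (sub_eq_zero.1 (h 0 0 1 2)).symm
  have b11 : K.b 1 1 = T.b := (two_mul_cancel (sub_eq_zero.1 (h 0 1 2 1))).symm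
  have k0002 := h 0 0 0 2
  have k1102 := h 1 1 0 2
  have k1120 := h 1 1 2 0
  have k0020 := h 0 0 2 0
  have k0011 := h 0 0 1 1
  have k1101 := h 1 1 0 1
  have k0010 := h 0 0 1 0
  have k0110 := h 0 1 1 0
  have k0120 := h 0 1 2 0
  have k1002 := h 1 0 0 2
  have k1020 := h 1 0 2 0
  have k0102 := h 0 1 0 2
  have k0111 := h 0 1 1 1
  have k1011 := h 1 0 1 1
  have k1111 := h 1 1 1 1
  have k0001 := h 0 0 0 1
  have k1110 := h 1 1 1 0
  have k0101 := h 0 1 0 1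
  have k1010 := h 1 0 1 0
  have k1001 := h 1 0 0 1
  simp only [commutatorCoeff, a00, b00, d00, b10, b01, f11, h00, f01, a10, d01, a11, d11, a01, d10,
    b11, map_zero, neg_zero, zero_mul, mul_zero, add_zero, zero_add, sub_zero]
    at k0002 k1102 k1120 k0020 k0011 k1101 k0010 k0110 k0120 k1002 k1020 k0102 k0111 k1011 k1111
      k0001 k1110 k0101 k1010 k1001
  -- Order two: some coefficients are equations for the tensors, the others determine entries of the
  -- first order part.
  have Ya : 𝒩.Y T.a = 0 := by linear_combination -k1020
  have Xd : 𝒩.X T.d = 0 := by linear_combination -k0102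
  have h01 : K.h 0 1 = 0 := by linear_combination -k1102
  have f10 : K.f 1 0 = 0 := by linear_combination -k0020
  have h10 : K.h 1 0 = T.al - 𝒩.X T.P := by linear_combination -k0011
  have f00 : K.f 0 0 = T.t₁ + 𝒩.X T.a + T.P * (u - v) := by linear_combination k0120
  have h11 : K.h 1 1 = T.t₂ + 𝒩.Y T.d - T.Q * (u - v) := by linear_combination k1002
  simp only [h01, f10, h10, f00, h11, map_zero, neg_zero, zero_mul, mul_zero, add_zero, zero_add,
    sub_zero, 𝒩.X.leibniz, 𝒩.Y.leibniz, smul_eq_mul, derivation_two, map_add, map_sub]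
    at k0002 k1120 k1101 k0010 k0110 k0111 k1011 k1111 k0001 k1110 k0101 k1010 k1001
  -- Once `h01` is known to vanish, the remaining second order coefficient is the derivative of `K.d
  -- 1 0 = 2 Q`.
  have XQ : 𝒩.X T.Q = 0 := two_mul_eq_zero (by linear_combination -k0002)
  have YP : 𝒩.Y T.P = 0 := two_mul_eq_zero (by linear_combination -k1120)
  have div : 𝒩.X T.P + 𝒩.Y T.Q = 0 := two_mul_eq_zero (by linear_combination -k1111)
  obtain ⟨YXa, XYd, YXP, XYQ, XXP⟩ := hT.second_derivatives Ya Xd YP XQ div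
  have Xb : 2 * 𝒩.X T.b + 𝒩.Y T.d = 0 := by linear_combination -k0111
  have Yb : 2 * 𝒩.Y T.b + 𝒩.X T.a = 0 := by linear_combination -k1011
  have g01 : K.g 0 1 = -𝒩.Φ * T.Q - 𝒩.R * T.Q + 2 * T.b * 𝒩.X v + 2 * T.d * 𝒩.Y v := by
    linear_combination -k1101
  have g10 : K.g 1 0 = 𝒩.Φ * T.P - 𝒩.R * T.P + 2 * T.a * 𝒩.X u + 2 * T.b * 𝒩.Y u := by
    linear_combination -k0010
  simp only [map_add, map_sub] at hg
  rw [f01] at hg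
  simp only [b10, b01, b00, d00, g01, g10, XQ, YP] at k0110 k0001 k1110 k0101 k1010 k1001 hg
  -- The diagonal zeroth order entries come from their difference, a first order coefficient
  -- (`k0110`), and their sum, which is the choice of `g` (`hg`).
  have hK' : 𝒩.Explicit K u v T := by
    constructor
    all_goals first | assumption | skip
    · simp only [map_add]
      linear_combination k0110 - hg
    · simp only [map_add]
      linear_combination -k0110 - hg
  have hD' : 𝒩.Determining u v T := by
    constructor
    all_goals first | assumption | skip
    all_goals simp only [map_add]
    · linear_combination XXP - k0001
    · linear_combination -YXP - k1110
    · linear_combination -YXa - k1010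
    · linear_combination -XYd - k0101
    · linear_combination -k0110 - k1001 - (u - v) * div
  refine ⟨hK', hD', ?_⟩
  -- With the left-hand sides zero, the order zero identities become the equations of `Final`.
  obtain ⟨h00, h11, h01, h10⟩ := two_mul_commutatorCoeff_zero hT hu hv hK' hD'
  simp only [h] at h00 h11 h01 h10
  exact ⟨(sub_eq_zero.1 (h01.symm.trans (mul_zero _))).symm,
    (sub_eq_zero.1 (h10.symm.trans (mul_zero _))).symm, h00.symm, h11.symm⟩

end

end NullCalculus

/-! ### The null calculus of a moving frame -/

section GradedDerivation

variable {C : Type*} [CommRing C] [Algebra ℂ C]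

/-- The derivation of the group algebra `C[ℤ × ℤ]` which is given on homogeneous elements by the
family `D`, and is of degree `s`. -/
def gradedDerivation (s : ℤ × ℤ) (D : ℤ × ℤ → C →ₗ[ℂ] C)
    (hD : ∀ k l f g, D (k + l) (f * g) = f * D l g + g * D k f) :
    Derivation ℂ (AddMonoidAlgebra C (ℤ × ℤ)) (AddMonoidAlgebra C (ℤ × ℤ)) :=
  Derivation.mk'
    ((Finsupp.lsum ℂ fun k => (AddMonoidAlgebra.coeffLinearEquiv ℂ).symm.toLinearMap ∘ₗ
        Finsupp.lsingle (k + s) ∘ₗ D k) ∘ₗ (AddMonoidAlgebra.coeffLinearEquiv ℂ).toLinearMap) (by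
    intro a b
    induction a using AddMonoidAlgebra.induction_linear with
    | zero => simp
    | add a a' ha ha' => 
      rw [add_mul, map_add, ha, ha', map_add]
      simp only [smul_eq_mul]
      ring
    | single k f =>
      induction b using AddMonoidAlgebra.induction_linear with
      | zero => simp
      | add b b' hb hb' =>
        rw [mul_add, map_add, hb, hb', map_add]
        simp only [smul_eq_mul]
        ring
      | single l g =>
        have key : ∀ k f, ((Finsupp.lsum ℂ fun k =>
            (AddMonoidAlgebra.coeffLinearEquiv ℂ).symm.toLinearMap ∘ₗ
            Finsupp.lsingle (k + s) ∘ₗ D k) ∘ₗ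
            (AddMonoidAlgebra.coeffLinearEquiv (S := C) ℂ).toLinearMap)
            (AddMonoidAlgebra.single k f) = AddMonoidAlgebra.single (k + s) (D k f) := by
          intro k f
          simp
        rw [AddMonoidAlgebra.single_mul_single, key, key, key, hD, AddMonoidAlgebra.single_add]
        simp only [smul_eq_mul, AddMonoidAlgebra.single_mul_single]
        congr 2 <;> abel)

theorem gradedDerivation_single (s : ℤ × ℤ) (D : ℤ × ℤ → C →ₗ[ℂ] C)
    (hD : ∀ k l f g, D (k + l) (f * g) = f * D l g + g * D k f) (k : ℤ × ℤ) (f : C) :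
    gradedDerivation s D hD (AddMonoidAlgebra.single k f) =
      AddMonoidAlgebra.single (k + s) (D k f) := by
  simp [gradedDerivation]

end GradedDerivation

theorem Signature.sgn_mul_self (σ : Signature) (a : Fin 2) : σ.sgn a * σ.sgn a = 1 := by
  rcases σ.sq a with h | h <;> simp [Signature.sgn, h]

/-- A commutative algebra with a moving frame `δ a` of derivations, the frame components `W a` of
the spin connection `Γ^{01}`, and the connection form `A a` of a line bundle. The number `c` is a
square root of `-η`. The characters `ev` separate points. -/
structure FrameCalculus (σ : Signature) (C : Type*) [CommRing C] [Algebra ℂ C] (ι : Type*) where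
  δ : Fin 2 → Derivation ℂ C C
  W : Fin 2 → C
  A : Fin 2 → C
  c : ℂ
  hc : c * c = -(σ.sgn 0 * σ.sgn 1)
  torsion : ∀ f, δ 0 (δ 1 f) - δ 1 (δ 0 f) = σ.sgn 1 • (W 0 * δ 0 f) + σ.sgn 0 • (W 1 * δ 1 f)
  ev : ι → C →ₐ[ℂ] ℂ
  sep : ∀ f, (∀ p, ev p f = 0) → f = 0

namespace FrameCalculus

variable {σ : Signature} {C : Type*} [CommRing C] [Algebra ℂ C] {ι : Type*}
  (𝓕 : FrameCalculus σ C ι)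

/-- The algebra of fields of arbitrary spin weight and charge. -/
abbrev Graded (C : Type*) [CommRing C] := AddMonoidAlgebra C (ℤ × ℤ)

/-- The field `f` of spin weight `k.1 / 2` and charge `k.2`. -/
abbrev hom (k : ℤ × ℤ) (f : C) : Graded C := AddMonoidAlgebra.single k f

/-- The curl of a covector in an orthonormal frame. -/
def curl (w : Fin 2 → C) : C :=
  𝓕.δ 0 (w 1) - 𝓕.δ 1 (w 0) - σ.sgn 1 • (𝓕.W 0 * w 0) - σ.sgn 0 • (𝓕.W 1 * w 1)

/-- The covariant derivative `∇_a` of a field of spin weight `k.1 / 2` and charge `k.2`. -/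
def covDeriv (a : Fin 2) (k : ℤ × ℤ) : C →ₗ[ℂ] C :=
  (𝓕.δ a).toLinearMap + (k.1 * (𝓕.c * σ.sgn 0 / 2) : ℂ) • LinearMap.mulLeft ℂ (𝓕.W a)
    - (k.2 : ℂ) • LinearMap.mulLeft ℂ (𝓕.A a)

theorem covDeriv_apply (a : Fin 2) (k : ℤ × ℤ) (f : C) :
    𝓕.covDeriv a k f = 𝓕.δ a f + (k.1 * (𝓕.c * σ.sgn 0 / 2) : ℂ) • (𝓕.W a * f)
      - (k.2 : ℂ) • (𝓕.A a * f) := rfl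

theorem covDeriv_mul (a : Fin 2) (k l : ℤ × ℤ) (f g : C) :
    𝓕.covDeriv a (k + l) (f * g) = f * 𝓕.covDeriv a l g + g * 𝓕.covDeriv a k f := by
  simp only [covDeriv_apply, Derivation.leibniz, Prod.fst_add, Prod.snd_add, Int.cast_add,
    smul_eq_mul, Algebra.smul_def (R := ℂ) (A := C), map_mul, map_add, add_mul]
  ring

/-- The null derivative `∂^0 + c ∂^1`. -/
def nullX : Derivation ℂ (Graded C) (Graded C) :=
  gradedDerivation (-2, 0)
    (fun k => σ.sgn 0 • 𝓕.covDeriv 0 k + (σ.sgn 1 * 𝓕.c) • 𝓕.covDeriv 1 k) (by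
      intro k l f g
      simp only [LinearMap.add_apply, LinearMap.smul_apply, covDeriv_mul,
        Algebra.smul_def (R := ℂ) (A := C)]
      ring)

/-- The null derivative `∂_0 - η c ∂_1`. -/
def nullY : Derivation ℂ (Graded C) (Graded C) :=
  gradedDerivation (2, 0)
    (fun k => 𝓕.covDeriv 0 k - (σ.sgn 0 * σ.sgn 1 * 𝓕.c) • 𝓕.covDeriv 1 k) (by
      intro k l f g
      simp only [LinearMap.sub_apply, LinearMap.smul_apply, covDeriv_mul,
        Algebra.smul_def (R := ℂ) (A := C)]
      ring)

/-- The derivation multiplying a homogeneous element by the value of `φ` on its degree. -/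
def grading (C : Type*) [CommRing C] [Algebra ℂ C] (φ : ℤ × ℤ →+ ℤ) :
    Derivation ℂ (Graded C) (Graded C) :=
  gradedDerivation 0 (fun k => (φ k : ℂ) • LinearMap.id) (by
    intro k l f g
    simp only [map_add, Int.cast_add, LinearMap.smul_apply, LinearMap.id_apply,
      Algebra.smul_def (R := ℂ) (A := C)]
    ring)

theorem nullX_hom (k : ℤ × ℤ) (f : C) : 𝓕.nullX (hom k f) =
    hom (k + (-2, 0)) (σ.sgn 0 • 𝓕.covDeriv 0 k f + (σ.sgn 1 * 𝓕.c) • 𝓕.covDeriv 1 k f) :=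
  gradedDerivation_single _ _ _ _ _

theorem nullY_hom (k : ℤ × ℤ) (f : C) : 𝓕.nullY (hom k f) =
    hom (k + (2, 0)) (𝓕.covDeriv 0 k f - (σ.sgn 0 * σ.sgn 1 * 𝓕.c) • 𝓕.covDeriv 1 k f) :=
  gradedDerivation_single _ _ _ _ _

theorem grading_hom (φ : ℤ × ℤ →+ ℤ) (k : ℤ × ℤ) (f : C) :
    grading C φ (hom k f) = hom k ((φ k : ℂ) • f) := by
  rw [grading, gradedDerivation_single, add_zero]
  rfl

theorem coeff_grading (φ : ℤ × ℤ →+ ℤ) (b : Graded C) (k : ℤ × ℤ) :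
    (grading C φ b).coeff k = (φ k : ℂ) • b.coeff k := by
  induction b using AddMonoidAlgebra.induction_linear with
  | zero => simp
  | add a b ha hb => simp [ha, hb]
  | single l f =>
    rw [grading_hom]
    by_cases h : l = k
    · subst h; simp
    · simp [Finsupp.single_eq_of_ne' h]

theorem sgn_eq (σ : Signature) (a : Fin 2) : σ.sgn a = 1 ∨ σ.sgn a = -1 := by
  rcases σ.sq a with h | h <;> simp [Signature.sgn, h]

theorem hom_ext {D D' : Graded C → Graded C} (h0 : D 0 = D' 0)
    (hadd : ∀ a b, D a = D' a → D b = D' b → D (a + b) = D' (a + b))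
    (h : ∀ k f, D (hom k f) = D' (hom k f)) (b : Graded C) : D b = D' b := by
  induction b using AddMonoidAlgebra.induction_linear with
  | zero => exact h0
  | add a b ha hb => exact hadd a b ha hb
  | single k f => exact h k f

-- The terms with first derivatives cancel: the frame commutator, expressed by `W` through
-- `torsion`, is compensated by the shift of the weight by `∓2`. What is left is the curl of the
-- connection form `m (c s₀ / 2) W - n A` in degree `(m, n)`, multiplied by `X^0 Y^1 - X^1 Y^0 = -2
-- s₁ c`. With `c² = -s₀ s₁` this gives the coefficient `1` of `curl W` and `2 s₁ c` of `curl A`.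
set_option maxHeartbeats 1000000 in
theorem nullX_nullY (b : Graded C) : 𝓕.nullX (𝓕.nullY b) = 𝓕.nullY (𝓕.nullX b)
    + hom 0 (𝓕.curl 𝓕.W) * grading C (AddMonoidHom.fst ℤ ℤ) b
    + hom 0 ((2 * σ.sgn 1 * 𝓕.c) • 𝓕.curl 𝓕.A) * grading C (AddMonoidHom.snd ℤ ℤ) b := by
  refine hom_ext (D := fun b => 𝓕.nullX (𝓕.nullY b)) (D' := fun b => 𝓕.nullY (𝓕.nullX b)
    + hom 0 (𝓕.curl 𝓕.W) * grading C (AddMonoidHom.fst ℤ ℤ) b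
    + hom 0 ((2 * σ.sgn 1 * 𝓕.c) • 𝓕.curl 𝓕.A) * grading C (AddMonoidHom.snd ℤ ℤ) b) (by simp)
    (fun a b ha hb => ?_) (fun k f => ?_) b
  · simp only [map_add] at ha hb ⊢
    rw [ha, hb]
    ring
  · obtain ⟨m, n⟩ := k
    simp only [nullX_hom, nullY_hom, grading_hom, AddMonoidAlgebra.single_mul_single, zero_add,
      Prod.mk_add_mk, add_zero]
    have e : m + 2 + -2 = m := by ring
    have e' : m + -2 + 2 = m := by ring
    rw [e, e', ← AddMonoidAlgebra.single_add, ← AddMonoidAlgebra.single_add]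
    congr 1
    have h1 := 𝓕.torsion f
    have hc := congrArg (algebraMap ℂ C) 𝓕.hc
    have h2 : algebraMap ℂ C 2⁻¹ * 2 = 1 := by
      rw [← map_ofNat (algebraMap ℂ C) 2, ← map_mul]; norm_num
    simp only [Algebra.smul_def (R := ℂ) (A := C)] at h1
    simp only [covDeriv_apply, curl, map_mul, map_add, map_sub, map_neg,
      Derivation.leibniz, smul_eq_mul, div_eq_mul_inv, Int.cast_add,
      Int.cast_neg, Int.cast_ofNat, AddMonoidHom.coe_fst, AddMonoidHom.coe_snd,
      Algebra.smul_def (R := ℂ) (A := C), Derivation.map_algebraMap,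
      mul_zero, zero_add, add_zero, map_ofNat] at h1 hc ⊢
    generalize algebraMap ℂ C 2⁻¹ = h at *
    generalize algebraMap ℂ C 𝓕.c = c at *
    generalize algebraMap ℂ C (m : ℂ) = m' at *
    generalize algebraMap ℂ C (n : ℂ) = n' at *
    rcases sgn_eq σ 0 with h0 | h0 <;> rcases sgn_eq σ 1 with h1' | h1' <;>
      simp only [h0, h1', map_one, map_neg, one_mul, neg_mul, mul_neg, neg_neg, mul_one] at h1 hc ⊢ <;>
      grind

/-- Evaluation of a graded element. -/
def gradedEv (p : ι) : Graded C →ₐ[ℂ] ℂ :=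
  AddMonoidAlgebra.liftNCAlgHom (𝓕.ev p) 1 (fun _ _ => Commute.all _ _)

theorem gradedEv_hom (p : ι) (k : ℤ × ℤ) (f : C) : 𝓕.gradedEv p (hom k f) = 𝓕.ev p f := by
  simp [gradedEv, hom]

/-- The null calculus of a moving frame. -/
def toNull : NullCalculus (Graded C) ι where
  X := 𝓕.nullX
  Y := 𝓕.nullY
  H := grading C (AddMonoidHom.fst ℤ ℤ)
  N := grading C (AddMonoidHom.snd ℤ ℤ)
  R := hom 0 (𝓕.curl 𝓕.W)
  Φ := hom 0 ((2 * σ.sgn 1 * 𝓕.c) • 𝓕.curl 𝓕.A)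
  comm := 𝓕.nullX_nullY
  HX := hom_ext (by simp) (fun a b ha hb => by simp only [map_add, ha, hb]; ring) fun k f => by
    simp only [grading_hom, nullX_hom, map_smul]
    rw [show (2 : Graded C) = hom 0 2 from rfl, AddMonoidAlgebra.single_mul_single, zero_add,
      ← AddMonoidAlgebra.single_sub]
    congr 1
    simp [Algebra.smul_def (R := ℂ) (A := C), map_ofNat (algebraMap ℂ C) 2]
    ring
  HY := hom_ext (by simp) (fun a b ha hb => by simp only [map_add, ha, hb]; ring) fun k f => by
    simp only [grading_hom, nullY_hom, map_smul]
    rw [show (2 : Graded C) = hom 0 2 from rfl, AddMonoidAlgebra.single_mul_single, zero_add,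
      ← AddMonoidAlgebra.single_add]
    congr 1
    simp [Algebra.smul_def (R := ℂ) (A := C), map_ofNat (algebraMap ℂ C) 2]
    ring
  NX := hom_ext (by simp) (fun a b ha hb => by simp only [map_add, ha, hb]) fun k f => by
    simp only [grading_hom, nullX_hom, map_smul]
    congr 1
    simp [Algebra.smul_def (R := ℂ) (A := C)]
    ring
  NY := hom_ext (by simp) (fun a b ha hb => by simp only [map_add, ha, hb]) fun k f => by
    simp only [grading_hom, nullY_hom, map_smul]
    congr 1
    simp [Algebra.smul_def (R := ℂ) (A := C)]
    ring
  HR := by simp [grading_hom]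
  NR := by simp [grading_hom]
  HΦ := by simp [grading_hom]
  NΦ := by simp [grading_hom]
  ev := 𝓕.gradedEv
  sep := by
    intro b k hH hN hev
    -- A simultaneous eigenvector of both gradings is concentrated in a single degree, so it is
    -- determined by one function in `C`, and evaluation at points separates such functions.
    -- Evaluation alone forgets the degree and would not separate inhomogeneous elements.
    have key : b = hom (k, 0) (b.coeff (k, 0)) := by
      refine AddMonoidAlgebra.ext (Finsupp.ext fun l => ?_)
      by_cases hl : l = (k, 0)
      · subst hl; simp
      · rw [AddMonoidAlgebra.coeff_single, Finsupp.single_eq_of_ne hl]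
        have h1 := congrArg (fun x => x.coeff l) hH
        have h2 := congrArg (fun x => x.coeff l) hN
        have h3 : (k : Graded C) * b = (k : ℂ) • b := by
          rw [Algebra.smul_def]; simp
        simp only [h3, coeff_grading] at h1 h2
        simp at h1 h2
        by_contra hb
        rw [or_iff_left hb] at h2
        have h4 := sub_eq_zero.2 h1
        rw [← sub_smul, smul_eq_zero, or_iff_left hb, sub_eq_zero] at h4
        exact hl (Prod.ext (by exact_mod_cast h4) h2)
    rw [key] at hev ⊢
    simp only [gradedEv_hom] at hev
    rw [𝓕.sep _ hev]
    exact AddMonoidAlgebra.single_zero _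

end FrameCalculus

/-! ### Smooth functions on the domain of a chart -/

section Chart

variable {M : Type*} [TopologicalSpace M] {W : Type*} [NormedAddCommGroup W] [NormedSpace ℝ W]

/-- Smoothness on the domain of a chart, expressed in coordinates. -/
def SmoothIn (φ : OpenPartialHomeomorph M Plane) (f : M → W) : Prop :=
  ContDiffOn ℝ ∞ (fun x => f (φ.symm x)) φ.target

variable {φ : OpenPartialHomeomorph M Plane}

theorem smoothIn_iff_contMDiffOn [ChartedSpace Plane M] [IsManifold (𝓡 2) ∞ M]
    (hφ : φ ∈ IsManifold.maximalAtlas (𝓡 2) ∞ M) {f : M → W} :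
    SmoothIn φ f ↔ ContMDiffOn (𝓡 2) 𝓘(ℝ, W) ∞ f φ.source := by
  rw [contMDiffOn_iff_source_of_mem_maximalAtlas hφ subset_rfl, contMDiffOn_iff_contDiffOn]
  simp [SmoothIn, OpenPartialHomeomorph.extend, Function.comp_def, φ.image_source_eq_target]

theorem pd_congr {f g : M → W} (h : ∀ r ∈ φ.source, f r = g r) (μ : Fin 2) {p : M}
    (hp : p ∈ φ.source) : pd φ μ f p = pd φ μ g p := by
  have : (fun x => f (φ.symm x)) =ᶠ[nhds (φ p)] fun x => g (φ.symm x) := by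
    filter_upwards [φ.open_target.mem_nhds (φ.map_source hp)] with x hx
    exact h _ (φ.map_target hx)
  simp only [pd, this.fderiv_eq]

theorem SmoothIn.congr {f g : M → W} (hf : SmoothIn φ f) (h : ∀ r ∈ φ.source, f r = g r) :
    SmoothIn φ g :=
  ContDiffOn.congr hf fun _ hx => (h _ (φ.map_target hx)).symm

theorem SmoothIn.differentiableAt {f : M → W} (hf : SmoothIn φ f) {p : M} (hp : p ∈ φ.source) :
    DifferentiableAt ℝ (fun x => f (φ.symm x)) (φ p) :=
  (hf.contDiffAt (φ.open_target.mem_nhds (φ.map_source hp))).differentiableAt (by simp)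

theorem SmoothIn.pd {f : M → W} (hf : SmoothIn φ f) (μ : Fin 2) :
    SmoothIn φ (SpinSurface.pd φ μ f) := by
  have h : ContDiffOn ℝ ∞ (fun x => fderiv ℝ (fun x => f (φ.symm x)) x
      (EuclideanSpace.single μ (1 : ℝ))) φ.target :=
    (hf.fderiv_of_isOpen φ.open_target (m := ∞) (by simp)).clm_apply contDiffOn_const
  refine h.congr fun x hx => ?_
  simp only [SpinSurface.pd, φ.right_inv hx]

theorem pd_pd {f : M → W} (hf : SmoothIn φ f) (μ ν : Fin 2) {p : M} (hp : p ∈ φ.source) :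
    pd φ μ (pd φ ν f) p = fderiv ℝ (fderiv ℝ (fun x => f (φ.symm x))) (φ p)
      (EuclideanSpace.single μ (1 : ℝ)) (EuclideanSpace.single ν (1 : ℝ)) := by
  have hx := φ.open_target.mem_nhds (φ.map_source hp)
  have : (fun x => pd φ ν f (φ.symm x)) =ᶠ[nhds (φ p)]
      fun x => fderiv ℝ (fun x => f (φ.symm x)) x (EuclideanSpace.single ν (1 : ℝ)) := by
    filter_upwards [hx] with x hx
    simp only [pd, φ.right_inv hx]
  have hd : DifferentiableAt ℝ (fderiv ℝ (fun x => f (φ.symm x))) (φ p) :=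
    ((hf.fderiv_of_isOpen φ.open_target (m := ∞) (by simp)).contDiffAt hx).differentiableAt (by simp)
  rw [pd, this.fderiv_eq, fderiv_clm_apply hd (by fun_prop)]
  simp

theorem pd_comm {f : M → W} (hf : SmoothIn φ f) (μ ν : Fin 2) {p : M} (hp : p ∈ φ.source) :
    pd φ μ (pd φ ν f) p = pd φ ν (pd φ μ f) p := by
  rw [pd_pd hf μ ν hp, pd_pd hf ν μ hp]
  exact ((hf.contDiffAt (φ.open_target.mem_nhds (φ.map_source hp))).isSymmSndFDerivAt
    (by rw [minSmoothness_of_isRCLikeNormedField]; exact WithTop.coe_le_coe.2 le_top)).eq _ _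

theorem SmoothIn.const (w : W) : SmoothIn φ (fun _ : M => w) := contDiffOn_const

theorem SmoothIn.add {f g : M → W} (hf : SmoothIn φ f) (hg : SmoothIn φ g) :
    SmoothIn φ (fun p => f p + g p) := ContDiffOn.add hf hg

theorem SmoothIn.sub {f g : M → W} (hf : SmoothIn φ f) (hg : SmoothIn φ g) :
    SmoothIn φ (fun p => f p - g p) := ContDiffOn.sub hf hg

theorem SmoothIn.mul {A : Type*} [NormedRing A] [NormedAlgebra ℝ A] {f g : M → A}
    (hf : SmoothIn φ f) (hg : SmoothIn φ g) : SmoothIn φ (fun p => f p * g p) := ContDiffOn.mul hf hg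

theorem SmoothIn.sum {κ : Type*} {s : Finset κ} {f : κ → M → W} (hf : ∀ k ∈ s, SmoothIn φ (f k)) :
    SmoothIn φ (fun p => ∑ k ∈ s, f k p) := ContDiffOn.sum hf

theorem SmoothIn.ofReal {f : M → ℝ} (hf : SmoothIn φ f) : SmoothIn φ (fun p => (f p : ℂ)) :=
  Complex.ofRealCLM.contDiff.comp_contDiffOn hf

theorem pd_add {f g : M → W} (hf : SmoothIn φ f) (hg : SmoothIn φ g) (μ : Fin 2) {p : M}
    (hp : p ∈ φ.source) : pd φ μ (fun r => f r + g r) p = pd φ μ f p + pd φ μ g p := by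
  simp only [pd]
  rw [fderiv_fun_add (hf.differentiableAt hp) (hg.differentiableAt hp)]
  rfl

theorem pd_const (w : W) (μ : Fin 2) (p : M) : pd φ μ (fun _ => w) p = 0 := by
  simp [pd]

theorem pd_mul {A : Type*} [NormedCommRing A] [NormedAlgebra ℝ A] {f g : M → A}
    (hf : SmoothIn φ f) (hg : SmoothIn φ g) (μ : Fin 2) {p : M}
    (hp : p ∈ φ.source) :
    pd φ μ (fun r => f r * g r) p = f p * pd φ μ g p + g p * pd φ μ f p := by
  simp only [pd]
  rw [fderiv_fun_mul (hf.differentiableAt hp) (hg.differentiableAt hp)]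
  simp [φ.left_inv hp]

theorem pd_clm {W' : Type*} [NormedAddCommGroup W'] [NormedSpace ℝ W'] (l : W →L[ℝ] W')
    {f : M → W} (hf : SmoothIn φ f) (μ : Fin 2) {p : M} (hp : p ∈ φ.source) :
    pd φ μ (fun r => l (f r)) p = l (pd φ μ f p) := by
  simp only [pd]
  rw [fderiv_fun_comp (φ p) l.differentiableAt (hf.differentiableAt hp)]
  simp

/-- The algebra of smooth complex functions on the domain of a chart. -/
def smoothAlgebra (φ : OpenPartialHomeomorph M Plane) : Subalgebra ℂ (φ.source → ℂ) where
  carrier := {f | ∃ g : M → ℂ, SmoothIn φ g ∧ ∀ p, f p = g p}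
  mul_mem' := by
    rintro _ _ ⟨f, hf, hf'⟩ ⟨g, hg, hg'⟩
    exact ⟨_, hf.mul hg, fun p => by simp [hf', hg']⟩
  add_mem' := by
    rintro _ _ ⟨f, hf, hf'⟩ ⟨g, hg, hg'⟩
    exact ⟨_, hf.add hg, fun p => by simp [hf', hg']⟩
  algebraMap_mem' c := ⟨_, SmoothIn.const c, fun p => rfl⟩

/-- A smooth function as an element of the algebra of smooth functions. -/
def SmoothIn.toAlg {f : M → ℂ} (hf : SmoothIn φ f) : smoothAlgebra φ :=
  ⟨fun p => f p, f, hf, fun _ => rfl⟩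

/-- The extension by zero of a smooth function on the domain of a chart. -/
def extend (f : smoothAlgebra φ) (p : M) : ℂ :=
  open Classical in if h : p ∈ φ.source then f.1 ⟨p, h⟩ else 0

theorem extend_apply (f : smoothAlgebra φ) {p : M} (hp : p ∈ φ.source) :
    extend f p = f.1 ⟨p, hp⟩ := dif_pos hp

theorem smoothIn_extend (f : smoothAlgebra φ) : SmoothIn φ (extend f) := by
  obtain ⟨g, hg, h⟩ := f.2
  exact hg.congr fun p hp => by rw [extend_apply f hp, h]

/-- The partial derivative `∂_μ` on the algebra of smooth functions. -/
def pdAlg (φ : OpenPartialHomeomorph M Plane) (μ : Fin 2) :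
    Derivation ℂ (smoothAlgebra φ) (smoothAlgebra φ) :=
  Derivation.mk'
    { toFun := fun f => ((smoothIn_extend f).pd μ).toAlg
      map_add' := fun f g => Subtype.ext <| funext fun p => by
        change pd φ μ (extend (f + g)) _ = pd φ μ (extend f) _ + pd φ μ (extend g) _
        rw [← pd_add (smoothIn_extend f) (smoothIn_extend g) μ p.2]
        exact pd_congr (fun r hr => by simp [extend_apply _ hr]) μ p.2
      map_smul' := fun c f => Subtype.ext <| funext fun p => by
        change pd φ μ (extend (c • f)) _ = c * pd φ μ (extend f) _
        have h := pd_mul (SmoothIn.const (φ := φ) c) (smoothIn_extend f) μ p.2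
        rw [pd_const (W := ℂ), mul_zero, add_zero] at h
        rw [← h]
        exact pd_congr (fun r hr => by simp [extend_apply _ hr]) μ p.2 }
    fun f g => Subtype.ext <| funext fun p => by
      change pd φ μ (extend (f * g)) _ = f.1 p * pd φ μ (extend g) _ + g.1 p * pd φ μ (extend f) _
      have h := pd_mul (smoothIn_extend f) (smoothIn_extend g) μ p.2
      rw [extend_apply f p.2, extend_apply g p.2] at h
      rw [← h]
      exact pd_congr (fun r hr => by simp [extend_apply _ hr]) μ p.2

/-- The smooth function `f` on the domain of a chart is represented by the element `F` of the
algebra. -/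
def Rep (φ : OpenPartialHomeomorph M Plane) (f : M → ℂ) (F : smoothAlgebra φ) : Prop :=
  ∀ p (hp : p ∈ φ.source), f p = F.1 ⟨p, hp⟩

theorem rep_toAlg {f : M → ℂ} (hf : SmoothIn φ f) : Rep φ f hf.toAlg := fun _ _ => rfl

theorem Rep.smoothIn {f : M → ℂ} {F : smoothAlgebra φ} (h : Rep φ f F) : SmoothIn φ f :=
  (smoothIn_extend F).congr fun r hr => by rw [extend_apply F hr, h r hr]

theorem Rep.pd {f : M → ℂ} {F : smoothAlgebra φ} (h : Rep φ f F) (μ : Fin 2) :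
    Rep φ (pd φ μ f) (pdAlg φ μ F) := fun p hp => by
  change _ = SpinSurface.pd φ μ (extend F) p
  exact pd_congr (fun r hr => by rw [extend_apply F hr, h r hr]) μ hp

theorem Rep.add {f g : M → ℂ} {F G : smoothAlgebra φ} (hf : Rep φ f F) (hg : Rep φ g G) :
    Rep φ (fun p => f p + g p) (F + G) := fun p hp => by simp [hf p hp, hg p hp]

theorem Rep.mul {f g : M → ℂ} {F G : smoothAlgebra φ} (hf : Rep φ f F) (hg : Rep φ g G) :
    Rep φ (fun p => f p * g p) (F * G) := fun p hp => by simp [hf p hp, hg p hp]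

theorem Rep.smul {f : M → ℂ} {F : smoothAlgebra φ} (hf : Rep φ f F) (c : ℂ) :
    Rep φ (fun p => c * f p) (c • F) := fun p hp => by simp [hf p hp]

theorem Rep.sum {κ : Type*} {s : Finset κ} {f : κ → M → ℂ} {F : κ → smoothAlgebra φ}
    (hf : ∀ k ∈ s, Rep φ (f k) (F k)) : Rep φ (fun p => ∑ k ∈ s, f k p) (∑ k ∈ s, F k) :=
  fun p hp => by
    rw [AddSubmonoidClass.coe_finsetSum, Finset.sum_apply]
    exact Finset.sum_congr rfl fun k hk => hf k hk p hp

theorem Rep.unique {f : M → ℂ} {F G : smoothAlgebra φ} (hF : Rep φ f F) (hG : Rep φ f G) : F = G :=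
  Subtype.ext <| funext fun p => (hF p.1 p.2).symm.trans (hG p.1 p.2)

/-- Evaluation at a point. -/
def evAlg (p : φ.source) : smoothAlgebra φ →ₐ[ℂ] ℂ :=
  (Pi.evalAlgHom ℂ (fun _ : φ.source => ℂ) p).comp (smoothAlgebra φ).val

theorem alg_ext {F G : smoothAlgebra φ} (h : ∀ p, evAlg p F = evAlg p G) : F = G :=
  Subtype.ext (funext h)

theorem rep_of_ev {f : M → ℂ} {F : smoothAlgebra φ}
    (h : ∀ p (hp : p ∈ φ.source), f p = evAlg ⟨p, hp⟩ F) : Rep φ f F := h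

theorem Rep.ev {f : M → ℂ} {F : smoothAlgebra φ} (h : Rep φ f F) {p : M} (hp : p ∈ φ.source) :
    evAlg ⟨p, hp⟩ F = f p := (h p hp).symm

theorem pdAlg_comm (F : smoothAlgebra φ) (μ ν : Fin 2) :
    pdAlg φ μ (pdAlg φ ν F) = pdAlg φ ν (pdAlg φ μ F) := by
  have h : Rep φ (extend F) F := fun p hp => extend_apply F hp
  refine ((h.pd ν).pd μ).unique fun p hp => ?_
  rw [pd_comm (smoothIn_extend F) μ ν hp]
  exact (h.pd μ).pd ν p hp

end Chart

/-! ### The spin connection of the frame -/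

theorem SmoothIn.inv {M : Type*} [TopologicalSpace M] {φ : OpenPartialHomeomorph M Plane}
    {f : M → ℝ} (hf : SmoothIn φ f) (h : ∀ p ∈ φ.source, f p ≠ 0) :
    SmoothIn φ (fun p => (f p)⁻¹) :=
  ContDiffOn.inv hf fun _ hx => h _ (φ.map_target hx)

namespace SpinManifold

variable {M : Type*} [TopologicalSpace M] [ChartedSpace Plane M]
  {σ : Signature} {γ : DiracMatrices σ} {ι : Type*} (𝒮 : SpinManifold M γ ι)

theorem frame_coframe (i : ι) {p : M} (hp : p ∈ (𝒮.chart i).source) (a b : Fin 2) :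
    ∑ μ, 𝒮.frame i a μ p * 𝒮.coframe i b μ p = if a = b then 1 else 0 := by
  have h := Matrix.mul_nonsing_inv (Matrix.of fun a μ => 𝒮.frame i a μ p)
    (isUnit_iff_ne_zero.2 (𝒮.frame_det i p hp))
  exact (congrFun (congrFun h a) b).trans (Matrix.one_apply)

theorem coframe_frame (i : ι) {p : M} (hp : p ∈ (𝒮.chart i).source) (μ ν : Fin 2) :
    ∑ a, 𝒮.coframe i a μ p * 𝒮.frame i a ν p = if μ = ν then 1 else 0 := by
  have h := Matrix.nonsing_inv_mul (Matrix.of fun a μ => 𝒮.frame i a μ p)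
    (isUnit_iff_ne_zero.2 (𝒮.frame_det i p hp))
  exact (congrFun (congrFun h μ) ν).trans (Matrix.one_apply)

theorem s_mul_self (σ : Signature) (a : Fin 2) : σ.s a * σ.s a = 1 := by
  rcases σ.sq a with h | h <;> simp [h]

theorem metricInv_eq (i : ι) {p : M} (hp : p ∈ (𝒮.chart i).source) (μ ν : Fin 2) :
    𝒮.metricInv i μ ν p = ∑ a, σ.s a * 𝒮.frame i a μ p * 𝒮.frame i a ν p := by
  have h : (Matrix.of fun ρ τ => 𝒮.metric i ρ τ p) *
      (Matrix.of fun μ ν => ∑ a, σ.s a * 𝒮.frame i a μ p * 𝒮.frame i a ν p) = 1 := by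
    ext μ ν
    have h00 := 𝒮.frame_coframe i hp 0 0
    have h01 := 𝒮.frame_coframe i hp 0 1
    have h10 := 𝒮.frame_coframe i hp 1 0
    have h11 := 𝒮.frame_coframe i hp 1 1
    have h := 𝒮.coframe_frame i hp μ ν
    have s0 := s_mul_self σ 0
    have s1 := s_mul_self σ 1
    simp only [Matrix.mul_apply, Matrix.of_apply, metric, Fin.sum_univ_two, Matrix.one_apply,
      if_true, Fin.isValue, zero_ne_one, one_ne_zero, if_false] at *
    rw [← h]
    generalize 𝒮.coframe i 0 μ p = t0 at *
    generalize 𝒮.coframe i 1 μ p = t1 at *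
    generalize 𝒮.frame i 0 ν p = f0 at *
    generalize 𝒮.frame i 1 ν p = f1 at *
    linear_combination (σ.s 0 * σ.s 0 * t0 * f0) * h00 + (σ.s 0 * σ.s 1 * t1 * f0) * h01
      + (σ.s 0 * σ.s 1 * t0 * f1) * h10 + (σ.s 1 * σ.s 1 * t1 * f1) * h11
      + t0 * f0 * s0 + t1 * f1 * s1
  have := Matrix.inv_eq_right_inv h
  rw [metricInv, this, Matrix.of_apply]

/-- The Christoffel symbols of the first kind. -/
def christoffelLow (i : ι) (l β μ : Fin 2) (p : M) : ℝ :=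
  (1 / 2) * (pd (𝒮.chart i) μ (𝒮.metric i l β) p + pd (𝒮.chart i) β (𝒮.metric i l μ) p
      - pd (𝒮.chart i) l (𝒮.metric i β μ) p)

theorem metric_symm (i : ι) (μ ν : Fin 2) : 𝒮.metric i μ ν = 𝒮.metric i ν μ := by
  funext p
  simp only [metric, Fin.sum_univ_two]
  ring

theorem christoffel_symm (i : ι) (α β μ : Fin 2) (p : M) :
    𝒮.christoffel i α β μ p = 𝒮.christoffel i α μ β p := by
  simp only [christoffel, 𝒮.metric_symm i β μ]
  congr 1
  exact Finset.sum_congr rfl fun l _ => by ring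

/-- Contracting the inverse metric with a coframe vector gives the corresponding frame vector times
its sign. This reduces the spin connection to Christoffel symbols of the first kind, for which
metric compatibility is immediate. -/
theorem coframe_christoffel (i : ι) (a β μ : Fin 2) {p : M} (hp : p ∈ (𝒮.chart i).source) :
    ∑ α, 𝒮.coframe i a α p * 𝒮.christoffel i α β μ p =
      σ.s a * ∑ l, 𝒮.frame i a l p * 𝒮.christoffelLow i l β μ p := by
  have h : ∀ α, 𝒮.christoffel i α β μ p =
      ∑ l, (∑ c, σ.s c * 𝒮.frame i c α p * 𝒮.frame i c l p) * 𝒮.christoffelLow i l β μ p := by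
    intro α
    simp only [christoffel, christoffelLow, 𝒮.metricInv_eq i hp, Fin.sum_univ_two]
    ring
  have h0 := 𝒮.frame_coframe i hp 0 a
  have h1 := 𝒮.frame_coframe i hp 1 a
  simp only [h, Fin.sum_univ_two] at h0 h1 ⊢
  fin_cases a
  · simp at h0 h1 ⊢
    linear_combination σ.s 0 * (𝒮.frame i 0 0 p * 𝒮.christoffelLow i 0 β μ p
      + 𝒮.frame i 0 1 p * 𝒮.christoffelLow i 1 β μ p) * h0
      + σ.s 1 * (𝒮.frame i 1 0 p * 𝒮.christoffelLow i 0 β μ p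
      + 𝒮.frame i 1 1 p * 𝒮.christoffelLow i 1 β μ p) * h1
  · simp at h0 h1 ⊢
    linear_combination σ.s 0 * (𝒮.frame i 0 0 p * 𝒮.christoffelLow i 0 β μ p
      + 𝒮.frame i 0 1 p * 𝒮.christoffelLow i 1 β μ p) * h0
      + σ.s 1 * (𝒮.frame i 1 0 p * 𝒮.christoffelLow i 0 β μ p
      + 𝒮.frame i 1 1 p * 𝒮.christoffelLow i 1 β μ p) * h1

theorem spinConn_eq (i : ι) (a b μ : Fin 2) {p : M} (hp : p ∈ (𝒮.chart i).source) :
    𝒮.spinConn i a b μ p = σ.s b * (σ.s a * (∑ l, ∑ β, 𝒮.frame i a l p * 𝒮.frame i b β p *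
      𝒮.christoffelLow i l β μ p) + ∑ α, 𝒮.coframe i a α p * pd (𝒮.chart i) μ (𝒮.frame i b α) p) := by
  have h0 := 𝒮.coframe_christoffel i a 0 μ hp
  have h1 := 𝒮.coframe_christoffel i a 1 μ hp
  simp only [spinConn, Fin.sum_univ_two] at h0 h1 ⊢
  linear_combination σ.s b * 𝒮.frame i b 0 p * h0 + σ.s b * 𝒮.frame i b 1 p * h1

/-- The covariant derivative of the frame. -/
theorem sum_spinConn_frame (i : ι) (b μ α : Fin 2) {p : M} (hp : p ∈ (𝒮.chart i).source) :
    ∑ a, σ.s b * 𝒮.spinConn i a b μ p * 𝒮.frame i a α p =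
      ∑ β, 𝒮.christoffel i α β μ p * 𝒮.frame i b β p + pd (𝒮.chart i) μ (𝒮.frame i b α) p := by
  have h0 := 𝒮.coframe_frame i hp 0 α
  have h1 := 𝒮.coframe_frame i hp 1 α
  have sb := s_mul_self σ b
  have h : ∃ x : Fin 2 → ℝ, ∀ α, x α =
      ∑ β, 𝒮.christoffel i α β μ p * 𝒮.frame i b β p + pd (𝒮.chart i) μ (𝒮.frame i b α) p :=
    ⟨_, fun _ => rfl⟩
  obtain ⟨x, hx⟩ := h
  have hc : ∀ a, 𝒮.spinConn i a b μ p = σ.s b * ∑ α, 𝒮.coframe i a α p * x α := by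
    intro a
    simp only [spinConn, hx, Fin.sum_univ_two]
    ring
  rw [← hx]
  simp only [hc, Fin.sum_univ_two] at h0 h1 ⊢
  fin_cases α <;> simp at h0 h1 ⊢
  · linear_combination σ.s b * σ.s b * x 0 * h0 + σ.s b * σ.s b * x 1 * h1 + x 0 * sb
  · linear_combination σ.s b * σ.s b * x 0 * h0 + σ.s b * σ.s b * x 1 * h1 + x 1 * sb

section Smooth

variable [IsManifold (𝓡 2) ∞ M] (i : ι)

theorem smoothIn_iff {W : Type*} [NormedAddCommGroup W] [NormedSpace ℝ W] {f : M → W} :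
    SmoothIn (𝒮.chart i) f ↔ ContMDiffOn (𝓡 2) 𝓘(ℝ, W) ∞ f (𝒮.dom i) :=
  smoothIn_iff_contMDiffOn (𝒮.chart_mem i)

theorem smoothIn_frame (a μ : Fin 2) : SmoothIn (𝒮.chart i) (𝒮.frame i a μ) :=
  (𝒮.smoothIn_iff i).2 (𝒮.frame_smooth i a μ)

theorem smoothIn_coframe (a μ : Fin 2) : SmoothIn (𝒮.chart i) (𝒮.coframe i a μ) := by
  have hd : SmoothIn (𝒮.chart i) (fun p => 𝒮.frame i 0 0 p * 𝒮.frame i 1 1 p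
      - 𝒮.frame i 0 1 p * 𝒮.frame i 1 0 p) :=
    ((𝒮.smoothIn_frame i 0 0).mul (𝒮.smoothIn_frame i 1 1)).sub
      ((𝒮.smoothIn_frame i 0 1).mul (𝒮.smoothIn_frame i 1 0))
  have hd' := hd.inv fun p hp => by
    have := 𝒮.frame_det i p hp
    rwa [Matrix.det_fin_two] at this
  have h : ∀ p, 𝒮.coframe i a μ p = (𝒮.frame i 0 0 p * 𝒮.frame i 1 1 p
      - 𝒮.frame i 0 1 p * 𝒮.frame i 1 0 p)⁻¹ *
      !![𝒮.frame i 1 1 p, -𝒮.frame i 0 1 p; -𝒮.frame i 1 0 p, 𝒮.frame i 0 0 p] μ a := by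
    intro p
    rw [coframe, Matrix.inv_def, Matrix.det_fin_two, Matrix.adjugate_fin_two, Matrix.smul_apply,
      Ring.inverse_eq_inv', smul_eq_mul]
    rfl
  have hneg : ∀ a μ, SmoothIn (𝒮.chart i) (fun p => -𝒮.frame i a μ p) := fun a μ =>
    ContDiffOn.neg (𝒮.smoothIn_frame i a μ)
  refine SmoothIn.congr (hd'.mul ?_) fun r _ => (h r).symm
  fin_cases a <;> fin_cases μ
  exacts [𝒮.smoothIn_frame i 1 1, hneg 1 0, hneg 0 1, 𝒮.smoothIn_frame i 0 0]

theorem smoothIn_metric (μ ν : Fin 2) : SmoothIn (𝒮.chart i) (𝒮.metric i μ ν) :=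
  SmoothIn.sum fun a _ => ((SmoothIn.const _).mul (𝒮.smoothIn_coframe i a μ)).mul
    (𝒮.smoothIn_coframe i a ν)

theorem smoothIn_metricInv (μ ν : Fin 2) : SmoothIn (𝒮.chart i) (𝒮.metricInv i μ ν) :=
  (SmoothIn.sum fun a _ => ((SmoothIn.const (σ.s a)).mul (𝒮.smoothIn_frame i a μ)).mul
    (𝒮.smoothIn_frame i a ν)).congr fun _ hr => (𝒮.metricInv_eq i hr μ ν).symm

theorem smoothIn_christoffel (α β μ : Fin 2) : SmoothIn (𝒮.chart i) (𝒮.christoffel i α β μ) :=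
  (SmoothIn.const _).mul (SmoothIn.sum fun l _ => (𝒮.smoothIn_metricInv i α l).mul
    ((((𝒮.smoothIn_metric i l β).pd μ).add ((𝒮.smoothIn_metric i l μ).pd β)).sub
      ((𝒮.smoothIn_metric i β μ).pd l)))

theorem smoothIn_spinConn (a b μ : Fin 2) : SmoothIn (𝒮.chart i) (𝒮.spinConn i a b μ) :=
  SmoothIn.sum fun α _ => (𝒮.smoothIn_coframe i a α).mul
    ((SmoothIn.sum fun β _ => (𝒮.smoothIn_christoffel i α β μ).mul
      ((SmoothIn.const _).mul (𝒮.smoothIn_frame i b β))).add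
      ((SmoothIn.const _).mul ((𝒮.smoothIn_frame i b α).pd μ)))

/-- `∂_μ` of the duality of the frame and the coframe. -/
theorem pd_frame_coframe (a b μ : Fin 2) {p : M} (hp : p ∈ (𝒮.chart i).source) :
    ∑ ν, (𝒮.frame i a ν p * pd (𝒮.chart i) μ (𝒮.coframe i b ν) p
      + 𝒮.coframe i b ν p * pd (𝒮.chart i) μ (𝒮.frame i a ν) p) = 0 := by
  have h := pd_congr (φ := 𝒮.chart i) (f := fun p => 𝒮.frame i a 0 p * 𝒮.coframe i b 0 p
      + 𝒮.frame i a 1 p * 𝒮.coframe i b 1 p) (g := fun _ => if a = b then 1 else 0)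
    (fun r hr => by rw [← 𝒮.frame_coframe i hr a b, Fin.sum_univ_two]) μ hp
  rw [pd_const, pd_add ((𝒮.smoothIn_frame i a 0).mul (𝒮.smoothIn_coframe i b 0))
    ((𝒮.smoothIn_frame i a 1).mul (𝒮.smoothIn_coframe i b 1)) μ hp,
    pd_mul (𝒮.smoothIn_frame i a 0) (𝒮.smoothIn_coframe i b 0) μ hp,
    pd_mul (𝒮.smoothIn_frame i a 1) (𝒮.smoothIn_coframe i b 1) μ hp] at h
  rw [Fin.sum_univ_two]
  exact h

theorem pd_metric (l β μ : Fin 2) {p : M} (hp : p ∈ (𝒮.chart i).source) :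
    pd (𝒮.chart i) μ (𝒮.metric i l β) p =
      ∑ c, σ.s c * (𝒮.coframe i c l p * pd (𝒮.chart i) μ (𝒮.coframe i c β) p
        + 𝒮.coframe i c β p * pd (𝒮.chart i) μ (𝒮.coframe i c l) p) := by
  have h : ∀ c, SmoothIn (𝒮.chart i) (fun p => 𝒮.coframe i c l p * 𝒮.coframe i c β p) := fun c =>
    (𝒮.smoothIn_coframe i c l).mul (𝒮.smoothIn_coframe i c β)
  rw [pd_congr (g := fun p => σ.s 0 * (𝒮.coframe i 0 l p * 𝒮.coframe i 0 β p)
      + σ.s 1 * (𝒮.coframe i 1 l p * 𝒮.coframe i 1 β p)) (fun r _ => by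
        simp only [metric, Fin.sum_univ_two]; ring) μ hp,
    pd_add ((SmoothIn.const _).mul (h 0)) ((SmoothIn.const _).mul (h 1)) μ hp,
    pd_mul (SmoothIn.const _) (h 0) μ hp, pd_mul (SmoothIn.const _) (h 1) μ hp,
    pd_mul (𝒮.smoothIn_coframe i 0 l) (𝒮.smoothIn_coframe i 0 β) μ hp,
    pd_mul (𝒮.smoothIn_coframe i 1 l) (𝒮.smoothIn_coframe i 1 β) μ hp, pd_const, pd_const,
    Fin.sum_univ_two]
  ring

/-- The spin connection is a metric connection. -/
theorem spinConn_antisymm (a b μ : Fin 2) {p : M} (hp : p ∈ (𝒮.chart i).source) :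
    𝒮.spinConn i a b μ p = -𝒮.spinConn i b a μ p := by
  -- Metric compatibility: in the sum the two antisymmetric parts cancel and the derivative of the
  -- metric remains.
  have hg : ∀ l β, 𝒮.christoffelLow i l β μ p + 𝒮.christoffelLow i β l μ p =
      pd (𝒮.chart i) μ (𝒮.metric i l β) p := by
    intro l β
    simp only [christoffelLow, 𝒮.metric_symm i β l]
    ring
  have hm : (∑ l, ∑ β, 𝒮.frame i a l p * 𝒮.frame i b β p * 𝒮.christoffelLow i l β μ p)
      + (∑ l, ∑ β, 𝒮.frame i b l p * 𝒮.frame i a β p * 𝒮.christoffelLow i l β μ p) =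
      ∑ l, ∑ β, 𝒮.frame i a l p * 𝒮.frame i b β p * pd (𝒮.chart i) μ (𝒮.metric i l β) p := by
    simp only [← hg, Fin.sum_univ_two]
    ring
  -- In frame components the derivative of the metric involves derivatives of the coframe;
  -- differentiating the duality relation exchanges these for derivatives of the frame, which are
  -- the remaining terms of the spin connection.
  have hd : (∑ l, ∑ β, 𝒮.frame i a l p * 𝒮.frame i b β p * pd (𝒮.chart i) μ (𝒮.metric i l β) p)
      = -(σ.s b * ∑ α, 𝒮.coframe i b α p * pd (𝒮.chart i) μ (𝒮.frame i a α) p)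
        - (σ.s a * ∑ α, 𝒮.coframe i a α p * pd (𝒮.chart i) μ (𝒮.frame i b α) p) := by
    have e : (∑ l, ∑ β, 𝒮.frame i a l p * 𝒮.frame i b β p * pd (𝒮.chart i) μ (𝒮.metric i l β) p)
      = ∑ c, σ.s c * ((∑ l, 𝒮.frame i a l p * 𝒮.coframe i c l p) *
          (∑ β, 𝒮.frame i b β p * pd (𝒮.chart i) μ (𝒮.coframe i c β) p)
        + (∑ l, 𝒮.frame i b l p * 𝒮.coframe i c l p) *
          (∑ β, 𝒮.frame i a β p * pd (𝒮.chart i) μ (𝒮.coframe i c β) p)) := by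
      simp only [𝒮.pd_metric i _ _ _ hp, Fin.sum_univ_two]
      ring
    have e1 : ∀ a c, (∑ β, 𝒮.frame i a β p * pd (𝒮.chart i) μ (𝒮.coframe i c β) p)
        = -∑ α, 𝒮.coframe i c α p * pd (𝒮.chart i) μ (𝒮.frame i a α) p := by
      intro a c
      have := 𝒮.pd_frame_coframe i a c μ hp
      rw [Finset.sum_add_distrib] at this
      linarith
    rw [e]
    simp only [e1, 𝒮.frame_coframe i hp, mul_add, ite_mul, one_mul, zero_mul, mul_ite, mul_zero,
      Finset.sum_add_distrib, Finset.sum_ite_eq, Finset.mem_univ, if_true]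
    ring
  rw [hd] at hm
  rw [𝒮.spinConn_eq i a b μ hp, 𝒮.spinConn_eq i b a μ hp]
  have sa := s_mul_self σ a
  have sb := s_mul_self σ b
  generalize (∑ l, ∑ β, 𝒮.frame i a l p * 𝒮.frame i b β p * 𝒮.christoffelLow i l β μ p) = x at *
  generalize (∑ l, ∑ β, 𝒮.frame i b l p * 𝒮.frame i a β p * 𝒮.christoffelLow i l β μ p) = y at *
  generalize ∑ α, 𝒮.coframe i b α p * pd (𝒮.chart i) μ (𝒮.frame i a α) p = z at *
  generalize ∑ α, 𝒮.coframe i a α p * pd (𝒮.chart i) μ (𝒮.frame i b α) p = w at *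
  linear_combination σ.s a * σ.s b * hm - σ.s a * z * sb - σ.s b * w * sa

theorem spinConn_self (a μ : Fin 2) {p : M} (hp : p ∈ (𝒮.chart i).source) :
    𝒮.spinConn i a a μ p = 0 := by
  linarith [𝒮.spinConn_antisymm i a a μ hp]

/-- The commutator of the frame vectors. -/
theorem frame_commutator (ν : Fin 2) {p : M} (hp : p ∈ (𝒮.chart i).source) :
    ∑ μ, (𝒮.frame i 0 μ p * pd (𝒮.chart i) μ (𝒮.frame i 1 ν) p
        - 𝒮.frame i 1 μ p * pd (𝒮.chart i) μ (𝒮.frame i 0 ν) p) =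
      σ.s 1 * (∑ μ, 𝒮.frame i 0 μ p * 𝒮.spinConn i 0 1 μ p) * 𝒮.frame i 0 ν p
      + σ.s 0 * (∑ μ, 𝒮.frame i 1 μ p * 𝒮.spinConn i 0 1 μ p) * 𝒮.frame i 1 ν p := by
  -- With the derivatives of the frame expressed by the connection, the Christoffel terms cancel by
  -- symmetry in the lower indices, and by antisymmetry of the spin connection only `Γ^{01}`
  -- survives.
  have h : ∀ b μ, pd (𝒮.chart i) μ (𝒮.frame i b ν) p =
      ∑ a, σ.s b * 𝒮.spinConn i a b μ p * 𝒮.frame i a ν p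
        - ∑ β, 𝒮.christoffel i ν β μ p * 𝒮.frame i b β p := by
    intro b μ
    rw [𝒮.sum_spinConn_frame i b μ ν hp]
    ring
  simp only [h, Fin.sum_univ_two, 𝒮.spinConn_self i _ _ hp, 𝒮.spinConn_antisymm i 1 0 _ hp,
    𝒮.christoffel_symm i ν 1 0]
  ring

end Smooth

end SpinManifold

/-! ### The frame calculus of a trivialisation -/

/-- A square root of `-η`. -/
def Signature.nullRoot (σ : Signature) : ℂ :=
  (IsAlgClosed.exists_eq_mul_self (-(σ.sgn 0 * σ.sgn 1))).choose

theorem Signature.nullRoot_mul_self (σ : Signature) :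
    σ.nullRoot * σ.nullRoot = -(σ.sgn 0 * σ.sgn 1) :=
  (IsAlgClosed.exists_eq_mul_self (-(σ.sgn 0 * σ.sgn 1))).choose_spec.symm

theorem pd_ofReal {M : Type*} [TopologicalSpace M] {φ : OpenPartialHomeomorph M Plane}
    {f : M → ℝ} (hf : SmoothIn φ f) (μ : Fin 2) {p : M} (hp : p ∈ φ.source) :
    pd φ μ (fun r => (f r : ℂ)) p = ((pd φ μ f p : ℝ) : ℂ) :=
  pd_clm Complex.ofRealCLM hf μ hp

theorem rep_pd_ofReal {M : Type*} [TopologicalSpace M] {φ : OpenPartialHomeomorph M Plane}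
    {f : M → ℝ} (hf : SmoothIn φ f) (μ : Fin 2) :
    Rep φ (fun p => ((pd φ μ f p : ℝ) : ℂ)) (pdAlg φ μ hf.ofReal.toAlg) :=
  fun p hp => by rw [← (rep_toAlg hf.ofReal).pd μ p hp, pd_ofReal hf μ hp]

namespace SpinManifold

variable {M : Type*} [TopologicalSpace M] [ChartedSpace Plane M] [IsManifold (𝓡 2) ∞ M]
  {σ : Signature} {γ : DiracMatrices σ} {ι : Type*} (𝒮 : SpinManifold M γ ι)
  {q : ℝ} (𝒜 : 𝒮.Potential q) (i : ι)

/-- The algebra of smooth functions on the domain of the `i`-th trivialisation. -/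
abbrev Alg := smoothAlgebra (𝒮.chart i)

/-- The components of the frame in the algebra of smooth functions. -/
def frameAlg (a μ : Fin 2) : 𝒮.Alg i := (𝒮.smoothIn_frame i a μ).ofReal.toAlg

/-- The spin connection in the algebra of smooth functions. -/
def connAlg (μ : Fin 2) : 𝒮.Alg i := (𝒮.smoothIn_spinConn i 0 1 μ).ofReal.toAlg

/-- The connection form `i q A_μ` in the algebra of smooth functions. -/
def potentialAlg {𝒮 : SpinManifold M γ ι} {q : ℝ} (𝒜 : 𝒮.Potential q) (i : ι) (μ : Fin 2) :
    𝒮.Alg i :=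
  ((SmoothIn.const (Complex.I * q)).mul
    ((𝒮.smoothIn_iff i).2 (𝒜.A_smooth i μ)).ofReal).toAlg

/-- The frame derivative `e_a^μ ∂_μ`. -/
def frameDeriv (a : Fin 2) : Derivation ℂ (𝒮.Alg i) (𝒮.Alg i) :=
  𝒮.frameAlg i a 0 • pdAlg (𝒮.chart i) 0 + 𝒮.frameAlg i a 1 • pdAlg (𝒮.chart i) 1

theorem frameDeriv_apply (a : Fin 2) (f : 𝒮.Alg i) : 𝒮.frameDeriv i a f =
    𝒮.frameAlg i a 0 * pdAlg (𝒮.chart i) 0 f + 𝒮.frameAlg i a 1 * pdAlg (𝒮.chart i) 1 f := rfl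

/-- The frame components of a coordinate covector. -/
def toFrame (w : Fin 2 → 𝒮.Alg i) (a : Fin 2) : 𝒮.Alg i :=
  𝒮.frameAlg i a 0 * w 0 + 𝒮.frameAlg i a 1 * w 1

theorem frameAlg_commutator (ν : Fin 2) :
    𝒮.frameDeriv i 0 (𝒮.frameAlg i 1 ν) - 𝒮.frameDeriv i 1 (𝒮.frameAlg i 0 ν) =
      σ.sgn 1 • (𝒮.toFrame i (𝒮.connAlg i) 0 * 𝒮.frameAlg i 0 ν)
      + σ.sgn 0 • (𝒮.toFrame i (𝒮.connAlg i) 1 * 𝒮.frameAlg i 1 ν) := by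
  refine alg_ext fun ⟨p, hp⟩ => ?_
  have h := congrArg (fun x : ℝ => (x : ℂ)) (𝒮.frame_commutator i ν hp)
  have e : ∀ b μ, evAlg ⟨p, hp⟩ (pdAlg (𝒮.chart i) μ (𝒮.frameAlg i b ν)) =
      ((pd (𝒮.chart i) μ (𝒮.frame i b ν) p : ℝ) : ℂ) := fun b μ =>
    (rep_pd_ofReal (𝒮.smoothIn_frame i b ν) μ p hp).symm
  have e' : ∀ a μ, evAlg ⟨p, hp⟩ (𝒮.frameAlg i a μ) = 𝒮.frame i a μ p := fun _ _ => rfl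
  have e'' : ∀ μ, evAlg ⟨p, hp⟩ (𝒮.connAlg i μ) = 𝒮.spinConn i 0 1 μ p := fun _ => rfl
  simp only [frameDeriv_apply, Fin.sum_univ_two, toFrame, map_add, map_sub, map_mul, map_smul, e,
    e', e'', smul_eq_mul] at h ⊢
  push_cast at h
  simp only [Signature.sgn]
  linear_combination h

/-- The frame calculus of the `i`-th trivialisation. -/
def calculus : FrameCalculus σ (𝒮.Alg i) (𝒮.chart i).source where
  δ := 𝒮.frameDeriv i
  W := 𝒮.toFrame i (𝒮.connAlg i)
  A := 𝒮.toFrame i (potentialAlg 𝒜 i)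
  c := σ.nullRoot
  hc := σ.nullRoot_mul_self
  torsion f := by
    have h0 := 𝒮.frameAlg_commutator i 0
    have h1 := 𝒮.frameAlg_commutator i 1
    have hc := pdAlg_comm f 0 1
    simp only [frameDeriv_apply, Derivation.leibniz, map_add, smul_eq_mul,
      Algebra.smul_def (R := ℂ) (A := 𝒮.Alg i)] at h0 h1 ⊢
    -- The components of the frame commutator account for the first derivatives of `f`; the second
    -- derivatives cancel because coordinate derivatives commute.
    linear_combination (pdAlg (𝒮.chart i) 0 f) * h0 + (pdAlg (𝒮.chart i) 1 f) * h1
      + (𝒮.frameAlg i 0 0 * 𝒮.frameAlg i 1 1 - 𝒮.frameAlg i 0 1 * 𝒮.frameAlg i 1 0) * hc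
  ev := evAlg
  sep f h := alg_ext fun p => (h p).trans (map_zero _).symm

/-- The connection terms in `curl` cancel the derivatives of the frame, so `curl` is the exterior
derivative evaluated on the frame. It can then be compared with curvature and field strength, which
are defined in coordinates. -/
theorem curl_toFrame (w : Fin 2 → 𝒮.Alg i) : (𝒮.calculus 𝒜 i).curl (𝒮.toFrame i w) =
    (𝒮.frameAlg i 0 0 * 𝒮.frameAlg i 1 1 - 𝒮.frameAlg i 0 1 * 𝒮.frameAlg i 1 0) *
      (pdAlg (𝒮.chart i) 0 (w 1) - pdAlg (𝒮.chart i) 1 (w 0)) := by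
  have h0 := 𝒮.frameAlg_commutator i 0
  have h1 := 𝒮.frameAlg_commutator i 1
  simp only [FrameCalculus.curl, calculus, toFrame, frameDeriv_apply, Derivation.leibniz, map_add,
    smul_eq_mul, Algebra.smul_def (R := ℂ) (A := 𝒮.Alg i)] at h0 h1 ⊢
  linear_combination w 0 * h0 + w 1 * h1

theorem Rep.grad {f : M → ℂ} {F : 𝒮.Alg i} (h : Rep (𝒮.chart i) f F) (a : Fin 2) :
    Rep (𝒮.chart i) (𝒮.grad i a f) ((𝒮.calculus 𝒜 i).δ a F) := by
  intro p hp
  rw [SpinManifold.grad, Fin.sum_univ_two, h.pd 0 p hp, h.pd 1 p hp]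
  rfl

theorem conn_eq (a : Fin 2) {p : M} (hp : p ∈ (𝒮.chart i).source) :
    𝒮.conn i 0 0 a p = 0 ∧ 𝒮.conn i 1 1 a p = 0 ∧
    𝒮.conn i 0 1 a p = evAlg ⟨p, hp⟩ ((𝒮.calculus 𝒜 i).W a) * σ.sgn 1 ∧
    𝒮.conn i 1 0 a p = -(evAlg ⟨p, hp⟩ ((𝒮.calculus 𝒜 i).W a) * σ.sgn 0) := by
  have e : evAlg ⟨p, hp⟩ ((𝒮.calculus 𝒜 i).W a) = (𝒮.frame i a 0 p : ℂ) * 𝒮.spinConn i 0 1 0 p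
    + (𝒮.frame i a 1 p : ℂ) * 𝒮.spinConn i 0 1 1 p := rfl
  rw [e]
  simp only [conn, Fin.sum_univ_two, 𝒮.spinConn_self i _ _ hp, 𝒮.spinConn_antisymm i 1 0 _ hp,
    Signature.sgn]
  push_cast
  refine ⟨by ring, by ring, by ring, by ring⟩

/-- The quadratic terms of the curvature vanish in dimension two, since `Γ^{01}` is the only
independent connection form. The factor `1/2` arises because the index pairs `01` and `10`
contribute equally to `R^{ab}{}_{ab}`. -/
theorem evAlg_curl_W {p : M} (hp : p ∈ (𝒮.chart i).source) :
    evAlg ⟨p, hp⟩ ((𝒮.calculus 𝒜 i).curl (𝒮.calculus 𝒜 i).W) = 𝒮.scalarCurv i p / 2 := by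
  have h := 𝒮.curl_toFrame 𝒜 i (𝒮.connAlg i)
  change (𝒮.calculus 𝒜 i).curl (𝒮.calculus 𝒜 i).W = _ at h
  rw [h]
  have e : ∀ μ ν, (pdAlg (𝒮.chart i) μ (𝒮.connAlg i ν)).1 ⟨p, hp⟩ =
      ((pd (𝒮.chart i) μ (𝒮.spinConn i 0 1 ν) p : ℝ) : ℂ) := fun μ ν =>
    (rep_pd_ofReal (𝒮.smoothIn_spinConn i 0 1 ν) μ p hp).symm
  change (((𝒮.frame i 0 0 p : ℂ) * 𝒮.frame i 1 1 p - (𝒮.frame i 0 1 p : ℂ) * 𝒮.frame i 1 0 p) *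
    ((pdAlg (𝒮.chart i) 0 (𝒮.connAlg i 1)).1 ⟨p, hp⟩
      - (pdAlg (𝒮.chart i) 1 (𝒮.connAlg i 0)).1 ⟨p, hp⟩)) = _
  rw [e, e]
  have h10 : ∀ μ ν, pd (𝒮.chart i) μ (𝒮.spinConn i 1 0 ν) p =
      -pd (𝒮.chart i) μ (𝒮.spinConn i 0 1 ν) p := by
    intro μ ν
    rw [pd_congr (g := fun r => (-1 : ℝ) * 𝒮.spinConn i 0 1 ν r) (fun r hr => by
      rw [𝒮.spinConn_antisymm i 1 0 ν hr]; ring) μ hp,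
      pd_mul (SmoothIn.const _) (𝒮.smoothIn_spinConn i 0 1 ν) μ hp, pd_const]
    ring
  have h0 : ∀ a μ ν, pd (𝒮.chart i) μ (𝒮.spinConn i a a ν) p = 0 := by
    intro a μ ν
    rw [pd_congr (g := fun _ => (0 : ℝ)) (fun r hr => 𝒮.spinConn_self i a ν hr) μ hp, pd_const]
  simp only [scalarCurv, curvature, Fin.sum_univ_two, h10, h0, 𝒮.spinConn_self i _ _ hp,
    𝒮.spinConn_antisymm i 1 0 _ hp]
  push_cast
  ring

theorem evAlg_curl_A {p : M} (hp : p ∈ (𝒮.chart i).source) :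
    evAlg ⟨p, hp⟩ ((𝒮.calculus 𝒜 i).curl (𝒮.calculus 𝒜 i).A) =
      Complex.I * q * 𝒮.fieldStrength 𝒜 i p := by
  have h := 𝒮.curl_toFrame 𝒜 i (potentialAlg 𝒜 i)
  change (𝒮.calculus 𝒜 i).curl (𝒮.calculus 𝒜 i).A = _ at h
  rw [h]
  have hA := fun ν => (𝒮.smoothIn_iff i).2 (𝒜.A_smooth i ν)
  have e : ∀ μ ν, (pdAlg (𝒮.chart i) μ (potentialAlg 𝒜 i ν)).1 ⟨p, hp⟩ =
      Complex.I * q * ((pd (𝒮.chart i) μ (𝒜.A i ν) p : ℝ) : ℂ) := by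
    intro μ ν
    refine ((rep_toAlg ((SmoothIn.const (Complex.I * q)).mul (hA ν).ofReal)).pd μ p hp).symm.trans
      ?_
    rw [pd_mul (SmoothIn.const _) (hA ν).ofReal μ hp, pd_const, pd_ofReal (hA ν) μ hp, mul_zero,
      add_zero]
  change (((𝒮.frame i 0 0 p : ℂ) * 𝒮.frame i 1 1 p - (𝒮.frame i 0 1 p : ℂ) * 𝒮.frame i 1 0 p) *
    ((pdAlg (𝒮.chart i) 0 (potentialAlg 𝒜 i 1)).1 ⟨p, hp⟩
      - (pdAlg (𝒮.chart i) 1 (potentialAlg 𝒜 i 0)).1 ⟨p, hp⟩)) = _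
  rw [e, e]
  simp only [fieldStrength, Fin.sum_univ_two]
  push_cast
  ring

end SpinManifold

/-! ### Second covariant derivatives in null form -/

namespace FrameCalculus

variable {σ : Signature} {C : Type*} [CommRing C] [Algebra ℂ C] {ι : Type*}
  (𝓕 : FrameCalculus σ C ι)

/-- The frame connection coefficients `Γ^b{}_{ca}`. -/
def conn (b c a : Fin 2) : C := !![0, σ.sgn 1 • 𝓕.W a; -(σ.sgn 0 • 𝓕.W a), 0] b c

/-- The second covariant derivative of a field of spin weight `k.1 / 2` and charge `k.2`. -/
def second (k : ℤ × ℤ) (a b : Fin 2) (f : C) : C :=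
  𝓕.covDeriv a k (𝓕.covDeriv b k f) - ∑ c, 𝓕.conn c b a * 𝓕.covDeriv c k f

/-- The contraction of a bilinear form with two vectors. -/
def contract (m n : Fin 2 → ℂ) (T : Fin 2 → Fin 2 → C) : C :=
  ∑ a, ∑ b, (m a * n b) • T a b

/-- The null vector of `X`. -/
def vecX : Fin 2 → ℂ := ![σ.sgn 0, σ.sgn 1 * 𝓕.c]

/-- The null vector of `Y`. -/
def vecY : Fin 2 → ℂ := ![1, -(σ.sgn 0 * σ.sgn 1 * 𝓕.c)]

theorem ext_ev {f g : C} (h : ∀ p, 𝓕.ev p f = 𝓕.ev p g) : f = g :=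
  sub_eq_zero.1 (𝓕.sep _ fun p => by rw [map_sub, h, sub_self])

/-- The connection only rescales a null vector, and this rescaling is the change of degree made by
the inner derivative. So an iterated null derivative is the full second covariant derivative
contracted with constant null vectors; the same reason applies to the three lemmas that follow. -/
theorem nullX_nullX_hom (k : ℤ × ℤ) (f : C) : 𝓕.nullX (𝓕.nullX (hom k f)) =
    hom (k + (-2, 0) + (-2, 0)) (contract 𝓕.vecX 𝓕.vecX fun a b => 𝓕.second k a b f) := by
  have hc := 𝓕.hc
  rw [nullX_hom, nullX_hom]
  congr 1
  refine 𝓕.ext_ev fun p => ?_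
  simp [contract, vecX, second, conn, Fin.sum_univ_two, covDeriv_apply]
  have h0 := σ.sgn_mul_self 0
  have h1 := σ.sgn_mul_self 1
  grind

theorem nullX_nullY_hom (k : ℤ × ℤ) (f : C) : 𝓕.nullX (𝓕.nullY (hom k f)) =
    hom k (contract 𝓕.vecX 𝓕.vecY fun a b => 𝓕.second k a b f) := by
  have hc := 𝓕.hc
  rw [nullY_hom, nullX_hom, show k + (2, 0) + (-2, 0) = k by ext <;> simp]
  congr 1
  refine 𝓕.ext_ev fun p => ?_
  simp [contract, vecX, vecY, second, conn, Fin.sum_univ_two, covDeriv_apply]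
  have h0 := σ.sgn_mul_self 0
  have h1 := σ.sgn_mul_self 1
  grind

theorem nullY_nullX_hom (k : ℤ × ℤ) (f : C) : 𝓕.nullY (𝓕.nullX (hom k f)) =
    hom k (contract 𝓕.vecY 𝓕.vecX fun a b => 𝓕.second k a b f) := by
  have hc := 𝓕.hc
  rw [nullX_hom, nullY_hom, show k + (-2, 0) + (2, 0) = k by ext <;> simp]
  congr 1
  refine 𝓕.ext_ev fun p => ?_
  simp [contract, vecX, vecY, second, conn, Fin.sum_univ_two, covDeriv_apply]
  have h0 := σ.sgn_mul_self 0
  have h1 := σ.sgn_mul_self 1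
  grind

theorem nullY_nullY_hom (k : ℤ × ℤ) (f : C) : 𝓕.nullY (𝓕.nullY (hom k f)) =
    hom (k + (2, 0) + (2, 0)) (contract 𝓕.vecY 𝓕.vecY fun a b => 𝓕.second k a b f) := by
  have hc := 𝓕.hc
  rw [nullY_hom, nullY_hom]
  congr 1
  refine 𝓕.ext_ev fun p => ?_
  simp [contract, vecY, second, conn, Fin.sum_univ_two, covDeriv_apply]
  have h0 := σ.sgn_mul_self 0
  have h1 := σ.sgn_mul_self 1
  grind

/-- The component along `X` of a vector. -/
def compX (v : Fin 2 → C) : C := (1 / 2 : ℂ) • (σ.sgn 0 • v 0 - (σ.sgn 0 * 𝓕.c) • v 1)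

/-- The component along `Y` of a vector. -/
def compY (v : Fin 2 → C) : C := (1 / 2 : ℂ) • (v 0 + 𝓕.c • v 1)

/-- The component along `X ⊗ X` of a symmetric tensor. -/
def compXX (T : Fin 2 → Fin 2 → C) : C := 𝓕.compX fun a => 𝓕.compX (T a)

/-- The mixed component of a symmetric tensor. -/
def compXY (T : Fin 2 → Fin 2 → C) : C := 𝓕.compX fun a => 𝓕.compY (T a)

/-- The component along `Y ⊗ Y` of a symmetric tensor. -/
def compYY (T : Fin 2 → Fin 2 → C) : C := 𝓕.compY fun a => 𝓕.compY (T a)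

/-- The weight of the entries of `𝔼^{ab}`, `𝔽^a`, `𝔾`, in null components. -/
def coeffs (E : Fin 2 → Fin 2 → Fin 2 → Fin 2 → C) (F : Fin 2 → Fin 2 → Fin 2 → C)
    (G : Fin 2 → Fin 2 → C) : NullCalculus.Coeffs (Graded C) where
  a k l := hom (NullCalculus.entryWeight k l + 4, 0) (𝓕.compXX fun a b => E a b k l)
  b k l := hom (NullCalculus.entryWeight k l, 0) (𝓕.compXY fun a b => E a b k l)
  d k l := hom (NullCalculus.entryWeight k l - 4, 0) (𝓕.compYY fun a b => E a b k l)
  f k l := hom (NullCalculus.entryWeight k l + 2, 0) (𝓕.compX fun a => F a k l)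
  h k l := hom (NullCalculus.entryWeight k l - 2, 0) (𝓕.compY fun a => F a k l)
  g k l := hom (NullCalculus.entryWeight k l, 0) (G k l)

theorem tensor_hom (k : ℤ) (f : C) : 𝓕.toNull.Tensor k (hom (k, 0) f) := by
  constructor
  · change grading C _ (hom (k, 0) f) = _
    rw [grading_hom, ← zsmul_eq_mul, hom, hom, ← Int.cast_smul_eq_zsmul ℂ, AddMonoidAlgebra.smul_single]
    rfl
  · change grading C _ (hom (k, 0) f) = _
    rw [grading_hom]
    simp

theorem isTensor_coeffs (E : Fin 2 → Fin 2 → Fin 2 → Fin 2 → C) (F : Fin 2 → Fin 2 → Fin 2 → C)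
    (G : Fin 2 → Fin 2 → C) : (𝓕.coeffs E F G).IsTensor 𝓕.toNull :=
  ⟨fun _ _ => 𝓕.tensor_hom _ _, fun _ _ => 𝓕.tensor_hom _ _, fun _ _ => 𝓕.tensor_hom _ _,
    fun _ _ => 𝓕.tensor_hom _ _, fun _ _ => 𝓕.tensor_hom _ _, fun _ _ => 𝓕.tensor_hom _ _⟩

/-- The spin weight (times two) and charge of the components of a spinor. -/
def spinWeight : Fin 2 → ℤ × ℤ := ![(-1, 1), (1, 1)]

theorem entryWeight_add_spinWeight (k l : Fin 2) :
    (NullCalculus.entryWeight k l, 0) + spinWeight l = spinWeight k := by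
  fin_cases k <;> fin_cases l <;> rfl

set_option maxHeartbeats 1000000 in
/-- The entries of a second order operator in terms of covariant derivatives. -/
theorem entry_hom (E : Fin 2 → Fin 2 → Fin 2 → Fin 2 → C) (F : Fin 2 → Fin 2 → Fin 2 → C)
    (G : Fin 2 → Fin 2 → C) (k l : Fin 2) (hE : ∀ a b, E a b k l = E b a k l) (f : C) :
    𝓕.toNull.entry (𝓕.coeffs E F G) k l (hom (spinWeight l) f) =
      hom (spinWeight k) (∑ a, ∑ b, E a b k l * ((1 / 2 : ℂ) •
          (𝓕.second (spinWeight l) a b f + 𝓕.second (spinWeight l) b a f))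
        + ∑ a, F a k l * 𝓕.covDeriv a (spinWeight l) f + G k l * f) := by
  have hc := 𝓕.hc
  have e : ∀ x y : ℤ, x + y = 0 → (NullCalculus.entryWeight k l + x, (0 : ℤ)) +
      (spinWeight l + (y, 0)) = spinWeight k := by
    intro x y h
    rw [← entryWeight_add_spinWeight k l]
    ext <;> simp
    linarith
  simp only [NullCalculus.entry]
  change _ * 𝓕.nullX (𝓕.nullX _) + _ * (𝓕.nullX (𝓕.nullY _) + 𝓕.nullY (𝓕.nullX _))
    + _ * 𝓕.nullY (𝓕.nullY _) + _ * 𝓕.nullX _ + _ * 𝓕.nullY _ + _ = _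
  rw [nullX_nullX_hom, nullX_nullY_hom, nullY_nullX_hom, nullY_nullY_hom, nullX_hom, nullY_hom]
  simp only [coeffs, add_assoc (spinWeight l), Prod.mk_add_mk, add_zero, sub_eq_add_neg,
    ← AddMonoidAlgebra.single_add, AddMonoidAlgebra.single_mul_single]
  norm_num [entryWeight_add_spinWeight, e 4 (-4) (by norm_num), e (-4) 4 (by norm_num),
    e 2 (-2) (by norm_num), e (-2) 2 (by norm_num)]
  simp only [← AddMonoidAlgebra.single_add]
  congr 1
  refine 𝓕.ext_ev fun p => ?_
  have h01 := hE 0 1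
  simp [contract, vecX, vecY, compXX, compXY, compYY, compX, compY, Fin.sum_univ_two, h01]
  have h0 := σ.sgn_mul_self 0
  have h1 := σ.sgn_mul_self 1
  grind

theorem diracEntry_hom (U : Fin 2 → C) (k l : Fin 2) (f : C) :
    𝓕.toNull.diracEntry (hom 0 (U 0)) (hom 0 (U 1)) k l (hom (spinWeight l) f) =
      hom (spinWeight k) (!![U 0 * f, ∑ a, 𝓕.vecX a • 𝓕.covDeriv a (spinWeight l) f;
        ∑ a, 𝓕.vecY a • 𝓕.covDeriv a (spinWeight l) f, U 1 * f] k l) := by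
  have hX : ∀ s, 𝓕.toNull.X s = 𝓕.nullX s := fun _ => rfl
  have hY : ∀ s, 𝓕.toNull.Y s = 𝓕.nullY s := fun _ => rfl
  fin_cases k <;> fin_cases l <;>
    simp [NullCalculus.diracEntry, spinWeight, AddMonoidAlgebra.single_mul_single, hX, hY,
      nullX_hom, nullY_hom, vecX, vecY, Fin.sum_univ_two, sub_eq_add_neg]

end FrameCalculus

/-! ### The normal form of the Dirac matrices -/

/-- The Dirac matrices in normal form. -/
def Signature.normalGamma (σ : Signature) : Fin 2 → Matrix (Fin 2) (Fin 2) ℂ :=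
  ![!![0, 1; σ.sgn 0, 0], !![0, σ.nullRoot; -(σ.nullRoot * σ.sgn 0), 0]]

theorem DiracMatrices.low_mul_self {σ : Signature} (γ : DiracMatrices σ) (a : Fin 2) :
    γ.low a * γ.low a = σ.sgn a • (1 : Matrix (Fin 2) (Fin 2) ℂ) := by
  have h := γ.clifford a a
  rw [← two_smul ℂ, Signature.eta, if_pos rfl, mul_smul] at h
  exact smul_right_injective _ (two_ne_zero' ℂ) h

theorem DiracMatrices.anticomm {σ : Signature} (γ : DiracMatrices σ) :
    γ.low 1 * γ.low 0 = -(γ.low 0 * γ.low 1) := by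
  have h := γ.clifford 0 1
  rw [Signature.eta, if_neg (by decide), mul_zero, zero_smul] at h
  exact eq_neg_of_add_eq_zero_right h

theorem DiracMatrices.vol_mul_self {σ : Signature} (γ : DiracMatrices σ) :
    γ.vol * γ.vol = (σ.nullRoot * σ.nullRoot) • (1 : Matrix (Fin 2) (Fin 2) ℂ) := by
  rw [σ.nullRoot_mul_self, DiracMatrices.vol, mul_assoc, ← mul_assoc (γ.low 1), γ.anticomm,
    neg_mul, mul_neg, mul_assoc, γ.low_mul_self, mul_smul_comm, mul_smul_comm, mul_one,
    γ.low_mul_self, smul_smul, neg_smul, mul_comm]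

/-- The matrix `vol` squares to `c² = -η ≠ 0` and anticommutes with `γ_0`. For an eigenvector `v`
with eigenvalue `k = c s₀`, the vector `γ_0 v` is an eigenvector with eigenvalue `-k`, and the
Clifford relations determine both Dirac matrices in the basis `γ_0 v, v`. -/
theorem DiracMatrices.exists_normalForm {σ : Signature} (γ : DiracMatrices σ) :
    ∃ P : Matrix (Fin 2) (Fin 2) ℂ, IsUnit P.det ∧ ∀ a, γ.low a * P = P * σ.normalGamma a := by
  have hs0 := σ.sgn_mul_self 0
  have hs1 := σ.sgn_mul_self 1
  have hcc := σ.nullRoot_mul_self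
  set k := σ.nullRoot * σ.sgn 0 with hk
  have hkk : k * k = σ.nullRoot * σ.nullRoot := by rw [hk]; linear_combination σ.nullRoot^2 * hs0
  have hk0 : k ≠ 0 := by
    intro h
    rw [h, hcc] at hkk
    have : σ.sgn 0 * σ.sgn 1 * (σ.sgn 0 * σ.sgn 1) = 1 := by linear_combination σ.sgn 1^2 * hs0 + hs1
    rw [show σ.sgn 0 * σ.sgn 1 = 0 by linear_combination hkk] at this
    simp at this
  have h00 : ∀ v, γ.low 0 *ᵥ (γ.low 0 *ᵥ v) = σ.sgn 0 • v := fun v => by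
    rw [Matrix.mulVec_mulVec, γ.low_mul_self, Matrix.smul_mulVec, Matrix.one_mulVec]
  have h10 : ∀ v, γ.low 1 *ᵥ (γ.low 0 *ᵥ v) = -(γ.vol *ᵥ v) := fun v => by
    rw [Matrix.mulVec_mulVec, γ.anticomm, Matrix.neg_mulVec, DiracMatrices.vol]
  have hv0 : ∀ v, γ.vol *ᵥ (γ.low 0 *ᵥ v) = -(γ.low 0 *ᵥ (γ.vol *ᵥ v)) := fun v => by
    rw [DiracMatrices.vol, ← Matrix.mulVec_mulVec, h10, Matrix.mulVec_neg, DiracMatrices.vol]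
  -- Any nonzero vector `(γ + k) w` is such an eigenvector, as `γ² = k²`. If all of them vanished,
  -- `γ` would be the scalar `-k`, which cannot anticommute with the invertible `γ_0`.
  obtain ⟨v, hv, hvk⟩ : ∃ v : Fin 2 → ℂ, v ≠ 0 ∧ γ.vol *ᵥ v = k • v := by
    by_cases h : ∀ w, γ.vol *ᵥ w + k • w = 0
    · exfalso
      have h1 := h (γ.low 0 *ᵥ (γ.low 0 *ᵥ ![1, 0]))
      rw [hv0, eq_neg_of_add_eq_zero_left (h (γ.low 0 *ᵥ ![1, 0])), Matrix.mulVec_neg, neg_neg,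
        Matrix.mulVec_smul, h00, ← two_smul ℂ] at h1
      have h2 := congrFun h1 0
      simp [hk0] at h2
      rw [h2] at hs0
      simp at hs0
    · push Not at h
      obtain ⟨w, hw⟩ := h
      refine ⟨_, hw, ?_⟩
      rw [Matrix.mulVec_add, Matrix.mulVec_mulVec, γ.vol_mul_self, Matrix.mulVec_smul,
        Matrix.smul_mulVec, Matrix.one_mulVec, ← hkk, smul_add, smul_smul, add_comm]
  have hP : ∀ A : Matrix (Fin 2) (Fin 2) ℂ, ∀ a b, (A * Matrix.of ![![(γ.low 0 *ᵥ v) 0, v 0],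
      ![(γ.low 0 *ᵥ v) 1, v 1]]) a b = ![(A *ᵥ (γ.low 0 *ᵥ v)) a, (A *ᵥ v) a] b := by
    intro A a b
    fin_cases b <;> simp [Matrix.mul_apply, Matrix.mulVec, dotProduct, Fin.sum_univ_two]
  -- Apply `γ_0` to the eigenvalue equation of `v` and use `γ_0² = s₀`.
  have h1v : γ.low 1 *ᵥ v = σ.nullRoot • (γ.low 0 *ᵥ v) := by
    have h1 : γ.low 0 *ᵥ (γ.vol *ᵥ v) = σ.sgn 0 • (γ.low 1 *ᵥ v) := by
      rw [DiracMatrices.vol, ← Matrix.mulVec_mulVec, h00]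
    rw [hvk, Matrix.mulVec_smul] at h1
    have h2 := congrArg (σ.sgn 0 • ·) h1
    simp only [smul_smul, hs0, one_smul] at h2
    rw [← h2, hk]
    congr 1
    linear_combination σ.nullRoot * hs0
  refine ⟨Matrix.of ![![(γ.low 0 *ᵥ v) 0, v 0], ![(γ.low 0 *ᵥ v) 1, v 1]], ?_, fun a => ?_⟩
  -- The columns are eigenvectors for the distinct eigenvalues `-k` and `k`: applying `vol` to a
  -- linear relation and combining it with the original one removes the `γ_0 v` term.
  · rw [isUnit_iff_ne_zero]
    intro hdet
    obtain ⟨w, hw, hw'⟩ := Matrix.exists_mulVec_eq_zero_iff.2 hdet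
    have e1 : w 0 • (γ.low 0 *ᵥ v) + w 1 • v = 0 := by
      ext a
      have := congrFun hw' a
      fin_cases a <;> simp [Matrix.mulVec, dotProduct, Fin.sum_univ_two] at this ⊢ <;>
        linear_combination this
    have e2 := congrArg (γ.vol *ᵥ ·) e1
    simp only [Matrix.mulVec_add, Matrix.mulVec_smul, hv0, hvk, Matrix.mulVec_zero] at e2
    have e3 : (2 * k * w 1) • v = 0 := by
      have : (2 * k * w 1) • v = k • (w 0 • (γ.low 0 *ᵥ v) + w 1 • v) +
        (w 0 • -(k • (γ.low 0 *ᵥ v)) + w 1 • k • v) := by module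
      rw [this, e1, e2, smul_zero, zero_add]
    rw [smul_eq_zero, or_iff_left hv, mul_eq_zero, or_iff_right (by simp [hk0])] at e3
    rw [e3, zero_smul, add_zero] at e1
    have e4 := congrArg (γ.low 0 *ᵥ ·) e1
    simp only [Matrix.mulVec_smul, h00, Matrix.mulVec_zero, smul_smul] at e4
    rw [smul_eq_zero, or_iff_left hv, mul_eq_zero] at e4
    refine hw (funext fun a => ?_)
    fin_cases a
    · exact e4.resolve_right fun h => by rw [h] at hs0; simp at hs0
    · exact e3
  · ext b d
    rw [hP]
    fin_cases a
    · simp only [Fin.zero_eta, h00]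
      fin_cases b <;> fin_cases d <;>
        simp [Signature.normalGamma, Matrix.mul_apply, Fin.sum_univ_two, mul_comm]
    · simp only [Fin.mk_one, h10, hvk, h1v]
      fin_cases b <;> fin_cases d <;>
        simp [Signature.normalGamma, Matrix.mul_apply, Fin.sum_univ_two, mul_comm, hk]

/-! ### Spinor fields and operators in null form -/

namespace FrameCalculus

variable {σ : Signature} {C : Type*} [CommRing C] [Algebra ℂ C] {ι : Type*}
  (𝓕 : FrameCalculus σ C ι)

/-- The second order operator with the given coefficients, acting on spinors. -/
def applyAlg (E : Fin 2 → Fin 2 → Fin 2 → Fin 2 → C) (F : Fin 2 → Fin 2 → Fin 2 → C)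
    (G : Fin 2 → Fin 2 → C) (Ψ : Fin 2 → C) (k : Fin 2) : C :=
  ∑ l, (∑ a, ∑ b, E a b k l * ((1 / 2 : ℂ) •
          (𝓕.second (spinWeight l) a b (Ψ l) + 𝓕.second (spinWeight l) b a (Ψ l)))
        + ∑ a, F a k l * 𝓕.covDeriv a (spinWeight l) (Ψ l) + G k l * Ψ l)

/-- The Dirac operator with potentials `U 0`, `U 1`, acting on spinors. -/
def diracAlg (U : Fin 2 → C) (Ψ : Fin 2 → C) (k : Fin 2) : C :=
  Complex.I • ∑ l, !![U 0 * Ψ l, ∑ a, 𝓕.vecX a • 𝓕.covDeriv a (spinWeight l) (Ψ l);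
        ∑ a, 𝓕.vecY a • 𝓕.covDeriv a (spinWeight l) (Ψ l), U 1 * Ψ l] k l

theorem hom_sum (k : ℤ × ℤ) (f : Fin 2 → C) : hom k (∑ l, f l) = ∑ l, hom k (f l) := by
  simp [Fin.sum_univ_two, AddMonoidAlgebra.single_add]

theorem hom_smul (k : ℤ × ℤ) (c : ℂ) (f : C) : hom k (c • f) = c • hom k f := by
  simp

theorem hom_applyAlg {E : Fin 2 → Fin 2 → Fin 2 → Fin 2 → C} (F : Fin 2 → Fin 2 → Fin 2 → C)
    (G : Fin 2 → Fin 2 → C) (hE : ∀ a b k l, E a b k l = E b a k l) (Ψ : Fin 2 → C) (k : Fin 2) :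
    hom (spinWeight k) (𝓕.applyAlg E F G Ψ k) =
      ∑ l, 𝓕.toNull.entry (𝓕.coeffs E F G) k l (hom (spinWeight l) (Ψ l)) := by
  rw [applyAlg, hom_sum]
  exact Finset.sum_congr rfl fun l _ => (𝓕.entry_hom E F G k l (fun a b => hE a b k l) _).symm

theorem hom_diracAlg (U : Fin 2 → C) (Ψ : Fin 2 → C) (k : Fin 2) :
    hom (spinWeight k) (𝓕.diracAlg U Ψ k) = Complex.I •
      ∑ l, 𝓕.toNull.diracEntry (hom 0 (U 0)) (hom 0 (U 1)) k l (hom (spinWeight l) (Ψ l)) := by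
  rw [diracAlg, hom_smul, hom_sum]
  congr 1
  exact Finset.sum_congr rfl fun l _ => (𝓕.diracEntry_hom U k l _).symm

/-- Links the matrix commutator on spinors with the entrywise one. The constant factor `i`, removed
from the Dirac operator in null form, comes out of both products. -/
theorem hom_commutator {E : Fin 2 → Fin 2 → Fin 2 → Fin 2 → C} (F : Fin 2 → Fin 2 → Fin 2 → C)
    (G : Fin 2 → Fin 2 → C) (hE : ∀ a b k l, E a b k l = E b a k l) (U Ψ : Fin 2 → C) (k : Fin 2) :
    hom (spinWeight k) (𝓕.applyAlg E F G (𝓕.diracAlg U Ψ) k - 𝓕.diracAlg U (𝓕.applyAlg E F G Ψ) k)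
      = Complex.I • ∑ l, 𝓕.toNull.commutatorEntry (𝓕.coeffs E F G) (hom 0 (U 0)) (hom 0 (U 1)) k l
        (hom (spinWeight l) (Ψ l)) := by
  rw [hom, AddMonoidAlgebra.single_sub]
  change hom _ _ - hom _ _ = _
  have hentry : ∀ k l s t, 𝓕.toNull.entry (𝓕.coeffs E F G) k l (s + t) =
      𝓕.toNull.entry (𝓕.coeffs E F G) k l s + 𝓕.toNull.entry (𝓕.coeffs E F G) k l t := by
    intro k l s t
    simp only [NullCalculus.entry, map_add]
    ring
  have hentry' : ∀ k l (c : ℂ) s, 𝓕.toNull.entry (𝓕.coeffs E F G) k l (c • s) =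
      c • 𝓕.toNull.entry (𝓕.coeffs E F G) k l s := by
    intro k l c s
    simp only [NullCalculus.entry, Derivation.map_smul, mul_smul_comm, ← smul_add]
  have hdirac : ∀ k l s t, 𝓕.toNull.diracEntry (hom 0 (U 0)) (hom 0 (U 1)) k l (s + t) =
      𝓕.toNull.diracEntry (hom 0 (U 0)) (hom 0 (U 1)) k l s
      + 𝓕.toNull.diracEntry (hom 0 (U 0)) (hom 0 (U 1)) k l t := by
    intro k l s t
    fin_cases k <;> fin_cases l <;> simp [NullCalculus.diracEntry, mul_add]
  rw [hom_applyAlg _ _ _ hE, hom_diracAlg]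
  simp only [hom_applyAlg _ _ _ hE, hom_diracAlg, hentry', NullCalculus.commutatorEntry,
    Fin.sum_univ_two, hentry, hdirac]
  simp only [← smul_add, ← smul_sub]
  congr 1
  ring

theorem commutator_eq_zero_iff {E : Fin 2 → Fin 2 → Fin 2 → Fin 2 → C}
    (F : Fin 2 → Fin 2 → Fin 2 → C) (G : Fin 2 → Fin 2 → C) (hE : ∀ a b k l, E a b k l = E b a k l)
    (U Ψ : Fin 2 → C) (k : Fin 2) :
    𝓕.applyAlg E F G (𝓕.diracAlg U Ψ) k = 𝓕.diracAlg U (𝓕.applyAlg E F G Ψ) k ↔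
      ∑ l, 𝓕.toNull.commutatorEntry (𝓕.coeffs E F G) (hom 0 (U 0)) (hom 0 (U 1)) k l
        (hom (spinWeight l) (Ψ l)) = 0 := by
  have h := 𝓕.hom_commutator F G hE U Ψ k
  constructor
  · intro h'
    rw [h', sub_self, hom, AddMonoidAlgebra.single_zero] at h
    exact (smul_eq_zero.1 h.symm).resolve_left Complex.I_ne_zero
  · intro h'
    rw [h', smul_zero] at h
    exact sub_eq_zero.1 (AddMonoidAlgebra.single_eq_zero.1 h)

end FrameCalculus

/-- A matrix which brings the Dirac matrices to normal form. -/
def DiracMatrices.conj {σ : Signature} (γ : DiracMatrices σ) : Matrix (Fin 2) (Fin 2) ℂ :=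
  γ.exists_normalForm.choose

section Normal

variable {σ : Signature} (γ : DiracMatrices σ)

theorem DiracMatrices.isUnit_det_conj : IsUnit γ.conj.det :=
  γ.exists_normalForm.choose_spec.1

theorem DiracMatrices.conj_mul_inv : γ.conj * γ.conj⁻¹ = 1 :=
  Matrix.mul_nonsing_inv _ γ.isUnit_det_conj

theorem DiracMatrices.inv_mul_conj : γ.conj⁻¹ * γ.conj = 1 :=
  Matrix.nonsing_inv_mul _ γ.isUnit_det_conj

theorem DiracMatrices.inv_conj_mul_low (a : Fin 2) :
    γ.conj⁻¹ * γ.low a = σ.normalGamma a * γ.conj⁻¹ := by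
  have h := γ.exists_normalForm.choose_spec.2 a
  change γ.low a * γ.conj = γ.conj * _ at h
  calc γ.conj⁻¹ * γ.low a = γ.conj⁻¹ * (γ.low a * γ.conj) * γ.conj⁻¹ := by
        rw [← mul_assoc, mul_assoc _ γ.conj, γ.conj_mul_inv, mul_one]
    _ = _ := by rw [h, ← mul_assoc, γ.inv_mul_conj, one_mul]

theorem DiracMatrices.inv_conj_mul_vol :
    γ.conj⁻¹ * γ.vol =
      !![-(σ.nullRoot * σ.sgn 0), 0; 0, σ.nullRoot * σ.sgn 0] * γ.conj⁻¹ := by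
  rw [DiracMatrices.vol, ← mul_assoc, γ.inv_conj_mul_low, mul_assoc, γ.inv_conj_mul_low, ← mul_assoc]
  congr 1
  ext a b
  fin_cases a <;> fin_cases b <;>
    simp [Signature.normalGamma, Matrix.mul_apply, Fin.sum_univ_two, mul_comm]

theorem DiracMatrices.bi_eq (a b : Fin 2) : γ.bi a b = eps a b • γ.vol := by
  fin_cases a <;> fin_cases b <;>
    simp [DiracMatrices.bi, eps, γ.anticomm, DiracMatrices.vol]
  · rw [← two_smul ℂ, smul_smul]; norm_num
  · rw [neg_sub_left, ← two_smul ℂ, smul_neg, smul_smul]; norm_num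

theorem DiracMatrices.inv_conj_mulVec_injective {v w : Fin 2 → ℂ}
    (h : γ.conj⁻¹ *ᵥ v = γ.conj⁻¹ *ᵥ w) : v = w := by
  have := congrArg (γ.conj *ᵥ ·) h
  simpa only [Matrix.mulVec_mulVec, γ.conj_mul_inv, Matrix.one_mulVec] using this

end Normal

/-- The entries of a matrix in the basis in which the Dirac matrices have normal form. -/
def DiracMatrices.toNormal {σ : Signature} (γ : DiracMatrices σ) (A : Matrix (Fin 2) (Fin 2) ℂ)
    (k l : Fin 2) : ℂ := (γ.conj⁻¹ * A * γ.conj) k l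

theorem DiracMatrices.inv_conj_mulVec_mulVec {σ : Signature} (γ : DiracMatrices σ)
    (A : Matrix (Fin 2) (Fin 2) ℂ) (v : Fin 2 → ℂ) (k : Fin 2) :
    (γ.conj⁻¹ *ᵥ (A *ᵥ v)) k = ∑ l, γ.toNormal A k l * (γ.conj⁻¹ *ᵥ v) l := by
  have : γ.conj⁻¹ *ᵥ (A *ᵥ v) = (γ.conj⁻¹ * A * γ.conj) *ᵥ (γ.conj⁻¹ *ᵥ v) := by
    rw [Matrix.mulVec_mulVec, Matrix.mulVec_mulVec, mul_assoc _ γ.conj, γ.conj_mul_inv, mul_one]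
  rw [this]
  rfl

namespace SpinManifold

variable {M : Type*} [TopologicalSpace M] [ChartedSpace Plane M] [IsManifold (𝓡 2) ∞ M]
  {σ : Signature} {γ : DiracMatrices σ} {ι : Type*} (𝒮 : SpinManifold M γ ι)
  {q : ℝ} (𝒜 : 𝒮.Potential q) (i : ι)

/-- The spinor `ψ` on the domain of the `i`-th trivialisation has components `Ψ` in the basis in
which the Dirac matrices have normal form. -/
def SpinRep (ψ : M → Fin 2 → ℂ) (Ψ : Fin 2 → 𝒮.Alg i) : Prop :=
  ∀ l, Rep (𝒮.chart i) (fun p => (γ.conj⁻¹ *ᵥ ψ p) l) (Ψ l)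

variable {𝒮 i}

theorem SpinRep.smoothIn {ψ : M → Fin 2 → ℂ} {Ψ : Fin 2 → 𝒮.Alg i} (h : 𝒮.SpinRep i ψ Ψ) :
    SmoothIn (𝒮.chart i) ψ := by
  have h' : ∀ p k, ψ p k = ∑ l, γ.conj k l * (γ.conj⁻¹ *ᵥ ψ p) l := by
    intro p k
    have : ψ p = γ.conj *ᵥ (γ.conj⁻¹ *ᵥ ψ p) := by
      rw [Matrix.mulVec_mulVec, γ.conj_mul_inv, Matrix.one_mulVec]
    exact congrFun this k
  refine contDiffOn_pi.2 fun k => ?_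
  change SmoothIn (𝒮.chart i) fun p => ψ p k
  simp only [h']
  exact SmoothIn.sum fun l _ => (SmoothIn.const _).mul (h l).smoothIn

theorem exists_spinRep {ψ : M → Fin 2 → ℂ} (h : SmoothIn (𝒮.chart i) ψ) :
    ∃ Ψ, 𝒮.SpinRep i ψ Ψ := by
  have h' : ∀ l, SmoothIn (𝒮.chart i) fun p => (γ.conj⁻¹ *ᵥ ψ p) l := fun l => by
    simp only [Matrix.mulVec, dotProduct]
    exact SmoothIn.sum fun k _ => (SmoothIn.const _).mul
      (show SmoothIn (𝒮.chart i) fun p => ψ p k from contDiffOn_pi.1 h k)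
  exact ⟨fun l => (h' l).toAlg, fun l => rep_toAlg (h' l)⟩

theorem SpinRep.pd {ψ : M → Fin 2 → ℂ} {Ψ : Fin 2 → 𝒮.Alg i} (h : 𝒮.SpinRep i ψ Ψ) (μ : Fin 2) :
    𝒮.SpinRep i (pd (𝒮.chart i) μ ψ) fun l => pdAlg (𝒮.chart i) μ (Ψ l) := by
  intro l p hp
  rw [← (h l).pd μ p hp]
  let L : (Fin 2 → ℂ) →L[ℝ] ℂ := ((LinearMap.proj l).comp
    (Matrix.mulVecLin (γ.conj⁻¹))).toContinuousLinearMap.restrictScalars ℝ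
  exact (pd_clm L h.smoothIn μ hp).symm

/-- In normal form `vol` is diagonal with entries `∓ c s₀`, so the spin connection acts on each
spinor component separately, as multiplication by its weight `∓1` times `(c s₀ / 2) Γ^{01}`. This is
why spinors fit into the same weighted calculus as tensors. -/
theorem SpinRep.Dframe {ψ : M → Fin 2 → ℂ} {Ψ : Fin 2 → 𝒮.Alg i} (h : 𝒮.SpinRep i ψ Ψ)
    (a : Fin 2) : 𝒮.SpinRep i (𝒮.Dframe 𝒜 i a ψ) fun l =>
      (𝒮.calculus 𝒜 i).covDeriv a (FrameCalculus.spinWeight l) (Ψ l) := by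
  refine fun l => rep_of_ev fun p hp => ?_
  have hcoord : ∀ μ, (γ.conj⁻¹ *ᵥ 𝒮.Dcoord 𝒜 i μ ψ p) l =
      evAlg ⟨p, hp⟩ (pdAlg (𝒮.chart i) μ (Ψ l)) + (FrameCalculus.spinWeight l).1 *
        (σ.nullRoot * σ.sgn 0 / 2) * (𝒮.spinConn i 0 1 μ p * evAlg ⟨p, hp⟩ (Ψ l))
      - Complex.I * q * (𝒜.A i μ p : ℂ) * evAlg ⟨p, hp⟩ (Ψ l) := by
    intro μ
    have h0 := (h.pd μ l).ev hp
    have h1 := (h l).ev hp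
    -- The index pairs `01` and `10` give equal terms, so the factor `1/4` becomes `1/2`.
    have hΓ : ((1 / 4 : ℂ) • ∑ a, ∑ b, (𝒮.spinConn i a b μ p : ℂ) • γ.bi a b) =
        ((1 / 2 : ℂ) * 𝒮.spinConn i 0 1 μ p) • γ.vol := by
      have e00 : eps 0 0 = 0 := rfl
      have e01 : eps 0 1 = 1 := rfl
      have e10 : eps 1 0 = -1 := rfl
      have e11 : eps 1 1 = 0 := rfl
      simp only [γ.bi_eq, Fin.sum_univ_two, 𝒮.spinConn_antisymm i 1 0 μ hp, e00, e01, e10, e11,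
        Complex.ofReal_neg]
      module
    rw [Dcoord, hΓ, Matrix.mulVec_sub, Matrix.mulVec_add, Matrix.smul_mulVec, Matrix.mulVec_smul,
      Matrix.mulVec_smul, Matrix.mulVec_mulVec, γ.inv_conj_mul_vol, ← Matrix.mulVec_mulVec]
    simp only [Pi.add_apply, Pi.sub_apply, Pi.smul_apply, smul_eq_mul, h0, h1]
    fin_cases l <;> simp [Matrix.mulVec, dotProduct, Fin.sum_univ_two, FrameCalculus.spinWeight] at h1 ⊢
    · ring
    · ring
  have e : evAlg ⟨p, hp⟩ ((𝒮.calculus 𝒜 i).covDeriv a (FrameCalculus.spinWeight l) (Ψ l)) =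
      ∑ μ, (𝒮.frame i a μ p : ℂ) * (evAlg ⟨p, hp⟩ (pdAlg (𝒮.chart i) μ (Ψ l))
        + (FrameCalculus.spinWeight l).1 *
        (σ.nullRoot * σ.sgn 0 / 2) * (𝒮.spinConn i 0 1 μ p * evAlg ⟨p, hp⟩ (Ψ l))
      - Complex.I * q * (𝒜.A i μ p : ℂ) * evAlg ⟨p, hp⟩ (Ψ l)) := by
    have e1 : ∀ μ, evAlg ⟨p, hp⟩ (𝒮.frameAlg i a μ) = 𝒮.frame i a μ p := fun _ => rfl
    have e2 : ∀ μ, evAlg ⟨p, hp⟩ (𝒮.connAlg i μ) = 𝒮.spinConn i 0 1 μ p := fun _ => rfl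
    have e3 : ∀ μ, evAlg ⟨p, hp⟩ (potentialAlg 𝒜 i μ) = Complex.I * q * (𝒜.A i μ p : ℂ) :=
      fun _ => rfl
    have e4 : (FrameCalculus.spinWeight l).2 = 1 := by fin_cases l <;> rfl
    simp only [FrameCalculus.covDeriv_apply, calculus, frameDeriv_apply, toFrame, map_add, map_sub,
      map_mul, map_smul, e1, e2, e3, e4, smul_eq_mul, Fin.sum_univ_two, Int.cast_one]
    ring
  rw [e]
  simp only [SpinManifold.Dframe, Fin.sum_univ_two, Matrix.mulVec_add, Matrix.mulVec_smul,
    Pi.add_apply, Pi.smul_apply, smul_eq_mul, hcoord]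

theorem rep_conn (b c a : Fin 2) :
    Rep (𝒮.chart i) (𝒮.conn i b c a) ((𝒮.calculus 𝒜 i).conn b c a) := by
  refine rep_of_ev fun p hp => ?_
  obtain ⟨h00, h11, h01, h10⟩ := 𝒮.conn_eq 𝒜 i a hp
  fin_cases b <;> fin_cases c <;> simp [FrameCalculus.conn, h00, h11, h01, h10, mul_comm]

theorem SpinRep.Dsecond {ψ : M → Fin 2 → ℂ} {Ψ : Fin 2 → 𝒮.Alg i} (h : 𝒮.SpinRep i ψ Ψ)
    (a b : Fin 2) : 𝒮.SpinRep i (𝒮.Dsecond 𝒜 i a b ψ) fun l =>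
      (𝒮.calculus 𝒜 i).second (FrameCalculus.spinWeight l) a b (Ψ l) := by
  refine fun l => rep_of_ev fun p hp => ?_
  have h1 := ((h.Dframe 𝒜 b).Dframe 𝒜 a l).ev hp
  have h2 := fun c => (h.Dframe 𝒜 c l).ev hp
  have h3 := fun c => (rep_conn 𝒜 c b a).ev hp
  simp only [FrameCalculus.second, SpinManifold.Dsecond, Fin.sum_univ_two, map_sub, map_add, map_mul,
    h1, h2, h3, Matrix.mulVec_sub, Matrix.mulVec_add, Matrix.mulVec_smul, Pi.add_apply,
    Pi.sub_apply, Pi.smul_apply, smul_eq_mul]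

theorem smoothIn_toNormal {A : M → Matrix (Fin 2) (Fin 2) ℂ}
    (hA : ∀ k l, ContMDiffOn (𝓡 2) 𝓘(ℝ, ℂ) ∞ (fun p => A p k l) (𝒮.dom i)) (k l : Fin 2) :
    SmoothIn (𝒮.chart i) fun p => γ.toNormal (A p) k l := by
  simp only [DiracMatrices.toNormal, Matrix.mul_apply]
  exact SmoothIn.sum fun m _ => (SmoothIn.sum fun n _ => (SmoothIn.const _).mul
    ((𝒮.smoothIn_iff i).2 (hA n m))).mul (SmoothIn.const _)

variable (i) in
/-- The coefficients `𝔼^{ab}` in normal form. -/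
def Operator2.algE (K : 𝒮.Operator2) (a b k l : Fin 2) : 𝒮.Alg i :=
  (smoothIn_toNormal (K.E_smooth i a b) k l).toAlg

variable (i) in
/-- The coefficients `𝔽^a` in normal form. -/
def Operator2.algF (K : 𝒮.Operator2) (a k l : Fin 2) : 𝒮.Alg i :=
  (smoothIn_toNormal (K.F_smooth i a) k l).toAlg

variable (i) in
/-- The coefficient `𝔾` in normal form. -/
def Operator2.algG (K : 𝒮.Operator2) (k l : Fin 2) : 𝒮.Alg i :=
  (smoothIn_toNormal (K.G_smooth i) k l).toAlg

theorem Operator2.algE_symm (K : 𝒮.Operator2) (a b k l : Fin 2) :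
    K.algE i a b k l = K.algE i b a k l :=
  alg_ext fun ⟨p, hp⟩ => by
    change γ.toNormal (K.E i a b p) k l = γ.toNormal (K.E i b a p) k l
    rw [K.E_symm i a b p hp]

theorem SpinRep.apply (K : 𝒮.Operator2) {ψ : M → Fin 2 → ℂ} {Ψ : Fin 2 → 𝒮.Alg i}
    (h : 𝒮.SpinRep i ψ Ψ) : 𝒮.SpinRep i (K.apply 𝒜 i ψ)
      ((𝒮.calculus 𝒜 i).applyAlg (K.algE i) (K.algF i) (K.algG i) Ψ) := by
  refine fun k => rep_of_ev fun p hp => ?_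
  have h0 := fun l => (h l).ev hp
  have h1 := fun a l => (h.Dframe 𝒜 a l).ev hp
  have h2 := fun a b l => (h.Dsecond 𝒜 a b l).ev hp
  have eE : ∀ a b k l, evAlg ⟨p, hp⟩ (K.algE i a b k l) = γ.toNormal (K.E i a b p) k l :=
    fun _ _ _ _ => rfl
  have eF : ∀ a k l, evAlg ⟨p, hp⟩ (K.algF i a k l) = γ.toNormal (K.F i a p) k l :=
    fun _ _ _ => rfl
  have eG : ∀ k l, evAlg ⟨p, hp⟩ (K.algG i k l) = γ.toNormal (K.G i p) k l := fun _ _ => rfl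
  simp only [Operator2.apply, FrameCalculus.applyAlg, Dsym, map_sum, map_add, map_mul, map_smul,
    h0, h1, h2, eE, eF, eG, Matrix.mulVec_add, Matrix.mulVec_sum, Pi.add_apply,
    Finset.sum_apply, smul_eq_mul, γ.inv_conj_mulVec_mulVec, Matrix.mulVec_smul, Pi.smul_apply]
  simp only [Fin.sum_univ_two]
  ring

variable {V Vh : M → ℂ}

variable (𝒮 i) in
/-- The potentials `i (V ∓ ĉ V̂)` of the Dirac operator in null form. -/
def potentials (hV : ContMDiff (𝓡 2) 𝓘(ℝ, ℂ) ∞ V) (hVh : ContMDiff (𝓡 2) 𝓘(ℝ, ℂ) ∞ Vh) :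
    Fin 2 → 𝒮.Alg i :=
  ![Complex.I • (((𝒮.smoothIn_iff i).2 hV.contMDiffOn).toAlg
      - (σ.nullRoot * σ.sgn 0) • ((𝒮.smoothIn_iff i).2 hVh.contMDiffOn).toAlg),
    Complex.I • (((𝒮.smoothIn_iff i).2 hV.contMDiffOn).toAlg
      + (σ.nullRoot * σ.sgn 0) • ((𝒮.smoothIn_iff i).2 hVh.contMDiffOn).toAlg)]

/-- In normal form `γ^a D_a` is off-diagonal with entries `X` and `Y`, and `γ` is diagonal. Taking
out the common factor `i` turns `-V ± c s₀ V̂` into `i` times the null potentials. -/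
theorem SpinRep.dirac (hV : ContMDiff (𝓡 2) 𝓘(ℝ, ℂ) ∞ V) (hVh : ContMDiff (𝓡 2) 𝓘(ℝ, ℂ) ∞ Vh)
    {ψ : M → Fin 2 → ℂ} {Ψ : Fin 2 → 𝒮.Alg i} (h : 𝒮.SpinRep i ψ Ψ) :
    𝒮.SpinRep i (𝒮.dirac 𝒜 V Vh i ψ) ((𝒮.calculus 𝒜 i).diracAlg (𝒮.potentials i hV hVh) Ψ) := by
  refine fun k => rep_of_ev fun p hp => ?_
  have h0 : ∀ l, (γ.conj⁻¹ *ᵥ ψ p) l = evAlg ⟨p, hp⟩ (Ψ l) := fun l => ((h l).ev hp).symm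
  have h1 : ∀ a l, (γ.conj⁻¹ *ᵥ 𝒮.Dframe 𝒜 i a ψ p) l = evAlg ⟨p, hp⟩
      ((𝒮.calculus 𝒜 i).covDeriv a (FrameCalculus.spinWeight l) (Ψ l)) :=
    fun a l => ((h.Dframe 𝒜 a l).ev hp).symm
  have eV : evAlg ⟨p, hp⟩ ((𝒮.smoothIn_iff i).2 hV.contMDiffOn).toAlg = V p := rfl
  have eVh : evAlg ⟨p, hp⟩ ((𝒮.smoothIn_iff i).2 hVh.contMDiffOn).toAlg = Vh p := rfl
  have hup : ∀ a v, (γ.conj⁻¹ *ᵥ (γ.up a *ᵥ v)) k =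
      σ.sgn a * ∑ l, σ.normalGamma a k l * (γ.conj⁻¹ *ᵥ v) l := by
    intro a v
    rw [DiracMatrices.up, Matrix.smul_mulVec, Matrix.mulVec_smul, Matrix.mulVec_mulVec,
      γ.inv_conj_mul_low, ← Matrix.mulVec_mulVec]
    rfl
  have hex : ∀ v, (γ.conj⁻¹ *ᵥ (γ.expand (V p) 0 (Vh p) *ᵥ v)) k = V p * (γ.conj⁻¹ *ᵥ v) k
      + Vh p * ∑ l, !![-(σ.nullRoot * σ.sgn 0), 0; 0, σ.nullRoot * σ.sgn 0] k l *
        (γ.conj⁻¹ *ᵥ v) l := by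
    intro v
    simp only [DiracMatrices.expand, Pi.zero_apply, zero_smul, Finset.sum_const_zero, add_zero,
      Matrix.add_mulVec, Matrix.smul_mulVec, Matrix.one_mulVec, Matrix.mulVec_add,
      Matrix.mulVec_smul]
    rw [Matrix.mulVec_mulVec, γ.inv_conj_mul_vol, ← Matrix.mulVec_mulVec]
    rfl
  have hs := σ.sgn_mul_self 0
  have ec : (𝒮.calculus 𝒜 i).c = σ.nullRoot := rfl
  simp only [SpinManifold.dirac, Matrix.mulVec_sub, Matrix.mulVec_smul, Matrix.mulVec_add,
    Pi.sub_apply, Pi.smul_apply, Pi.add_apply, hex, hup, h0, h1, FrameCalculus.diracAlg,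
    map_smul, Fin.sum_univ_two, smul_eq_mul]
  fin_cases k <;>
    simp [FrameCalculus.vecX, FrameCalculus.vecY, potentials, eV, eVh, ec, Signature.normalGamma]
  · linear_combination (-(V p) + σ.nullRoot * σ.sgn 0 * Vh p) * evAlg ⟨p, hp⟩ (Ψ 0) *
      Complex.I_mul_I
  · linear_combination (-(V p) - σ.nullRoot * σ.sgn 0 * Vh p) * evAlg ⟨p, hp⟩ (Ψ 1) *
      Complex.I_mul_I + Complex.I * evAlg ⟨p, hp⟩
        ((𝒮.calculus 𝒜 i).covDeriv 0 (FrameCalculus.spinWeight 0) (Ψ 0)) * hs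

/-- In a trivialisation, the symmetry condition on a spinor field in null form. -/
theorem apply_dirac_eq_iff (K : 𝒮.Operator2) (hV : ContMDiff (𝓡 2) 𝓘(ℝ, ℂ) ∞ V)
    (hVh : ContMDiff (𝓡 2) 𝓘(ℝ, ℂ) ∞ Vh) {ψ : M → Fin 2 → ℂ} {Ψ : Fin 2 → 𝒮.Alg i}
    (h : 𝒮.SpinRep i ψ Ψ) :
    (∀ p ∈ 𝒮.dom i, K.apply 𝒜 i (𝒮.dirac 𝒜 V Vh i ψ) p = 𝒮.dirac 𝒜 V Vh i (K.apply 𝒜 i ψ) p) ↔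
    ∀ k, ∑ l, (𝒮.calculus 𝒜 i).toNull.commutatorEntry
      ((𝒮.calculus 𝒜 i).coeffs (K.algE i) (K.algF i) (K.algG i))
      (FrameCalculus.hom 0 (𝒮.potentials i hV hVh 0)) (FrameCalculus.hom 0 (𝒮.potentials i hV hVh 1))
      k l (FrameCalculus.hom (FrameCalculus.spinWeight l) (Ψ l)) = 0 := by
  simp only [← FrameCalculus.commutator_eq_zero_iff _ _ _ K.algE_symm]
  have h1 := (h.dirac 𝒜 hV hVh).apply 𝒜 K
  have h2 := (h.apply 𝒜 K).dirac 𝒜 hV hVh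
  constructor
  · intro hK k
    refine (h1 k).unique fun p hp => ?_
    rw [← h2 k p hp]
    simp only [hK p hp]
  · intro hK p hp
    refine γ.inv_conj_mulVec_injective (funext fun k => ?_)
    have e1 := h1 k p hp
    rw [hK k] at e1
    exact e1.trans (h2 k p hp).symm

end SpinManifold

/-! ### Spin weights of the commutator coefficients. -/

namespace NullCalculus

variable {B : Type*} [CommRing B] [Algebra ℂ B] {ι : Type*} {𝒩 : NullCalculus B ι}

theorem derivation_four (D : Derivation ℂ B B) : D 4 = 0 := by
  simpa using D.map_natCast 4

theorem derivation_six (D : Derivation ℂ B B) : D 6 = 0 := by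
  simpa using D.map_natCast 6

theorem derivation_seven (D : Derivation ℂ B B) : D 7 = 0 := by
  simpa using D.map_natCast 7

-- Vanishing at all points implies vanishing only for homogeneous elements, so each coefficient
-- needs a weight. The terms `± 2` compensate for the weights of the derivatives `X` and `Y` which
-- the coefficient multiplies.
set_option maxHeartbeats 2000000 in
theorem tensor_commutatorCoeff {K : Coeffs B} (hK : K.IsTensor 𝒩) {u v : B} (hu : 𝒩.Tensor 0 u)
    (hv : 𝒩.Tensor 0 v) (k l : Fin 2) (i j : Fin 4) :
    𝒩.Tensor (entryWeight k l + 2 * i - 2 * j) (𝒩.commutatorCoeff K u v k l i j) := by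
  obtain ⟨hu, hu'⟩ := hu
  obtain ⟨hv, hv'⟩ := hv
  obtain ⟨ha, hb, hd, hf, hh, hg⟩ := hK
  simp only [Tensor, forall_and, Fin.forall_fin_two] at ha hb hd hf hh hg
  obtain ⟨⟨⟨a1, a2⟩, a3, a4⟩, ⟨a5, a6⟩, a7, a8⟩ := ha
  obtain ⟨⟨⟨b1, b2⟩, b3, b4⟩, ⟨b5, b6⟩, b7, b8⟩ := hb
  obtain ⟨⟨⟨d1, d2⟩, d3, d4⟩, ⟨d5, d6⟩, d7, d8⟩ := hd
  obtain ⟨⟨⟨f1, f2⟩, f3, f4⟩, ⟨f5, f6⟩, f7, f8⟩ := hf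
  obtain ⟨⟨⟨h1, h2⟩, h3, h4⟩, ⟨h5, h6⟩, h7, h8⟩ := hh
  obtain ⟨⟨⟨g1, g2⟩, g3, g4⟩, ⟨g5, g6⟩, g7, g8⟩ := hg
  simp only [entryWeight, Matrix.cons_val', Matrix.cons_val_zero, Matrix.cons_val_one,
    Matrix.of_apply, Matrix.cons_val_fin_one] at *
  norm_num at *
  constructor
  · fin_cases k <;> fin_cases l <;> fin_cases i <;> fin_cases j <;>
    · simp only [Fin.zero_eta, Fin.mk_one, Fin.reduceFinMk, commutatorCoeff, map_add, map_sub, map_neg, map_zero, Derivation.leibniz,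
        smul_eq_mul, 𝒩.HX, 𝒩.HY, 𝒩.HR, 𝒩.HΦ, hu, hv, a1, a2, a3, a4, b1, b2, b3, b4, d1, d2, d3, d4,
        f1, f2, f3, f4, g1, g2, g3, g4, h1, h2, h3, h4, derivation_two, derivation_three,
        derivation_four, derivation_six, derivation_seven]
      try norm_num
      try ring
  · fin_cases k <;> fin_cases l <;> fin_cases i <;> fin_cases j <;>
    · simp [commutatorCoeff, 𝒩.NX, 𝒩.NY, 𝒩.NR, 𝒩.NΦ, derivation_two, derivation_three,
        derivation_four, derivation_seven, *]

end NullCalculus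

/-! ### Test spinors -/

theorem pd_coordinate {M : Type*} [TopologicalSpace M] (φ : OpenPartialHomeomorph M Plane)
    (x : ℝ) (μ ν : Fin 2) {p : M} (hp : p ∈ φ.source) :
    pd φ μ (fun r => φ r ν - x) p = if μ = ν then 1 else 0 := by
  have h : (fun y => φ (φ.symm y) ν - x) =ᶠ[nhds (φ p)] fun y : Plane => y ν - x := by
    filter_upwards [φ.open_target.mem_nhds (φ.map_source hp)] with y hy
    rw [φ.right_inv hy]
  rw [pd, h.fderiv_eq, fderiv_sub_const]
  have : HasFDerivAt (fun y : Plane => y ν) (EuclideanSpace.proj (𝕜 := ℝ) ν) (φ p) :=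
    (EuclideanSpace.proj (𝕜 := ℝ) ν).hasFDerivAt
  rw [this.fderiv]
  simp [eq_comm]

theorem smoothIn_coordinate {M : Type*} [TopologicalSpace M] (φ : OpenPartialHomeomorph M Plane)
    (x : ℝ) (ν : Fin 2) : SmoothIn φ (fun r => φ r ν - x) := by
  have h : ContDiffOn ℝ ∞ (fun y : Plane => y ν - x) φ.target :=
    ((EuclideanSpace.proj (𝕜 := ℝ) ν).contDiff.sub contDiff_const).contDiffOn
  exact h.congr fun y hy => by simp only [φ.right_inv hy]

theorem contMDiffAt_mul {M : Type*} [TopologicalSpace M] [ChartedSpace Plane M] {f g : M → ℂ}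
    {p : M} (hf : ContMDiffAt (𝓡 2) 𝓘(ℝ, ℂ) ∞ f p) (hg : ContMDiffAt (𝓡 2) 𝓘(ℝ, ℂ) ∞ g p) :
    ContMDiffAt (𝓡 2) 𝓘(ℝ, ℂ) ∞ (fun r => f r * g r) p :=
  (contDiff_mul (𝕜 := ℝ) (𝔸 := ℂ)).contMDiff.contMDiffAt.comp p (hf.prodMk_space hg)

namespace SpinManifold

variable {M : Type*} [TopologicalSpace M] [ChartedSpace Plane M] [IsManifold (𝓡 2) ∞ M]
  {σ : Signature} {γ : DiracMatrices σ} {ι : Type*} {𝒮 : SpinManifold M γ ι}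
  {q : ℝ} (𝒜 : 𝒮.Potential q) {i : ι}

/-- Take a constant combination of the coordinates centred at `p`, with coefficients obtained from
`w` by the coframe at `p`. -/
theorem exists_coordinate (p : (𝒮.chart i).source) (w : Fin 2 → ℂ) :
    ∃ f : 𝒮.Alg i, evAlg p f = 0 ∧ ∀ a, evAlg p (𝒮.frameDeriv i a f) = w a := by
  obtain ⟨p, hp⟩ := p
  obtain ⟨ξ, h0, h1⟩ : ∃ ξ : Fin 2 → 𝒮.Alg i, (∀ ν, evAlg ⟨p, hp⟩ (ξ ν) = 0) ∧
      ∀ μ ν, evAlg ⟨p, hp⟩ (pdAlg (𝒮.chart i) μ (ξ ν)) = if μ = ν then 1 else 0 := by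
    refine ⟨fun ν => (smoothIn_coordinate (𝒮.chart i) (𝒮.chart i p ν) ν).ofReal.toAlg,
      fun ν => ?_, fun μ ν => ?_⟩
    · change ((𝒮.chart i p ν - 𝒮.chart i p ν : ℝ) : ℂ) = 0
      simp
    refine ((rep_pd_ofReal (smoothIn_coordinate (𝒮.chart i) (𝒮.chart i p ν) ν) μ).ev hp).trans ?_
    rw [pd_coordinate _ _ _ _ hp]
    split_ifs <;> simp
  have e : ∀ a μ, evAlg ⟨p, hp⟩ (𝒮.frameAlg i a μ) = 𝒮.frame i a μ p := fun _ _ => rfl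
  refine ⟨∑ ν, (∑ b, w b * (𝒮.coframe i b ν p : ℂ)) • ξ ν, by simp [h0], fun a => ?_⟩
  have h := fun b => congrArg (fun x : ℝ => (x : ℂ)) (𝒮.frame_coframe i hp a b)
  simp only [Fin.sum_univ_two] at h
  push_cast at h
  simp only [frameDeriv_apply, map_add, map_mul, map_smul, Derivation.map_smul, h1, e,
    Fin.sum_univ_two]
  have hh0 := h 0
  have hh1 := h 1
  fin_cases a <;> simp at hh0 hh1 ⊢ <;> linear_combination w 0 * hh0 + w 1 * hh1

/-- The spinor field with components `P e_l f` in the `i`-th trivialisation, where `f` is a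
function with support in its domain. -/
def testSpinor (l : Fin 2) {f : M → ℂ} (hf : ContMDiffOn (𝓡 2) 𝓘(ℝ, ℂ) ∞ f (𝒮.dom i))
    (hs : tsupport f ⊆ 𝒮.dom i) : 𝒮.SpinorField 𝒜 where
  val j r := 𝒜.phase j i r • (𝒮.spinT j i r *ᵥ fun m => γ.conj m l * f r)
  smooth j := by
    intro r hr
    refine ContMDiffAt.contMDiffWithinAt ?_
    -- The transition functions are controlled only on overlaps with the domain of `i`. Points of
    -- the support lie in that domain; near all other points the spinor is zero.
    by_cases hri : r ∈ tsupport f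
    · have ho : (𝒮.dom j ∩ 𝒮.dom i) ∈ nhds r :=
        ((𝒮.chart j).open_source.inter (𝒮.chart i).open_source).mem_nhds ⟨hr, hs hri⟩
      have ho' : 𝒮.dom i ∈ nhds r := (𝒮.chart i).open_source.mem_nhds (hs hri)
      rw [contMDiffAt_pi_space]
      intro k
      simp only [Pi.smul_apply, Matrix.mulVec, dotProduct, smul_eq_mul, Fin.sum_univ_two]
      have h1 := (𝒜.phase_smooth j i).contMDiffAt ho
      have h2 := fun m => (𝒮.spinT_smooth j i k m).contMDiffAt ho
      have h3 := hf.contMDiffAt ho'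
      exact contMDiffAt_mul h1 ((contMDiffAt_mul (h2 0) (contMDiffAt_mul contMDiffAt_const h3)).add
        (contMDiffAt_mul (h2 1) (contMDiffAt_mul contMDiffAt_const h3)))
    · have h : (fun r => 𝒜.phase j i r • (𝒮.spinT j i r *ᵥ fun m => γ.conj m l * f r))
          =ᶠ[nhds r] fun _ => 0 := by
        filter_upwards [(isClosed_tsupport f).isOpen_compl.mem_nhds hri] with x hx
        rw [image_eq_zero_of_notMem_tsupport hx]
        simp only [mul_zero]
        rw [← Pi.zero_def, Matrix.mulVec_zero, smul_zero]
      exact contMDiffAt_const.congr_of_eventuallyEq h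
  trans j k r hr := by
    by_cases hri : r ∈ tsupport f
    · have hri' := hs hri
      rw [← 𝒜.phase_cocycle j k i r ⟨hr, hri'⟩, ← 𝒮.spinT_cocycle j k i r ⟨hr, hri'⟩,
        Matrix.mulVec_smul, Matrix.mulVec_mulVec, smul_smul]
    · rw [image_eq_zero_of_notMem_tsupport hri]
      simp only [mul_zero]
      rw [← Pi.zero_def, Matrix.mulVec_zero, Matrix.mulVec_zero, smul_zero, smul_zero,
        Matrix.mulVec_zero, smul_zero]

theorem spinRep_testSpinor (l : Fin 2) {f : M → ℂ} (hf : ContMDiffOn (𝓡 2) 𝓘(ℝ, ℂ) ∞ f (𝒮.dom i))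
    (hs : tsupport f ⊆ 𝒮.dom i) {F : 𝒮.Alg i} (hF : Rep (𝒮.chart i) f F) :
    𝒮.SpinRep i ((testSpinor 𝒜 l hf hs).val i) (Pi.single l F) := by
  intro k p hp
  simp only [testSpinor, 𝒜.phase_self i p hp, 𝒮.spinT_self i p hp, one_smul, Matrix.one_mulVec]
  have h1 : (fun m => γ.conj m l * f p) = f p • (γ.conj *ᵥ Pi.single l 1) := by
    ext m
    simp [mul_comm]
  rw [h1, Matrix.mulVec_smul, Matrix.mulVec_mulVec, γ.inv_mul_conj, Matrix.one_mulVec, hF p hp]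
  by_cases h : k = l
  · subst h; simp
  · simp [h]

/-- The symmetry condition in terms of the coefficients of the commutator. -/
theorem isSymmetryOperator_iff [T2Space M] (K : 𝒮.Operator2) {V Vh : M → ℂ}
    (hV : ContMDiff (𝓡 2) 𝓘(ℝ, ℂ) ∞ V) (hVh : ContMDiff (𝓡 2) 𝓘(ℝ, ℂ) ∞ Vh) :
    K.IsSymmetryOperator 𝒜 V Vh ↔ ∀ i k l m n, (𝒮.calculus 𝒜 i).toNull.commutatorCoeff
      ((𝒮.calculus 𝒜 i).coeffs (K.algE i) (K.algF i) (K.algG i))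
      (FrameCalculus.hom 0 (𝒮.potentials i hV hVh 0)) (FrameCalculus.hom 0 (𝒮.potentials i hV hVh 1))
      k l m n = 0 := by
  have hop : ∀ (i : ι) (k l : Fin 2) (f : 𝒮.Alg i),
      (𝒮.calculus 𝒜 i).toNull.commutatorEntry
      ((𝒮.calculus 𝒜 i).coeffs (K.algE i) (K.algF i) (K.algG i))
      (FrameCalculus.hom 0 (𝒮.potentials i hV hVh 0)) (FrameCalculus.hom 0 (𝒮.potentials i hV hVh 1))
      k l (FrameCalculus.hom (FrameCalculus.spinWeight l) f) =
      (𝒮.calculus 𝒜 i).toNull.op3 ((𝒮.calculus 𝒜 i).toNull.commutatorCoeff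
      ((𝒮.calculus 𝒜 i).coeffs (K.algE i) (K.algF i) (K.algG i))
      (FrameCalculus.hom 0 (𝒮.potentials i hV hVh 0)) (FrameCalculus.hom 0 (𝒮.potentials i hV hVh 1))
      k l) (FrameCalculus.hom (FrameCalculus.spinWeight l) f) := by
    intro i k l f
    refine NullCalculus.commutatorEntry_eq_op3 _ ((𝒮.calculus 𝒜 i).tensor_hom 0 _)
      ((𝒮.calculus 𝒜 i).tensor_hom 0 _) k l ?_ ?_
    · change FrameCalculus.grading _ _ _ = _
      rw [FrameCalculus.grading_hom]
      fin_cases l <;> simp [FrameCalculus.spinWeight]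
    · change FrameCalculus.grading _ _ _ = _
      rw [FrameCalculus.grading_hom]
      fin_cases l <;> simp [FrameCalculus.spinWeight]
  constructor
  · intro hK i k l m n
    by_cases hmn : (m : ℕ) + n ≤ 3
    swap
    -- The table has default value zero beyond order three.
    · fin_cases k <;> fin_cases l <;> fin_cases m <;> fin_cases n <;> first
        | rfl
        | exact absurd (by decide) hmn
    refine (𝒮.calculus 𝒜 i).toNull.sep _ _ (NullCalculus.tensor_commutatorCoeff
      ((𝒮.calculus 𝒜 i).isTensor_coeffs _ _ _) ((𝒮.calculus 𝒜 i).tensor_hom 0 _)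
      ((𝒮.calculus 𝒜 i).tensor_hom 0 _) k l m n).1 (NullCalculus.tensor_commutatorCoeff
      ((𝒮.calculus 𝒜 i).isTensor_coeffs _ _ _) ((𝒮.calculus 𝒜 i).tensor_hom 0 _)
      ((𝒮.calculus 𝒜 i).tensor_hom 0 _) k l m n).2 fun p => ?_
    obtain ⟨⟨p, hp⟩, rfl⟩ : ∃ p' : (𝒮.chart i).source, p' = p := ⟨p, rfl⟩
    have hc : (𝒮.calculus 𝒜 i).c * (𝒮.calculus 𝒜 i).c = _ := (𝒮.calculus 𝒜 i).hc
    have hs0 := σ.sgn_mul_self 0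
    have hs1 := σ.sgn_mul_self 1
    -- The prescribed gradients are the covectors dual to the null basis (the coefficients of
    -- `compX` and `compY`), so that `X x = Y y = 1` and `Y x = X y = 0` at `p`.
    obtain ⟨x, hx, hx'⟩ := exists_coordinate ⟨p, hp⟩
      ![1 / 2 * σ.sgn 0, -(1 / 2 * σ.sgn 0 * (𝒮.calculus 𝒜 i).c)]
    obtain ⟨y, hy, hy'⟩ := exists_coordinate ⟨p, hp⟩ ![1 / 2, 1 / 2 * (𝒮.calculus 𝒜 i).c]
    have hδ : ∀ a f, evAlg ⟨p, hp⟩ ((𝒮.calculus 𝒜 i).δ a f) = evAlg ⟨p, hp⟩ (𝒮.frameDeriv i a f) :=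
      fun _ _ => rfl
    have hev : ∀ k f, (𝒮.calculus 𝒜 i).toNull.ev ⟨p, hp⟩ (FrameCalculus.hom k f) =
      evAlg ⟨p, hp⟩ f := fun k f => (𝒮.calculus 𝒜 i).gradedEv_hom _ _ _
    have hX : ∀ f, (𝒮.calculus 𝒜 i).toNull.ev ⟨p, hp⟩ ((𝒮.calculus 𝒜 i).toNull.X
        (FrameCalculus.hom 0 f)) = σ.sgn 0 * evAlg ⟨p, hp⟩ (𝒮.frameDeriv i 0 f)
        + σ.sgn 1 * (𝒮.calculus 𝒜 i).c * evAlg ⟨p, hp⟩ (𝒮.frameDeriv i 1 f) := by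
      intro f
      change (𝒮.calculus 𝒜 i).toNull.ev ⟨p, hp⟩ ((𝒮.calculus 𝒜 i).nullX _) = _
      rw [FrameCalculus.nullX_hom, hev]
      simp [FrameCalculus.covDeriv_apply, hδ]
    have hY : ∀ f, (𝒮.calculus 𝒜 i).toNull.ev ⟨p, hp⟩ ((𝒮.calculus 𝒜 i).toNull.Y
        (FrameCalculus.hom 0 f)) = evAlg ⟨p, hp⟩ (𝒮.frameDeriv i 0 f)
        - σ.sgn 0 * σ.sgn 1 * (𝒮.calculus 𝒜 i).c * evAlg ⟨p, hp⟩ (𝒮.frameDeriv i 1 f) := by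
      intro f
      change (𝒮.calculus 𝒜 i).toNull.ev ⟨p, hp⟩ ((𝒮.calculus 𝒜 i).nullY _) = _
      rw [FrameCalculus.nullY_hom, hev]
      simp [FrameCalculus.covDeriv_apply, hδ]
    -- The cut-off makes a local test function into a global spinor field. Only its value `1` at `p`
    -- is used in extracting the coefficients, not that it is constant near `p`.
    obtain ⟨χ, -, hχ⟩ := (SmoothBumpFunction.nhds_basis_tsupport (I := 𝓡 2) p).mem_iff.1
      ((𝒮.chart i).open_source.mem_nhds hp)
    have hχs : ContMDiffOn (𝓡 2) 𝓘(ℝ, ℂ) ∞ (fun r => (χ r : ℂ)) (𝒮.dom i) :=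
      (Complex.ofRealCLM.contMDiff.comp χ.contMDiff).contMDiffOn
    have hχi := (𝒮.smoothIn_iff i).2 hχs
    refine NullCalculus.op3_coeff_eq_zero (x := FrameCalculus.hom 0 x) (y := FrameCalculus.hom 0 y)
      (χ := FrameCalculus.hom (FrameCalculus.spinWeight l) hχi.toAlg)
      -- The test elements are smooth functions, placed in degree zero; the cut-off carries the
      -- weight of the spinor component.
      (S := MonoidHom.mrange ((AddMonoidAlgebra.singleZeroRingHom :
        𝒮.Alg i →+* FrameCalculus.Graded (𝒮.Alg i)) : 𝒮.Alg i →* FrameCalculus.Graded (𝒮.Alg i)))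
      ⟨x, rfl⟩ ⟨y, rfl⟩ ?_ ?_ ?_ ?_ ?_ ?_ ?_ ?_ m n hmn
    · rw [hev, hx]
    · rw [hev, hy]
    · rw [hX, hx', hx']
      simp
      linear_combination (1 / 2) * hs0 - (1 / 2) * σ.sgn 0 * σ.sgn 1 * hc + (1 / 2) * hs0 * σ.sgn 1 ^ 2 + (1 / 2) * hs1
    · rw [hY, hx', hx']
      simp
      linear_combination (1 / 2) * σ.sgn 1 * hc * σ.sgn 0^2 - (1 / 2) * σ.sgn 0 * σ.sgn 1 ^ 2 * hs0 - (1 / 2) * σ.sgn 0 * hs1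
    · rw [hX, hy', hy']
      simp
      linear_combination (1 / 2) * σ.sgn 1 * hc - (1 / 2) * σ.sgn 0 * hs1
    · rw [hY, hy', hy']
      simp
      linear_combination -(1 / 2) * σ.sgn 0 * σ.sgn 1 * hc + (1 / 2) * hs0 * σ.sgn 1 ^ 2 + (1 / 2) * hs1
    · rw [hev]
      change ((χ p : ℝ) : ℂ) = 1
      rw [χ.eq_one]
      simp
    · rintro _ ⟨f, rfl⟩
      change (𝒮.calculus 𝒜 i).toNull.op3 _ (FrameCalculus.hom 0 f * FrameCalculus.hom _ _) = 0
      rw [AddMonoidAlgebra.single_mul_single, zero_add]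
      have hg : SmoothIn (𝒮.chart i) (fun r => extend f r * (χ r : ℂ)) :=
        (smoothIn_extend f).mul hχi
      have hgs : tsupport (fun r => extend f r * (χ r : ℂ)) ⊆ 𝒮.dom i := by
        refine (closure_mono fun r hr => ?_).trans hχ
        rw [Function.mem_support] at hr ⊢
        intro h0
        rw [h0] at hr
        simp at hr
      have hgr : Rep (𝒮.chart i) (fun r => extend f r * (χ r : ℂ)) (f * hχi.toAlg) :=
        Rep.mul (fun r hr => extend_apply f hr) (rep_toAlg hχi)
      have h := (apply_dirac_eq_iff 𝒜 K hV hVh (spinRep_testSpinor 𝒜 l ((𝒮.smoothIn_iff i).1 hg)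
        hgs hgr)).1 (fun p hp => hK _ i p hp) k
      -- The test spinor has the single component `l`, so one entry of the commutator is isolated at
      -- a time.
      rw [Finset.sum_eq_single l (fun j _ hj => by
        rw [hop, Pi.single_eq_of_ne hj, show FrameCalculus.hom (FrameCalculus.spinWeight j)
          (0 : 𝒮.Alg i) = 0 from AddMonoidAlgebra.single_zero _]
        simp [NullCalculus.op3]) (by simp), hop, Pi.single_eq_same] at h
      exact h
  · intro h ψ i
    obtain ⟨Ψ, hΨ⟩ := exists_spinRep ((𝒮.smoothIn_iff i).2 (ψ.smooth i))
    refine (apply_dirac_eq_iff 𝒜 K hV hVh hΨ).2 fun k => Finset.sum_eq_zero fun l _ => ?_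
    rw [hop]
    simp only [NullCalculus.op3, h, zero_mul, add_zero]

end SpinManifold

/-! ### Null components of tensor fields and their covariant derivatives. -/

namespace NullCalculus

variable {B : Type*} [CommRing B] [Algebra ℂ B] {ι : Type*} {𝒩 : NullCalculus B ι}

theorem Tensor.ext {k : ℤ} {x y : B} (hx : 𝒩.Tensor k x) (hy : 𝒩.Tensor k y)
    (h : ∀ p, 𝒩.ev p x = 𝒩.ev p y) : x = y :=
  sub_eq_zero.1 (𝒩.sep _ k (by rw [map_sub, hx.1, hy.1]; ring) (by rw [map_sub, hx.2, hy.2, sub_zero])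
    fun p => by rw [map_sub, h, sub_self])

end NullCalculus

namespace SpinManifold

variable {M : Type*} [TopologicalSpace M] [ChartedSpace Plane M] [IsManifold (𝓡 2) ∞ M]
  {σ : Signature} {γ : DiracMatrices σ} {ι : Type*} {𝒮 : SpinManifold M γ ι}
  {q : ℝ} (𝒜 : 𝒮.Potential q) (i : ι)

/-- The components of a vector field in the algebra of smooth functions. -/
def VectorField.alg (v : 𝒮.VectorField) (a : Fin 2) : 𝒮.Alg i :=
  ((𝒮.smoothIn_iff i).2 (v.smooth i a)).toAlg

/-- The components of a symmetric tensor field in the algebra of smooth functions. -/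
def SymTensorField.alg (e : 𝒮.SymTensorField) (a b : Fin 2) : 𝒮.Alg i :=
  ((𝒮.smoothIn_iff i).2 (e.smooth i a b)).toAlg

variable (𝒮) in
/-- A smooth function on `M` in the algebra of smooth functions on the domain of a chart. -/
def funAlg {f : M → ℂ} (hf : ContMDiff (𝓡 2) 𝓘(ℝ, ℂ) ∞ f) : 𝒮.Alg i :=
  ((𝒮.smoothIn_iff i).2 hf.contMDiffOn).toAlg

open FrameCalculus in
/-- The null components of the tensor fields. -/
def nullFields (e : 𝒮.SymTensorField) (α ζ : 𝒮.VectorField) {α₀ g' : M → ℂ}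
    (hα₀ : ContMDiff (𝓡 2) 𝓘(ℝ, ℂ) ∞ α₀) (hg' : ContMDiff (𝓡 2) 𝓘(ℝ, ℂ) ∞ g') :
    NullCalculus.Fields (Graded (𝒮.Alg i)) where
  a := hom (4, 0) ((𝒮.calculus 𝒜 i).compXX (e.alg i))
  b := hom 0 ((𝒮.calculus 𝒜 i).compXY (e.alg i))
  d := hom (-4, 0) ((𝒮.calculus 𝒜 i).compYY (e.alg i))
  P := hom (2, 0) ((𝒮.calculus 𝒜 i).compX (α.alg i))
  Q := hom (-2, 0) ((𝒮.calculus 𝒜 i).compY (α.alg i))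
  t₁ := hom (2, 0) ((𝒮.calculus 𝒜 i).compX (ζ.alg i))
  t₂ := hom (-2, 0) ((𝒮.calculus 𝒜 i).compY (ζ.alg i))
  al := hom 0 (𝒮.funAlg i hα₀)
  g := hom 0 (𝒮.funAlg i hg')

theorem isTensor_nullFields (e : 𝒮.SymTensorField) (α ζ : 𝒮.VectorField) {α₀ g' : M → ℂ}
    (hα₀ : ContMDiff (𝓡 2) 𝓘(ℝ, ℂ) ∞ α₀) (hg' : ContMDiff (𝓡 2) 𝓘(ℝ, ℂ) ∞ g') :
    (nullFields 𝒜 i e α ζ hα₀ hg').IsTensor (𝒮.calculus 𝒜 i).toNull := by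
  constructor <;> exact (𝒮.calculus 𝒜 i).tensor_hom _ _

theorem nabla2_symm (i : ι) {p : M} (hp : p ∈ (𝒮.chart i).source) (e : 𝒮.SymTensorField) (a b c : Fin 2) :
    𝒮.nabla2 i a (e.val i) b c p = 𝒮.nabla2 i a (e.val i) c b p := by
  have h : 𝒮.grad i a (e.val i b c) p = 𝒮.grad i a (e.val i c b) p := by
    simp only [grad]
    exact Finset.sum_congr rfl fun μ _ => by rw [pd_congr (fun r hr => e.symm i b c r hr) μ hp]
  simp only [nabla2, h, Fin.sum_univ_two, e.symm i b _ p hp, e.symm i c _ p hp]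
  ring

section Evaluation

variable {p : M} (hp : p ∈ (𝒮.chart i).source)

theorem evAlg_alg (v : 𝒮.VectorField) (a : Fin 2) : evAlg ⟨p, hp⟩ (v.alg i a) = v.val i a p := rfl

theorem evAlg_tensorAlg (e : 𝒮.SymTensorField) (a b : Fin 2) :
    evAlg ⟨p, hp⟩ (e.alg i a b) = e.val i a b p := rfl

theorem evAlg_funAlg {f : M → ℂ} (hf : ContMDiff (𝓡 2) 𝓘(ℝ, ℂ) ∞ f) :
    evAlg ⟨p, hp⟩ (𝒮.funAlg i hf) = f p := rfl

theorem evAlg_δ_funAlg {f : M → ℂ} (hf : ContMDiff (𝓡 2) 𝓘(ℝ, ℂ) ∞ f) (a : Fin 2) :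
    evAlg ⟨p, hp⟩ ((𝒮.calculus 𝒜 i).δ a (𝒮.funAlg i hf)) = 𝒮.grad i a f p :=
  (Rep.grad 𝒮 𝒜 i (rep_toAlg _) a).ev hp

theorem evAlg_δ_alg (v : 𝒮.VectorField) (a b : Fin 2) :
    evAlg ⟨p, hp⟩ ((𝒮.calculus 𝒜 i).δ a (v.alg i b)) = 𝒮.grad i a (v.val i b) p :=
  (Rep.grad 𝒮 𝒜 i (rep_toAlg _) a).ev hp

theorem evAlg_δ_tensorAlg (e : 𝒮.SymTensorField) (a b c : Fin 2) :
    evAlg ⟨p, hp⟩ ((𝒮.calculus 𝒜 i).δ a (e.alg i b c)) = 𝒮.grad i a (e.val i b c) p :=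
  (Rep.grad 𝒮 𝒜 i (rep_toAlg _) a).ev hp

/-- Taking null components commutes with covariant differentiation because the connection is
diagonal in the null basis, acting there through the weight. The analogous lemmas for `compY`,
`compXX`, `compXY` and `compYY` hold for the same reason. -/
theorem evAlg_covDeriv_compX (v : 𝒮.VectorField) (a : Fin 2) :
    evAlg ⟨p, hp⟩ ((𝒮.calculus 𝒜 i).covDeriv a (2, 0) ((𝒮.calculus 𝒜 i).compX (v.alg i))) =
      1 / 2 * (σ.sgn 0 * 𝒮.nabla1 i a (v.val i) 0 p
        - σ.sgn 0 * σ.nullRoot * 𝒮.nabla1 i a (v.val i) 1 p) := by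
  have hc := σ.nullRoot_mul_self
  have ec : (𝒮.calculus 𝒜 i).c = σ.nullRoot := rfl
  obtain ⟨h00, h11, h01, h10⟩ := 𝒮.conn_eq 𝒜 i a hp
  simp [FrameCalculus.covDeriv_apply, FrameCalculus.compX, ec, evAlg_δ_alg, evAlg_alg, nabla1,
    Fin.sum_univ_two, h00, h11, h01, h10]
  have h0 := σ.sgn_mul_self 0
  have h1 := σ.sgn_mul_self 1
  clear h00 h11 h01 h10
  grind

theorem evAlg_covDeriv_compY (v : 𝒮.VectorField) (a : Fin 2) :
    evAlg ⟨p, hp⟩ ((𝒮.calculus 𝒜 i).covDeriv a (-2, 0) ((𝒮.calculus 𝒜 i).compY (v.alg i))) =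
      1 / 2 * (𝒮.nabla1 i a (v.val i) 0 p + σ.nullRoot * 𝒮.nabla1 i a (v.val i) 1 p) := by
  have hc := σ.nullRoot_mul_self
  have ec : (𝒮.calculus 𝒜 i).c = σ.nullRoot := rfl
  obtain ⟨h00, h11, h01, h10⟩ := 𝒮.conn_eq 𝒜 i a hp
  simp [FrameCalculus.covDeriv_apply, FrameCalculus.compY, ec, evAlg_δ_alg, evAlg_alg, nabla1,
    Fin.sum_univ_two, h00, h11, h01, h10]
  have h0 := σ.sgn_mul_self 0
  have h1 := σ.sgn_mul_self 1
  clear h00 h11 h01 h10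
  grind

theorem evAlg_covDeriv_compXX (e : 𝒮.SymTensorField) (a : Fin 2) :
    evAlg ⟨p, hp⟩ ((𝒮.calculus 𝒜 i).covDeriv a (4, 0) ((𝒮.calculus 𝒜 i).compXX (e.alg i))) =
      1 / 4 * (𝒮.nabla2 i a (e.val i) 0 0 p - 2 * σ.nullRoot * 𝒮.nabla2 i a (e.val i) 0 1 p
        + σ.nullRoot ^ 2 * 𝒮.nabla2 i a (e.val i) 1 1 p) := by
  have hc := σ.nullRoot_mul_self
  have ec : (𝒮.calculus 𝒜 i).c = σ.nullRoot := rfl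
  obtain ⟨h00, h11, h01, h10⟩ := 𝒮.conn_eq 𝒜 i a hp
  have hs := nabla2_symm i hp e a 0 1
  have hs' := e.symm i 0 1 p hp
  simp [FrameCalculus.covDeriv_apply, FrameCalculus.compX, FrameCalculus.compXX, ec,
    evAlg_δ_tensorAlg, evAlg_tensorAlg, nabla2, Fin.sum_univ_two, h00, h11, h01, h10] at hs ⊢
  have h0 := σ.sgn_mul_self 0
  have h1 := σ.sgn_mul_self 1
  clear h00 h11 h01 h10
  grind

theorem evAlg_covDeriv_compXY (e : 𝒮.SymTensorField) (a : Fin 2) :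
    evAlg ⟨p, hp⟩ ((𝒮.calculus 𝒜 i).covDeriv a 0 ((𝒮.calculus 𝒜 i).compXY (e.alg i))) =
      1 / 4 * σ.sgn 0 * (𝒮.nabla2 i a (e.val i) 0 0 p
        - σ.nullRoot ^ 2 * 𝒮.nabla2 i a (e.val i) 1 1 p) := by
  have hc := σ.nullRoot_mul_self
  have ec : (𝒮.calculus 𝒜 i).c = σ.nullRoot := rfl
  obtain ⟨h00, h11, h01, h10⟩ := 𝒮.conn_eq 𝒜 i a hp
  have hs := nabla2_symm i hp e a 0 1
  have hs' := e.symm i 0 1 p hp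
  simp [FrameCalculus.covDeriv_apply, FrameCalculus.compX, FrameCalculus.compY,
    FrameCalculus.compXY, ec,
    evAlg_δ_tensorAlg, evAlg_tensorAlg, nabla2, Fin.sum_univ_two, h00, h11, h01, h10] at hs ⊢
  have h0 := σ.sgn_mul_self 0
  have h1 := σ.sgn_mul_self 1
  clear h00 h11 h01 h10
  grind

theorem evAlg_covDeriv_compYY (e : 𝒮.SymTensorField) (a : Fin 2) :
    evAlg ⟨p, hp⟩ ((𝒮.calculus 𝒜 i).covDeriv a (-4, 0) ((𝒮.calculus 𝒜 i).compYY (e.alg i))) =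
      1 / 4 * (𝒮.nabla2 i a (e.val i) 0 0 p + 2 * σ.nullRoot * 𝒮.nabla2 i a (e.val i) 0 1 p
        + σ.nullRoot ^ 2 * 𝒮.nabla2 i a (e.val i) 1 1 p) := by
  have hc := σ.nullRoot_mul_self
  have ec : (𝒮.calculus 𝒜 i).c = σ.nullRoot := rfl
  obtain ⟨h00, h11, h01, h10⟩ := 𝒮.conn_eq 𝒜 i a hp
  have hs := nabla2_symm i hp e a 0 1
  have hs' := e.symm i 0 1 p hp
  simp [FrameCalculus.covDeriv_apply, FrameCalculus.compY, FrameCalculus.compYY, ec,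
    evAlg_δ_tensorAlg, evAlg_tensorAlg, nabla2, Fin.sum_univ_two, h00, h11, h01, h10] at hs ⊢
  have h0 := σ.sgn_mul_self 0
  have h1 := σ.sgn_mul_self 1
  clear h00 h11 h01 h10
  grind

theorem evAlg_second_funAlg {f : M → ℂ} (hf : ContMDiff (𝓡 2) 𝓘(ℝ, ℂ) ∞ f) (a b : Fin 2) :
    evAlg ⟨p, hp⟩ ((𝒮.calculus 𝒜 i).second 0 a b (𝒮.funAlg i hf)) = 𝒮.hess i a b f p := by
  have h1 := (Rep.grad 𝒮 𝒜 i (Rep.grad 𝒮 𝒜 i (rep_toAlg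
    ((𝒮.smoothIn_iff i).2 (hf.contMDiffOn (s := 𝒮.dom i)))) b) a).ev hp
  have h2 := fun c => (rep_conn 𝒜 c b a).ev hp
  have h3 := fun c => evAlg_δ_funAlg 𝒜 i hp hf c
  change evAlg ⟨p, hp⟩ ((𝒮.calculus 𝒜 i).δ a ((𝒮.calculus 𝒜 i).δ b (𝒮.funAlg i hf))) = _ at h1
  simp [FrameCalculus.second, FrameCalculus.covDeriv_apply, hess, nablaCo, Fin.sum_univ_two,
    h1, h2, h3]

variable {V Vh : M → ℂ} (hV : ContMDiff (𝓡 2) 𝓘(ℝ, ℂ) ∞ V)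
  (hVh : ContMDiff (𝓡 2) 𝓘(ℝ, ℂ) ∞ Vh)

theorem potentials_eq : 𝒮.potentials i hV hVh =
    ![Complex.I • (𝒮.funAlg i hV - (σ.nullRoot * σ.sgn 0) • 𝒮.funAlg i hVh),
      Complex.I • (𝒮.funAlg i hV + (σ.nullRoot * σ.sgn 0) • 𝒮.funAlg i hVh)] := rfl

end Evaluation

/-- This is the vanishing of the torsion, read on a function. -/
theorem hess_symm {q : ℝ} (𝒜 : 𝒮.Potential q) (i : ι) {p : M} (hp : p ∈ (𝒮.chart i).source) {f : M → ℂ}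
    (hf : ContMDiff (𝓡 2) 𝓘(ℝ, ℂ) ∞ f) : 𝒮.hess i 0 1 f p = 𝒮.hess i 1 0 f p := by
  rw [← evAlg_second_funAlg 𝒜 i hp hf, ← evAlg_second_funAlg 𝒜 i hp hf]
  congr 1
  have h := (𝒮.calculus 𝒜 i).torsion (𝒮.funAlg i hf)
  simp [FrameCalculus.second, FrameCalculus.covDeriv_apply, FrameCalculus.conn, Fin.sum_univ_two]
  simp only [Algebra.smul_def] at h ⊢
  linear_combination h

end SpinManifold

/-! ### The determining equations in null components -/

namespace FrameCalculus

variable {σ : Signature} {C : Type*} [CommRing C] [Algebra ℂ C] {ι : Type*}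
  (𝓕 : FrameCalculus σ C ι)

theorem gradedEv_X_hom (p : ι) (k : ℤ × ℤ) (f : C) : 𝓕.gradedEv p (𝓕.toNull.X (hom k f)) =
    σ.sgn 0 * 𝓕.ev p (𝓕.covDeriv 0 k f) + σ.sgn 1 * 𝓕.c * 𝓕.ev p (𝓕.covDeriv 1 k f) := by
  change 𝓕.gradedEv p (𝓕.nullX (hom k f)) = _
  rw [nullX_hom, gradedEv_hom]
  simp

theorem gradedEv_Y_hom (p : ι) (k : ℤ × ℤ) (f : C) : 𝓕.gradedEv p (𝓕.toNull.Y (hom k f)) =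
    𝓕.ev p (𝓕.covDeriv 0 k f) - σ.sgn 0 * σ.sgn 1 * 𝓕.c * 𝓕.ev p (𝓕.covDeriv 1 k f) := by
  change 𝓕.gradedEv p (𝓕.nullY (hom k f)) = _
  rw [nullY_hom, gradedEv_hom]
  simp

theorem gradedEv_XX_hom (p : ι) (k : ℤ × ℤ) (f : C) :
    𝓕.gradedEv p (𝓕.toNull.X (𝓕.toNull.X (hom k f))) =
      𝓕.ev p (contract 𝓕.vecX 𝓕.vecX fun a b => 𝓕.second k a b f) := by
  change 𝓕.gradedEv p (𝓕.nullX (𝓕.nullX (hom k f))) = _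
  rw [nullX_nullX_hom, gradedEv_hom]

theorem gradedEv_YX_hom (p : ι) (k : ℤ × ℤ) (f : C) :
    𝓕.gradedEv p (𝓕.toNull.Y (𝓕.toNull.X (hom k f))) =
      𝓕.ev p (contract 𝓕.vecY 𝓕.vecX fun a b => 𝓕.second k a b f) := by
  change 𝓕.gradedEv p (𝓕.nullY (𝓕.nullX (hom k f))) = _
  rw [nullY_nullX_hom, gradedEv_hom]

theorem gradedEv_YY_hom (p : ι) (k : ℤ × ℤ) (f : C) :
    𝓕.gradedEv p (𝓕.toNull.Y (𝓕.toNull.Y (hom k f))) =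
      𝓕.ev p (contract 𝓕.vecY 𝓕.vecY fun a b => 𝓕.second k a b f) := by
  change 𝓕.gradedEv p (𝓕.nullY (𝓕.nullY (hom k f))) = _
  rw [nullY_nullY_hom, gradedEv_hom]

end FrameCalculus

namespace SpinManifold

variable {M : Type*} [TopologicalSpace M] [ChartedSpace Plane M] [IsManifold (𝓡 2) ∞ M]
  {σ : Signature} {γ : DiracMatrices σ} {ι : Type*} {𝒮 : SpinManifold M γ ι}
  {q : ℝ} (𝒜 : 𝒮.Potential q) (i : ι)

theorem evAlg_covDeriv_funAlg {p : M} (hp : p ∈ (𝒮.chart i).source) {f : M → ℂ}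
    (hf : ContMDiff (𝓡 2) 𝓘(ℝ, ℂ) ∞ f) (a : Fin 2) :
    evAlg ⟨p, hp⟩ ((𝒮.calculus 𝒜 i).covDeriv a 0 (𝒮.funAlg i hf)) = 𝒮.grad i a f p := by
  simp [FrameCalculus.covDeriv_apply, evAlg_δ_funAlg]

theorem gradedEv_hom_evAlg (p : {p // p ∈ (𝒮.chart i).source}) (k : ℤ × ℤ) (f : 𝒮.Alg i) :
    (𝒮.calculus 𝒜 i).gradedEv p (FrameCalculus.hom k f) = evAlg p f :=
  (𝒮.calculus 𝒜 i).gradedEv_hom p k f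

theorem calculus_ev (p : {p // p ∈ (𝒮.chart i).source}) :
    (𝒮.calculus 𝒜 i).ev p = evAlg p := rfl

theorem toNull_ev (p : {p // p ∈ (𝒮.chart i).source}) :
    (𝒮.calculus 𝒜 i).toNull.ev p = (𝒮.calculus 𝒜 i).gradedEv p := rfl

theorem calculus_c : (𝒮.calculus 𝒜 i).c = σ.nullRoot := rfl

theorem gradedEv_Φ {p : M} (hp : p ∈ (𝒮.chart i).source) :
    (𝒮.calculus 𝒜 i).gradedEv ⟨p, hp⟩ (𝒮.calculus 𝒜 i).toNull.Φ =
      2 * σ.sgn 1 * σ.nullRoot * (Complex.I * q * 𝒮.fieldStrength 𝒜 i p) := by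
  have h := 𝒮.evAlg_curl_A 𝒜 i hp
  change (𝒮.calculus 𝒜 i).gradedEv ⟨p, hp⟩ (FrameCalculus.hom 0 _) = _
  rw [gradedEv_hom_evAlg, map_smul, h, calculus_c]
  rfl

theorem gradedEv_R {p : M} (hp : p ∈ (𝒮.chart i).source) :
    (𝒮.calculus 𝒜 i).gradedEv ⟨p, hp⟩ (𝒮.calculus 𝒜 i).toNull.R = 𝒮.scalarCurv i p / 2 := by
  change (𝒮.calculus 𝒜 i).gradedEv ⟨p, hp⟩ (FrameCalculus.hom 0 _) = _
  rw [gradedEv_hom_evAlg, 𝒮.evAlg_curl_W]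

/-- The algebra of the frozen equations at a point and in a chart which determine the covariant
derivatives of `e^{ab}`, `α^a`, `α`, `ζ^a`. -/
structure LocalDetermining (V : M → ℂ) (e : 𝒮.SymTensorField) (α ζ : 𝒮.VectorField)
    (α₀ : M → ℂ) (p : M) : Prop where
  killing_tensor : ∀ a b c, (1 / 3) * (𝒮.nabla2Up i c (e.val i) a b p
    + 𝒮.nabla2Up i a (e.val i) b c p + 𝒮.nabla2Up i b (e.val i) c a p) = 0
  killing_vector : ∀ a b,
    (1 / 2) * (𝒮.nabla1Up i a (α.val i) b p + 𝒮.nabla1Up i b (α.val i) a p) = 0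
  grad_α₀ : ∀ a, 𝒮.grad i a α₀ p = 𝒮.omega 𝒜 V e α i a p
  sym_grad_ζ : ∀ c a, (1 / 2) * (𝒮.nabla1Up i c (ζ.val i) a p + 𝒮.nabla1Up i a (ζ.val i) c p)
      = (1 / 2) * 𝒮.LambdaUp 𝒜 V e α i c a p

theorem localDetermining_def (V : M → ℂ) (e : 𝒮.SymTensorField) (α ζ : 𝒮.VectorField)
    (α₀ : M → ℂ) (p : M) : LocalDetermining 𝒜 i V e α ζ α₀ p ↔
    (∀ a b c, (1 / 3) * (𝒮.nabla2Up i c (e.val i) a b p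
      + 𝒮.nabla2Up i a (e.val i) b c p + 𝒮.nabla2Up i b (e.val i) c a p) = 0) ∧
    (∀ a b, (1 / 2) * (𝒮.nabla1Up i a (α.val i) b p + 𝒮.nabla1Up i b (α.val i) a p) = 0) ∧
    (∀ a, 𝒮.grad i a α₀ p = 𝒮.omega 𝒜 V e α i a p) ∧
    ∀ c a, (1 / 2) * (𝒮.nabla1Up i c (ζ.val i) a p + 𝒮.nabla1Up i a (ζ.val i) c p)
      = (1 / 2) * 𝒮.LambdaUp 𝒜 V e α i c a p :=
  ⟨fun h => ⟨h.1, h.2, h.3, h.4⟩, fun h => ⟨h.1, h.2.1, h.2.2.1, h.2.2.2⟩⟩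

variable {V Vh : M → ℂ} (hV : ContMDiff (𝓡 2) 𝓘(ℝ, ℂ) ∞ V)
  (hVh : ContMDiff (𝓡 2) 𝓘(ℝ, ℂ) ∞ Vh) (e : 𝒮.SymTensorField) (α ζ : 𝒮.VectorField)
  {α₀ g' : M → ℂ} (hα₀ : ContMDiff (𝓡 2) 𝓘(ℝ, ℂ) ∞ α₀) (hg' : ContMDiff (𝓡 2) 𝓘(ℝ, ℂ) ∞ g')

/-- The pseudoscalar potential cancels from `u + v`. Hence the equations for `e^{ab}`, `α^a`, `α`
and `ζ^a`, which contain the potentials only through this sum, do not involve `V̂`. -/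
theorem hom_potentials_add : FrameCalculus.hom 0 (𝒮.potentials i hV hVh 0)
    + FrameCalculus.hom 0 (𝒮.potentials i hV hVh 1)
      = FrameCalculus.hom 0 ((2 * Complex.I) • 𝒮.funAlg i hV) := by
  rw [potentials_eq, ← AddMonoidAlgebra.single_add]
  congr 1
  simp
  module

-- The twelve null equations are the frame equations in another basis: four for the Killing tensor,
-- three for the Killing vector, two for `∇α` and three for the symmetrized derivative of `ζ`. The
-- change of basis is invertible since `c² = -η ≠ 0`. Everything takes place at one point.
open FrameCalculus in
set_option maxHeartbeats 2000000 in
theorem localDetermining_iff {p : M} (hp : p ∈ (𝒮.chart i).source) :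
    let 𝒩 := (𝒮.calculus 𝒜 i).toNull
    let ev := (𝒮.calculus 𝒜 i).gradedEv ⟨p, hp⟩
    let T := nullFields 𝒜 i e α ζ hα₀ hg'
    let u := hom 0 (𝒮.potentials i hV hVh 0)
    let v := hom 0 (𝒮.potentials i hV hVh 1)
    LocalDetermining 𝒜 i V e α ζ α₀ p ↔ ev (𝒩.Y T.a) = 0 ∧ ev (𝒩.X T.d) = 0 ∧ ev (2 * 𝒩.X T.b + 𝒩.Y T.d) = 0
      ∧ ev (2 * 𝒩.Y T.b + 𝒩.X T.a) = 0
      ∧ ev (𝒩.Y T.P) = 0 ∧ ev (𝒩.X T.Q) = 0 ∧ ev (𝒩.X T.P + 𝒩.Y T.Q) = 0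
      ∧ ev (𝒩.X T.al) = ev (-2 * 𝒩.Φ * T.Q + 2 * T.b * 𝒩.X (u + v) + 2 * T.d * 𝒩.Y (u + v))
      ∧ ev (𝒩.Y T.al) = ev (2 * 𝒩.Φ * T.P + 2 * T.a * 𝒩.X (u + v) + 2 * T.b * 𝒩.Y (u + v))
      ∧ ev (𝒩.Y T.t₁) = ev (2 * 𝒩.Φ * T.a + T.P * 𝒩.Y (u + v))
      ∧ ev (𝒩.X T.t₂) = ev (-2 * 𝒩.Φ * T.d + T.Q * 𝒩.X (u + v))
      ∧ ev (𝒩.X T.t₁ + 𝒩.Y T.t₂) = ev (3 * (T.P * 𝒩.X (u + v) + T.Q * 𝒩.Y (u + v))) := by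
  intro 𝒩 ev T u v
  have hc := σ.nullRoot_mul_self
  rw [localDetermining_def]
  simp only [Fin.forall_fin_two, nabla2Up, nabla1Up, omega, LambdaUp, Fin.sum_univ_two,
    Signature.epsMixed, Signature.eta, eps, nabla2_symm i hp e _ 1 0, e.symm i 1 0 p hp]
  simp only [ev, 𝒩, T, u, v, hom_potentials_add, nullFields, map_add, map_mul, map_neg, map_ofNat,
    gradedEv_X_hom, gradedEv_Y_hom, Prod.mk_zero_zero, smul_eq_mul, map_smul,
    calculus_ev, calculus_c, evAlg_covDeriv_compX, evAlg_covDeriv_compY, evAlg_covDeriv_compXX,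
    evAlg_covDeriv_compXY, evAlg_covDeriv_compYY, evAlg_covDeriv_funAlg, gradedEv_Φ,
    gradedEv_hom_evAlg]
  simp only [compXX, compXY, compYY, compX, compY, map_smul, map_sub, map_add, smul_eq_mul, calculus_c, evAlg_alg,
    evAlg_tensorAlg, e.symm i 1 0 p hp]
  clear_value ev T u v 𝒩
  constructor
  · rintro ⟨kt, kv, ga, gz⟩
    -- In each of the four signatures the claims become polynomial identities modulo `c² = ±1`.
    rcases FrameCalculus.sgn_eq σ 0 with h0 | h0 <;> rcases FrameCalculus.sgn_eq σ 1 with h1 | h1 <;>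
      simp [h0, h1, -one_div] at hc kt kv ga gz ⊢ <;> clear h0 h1 <;>
      refine ⟨?_, ?_, ?_, ?_, ?_, ?_, ?_, ?_, ?_, ?_, ?_, ?_⟩
    all_goals first | (rw [ga.1, ga.2]; clear kt kv gz ga; grind) | grind
  · rintro ⟨k1, k2, k3, k4, k5, k6, k7, k8, k9, k10, k11, k12⟩
    rcases FrameCalculus.sgn_eq σ 0 with h0 | h0 <;> rcases FrameCalculus.sgn_eq σ 1 with h1 | h1 <;>
      simp [h0, h1, -one_div] at hc k1 k2 k3 k4 k5 k6 k7 k8 k9 k10 k11 k12 ⊢ <;> clear h0 h1 <;>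
      refine ⟨by clear k5 k6 k7 k8 k9 k10 k11 k12; grind,
        by clear k1 k2 k3 k4 k8 k9 k10 k11 k12; grind,
        by clear k1 k2 k3 k4 k5 k6 k7 k10 k11 k12; grind,
        by clear k1 k2 k3 k4 k5 k6 k7 k8 k9; grind⟩

end SpinManifold

/-! ### Closure properties of homogeneous elements. -/

namespace NullCalculus

variable {B : Type*} [CommRing B] [Algebra ℂ B] {ι : Type*} {𝒩 : NullCalculus B ι} {k l : ℤ}
  {x y : B}

theorem Tensor.add (hx : 𝒩.Tensor k x) (hy : 𝒩.Tensor k y) : 𝒩.Tensor k (x + y) :=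
  ⟨by rw [map_add, hx.1, hy.1]; ring, by rw [map_add, hx.2, hy.2, add_zero]⟩

theorem Tensor.sub (hx : 𝒩.Tensor k x) (hy : 𝒩.Tensor k y) : 𝒩.Tensor k (x - y) :=
  ⟨by rw [map_sub, hx.1, hy.1]; ring, by rw [map_sub, hx.2, hy.2, sub_zero]⟩

theorem Tensor.neg (hx : 𝒩.Tensor k x) : 𝒩.Tensor k (-x) :=
  ⟨by rw [map_neg, hx.1]; ring, by rw [map_neg, hx.2, neg_zero]⟩

theorem Tensor.mul (hx : 𝒩.Tensor k x) (hy : 𝒩.Tensor l y) : 𝒩.Tensor (k + l) (x * y) :=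
  ⟨by simp only [Derivation.leibniz, hx.1, hy.1, smul_eq_mul, Int.cast_add]; ring,
    by simp only [Derivation.leibniz, hx.2, hy.2, smul_zero, add_zero]⟩

theorem Tensor.X (hx : 𝒩.Tensor k x) : 𝒩.Tensor (k - 2) (𝒩.X x) :=
  ⟨by simp [𝒩.HX, hx.1]; ring, by simp [𝒩.NX, hx.2]⟩

theorem Tensor.Y (hx : 𝒩.Tensor k x) : 𝒩.Tensor (k + 2) (𝒩.Y x) :=
  ⟨by simp [𝒩.HY, hx.1]; ring, by simp [𝒩.NY, hx.2]⟩

theorem Tensor.of_weight (hx : 𝒩.Tensor k x) (h : k = l) : 𝒩.Tensor l x := h ▸ hx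

variable (𝒩)

theorem tensor_zero : 𝒩.Tensor k 0 := ⟨by simp, by simp⟩

theorem tensor_ofNat (n : ℕ) [n.AtLeastTwo] : 𝒩.Tensor 0 (ofNat(n) : B) :=
  ⟨by rw [← map_ofNat (algebraMap ℂ B)]; simp ,
    by rw [← map_ofNat (algebraMap ℂ B)]; simp ⟩

theorem tensor_R : 𝒩.Tensor 0 𝒩.R := ⟨by simp [𝒩.HR], 𝒩.NR⟩

theorem tensor_Φ : 𝒩.Tensor 0 𝒩.Φ := ⟨by simp [𝒩.HΦ], 𝒩.NΦ⟩

end NullCalculus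

namespace SpinManifold

open FrameCalculus

variable {M : Type*} [TopologicalSpace M] [ChartedSpace Plane M] [IsManifold (𝓡 2) ∞ M]
  {σ : Signature} {γ : DiracMatrices σ} {ι : Type*} {𝒮 : SpinManifold M γ ι}
  {q : ℝ} (𝒜 : 𝒮.Potential q) (i : ι)

variable {V Vh : M → ℂ} (hV : ContMDiff (𝓡 2) 𝓘(ℝ, ℂ) ∞ V)
  (hVh : ContMDiff (𝓡 2) 𝓘(ℝ, ℂ) ∞ Vh) (e : 𝒮.SymTensorField) (α ζ : 𝒮.VectorField)
  {α₀ g' : M → ℂ} (hα₀ : ContMDiff (𝓡 2) 𝓘(ℝ, ℂ) ∞ α₀) (hg' : ContMDiff (𝓡 2) 𝓘(ℝ, ℂ) ∞ g')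

-- Passes from points to the algebra: both sides of each null equation have the same weight and
-- charge zero, so agreement under all evaluations is equality. The weight computations exist for
-- this purpose.
set_option maxHeartbeats 1000000 in
theorem determining_nullFields_iff :
    (𝒮.calculus 𝒜 i).toNull.Determining (hom 0 (𝒮.potentials i hV hVh 0))
      (hom 0 (𝒮.potentials i hV hVh 1)) (nullFields 𝒜 i e α ζ hα₀ hg') ↔
    ∀ p ∈ 𝒮.dom i, LocalDetermining 𝒜 i V e α ζ α₀ p := by
  constructor
  · intro h p hp
    refine (localDetermining_iff 𝒜 i hV hVh e α ζ hα₀ hg' hp).2 ?_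
    simp only [h.Ya, h.Xd, h.Xb, h.Yb, h.YP, h.XQ, h.div, h.Xal, h.Yal, h.Yt₁, h.Xt₂, h.Xt₁,
      map_zero, and_self]
  · intro h
    have h' := fun p : {p // p ∈ (𝒮.chart i).source} =>
      (localDetermining_iff 𝒜 i hV hVh e α ζ hα₀ hg' p.2).1 (h p.1 p.2)
    have hT := isTensor_nullFields 𝒜 i e α ζ hα₀ hg'
    have hu := (𝒮.calculus 𝒜 i).tensor_hom 0 (𝒮.potentials i hV hVh 0)
    have hv := (𝒮.calculus 𝒜 i).tensor_hom 0 (𝒮.potentials i hV hVh 1)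
    change (𝒮.calculus 𝒜 i).toNull.Tensor 0 (hom 0 _) at hu hv
    generalize nullFields 𝒜 i e α ζ hα₀ hg' = T at *
    generalize hom 0 (𝒮.potentials i hV hVh 0) = u at *
    generalize hom 0 (𝒮.potentials i hV hVh 1) = v at *
    have huv := hu.add hv
    have hΦ := (𝒮.calculus 𝒜 i).toNull.tensor_Φ
    have h2 := (𝒮.calculus 𝒜 i).toNull.tensor_ofNat 2
    have h3 := (𝒮.calculus 𝒜 i).toNull.tensor_ofNat 3
    have h0 := fun k => (𝒮.calculus 𝒜 i).toNull.tensor_zero (k := k)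
    have Xuv := huv.X
    have Yuv := huv.Y
    constructor
    · exact hT.a.Y.ext (h0 _) fun p => by rw [map_zero]; exact (h' p).1
    · exact hT.d.X.ext (h0 _) fun p => by rw [map_zero]; exact (h' p).2.1
    · exact ((h2.mul hT.b.X).add (hT.d.Y.of_weight (by norm_num))).ext (h0 _) fun p => by
        rw [map_zero]; exact (h' p).2.2.1
    · exact ((h2.mul hT.b.Y).add (hT.a.X.of_weight (by norm_num))).ext (h0 _) fun p => by
        rw [map_zero]; exact (h' p).2.2.2.1
    · exact hT.P.Y.ext (h0 _) fun p => by rw [map_zero]; exact (h' p).2.2.2.2.1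
    · exact hT.Q.X.ext (h0 _) fun p => by rw [map_zero]; exact (h' p).2.2.2.2.2.1
    · exact (hT.P.X.add (hT.Q.Y.of_weight (by norm_num))).ext (h0 _) fun p => by
        rw [map_zero]; exact (h' p).2.2.2.2.2.2.1
    · refine hT.al.X.ext (((NullCalculus.Tensor.of_weight ((h2.neg.mul hΦ).mul hT.Q) (by norm_num)).add
        (NullCalculus.Tensor.of_weight ((h2.mul hT.b).mul Xuv) (by norm_num))).add
        (NullCalculus.Tensor.of_weight ((h2.mul hT.d).mul Yuv) (by norm_num)))
        fun p => (h' p).2.2.2.2.2.2.2.1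
    · refine hT.al.Y.ext (((NullCalculus.Tensor.of_weight ((h2.mul hΦ).mul hT.P) (by norm_num)).add
        (NullCalculus.Tensor.of_weight ((h2.mul hT.a).mul Xuv) (by norm_num))).add
        (NullCalculus.Tensor.of_weight ((h2.mul hT.b).mul Yuv) (by norm_num)))
        fun p => (h' p).2.2.2.2.2.2.2.2.1
    · refine hT.t₁.Y.ext ((NullCalculus.Tensor.of_weight ((h2.mul hΦ).mul hT.a) (by norm_num)).add
        (NullCalculus.Tensor.of_weight (hT.P.mul Yuv) (by norm_num)))
        fun p => (h' p).2.2.2.2.2.2.2.2.2.1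
    · refine hT.t₂.X.ext ((NullCalculus.Tensor.of_weight ((h2.neg.mul hΦ).mul hT.d) (by norm_num)).add
        (NullCalculus.Tensor.of_weight (hT.Q.mul Xuv) (by norm_num)))
        fun p => (h' p).2.2.2.2.2.2.2.2.2.2.1
    · refine (hT.t₁.X.add (hT.t₂.Y.of_weight (by norm_num))).ext
        (NullCalculus.Tensor.of_weight (h3.mul ((NullCalculus.Tensor.of_weight (hT.P.mul Xuv) (by norm_num) :
          NullCalculus.Tensor _ 0 _).add (NullCalculus.Tensor.of_weight (hT.Q.mul Yuv) (by norm_num))))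
          (by norm_num)) fun p => (h' p).2.2.2.2.2.2.2.2.2.2.2

end SpinManifold

/-! ### The conditions on the potentials and the equations for `g'` in null components. -/

namespace SpinManifold

open FrameCalculus

variable {M : Type*} [TopologicalSpace M] [ChartedSpace Plane M] [IsManifold (𝓡 2) ∞ M]
  {σ : Signature} {γ : DiracMatrices σ} {ι : Type*} {𝒮 : SpinManifold M γ ι}
  {q : ℝ} (𝒜 : 𝒮.Potential q) (i : ι)

theorem Rep.grad_mul {f g : M → ℂ} {F G : 𝒮.Alg i} (hf : Rep (𝒮.chart i) f F)
    (hg : Rep (𝒮.chart i) g G) (a : Fin 2) {p : M} (hp : p ∈ (𝒮.chart i).source) :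
    𝒮.grad i a (fun r => f r * g r) p = f p * 𝒮.grad i a g p + g p * 𝒮.grad i a f p := by
  simp only [SpinManifold.grad, Fin.sum_univ_two, (hf.mul hg).pd _ p hp, hf.pd _ p hp,
    hg.pd _ p hp, hf p hp, hg p hp, Derivation.leibniz]
  change _ * (F.1 ⟨p, hp⟩ * (pdAlg (𝒮.chart i) 0 G).1 ⟨p, hp⟩
      + G.1 ⟨p, hp⟩ * (pdAlg (𝒮.chart i) 0 F).1 ⟨p, hp⟩)
    + _ * (F.1 ⟨p, hp⟩ * (pdAlg (𝒮.chart i) 1 G).1 ⟨p, hp⟩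
      + G.1 ⟨p, hp⟩ * (pdAlg (𝒮.chart i) 1 F).1 ⟨p, hp⟩) = _
  ring

theorem rep_scalarCurv : Rep (𝒮.chart i) (𝒮.scalarCurv i)
    ((2 : ℂ) • (𝒮.calculus 𝒜 i).curl (𝒮.calculus 𝒜 i).W) :=
  rep_of_ev fun p hp => by rw [map_smul, 𝒮.evAlg_curl_W, smul_eq_mul]; ring

theorem evAlg_covDeriv_curl_W {p : M} (hp : p ∈ (𝒮.chart i).source) (a : Fin 2) :
    evAlg ⟨p, hp⟩ ((𝒮.calculus 𝒜 i).covDeriv a 0 ((𝒮.calculus 𝒜 i).curl (𝒮.calculus 𝒜 i).W)) =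
      𝒮.grad i a (𝒮.scalarCurv i) p / 2 := by
  have h := (Rep.grad 𝒮 𝒜 i (rep_scalarCurv 𝒜 i) a).ev hp
  rw [Derivation.map_smul, map_smul, smul_eq_mul] at h
  simp [FrameCalculus.covDeriv_apply, ← h]

theorem gradedEv_X_R {p : M} (hp : p ∈ (𝒮.chart i).source) :
    (𝒮.calculus 𝒜 i).gradedEv ⟨p, hp⟩ ((𝒮.calculus 𝒜 i).toNull.X (𝒮.calculus 𝒜 i).toNull.R) =
      σ.sgn 0 * (𝒮.grad i 0 (𝒮.scalarCurv i) p / 2)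
        + σ.sgn 1 * σ.nullRoot * (𝒮.grad i 1 (𝒮.scalarCurv i) p / 2) := by
  change (𝒮.calculus 𝒜 i).gradedEv ⟨p, hp⟩ ((𝒮.calculus 𝒜 i).toNull.X (hom 0 _)) = _
  rw [gradedEv_X_hom, calculus_ev, evAlg_covDeriv_curl_W, evAlg_covDeriv_curl_W, calculus_c]

theorem gradedEv_Y_R {p : M} (hp : p ∈ (𝒮.chart i).source) :
    (𝒮.calculus 𝒜 i).gradedEv ⟨p, hp⟩ ((𝒮.calculus 𝒜 i).toNull.Y (𝒮.calculus 𝒜 i).toNull.R) =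
      𝒮.grad i 0 (𝒮.scalarCurv i) p / 2
        - σ.sgn 0 * σ.sgn 1 * σ.nullRoot * (𝒮.grad i 1 (𝒮.scalarCurv i) p / 2) := by
  change (𝒮.calculus 𝒜 i).gradedEv ⟨p, hp⟩ ((𝒮.calculus 𝒜 i).toNull.Y (hom 0 _)) = _
  rw [gradedEv_Y_hom, calculus_ev, evAlg_covDeriv_curl_W, evAlg_covDeriv_curl_W, calculus_c]

theorem nabla2_scalarCurv_mul (𝒜 : 𝒮.Potential q) (e : 𝒮.SymTensorField) (a b c : Fin 2) {p : M}
    (hp : p ∈ (𝒮.chart i).source) :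
    𝒮.nabla2 i a (fun b d r => 𝒮.scalarCurv i r * e.val i b d r) b c p =
      𝒮.scalarCurv i p * 𝒮.nabla2 i a (e.val i) b c p
        + 𝒮.grad i a (𝒮.scalarCurv i) p * e.val i b c p := by
  rw [nabla2, Rep.grad_mul i (rep_scalarCurv 𝒜 i)
    (rep_toAlg ((𝒮.smoothIn_iff i).2 (e.smooth i b c))) a hp, nabla2]
  simp only [Fin.sum_univ_two]
  ring

theorem grad_sq {f : M → ℂ} (hf : ContMDiff (𝓡 2) 𝓘(ℝ, ℂ) ∞ f) (a : Fin 2) {p : M}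
    (hp : p ∈ (𝒮.chart i).source) :
    𝒮.grad i a (fun r => f r ^ 2) p = 2 * f p * 𝒮.grad i a f p := by
  have h := rep_toAlg ((𝒮.smoothIn_iff i).2 (hf.contMDiffOn (s := 𝒮.dom i)))
  simp only [pow_two, Rep.grad_mul i h h a hp]
  ring

variable {V Vh : M → ℂ} (hV : ContMDiff (𝓡 2) 𝓘(ℝ, ℂ) ∞ V)
  (hVh : ContMDiff (𝓡 2) 𝓘(ℝ, ℂ) ∞ Vh) (e : 𝒮.SymTensorField) (α ζ : 𝒮.VectorField)
  {α₀ g' : M → ℂ} (hα₀ : ContMDiff (𝓡 2) 𝓘(ℝ, ℂ) ∞ α₀) (hg' : ContMDiff (𝓡 2) 𝓘(ℝ, ℂ) ∞ g')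

theorem hom_potentials_zero : hom 0 (𝒮.potentials i hV hVh 0) =
    Complex.I • hom 0 (𝒮.funAlg i hV)
      - (Complex.I * σ.nullRoot * σ.sgn 0) • hom 0 (𝒮.funAlg i hVh) := by
  rw [potentials_eq, hom, hom, hom, AddMonoidAlgebra.smul_single, AddMonoidAlgebra.smul_single,
    ← AddMonoidAlgebra.single_sub]
  congr 1
  simp
  module

theorem hom_potentials_one : hom 0 (𝒮.potentials i hV hVh 1) =
    Complex.I • hom 0 (𝒮.funAlg i hV)
      + (Complex.I * σ.nullRoot * σ.sgn 0) • hom 0 (𝒮.funAlg i hVh) := by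
  rw [potentials_eq, hom, hom, hom, AddMonoidAlgebra.smul_single, AddMonoidAlgebra.smul_single,
    ← AddMonoidAlgebra.single_add]
  congr 1
  simp
  module

/-- The Killing tensor equation has four independent components. They are solved so that only the
derivatives of `e^{01}` remain free, which eliminates the others by rewriting. -/
theorem LocalDetermining.killing {V : M → ℂ} {e : 𝒮.SymTensorField} {α ζ : 𝒮.VectorField}
    {α₀ : M → ℂ} {p : M} (hp : p ∈ (𝒮.chart i).source) (h : LocalDetermining 𝒜 i V e α ζ α₀ p) :
    𝒮.nabla2 i 0 (e.val i) 0 0 p = 0 ∧ 𝒮.nabla2 i 1 (e.val i) 1 1 p = 0 ∧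
    𝒮.nabla2 i 1 (e.val i) 0 0 p = -(2 * σ.sgn 0 * σ.sgn 1 * 𝒮.nabla2 i 0 (e.val i) 0 1 p) ∧
    𝒮.nabla2 i 0 (e.val i) 1 1 p = -(2 * σ.sgn 0 * σ.sgn 1 * 𝒮.nabla2 i 1 (e.val i) 0 1 p) := by
  have h000 := h.killing_tensor 0 0 0
  have h111 := h.killing_tensor 1 1 1
  have h001 := h.killing_tensor 0 0 1
  have h011 := h.killing_tensor 0 1 1
  simp only [nabla2Up, nabla2_symm i hp e _ 1 0] at h000 h111 h001 h011
  rcases FrameCalculus.sgn_eq σ 0 with h0 | h0 <;> rcases FrameCalculus.sgn_eq σ 1 with h1 | h1 <;>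
    simp only [h0, h1] at h000 h111 h001 h011 ⊢ <;>
    exact ⟨by grind, by grind, by grind, by grind⟩

theorem eps_00 : eps 0 0 = 0 := rfl

theorem eps_01 : eps 0 1 = 1 := rfl

theorem eps_10 : eps 1 0 = -1 := rfl

theorem eps_11 : eps 1 1 = 0 := rfl

/-- The diagonal null conditions contain the potentials `i (V ∓ k V̂)`, so they are the sum and the
difference of the conditions on `V` and `V̂`; these can be separated because `k ≠ 0`. -/
theorem combination_iff {A A' B B' C C' k : ℂ} (hk : k ≠ 0)
    (h : C = Complex.I * ((A - A') - k * (B - B')))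
    (h' : C' = Complex.I * ((A - A') + k * (B - B'))) : A = A' ∧ B = B' ↔ C = 0 ∧ C' = 0 := by
  have hI := Complex.I_mul_I
  constructor
  · rintro ⟨rfl, rfl⟩
    simp [h, h']
  · rintro ⟨rfl, rfl⟩
    have h1 : A - A' = 0 := by linear_combination (Complex.I * (h + h') / 2) + hI * (A - A')
    have h2 : k * (B - B') = 0 := by
      linear_combination (Complex.I * (h' - h) / 2) + hI * (k * (B - B'))
    exact ⟨sub_eq_zero.1 h1, sub_eq_zero.1 ((mul_eq_zero_iff_left hk).1 h2)⟩

-- Expanding `C₁` and `C₂` in frame components and using the Killing tensor equation gives the two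
-- conditions in the combination above, with `k = c s₀`. The factors `2/3` result from eliminating
-- dependent derivatives of `e^{ab}`.
set_option maxHeartbeats 2000000 in
theorem localPotential_iff {p : M} (hp : p ∈ (𝒮.chart i).source)
    (h : LocalDetermining 𝒜 i V e α ζ α₀ p) :
    let 𝒩 := (𝒮.calculus 𝒜 i).toNull
    let ev := (𝒮.calculus 𝒜 i).gradedEv ⟨p, hp⟩
    let T := nullFields 𝒜 i e α ζ hα₀ hg'
    let u := hom 0 (𝒮.potentials i hV hVh 0)
    let v := hom 0 (𝒮.potentials i hV hVh 1)
    (∑ a, ζ.val i a p * 𝒮.grad i a V p =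
      -(σ.det *
        ((2 / 3) * ∑ a, ∑ b, ∑ c,
            𝒮.nabla2 i a (e.val i) b c p * 𝒮.grad i c Vh p * σ.epsMixed a b
          + ∑ a, ∑ b, ∑ c, e.val i b c p * 𝒮.hess i a c Vh p * σ.epsMixed a b
          - Complex.I * ∑ a, α.val i a p * 𝒮.grad i a (fun r => Vh r ^ 2) p)) ∧
    ∑ a, ζ.val i a p * 𝒮.grad i a Vh p =
      (2 / 3) * ∑ c, ∑ b, ∑ a, eps c b * 𝒮.nabla2Up i c (e.val i) a b p * 𝒮.grad i a V p
        + ∑ c, ∑ b, ∑ a, σ.epsMixed c b * e.val i a b p * 𝒮.hess i c a V p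
        - 2 * Complex.I * ∑ a, α.val i a p * 𝒮.grad i a V p * Vh p) ↔
    ev ((T.t₁ - 𝒩.X T.a + T.P * (u - v)) * 𝒩.X u + (T.t₂ + 𝒩.Y T.d + T.Q * (u - v)) * 𝒩.Y u
      - T.a * 𝒩.X (𝒩.X u) + T.d * 𝒩.Y (𝒩.Y u)) = 0 ∧
    ev ((T.t₁ + 𝒩.X T.a - T.P * (u - v)) * 𝒩.X v + (T.t₂ - 𝒩.Y T.d - T.Q * (u - v)) * 𝒩.Y v
      + T.a * 𝒩.X (𝒩.X v) - T.d * 𝒩.Y (𝒩.Y v)) = 0 := by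
  intro 𝒩 ev T u v
  have hc := σ.nullRoot_mul_self
  have hI := Complex.I_mul_I
  have h0 := σ.sgn_mul_self 0
  have h1 := σ.sgn_mul_self 1
  obtain ⟨k0, k1, k2, k3⟩ := h.killing 𝒜 i hp
  clear h
  simp only [Fin.forall_fin_two, nabla2Up, Fin.sum_univ_two, Signature.det,
    Signature.epsMixed, eps_00, eps_01, eps_10, eps_11, nabla2_symm i hp e _ 1 0, e.symm i 1 0 p hp, grad_sq i hVh _ hp,
    hess_symm 𝒜 i hp hV, hess_symm 𝒜 i hp hVh]
  simp only [ev, 𝒩, T, u, v, hom_potentials_zero, hom_potentials_one, nullFields, map_add, map_mul,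
    map_neg, map_sub, map_ofNat, Derivation.map_smul, gradedEv_X_hom, gradedEv_Y_hom,
    gradedEv_XX_hom, gradedEv_YX_hom, gradedEv_YY_hom, smul_eq_mul, map_smul,
    calculus_ev, calculus_c, evAlg_covDeriv_compX, evAlg_covDeriv_compY, evAlg_covDeriv_compXX,
    evAlg_covDeriv_compXY, evAlg_covDeriv_compYY, evAlg_covDeriv_funAlg, gradedEv_Φ,
    gradedEv_hom_evAlg]
  simp only [contract, vecX, vecY, compXX, compXY, compYY, compX, compY, map_smul, map_sub, map_add,
    smul_eq_mul, calculus_c, evAlg_alg, Fin.sum_univ_two, evAlg_second_funAlg,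
    hess_symm 𝒜 i hp hV, hess_symm 𝒜 i hp hVh,
    evAlg_tensorAlg, evAlg_funAlg, e.symm i 1 0 p hp,
    Matrix.cons_val_zero, Matrix.cons_val_one]
  clear_value ev T u v 𝒩
  refine combination_iff (k := σ.nullRoot * σ.sgn 0) ?_ ?_ ?_
  · clear h0
    intro h0
    rw [mul_eq_zero, mul_self_eq_zero.symm, hc] at h0
    rcases FrameCalculus.sgn_eq σ 0 with h0' | h0' <;>
      rcases FrameCalculus.sgn_eq σ 1 with h1' | h1' <;> simp [h0', h1'] at h0
  all_goals
    rw [k0, k1, k2, k3]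
    clear k0 k1 k2 k3
    grind

end SpinManifold

namespace SpinManifold

open FrameCalculus

variable {M : Type*} [TopologicalSpace M] [ChartedSpace Plane M] [IsManifold (𝓡 2) ∞ M]
  {σ : Signature} {γ : DiracMatrices σ} {ι : Type*} {𝒮 : SpinManifold M γ ι}
  {q : ℝ} (𝒜 : 𝒮.Potential q) (i : ι)

variable {V Vh : M → ℂ} (hV : ContMDiff (𝓡 2) 𝓘(ℝ, ℂ) ∞ V)
  (hVh : ContMDiff (𝓡 2) 𝓘(ℝ, ℂ) ∞ Vh) (e : 𝒮.SymTensorField) (α ζ : 𝒮.VectorField)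
  {α₀ g' : M → ℂ} (hα₀ : ContMDiff (𝓡 2) 𝓘(ℝ, ℂ) ∞ α₀) (hg' : ContMDiff (𝓡 2) 𝓘(ℝ, ℂ) ∞ g')

/-- A covector equation may be tested on `X` and `Y` instead of on the frame, as these vectors form
a basis; the factor `2` matches the doubled equations for `g`. -/
theorem null_combination_iff {A A' B B' C C' D D' : ℂ}
    (hc : σ.nullRoot * σ.nullRoot = -(σ.sgn 0 * σ.sgn 1))
    (h : C - C' = 2 * (σ.sgn 0 * (A - A') + σ.sgn 1 * σ.nullRoot * (B - B')))
    (h' : D - D' = 2 * ((A - A') - σ.sgn 0 * σ.sgn 1 * σ.nullRoot * (B - B'))) :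
    A = A' ∧ B = B' ↔ C = C' ∧ D = D' := by
  have h0 := σ.sgn_mul_self 0
  have h1 := σ.sgn_mul_self 1
  constructor
  · rintro ⟨rfl, rfl⟩
    simp only [sub_self, mul_zero, add_zero] at h h'
    exact ⟨sub_eq_zero.1 h, sub_eq_zero.1 h'⟩
  · rintro ⟨rfl, rfl⟩
    simp only [sub_self] at h h'
    have e1 : A - A' = 0 := by
      linear_combination -(σ.sgn 0 * h + h') / 4 - (A - A') / 2 * h0
    have e2 : B - B' = 0 := by
      rw [e1] at h
      linear_combination (-h / 2) * (-σ.sgn 0 * σ.nullRoot) - (B - B') * h0 * σ.sgn 1 ^ 2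
        - (B - B') * h1 + (σ.sgn 0 * σ.sgn 1 * (B - B')) * hc
    exact ⟨sub_eq_zero.1 e1, sub_eq_zero.1 e2⟩

-- The off-diagonal equations are the contractions of `∇g' = Λ` with the two null vectors, after the
-- Killing tensor equation has been used. The product `u v` contains `V²` and `V̂²`, and the
-- differences `u - v` contain only `V̂`.
set_option maxHeartbeats 2000000 in
theorem localGradient_iff {p : M} (hp : p ∈ (𝒮.chart i).source)
    (h : LocalDetermining 𝒜 i V e α ζ α₀ p) :
    let 𝒩 := (𝒮.calculus 𝒜 i).toNull
    let ev := (𝒮.calculus 𝒜 i).gradedEv ⟨p, hp⟩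
    let T := nullFields 𝒜 i e α ζ hα₀ hg'
    let u := hom 0 (𝒮.potentials i hV hVh 0)
    let v := hom 0 (𝒮.potentials i hV hVh 1)
    (𝒮.grad i 0 g' p = 𝒮.LambdaDown 𝒜 V Vh e α ζ i 0 p ∧
      𝒮.grad i 1 g' p = 𝒮.LambdaDown 𝒜 V Vh e α ζ i 1 p) ↔
    ev (2 * 𝒩.X T.g) = ev (-T.P * 𝒩.X (𝒩.X (u - v)) - T.Q * 𝒩.Y (𝒩.X (u - v))
      + 2 * 𝒩.Φ * T.Q * (u + v) - 2 * 𝒩.Φ * T.t₂ + 2 * 𝒩.R * T.Q * (u - v) - 𝒩.R * 𝒩.Y T.d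
      - 2 * T.d * 𝒩.Y 𝒩.R - 2 * T.b * 𝒩.X 𝒩.R - 4 * T.b * 𝒩.X (u * v) - 4 * T.d * 𝒩.Y (u * v)) ∧
    ev (2 * 𝒩.Y T.g) = ev (T.P * 𝒩.Y (𝒩.X (u - v)) + T.Q * 𝒩.Y (𝒩.Y (u - v))
      - 2 * 𝒩.Φ * T.P * (u + v) + 2 * 𝒩.Φ * T.t₁ - 2 * 𝒩.R * T.P * (u - v) - 𝒩.R * 𝒩.X T.a
      - 2 * T.b * 𝒩.Y 𝒩.R - 2 * T.a * 𝒩.X 𝒩.R - 4 * T.a * 𝒩.X (u * v) - 4 * T.b * 𝒩.Y (u * v)) := by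
  intro 𝒩 ev T u v
  have hc := σ.nullRoot_mul_self
  have hI := Complex.I_mul_I
  have h0 := σ.sgn_mul_self 0
  have h1 := σ.sgn_mul_self 1
  obtain ⟨k0, k1, k2, k3⟩ := h.killing 𝒜 i hp
  clear h
  simp only [Fin.forall_fin_two, nabla2Up, Fin.sum_univ_two, Signature.det, LambdaDown, omega,
    nabla2_scalarCurv_mul i 𝒜 e _ _ _ hp,
    Signature.epsMixed, eps_00, eps_01, eps_10, eps_11, nabla2_symm i hp e _ 1 0, e.symm i 1 0 p hp, grad_sq i hVh _ hp,
    hess_symm 𝒜 i hp hV, hess_symm 𝒜 i hp hVh]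
  simp only [ev, 𝒩, T, u, v, hom_potentials_zero, hom_potentials_one, nullFields, map_add, map_mul,
    map_neg, map_sub, map_ofNat, Derivation.map_smul, gradedEv_X_hom, gradedEv_Y_hom,
    gradedEv_XX_hom, gradedEv_YX_hom, gradedEv_YY_hom, smul_eq_mul, map_smul,
    calculus_ev, calculus_c, evAlg_covDeriv_compX, evAlg_covDeriv_compY, evAlg_covDeriv_compXX,
    evAlg_covDeriv_compXY, evAlg_covDeriv_compYY, evAlg_covDeriv_funAlg, gradedEv_Φ, gradedEv_R, gradedEv_X_R, gradedEv_Y_R,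
    Derivation.leibniz,
    gradedEv_hom_evAlg]
  simp only [contract, vecX, vecY, compXX, compXY, compYY, compX, compY, map_smul, map_sub, map_add,
    smul_eq_mul, calculus_c, evAlg_alg, Fin.sum_univ_two, evAlg_second_funAlg,
    hess_symm 𝒜 i hp hV, hess_symm 𝒜 i hp hVh, 
    evAlg_tensorAlg, evAlg_funAlg, e.symm i 1 0 p hp,
    Matrix.cons_val_zero, Matrix.cons_val_one]
  clear_value ev T u v 𝒩
  refine null_combination_iff hc ?_ ?_
  all_goals
    rw [k0, k1, k2, k3]
    clear k0 k1 k2 k3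
    grind

end SpinManifold

namespace SpinManifold

open FrameCalculus

variable {M : Type*} [TopologicalSpace M] [ChartedSpace Plane M] [IsManifold (𝓡 2) ∞ M]
  {σ : Signature} {γ : DiracMatrices σ} {ι : Type*} {𝒮 : SpinManifold M γ ι}
  {q : ℝ} (𝒜 : 𝒮.Potential q) (i : ι)

/-- The equations for `g'`, and the conditions on `ζ^a ∇_a V` and `ζ^a ∇_a V̂`, at a point. -/
structure LocalFinal (V Vh : M → ℂ) (e : 𝒮.SymTensorField) (α ζ : 𝒮.VectorField)
    (g' : M → ℂ) (p : M) : Prop where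
  grad_g' : ∀ a, 𝒮.grad i a g' p = 𝒮.LambdaDown 𝒜 V Vh e α ζ i a p
  grad_V : ∑ a, ζ.val i a p * 𝒮.grad i a V p =
    -(σ.det *
      ((2 / 3) * ∑ a, ∑ b, ∑ c,
          𝒮.nabla2 i a (e.val i) b c p * 𝒮.grad i c Vh p * σ.epsMixed a b
        + ∑ a, ∑ b, ∑ c, e.val i b c p * 𝒮.hess i a c Vh p * σ.epsMixed a b
        - Complex.I * ∑ a, α.val i a p * 𝒮.grad i a (fun r => Vh r ^ 2) p))
  grad_Vh : ∑ a, ζ.val i a p * 𝒮.grad i a Vh p =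
    (2 / 3) * ∑ c, ∑ b, ∑ a, eps c b * 𝒮.nabla2Up i c (e.val i) a b p * 𝒮.grad i a V p
      + ∑ c, ∑ b, ∑ a, σ.epsMixed c b * e.val i a b p * 𝒮.hess i c a V p
      - 2 * Complex.I * ∑ a, α.val i a p * 𝒮.grad i a V p * Vh p

variable {V Vh : M → ℂ} (hV : ContMDiff (𝓡 2) 𝓘(ℝ, ℂ) ∞ V)
  (hVh : ContMDiff (𝓡 2) 𝓘(ℝ, ℂ) ∞ Vh) (e : 𝒮.SymTensorField) (α ζ : 𝒮.VectorField)
  {α₀ g' : M → ℂ} (hα₀ : ContMDiff (𝓡 2) 𝓘(ℝ, ℂ) ∞ α₀) (hg' : ContMDiff (𝓡 2) 𝓘(ℝ, ℂ) ∞ g')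

-- Assembles the pointwise comparisons by the same homogeneity argument. The determining equations
-- are assumed because the two forms agree only modulo the Killing tensor equation.
set_option maxHeartbeats 1000000 in
theorem final_nullFields_iff (hD : ∀ p ∈ 𝒮.dom i, LocalDetermining 𝒜 i V e α ζ α₀ p) :
    (𝒮.calculus 𝒜 i).toNull.Final (hom 0 (𝒮.potentials i hV hVh 0))
      (hom 0 (𝒮.potentials i hV hVh 1)) (nullFields 𝒜 i e α ζ hα₀ hg') ↔
    ∀ p ∈ 𝒮.dom i, LocalFinal 𝒜 i V Vh e α ζ g' p := by
  constructor
  · intro h p hp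
    have h1 := (localGradient_iff 𝒜 i hV hVh e α ζ hα₀ hg' hp (hD p hp)).2
      ⟨congrArg _ h.Xg, congrArg _ h.Yg⟩
    have h2 := (localPotential_iff 𝒜 i hV hVh e α ζ hα₀ hg' hp (hD p hp)).2
      ⟨by rw [h.C₁, map_zero], by rw [h.C₂, map_zero]⟩
    exact ⟨Fin.forall_fin_two.2 h1, h2.1, h2.2⟩
  · intro h
    have h1 := fun p : {p // p ∈ (𝒮.chart i).source} =>
      (localGradient_iff 𝒜 i hV hVh e α ζ hα₀ hg' p.2 (hD p.1 p.2)).1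
        (Fin.forall_fin_two.1 (h p.1 p.2).grad_g')
    have h2 := fun p : {p // p ∈ (𝒮.chart i).source} =>
      (localPotential_iff 𝒜 i hV hVh e α ζ hα₀ hg' p.2 (hD p.1 p.2)).1
        ⟨(h p.1 p.2).grad_V, (h p.1 p.2).grad_Vh⟩
    have hT := isTensor_nullFields 𝒜 i e α ζ hα₀ hg'
    have hu := (𝒮.calculus 𝒜 i).tensor_hom 0 (𝒮.potentials i hV hVh 0)
    have hv := (𝒮.calculus 𝒜 i).tensor_hom 0 (𝒮.potentials i hV hVh 1)
    change (𝒮.calculus 𝒜 i).toNull.Tensor 0 (hom 0 _) at hu hv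
    generalize nullFields 𝒜 i e α ζ hα₀ hg' = T at *
    generalize hom 0 (𝒮.potentials i hV hVh 0) = u at *
    generalize hom 0 (𝒮.potentials i hV hVh 1) = v at *
    have hΦ := (𝒮.calculus 𝒜 i).toNull.tensor_Φ
    have hR := (𝒮.calculus 𝒜 i).toNull.tensor_R
    have c2 := (𝒮.calculus 𝒜 i).toNull.tensor_ofNat 2
    have c4 := (𝒮.calculus 𝒜 i).toNull.tensor_ofNat 4
    have Xd := (hu.sub hv).X.X
    have YXd := (hu.sub hv).X.Y
    have YYd := (hu.sub hv).Y.Y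
    have Xm := (hu.mul hv).X
    have Ym := (hu.mul hv).Y
    have w := @NullCalculus.Tensor.of_weight _ _ _ _ (𝒮.calculus 𝒜 i).toNull
    constructor
    · refine (c2.mul hT.g.X).ext ?_ fun p => (h1 p).1
      refine ((((((((w (hT.P.neg.mul Xd) ?_).sub (w (hT.Q.mul YXd) ?_)).add
        (w (((c2.mul hΦ).mul hT.Q).mul (hu.add hv)) ?_)).sub
        (w ((c2.mul hΦ).mul hT.t₂) ?_)).add
        (w (((c2.mul hR).mul hT.Q).mul (hu.sub hv)) ?_)).sub
        (w (hR.mul hT.d.Y) ?_)).sub (w ((c2.mul hT.d).mul hR.Y) ?_)).sub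
        (w ((c2.mul hT.b).mul hR.X) ?_)).sub
        (w ((c4.mul hT.b).mul Xm) ?_) |>.sub (w ((c4.mul hT.d).mul Ym) ?_) <;> norm_num
    · refine (c2.mul hT.g.Y).ext ?_ fun p => (h1 p).2
      refine ((((((((w (hT.P.mul YXd) ?_).add (w (hT.Q.mul YYd) ?_)).sub
        (w (((c2.mul hΦ).mul hT.P).mul (hu.add hv)) ?_)).add
        (w ((c2.mul hΦ).mul hT.t₁) ?_)).sub
        (w (((c2.mul hR).mul hT.P).mul (hu.sub hv)) ?_)).sub
        (w (hR.mul hT.a.X) ?_)).sub (w ((c2.mul hT.b).mul hR.Y) ?_)).sub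
        (w ((c2.mul hT.a).mul hR.X) ?_)).sub
        (w ((c4.mul hT.a).mul Xm) ?_) |>.sub (w ((c4.mul hT.b).mul Ym) ?_) <;> norm_num
    · refine NullCalculus.Tensor.ext (k := 0) ?_ (𝒮.calculus 𝒜 i).toNull.tensor_zero
        fun p => by rw [map_zero]; exact (h2 p).1
      refine (((w (((hT.t₁.sub (w hT.a.X ?_)).add (w (hT.P.mul (hu.sub hv)) ?_)).mul
        hu.X) ?_).add (w (((hT.t₂.add (w hT.d.Y ?_)).add
        (w (hT.Q.mul (hu.sub hv)) ?_)).mul hu.Y) ?_)).sub (w (hT.a.mul hu.X.X) ?_)).add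
        (w (hT.d.mul hu.Y.Y) ?_) <;> norm_num
    · refine NullCalculus.Tensor.ext (k := 0) ?_ (𝒮.calculus 𝒜 i).toNull.tensor_zero
        fun p => by rw [map_zero]; exact (h2 p).2
      refine (((w (((hT.t₁.add (w hT.a.X ?_)).sub (w (hT.P.mul (hu.sub hv)) ?_)).mul
        hv.X) ?_).add (w (((hT.t₂.sub (w hT.d.Y ?_)).sub
        (w (hT.Q.mul (hu.sub hv)) ?_)).mul hv.Y) ?_)).add (w (hT.a.mul hv.X.X) ?_)).sub
        (w (hT.d.mul hv.Y.Y) ?_) <;> norm_num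

end SpinManifold

/-! ### The explicit form of the coefficients in null components -/

theorem DiracMatrices.toNormal_injective {σ : Signature} (γ : DiracMatrices σ)
    {A B : Matrix (Fin 2) (Fin 2) ℂ} (h : ∀ k l, γ.toNormal A k l = γ.toNormal B k l) : A = B := by
  have h' : γ.conj⁻¹ * A * γ.conj = γ.conj⁻¹ * B * γ.conj := Matrix.ext h
  have e : ∀ X, X = γ.conj * (γ.conj⁻¹ * X * γ.conj) * γ.conj⁻¹ := fun X => by
    rw [← mul_assoc, ← mul_assoc, γ.conj_mul_inv, one_mul, mul_assoc, γ.conj_mul_inv, mul_one]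
  rw [e A, h', ← e B]

theorem DiracMatrices.toNormal_expand {σ : Signature} (γ : DiracMatrices σ) (v : ℂ)
    (w : Fin 2 → ℂ) (u : ℂ) (k l : Fin 2) : γ.toNormal (γ.expand v w u) k l =
      !![v - σ.nullRoot * σ.sgn 0 * u, σ.sgn 0 * w 0 + σ.sgn 1 * σ.nullRoot * w 1;
        w 0 - σ.sgn 0 * σ.sgn 1 * σ.nullRoot * w 1, v + σ.nullRoot * σ.sgn 0 * u] k l := by
  have h : γ.conj⁻¹ * γ.expand v w u * γ.conj = v • (1 : Matrix (Fin 2) (Fin 2) ℂ)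
      + (w 0 * σ.sgn 0) • σ.normalGamma 0 + (w 1 * σ.sgn 1) • σ.normalGamma 1
      + u • !![-(σ.nullRoot * σ.sgn 0), 0; 0, σ.nullRoot * σ.sgn 0] := by
    simp only [DiracMatrices.expand, DiracMatrices.up, Fin.sum_univ_two, mul_add, add_mul,
      Matrix.mul_smul, Matrix.smul_mul, mul_one, γ.inv_conj_mul_low, γ.inv_conj_mul_vol, mul_assoc,
      γ.inv_mul_conj, smul_smul, add_assoc]
  rw [DiracMatrices.toNormal, h]
  have h0 := σ.sgn_mul_self 0
  fin_cases k <;> fin_cases l <;> simp [Signature.normalGamma]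
  · ring
  · ring
  · linear_combination w 0 * h0
  · ring

/-- The null components of a vector. -/
def Signature.nullComp (σ : Signature) (n : Fin 2) (v : Fin 2 → ℂ) : ℂ :=
  ![(1 / 2) * (σ.sgn 0 * v 0 - σ.sgn 0 * σ.nullRoot * v 1), (1 / 2) * (v 0 + σ.nullRoot * v 1)] n

theorem Signature.nullRoot_ne_zero (σ : Signature) : σ.nullRoot ≠ 0 := by
  intro h0
  have hc := σ.nullRoot_mul_self
  rw [h0] at hc
  rcases FrameCalculus.sgn_eq σ 0 with h0' | h0' <;>
    rcases FrameCalculus.sgn_eq σ 1 with h1' | h1' <;> simp [h0', h1'] at hc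

theorem Signature.nullComp_injective (σ : Signature) {v w : Fin 2 → ℂ}
    (h : ∀ n, σ.nullComp n v = σ.nullComp n w) : v = w := by
  have h0 := h 0
  have h1 := h 1
  simp only [Signature.nullComp, Matrix.cons_val_zero, Matrix.cons_val_one] at h0 h1
  have hs := σ.sgn_mul_self 0
  have e0 : v 0 = w 0 := by
    linear_combination σ.sgn 0 * h0 + h1 - (v 0 - w 0 - σ.nullRoot * (v 1 - w 1)) / 2 * hs
  have e1 : σ.nullRoot * (v 1 - w 1) = 0 := by linear_combination 2 * h1 - e0
  exact funext (Fin.forall_fin_two.2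
    ⟨e0, sub_eq_zero.1 ((mul_eq_zero_iff_left σ.nullRoot_ne_zero).1 e1)⟩)

theorem Signature.nullComp_symm (σ : Signature) {T : Fin 2 → Fin 2 → ℂ} (h : T 0 1 = T 1 0) :
    σ.nullComp 1 (fun a => σ.nullComp 0 (T a)) = σ.nullComp 0 (fun a => σ.nullComp 1 (T a)) := by
  simp [Signature.nullComp, h]
  ring

/-- For symmetric tensors the two mixed components agree, so three null components suffice. -/
theorem Signature.nullComp_symm_injective (σ : Signature) {S T : Fin 2 → Fin 2 → ℂ}
    (hS : S 0 1 = S 1 0) (hT : T 0 1 = T 1 0)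
    (h00 : σ.nullComp 0 (fun a => σ.nullComp 0 (S a)) = σ.nullComp 0 (fun a => σ.nullComp 0 (T a)))
    (h01 : σ.nullComp 0 (fun a => σ.nullComp 1 (S a)) = σ.nullComp 0 (fun a => σ.nullComp 1 (T a)))
    (h11 : σ.nullComp 1 (fun a => σ.nullComp 1 (S a)) = σ.nullComp 1 (fun a => σ.nullComp 1 (T a))) :
    S = T := by
  have h10 := h01
  rw [← σ.nullComp_symm hS, ← σ.nullComp_symm hT] at h10
  have k : ∀ m, (fun a => σ.nullComp m (S a)) = fun a => σ.nullComp m (T a) := by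
    refine Fin.forall_fin_two.2 ⟨σ.nullComp_injective (Fin.forall_fin_two.2 ⟨h00, h10⟩),
      σ.nullComp_injective (Fin.forall_fin_two.2 ⟨h01, h11⟩)⟩
  exact funext fun a => σ.nullComp_injective fun m => congrFun (k m) a

namespace SpinManifold

open FrameCalculus

variable {M : Type*} [TopologicalSpace M] [ChartedSpace Plane M] [IsManifold (𝓡 2) ∞ M]
  {σ : Signature} {γ : DiracMatrices σ} {ι : Type*} {𝒮 : SpinManifold M γ ι}
  {q : ℝ} (𝒜 : 𝒮.Potential q) (i : ι)

theorem evAlg_compX {p : M} (hp : p ∈ (𝒮.chart i).source) (v : Fin 2 → 𝒮.Alg i) :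
    evAlg ⟨p, hp⟩ ((𝒮.calculus 𝒜 i).compX v) = σ.nullComp 0 fun a => evAlg ⟨p, hp⟩ (v a) := by
  simp [compX, Signature.nullComp, calculus_c]

theorem evAlg_compY {p : M} (hp : p ∈ (𝒮.chart i).source) (v : Fin 2 → 𝒮.Alg i) :
    evAlg ⟨p, hp⟩ ((𝒮.calculus 𝒜 i).compY v) = σ.nullComp 1 fun a => evAlg ⟨p, hp⟩ (v a) := by
  simp [compY, Signature.nullComp, calculus_c]
  ring

/-- The explicit form of the coefficients at a point. -/
structure LocalExplicit (V Vh : M → ℂ) (K : 𝒮.Operator2) (e : 𝒮.SymTensorField)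
    (α ζ : 𝒮.VectorField) (α₀ g' : M → ℂ) (p : M) : Prop where
  E_eq : ∀ a b, K.E i a b p = e.val i a b p • (1 : Matrix (Fin 2) (Fin 2) ℂ)
    + (α.val i a p • γ.up b + α.val i b p • γ.up a)
  F_eq : ∀ a, K.F i a p = γ.expand
    (ζ.val i a p + ∑ b, 𝒮.nabla2 i b (e.val i) a b p)
    (fun c => (if a = c then α₀ p else 0) + 𝒮.nabla1 i c (α.val i) a p)
    ((1 / 3) * ∑ c, ∑ b, eps c b * 𝒮.nabla2Up i c (e.val i) a b p
      + 2 * Complex.I * α.val i a p * Vh p)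
  G_eq : K.G i p = γ.expand
    (g' p + 3 * Complex.I * ∑ a, α.val i a p * 𝒮.grad i a V p + Complex.I * α₀ p * V p)
    (fun a => Complex.I * q * 𝒮.fieldStrength 𝒜 i p * ∑ b, eps a b * α.val i b p
      + Complex.I * ∑ b, σ.sgn a * e.val i a b p * 𝒮.grad i b V p
      - (1 / 4) * 𝒮.scalarCurv i p * (σ.sgn a * α.val i a p)
      - Complex.I * σ.det * ∑ c, ∑ b, e.val i c b p * 𝒮.grad i b Vh p * eps a c)
    ((1 / 4) * ∑ c, ∑ a,
        (𝒮.nabla1Up i c (ζ.val i) a p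
          - 2 * Complex.I * q * 𝒮.fieldStrength 𝒜 i p * ∑ b, σ.epsMixed c b * e.val i a b p
          - 2 * Complex.I * α.val i a p * (σ.sgn c * 𝒮.grad i c V p)) * eps c a
      + Complex.I * ∑ a, α.val i a p * 𝒮.grad i a Vh p + Complex.I * α₀ p * Vh p)

/-- The values of the coefficients of the explicit form in null components. -/
structure NullValues {B : Type*} [CommRing B] [Algebra ℂ B] {ι' : Type*} (𝒩 : NullCalculus B ι')
    (ev : B →ₐ[ℂ] ℂ) (E : Fin 2 → Fin 2 → Fin 2 → Fin 2 → ℂ) (F : Fin 2 → Fin 2 → Fin 2 → ℂ)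
    (G : Fin 2 → Fin 2 → ℂ) (u v : B) (T : NullCalculus.Fields B) : Prop where
  a00 : σ.nullComp 0 (fun a => σ.nullComp 0 fun b => E a b 0 0) = ev T.a
  a11 : σ.nullComp 0 (fun a => σ.nullComp 0 fun b => E a b 1 1) = ev T.a
  b00 : σ.nullComp 0 (fun a => σ.nullComp 1 fun b => E a b 0 0) = ev T.b
  b11 : σ.nullComp 0 (fun a => σ.nullComp 1 fun b => E a b 1 1) = ev T.b
  d00 : σ.nullComp 1 (fun a => σ.nullComp 1 fun b => E a b 0 0) = ev T.d
  d11 : σ.nullComp 1 (fun a => σ.nullComp 1 fun b => E a b 1 1) = ev T.d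
  a01 : σ.nullComp 0 (fun a => σ.nullComp 0 fun b => E a b 0 1) = ev (2 * T.P)
  b01 : σ.nullComp 0 (fun a => σ.nullComp 1 fun b => E a b 0 1) = ev T.Q
  d01 : σ.nullComp 1 (fun a => σ.nullComp 1 fun b => E a b 0 1) = 0
  a10 : σ.nullComp 0 (fun a => σ.nullComp 0 fun b => E a b 1 0) = 0
  b10 : σ.nullComp 0 (fun a => σ.nullComp 1 fun b => E a b 1 0) = ev T.P
  d10 : σ.nullComp 1 (fun a => σ.nullComp 1 fun b => E a b 1 0) = ev (2 * T.Q)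
  f00 : σ.nullComp 0 (fun a => F a 0 0) = ev (T.t₁ + 𝒩.X T.a + T.P * (u - v))
  f11 : σ.nullComp 0 (fun a => F a 1 1) = ev (T.t₁ - T.P * (u - v))
  h00 : σ.nullComp 1 (fun a => F a 0 0) = ev (T.t₂ + T.Q * (u - v))
  h11 : σ.nullComp 1 (fun a => F a 1 1) = ev (T.t₂ + 𝒩.Y T.d - T.Q * (u - v))
  f01 : σ.nullComp 0 (fun a => F a 0 1) = ev (T.al + 𝒩.X T.P)
  h01 : σ.nullComp 1 (fun a => F a 0 1) = 0
  f10 : σ.nullComp 0 (fun a => F a 1 0) = 0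
  h10 : σ.nullComp 1 (fun a => F a 1 0) = ev (T.al - 𝒩.X T.P)
  g01 : G 0 1 = ev (-𝒩.Φ * T.Q - 𝒩.R * T.Q + 2 * T.b * 𝒩.X v + 2 * T.d * 𝒩.Y v)
  g10 : G 1 0 = ev (𝒩.Φ * T.P - 𝒩.R * T.P + 2 * T.a * 𝒩.X u + 2 * T.b * 𝒩.Y u)
  g00 : 2 * G 0 0 = ev (2 * T.g + 3 * (T.P * 𝒩.X (u + v) + T.Q * 𝒩.Y (u + v)) + T.al * (u + v)
    + (𝒩.X T.t₁ - T.P * 𝒩.X u - 3 * T.P * 𝒩.X v + 2 * 𝒩.Φ * T.b - 2 * T.Q * 𝒩.Y v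
      + T.al * (u - v)))
  g11 : 2 * G 1 1 = ev (2 * T.g + 3 * (T.P * 𝒩.X (u + v) + T.Q * 𝒩.Y (u + v)) + T.al * (u + v)
    - (𝒩.X T.t₁ - T.P * 𝒩.X u - 3 * T.P * 𝒩.X v + 2 * 𝒩.Φ * T.b - 2 * T.Q * 𝒩.Y v
      + T.al * (u - v)))

end SpinManifold

namespace SpinManifold

open FrameCalculus

variable {M : Type*} [TopologicalSpace M] [ChartedSpace Plane M] [IsManifold (𝓡 2) ∞ M]
  {σ : Signature} {γ : DiracMatrices σ} {ι : Type*} {𝒮 : SpinManifold M γ ι}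
  {q : ℝ} (𝒜 : 𝒮.Potential q) (i : ι)

variable {V Vh : M → ℂ} (hV : ContMDiff (𝓡 2) 𝓘(ℝ, ℂ) ∞ V)
  (hVh : ContMDiff (𝓡 2) 𝓘(ℝ, ℂ) ∞ Vh) (e : 𝒮.SymTensorField) (α ζ : 𝒮.VectorField)
  {α₀ g' : M → ℂ} (hα₀ : ContMDiff (𝓡 2) 𝓘(ℝ, ℂ) ∞ α₀) (hg' : ContMDiff (𝓡 2) 𝓘(ℝ, ℂ) ∞ g')

theorem LocalDetermining.killing_vec {e : 𝒮.SymTensorField} {α ζ : 𝒮.VectorField}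
    {p : M} (h : LocalDetermining 𝒜 i V e α ζ α₀ p) :
    𝒮.nabla1 i 0 (α.val i) 0 p = 0 ∧ 𝒮.nabla1 i 1 (α.val i) 1 p = 0 ∧
    𝒮.nabla1 i 1 (α.val i) 0 p = -(σ.sgn 0 * σ.sgn 1 * 𝒮.nabla1 i 0 (α.val i) 1 p) := by
  have h00 := h.killing_vector 0 0
  have h11 := h.killing_vector 1 1
  have h01 := h.killing_vector 0 1
  simp only [nabla1Up] at h00 h11 h01
  rcases FrameCalculus.sgn_eq σ 0 with h0 | h0 <;> rcases FrameCalculus.sgn_eq σ 1 with h1 | h1 <;>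
    simp only [h0, h1] at h00 h11 h01 ⊢ <;>
    exact ⟨by grind, by grind, by grind⟩

/-- Brings `𝔼^{ab}` to the form used for `𝔽^a` and `𝔾`, so that `toNormal_expand` treats all
coefficients alike. -/
theorem E_eq_expand (e : 𝒮.SymTensorField) (α : 𝒮.VectorField) (p : M) (a b : Fin 2) :
    e.val i a b p • (1 : Matrix (Fin 2) (Fin 2) ℂ) + (α.val i a p • γ.up b + α.val i b p • γ.up a) =
      γ.expand (e.val i a b p) (fun c => (if b = c then α.val i a p else 0)
        + if a = c then α.val i b p else 0) 0 := by
  simp [DiracMatrices.expand, add_smul, Finset.sum_add_distrib, ite_smul]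

-- A componentwise comparison of the covariant formulas with the null ones. They agree only modulo
-- the determining equations: these remove the symmetric part of `∇α` from `𝔽`, simplify the
-- derivatives of `e^{ab}`, and supply the divergence of `ζ` for `𝔾`.
set_option maxHeartbeats 4000000 in
theorem nullValues_of_localDetermining {p : M} (hp : p ∈ (𝒮.chart i).source)
    (h : LocalDetermining 𝒜 i V e α ζ α₀ p) :
    NullValues (σ := σ) (𝒮.calculus 𝒜 i).toNull ((𝒮.calculus 𝒜 i).gradedEv ⟨p, hp⟩)
      (fun a b => γ.toNormal (γ.expand (e.val i a b p) (fun c => (if b = c then α.val i a p else 0)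
        + if a = c then α.val i b p else 0) 0))
      (fun a => γ.toNormal (γ.expand
        (ζ.val i a p + ∑ b, 𝒮.nabla2 i b (e.val i) a b p)
        (fun c => (if a = c then α₀ p else 0) + 𝒮.nabla1 i c (α.val i) a p)
        ((1 / 3) * ∑ c, ∑ b, eps c b * 𝒮.nabla2Up i c (e.val i) a b p
          + 2 * Complex.I * α.val i a p * Vh p)))
      (γ.toNormal (γ.expand
        (g' p + 3 * Complex.I * ∑ a, α.val i a p * 𝒮.grad i a V p + Complex.I * α₀ p * V p)
        (fun a => Complex.I * q * 𝒮.fieldStrength 𝒜 i p * ∑ b, eps a b * α.val i b p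
          + Complex.I * ∑ b, σ.sgn a * e.val i a b p * 𝒮.grad i b V p
          - (1 / 4) * 𝒮.scalarCurv i p * (σ.sgn a * α.val i a p)
          - Complex.I * σ.det * ∑ c, ∑ b, e.val i c b p * 𝒮.grad i b Vh p * eps a c)
        ((1 / 4) * ∑ c, ∑ a,
            (𝒮.nabla1Up i c (ζ.val i) a p
              - 2 * Complex.I * q * 𝒮.fieldStrength 𝒜 i p * ∑ b, σ.epsMixed c b * e.val i a b p
              - 2 * Complex.I * α.val i a p * (σ.sgn c * 𝒮.grad i c V p)) * eps c a
          + Complex.I * ∑ a, α.val i a p * 𝒮.grad i a Vh p + Complex.I * α₀ p * Vh p)))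
      (hom 0 (𝒮.potentials i hV hVh 0)) (hom 0 (𝒮.potentials i hV hVh 1))
      (nullFields 𝒜 i e α ζ hα₀ hg') := by
  have hc := σ.nullRoot_mul_self
  have h0 := σ.sgn_mul_self 0
  have h1 := σ.sgn_mul_self 1
  obtain ⟨k0, k1, k2, k3⟩ := h.killing 𝒜 i hp
  obtain ⟨k4, k5, k6⟩ := h.killing_vec
  -- The covariant form of `𝔾` contains the curl of `ζ`, the null form contains `X t₁` alone. The
  -- two differ by the divergence, which is determined by the diagonal components of the equation
  -- for `ζ`.
  have z00 := h.sym_grad_ζ 0 0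
  have z11 := h.sym_grad_ζ 1 1
  clear h
  simp only [LambdaUp, nabla1Up, Signature.eta, if_true] at z00 z11
  constructor
  all_goals
    simp only [Fin.sum_univ_two, γ.toNormal_expand, Signature.det, LambdaDown, omega, nabla2Up,
      nabla1Up, Signature.epsMixed, eps_00, eps_01, eps_10, eps_11, nabla2_symm i hp e _ 1 0,
      e.symm i 1 0 p hp, Fin.isValue, if_true, if_neg (zero_ne_one (α := Fin 2)),
      if_neg (one_ne_zero (α := Fin 2)), Signature.nullComp, Matrix.of_apply, Matrix.cons_val',
      Matrix.cons_val_zero, Matrix.cons_val_one, Matrix.cons_val_fin_one] at z00 z11 ⊢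
    try simp only [hom_potentials_zero, hom_potentials_one, nullFields, map_add, map_mul,
      map_neg, map_sub, map_ofNat, Derivation.map_smul, gradedEv_X_hom, gradedEv_Y_hom,
      smul_eq_mul, map_smul,
      calculus_ev, calculus_c, evAlg_covDeriv_compX, evAlg_covDeriv_compY, evAlg_covDeriv_compXX,
      evAlg_covDeriv_compXY, evAlg_covDeriv_compYY, evAlg_covDeriv_funAlg, gradedEv_Φ, gradedEv_R,
      gradedEv_hom_evAlg]
    try simp only [compXX, compXY, compYY, compX, compY, map_smul, map_sub, map_add,
      smul_eq_mul, calculus_c, evAlg_alg, Fin.sum_univ_two,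
      evAlg_tensorAlg, evAlg_funAlg, e.symm i 1 0 p hp,
      Matrix.cons_val_zero, Matrix.cons_val_one]
    try simp only [k0, k1, k2, k3, k4, k5, k6]
  all_goals clear k0 k1 k2 k3 k4 k5 k6
  all_goals first | (clear z00 z11; grind) | grind

end SpinManifold

namespace SpinManifold

open FrameCalculus

variable {M : Type*} [TopologicalSpace M] [ChartedSpace Plane M] [IsManifold (𝓡 2) ∞ M]
  {σ : Signature} {γ : DiracMatrices σ} {ι : Type*} {𝒮 : SpinManifold M γ ι}
  {q : ℝ} (𝒜 : 𝒮.Potential q) (i : ι)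

variable {V Vh : M → ℂ} (hV : ContMDiff (𝓡 2) 𝓘(ℝ, ℂ) ∞ V)
  (hVh : ContMDiff (𝓡 2) 𝓘(ℝ, ℂ) ∞ Vh) (e : 𝒮.SymTensorField) (α ζ : 𝒮.VectorField)
  {α₀ g' : M → ℂ} (hα₀ : ContMDiff (𝓡 2) 𝓘(ℝ, ℂ) ∞ α₀) (hg' : ContMDiff (𝓡 2) 𝓘(ℝ, ℂ) ∞ g')

/-- `NullValues` prescribes every null component of every matrix entry, and null components
determine vectors and symmetric tensors. This lets the comparison for the covariant formulas be
inverted. -/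
theorem NullValues.unique {B : Type*} [CommRing B] [Algebra ℂ B] {ι' : Type*}
    {𝒩 : NullCalculus B ι'} {ev : B →ₐ[ℂ] ℂ} {E E' : Fin 2 → Fin 2 → Fin 2 → Fin 2 → ℂ}
    {F F' : Fin 2 → Fin 2 → Fin 2 → ℂ} {G G' : Fin 2 → Fin 2 → ℂ} {u v : B}
    {T : NullCalculus.Fields B} (h : NullValues (σ := σ) 𝒩 ev E F G u v T)
    (h' : NullValues (σ := σ) 𝒩 ev E' F' G' u v T) (hE : ∀ k l, E 0 1 k l = E 1 0 k l)
    (hE' : ∀ k l, E' 0 1 k l = E' 1 0 k l) :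
    (∀ a b k l, E a b k l = E' a b k l) ∧ (∀ a k l, F a k l = F' a k l) ∧
      ∀ k l, G k l = G' k l := by
  have key : ∀ k l, (σ.nullComp 0 (fun a => σ.nullComp 0 fun b => E a b k l) =
      σ.nullComp 0 (fun a => σ.nullComp 0 fun b => E' a b k l) ∧
      σ.nullComp 0 (fun a => σ.nullComp 1 fun b => E a b k l) =
      σ.nullComp 0 (fun a => σ.nullComp 1 fun b => E' a b k l) ∧
      σ.nullComp 1 (fun a => σ.nullComp 1 fun b => E a b k l) =
      σ.nullComp 1 (fun a => σ.nullComp 1 fun b => E' a b k l)) ∧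
      (∀ n, σ.nullComp n (fun a => F a k l) = σ.nullComp n (fun a => F' a k l)) ∧
      G k l = G' k l := by
    refine Fin.forall_fin_two.2 ⟨Fin.forall_fin_two.2 ⟨?_, ?_⟩, Fin.forall_fin_two.2 ⟨?_, ?_⟩⟩
    · exact ⟨⟨h.a00.trans h'.a00.symm, h.b00.trans h'.b00.symm, h.d00.trans h'.d00.symm⟩,
        Fin.forall_fin_two.2 ⟨h.f00.trans h'.f00.symm, h.h00.trans h'.h00.symm⟩,
        mul_left_cancel₀ two_ne_zero (h.g00.trans h'.g00.symm)⟩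
    · exact ⟨⟨h.a01.trans h'.a01.symm, h.b01.trans h'.b01.symm, h.d01.trans h'.d01.symm⟩,
        Fin.forall_fin_two.2 ⟨h.f01.trans h'.f01.symm, h.h01.trans h'.h01.symm⟩,
        h.g01.trans h'.g01.symm⟩
    · exact ⟨⟨h.a10.trans h'.a10.symm, h.b10.trans h'.b10.symm, h.d10.trans h'.d10.symm⟩,
        Fin.forall_fin_two.2 ⟨h.f10.trans h'.f10.symm, h.h10.trans h'.h10.symm⟩,
        h.g10.trans h'.g10.symm⟩
    · exact ⟨⟨h.a11.trans h'.a11.symm, h.b11.trans h'.b11.symm, h.d11.trans h'.d11.symm⟩,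
        Fin.forall_fin_two.2 ⟨h.f11.trans h'.f11.symm, h.h11.trans h'.h11.symm⟩,
        mul_left_cancel₀ two_ne_zero (h.g11.trans h'.g11.symm)⟩
  refine ⟨fun a b k l => ?_, fun a k l => ?_, fun k l => (key k l).2.2⟩
  · obtain ⟨⟨h0, h1, h2⟩, -⟩ := key k l
    exact congrFun₂ (σ.nullComp_symm_injective (S := fun a b => E a b k l)
      (T := fun a b => E' a b k l) (hE k l) (hE' k l) h0 h1 h2) a b
  · exact congrFun (σ.nullComp_injective (v := fun a => F a k l) (w := fun a => F' a k l)
      (key k l).2.1) a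

theorem gradedEv_coeffs (K : 𝒮.Operator2) {p : M} (hp : p ∈ (𝒮.chart i).source) (k l : Fin 2) :
    let 𝒦 := (𝒮.calculus 𝒜 i).coeffs (K.algE i) (K.algF i) (K.algG i)
    let ev := (𝒮.calculus 𝒜 i).gradedEv ⟨p, hp⟩
    ev (𝒦.a k l) = σ.nullComp 0 (fun a => σ.nullComp 0 fun b => γ.toNormal (K.E i a b p) k l) ∧
    ev (𝒦.b k l) = σ.nullComp 0 (fun a => σ.nullComp 1 fun b => γ.toNormal (K.E i a b p) k l) ∧
    ev (𝒦.d k l) = σ.nullComp 1 (fun a => σ.nullComp 1 fun b => γ.toNormal (K.E i a b p) k l) ∧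
    ev (𝒦.f k l) = σ.nullComp 0 (fun a => γ.toNormal (K.F i a p) k l) ∧
    ev (𝒦.h k l) = σ.nullComp 1 (fun a => γ.toNormal (K.F i a p) k l) ∧
    ev (𝒦.g k l) = γ.toNormal (K.G i p) k l := by
  have eE : ∀ a b, evAlg ⟨p, hp⟩ (K.algE i a b k l) = γ.toNormal (K.E i a b p) k l :=
    fun _ _ => rfl
  have eF : ∀ a, evAlg ⟨p, hp⟩ (K.algF i a k l) = γ.toNormal (K.F i a p) k l := fun _ => rfl
  have eG : evAlg ⟨p, hp⟩ (K.algG i k l) = γ.toNormal (K.G i p) k l := rfl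
  refine ⟨?_, ?_, ?_, ?_, ?_, ?_⟩ <;>
    simp only [coeffs, gradedEv_hom_evAlg, compXX, compXY, compYY, evAlg_compX, evAlg_compY, eE, eF,
      eG]

/-- The coefficients have the explicit form if and only if they have it in null components. -/
theorem nullValues_iff (K : 𝒮.Operator2) {p : M} (hp : p ∈ (𝒮.chart i).source)
    (h : LocalDetermining 𝒜 i V e α ζ α₀ p) :
    NullValues (σ := σ) (𝒮.calculus 𝒜 i).toNull ((𝒮.calculus 𝒜 i).gradedEv ⟨p, hp⟩)
      (fun a b => γ.toNormal (K.E i a b p)) (fun a => γ.toNormal (K.F i a p))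
      (γ.toNormal (K.G i p)) (hom 0 (𝒮.potentials i hV hVh 0)) (hom 0 (𝒮.potentials i hV hVh 1))
      (nullFields 𝒜 i e α ζ hα₀ hg') ↔ LocalExplicit 𝒜 i V Vh K e α ζ α₀ g' p := by
  have h0 := nullValues_of_localDetermining 𝒜 i hV hVh e α ζ hα₀ hg' hp h
  constructor
  · intro h1
    obtain ⟨hE, hF, hG⟩ := h1.unique h0 (fun k l => by rw [K.E_symm i 0 1 p hp]) (fun k l => by
      simp only [γ.toNormal_expand, e.symm i 0 1 p hp, one_ne_zero, zero_ne_one, if_true, if_false,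
        add_comm])
    exact ⟨fun a b => by rw [E_eq_expand]; exact γ.toNormal_injective (hE a b),
      fun a => γ.toNormal_injective (hF a), γ.toNormal_injective hG⟩
  · intro h1
    have hE := h1.E_eq
    simp only [E_eq_expand] at hE
    simp only [hE, h1.F_eq, h1.G_eq]
    exact h0

-- Evaluation gives the pointwise statement in one direction. In the other, both sides of each
-- equation are homogeneous of equal weight and are therefore determined by their values.
set_option maxHeartbeats 2000000 in
theorem explicit_nullFields_iff (K : 𝒮.Operator2)
    (hD : ∀ p ∈ 𝒮.dom i, LocalDetermining 𝒜 i V e α ζ α₀ p) :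
    (𝒮.calculus 𝒜 i).toNull.Explicit
      ((𝒮.calculus 𝒜 i).coeffs (K.algE i) (K.algF i) (K.algG i))
      (hom 0 (𝒮.potentials i hV hVh 0)) (hom 0 (𝒮.potentials i hV hVh 1))
      (nullFields 𝒜 i e α ζ hα₀ hg') ↔
    ∀ p ∈ 𝒮.dom i, LocalExplicit 𝒜 i V Vh K e α ζ α₀ g' p := by
  have hev := fun (p : {p // p ∈ (𝒮.chart i).source}) k l => gradedEv_coeffs 𝒜 i K p.2 k l
  simp only [Subtype.coe_eta] at hev
  constructor
  · intro h p hp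
    refine (nullValues_iff 𝒜 i hV hVh e α ζ hα₀ hg' K hp (hD p hp)).1 ?_
    have hev' := fun k l => hev ⟨p, hp⟩ k l
    generalize nullFields 𝒜 i e α ζ hα₀ hg' = T at *
    generalize (𝒮.calculus 𝒜 i).coeffs (K.algE i) (K.algF i) (K.algG i) = 𝒦 at *
    constructor
    · rw [← h.a00, (hev' 0 0).1]
    · rw [← h.a11, (hev' 1 1).1]
    · rw [← h.b00, (hev' 0 0).2.1]
    · rw [← h.b11, (hev' 1 1).2.1]
    · rw [← h.d00, (hev' 0 0).2.2.1]
    · rw [← h.d11, (hev' 1 1).2.2.1]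
    · rw [← h.a01, (hev' 0 1).1]
    · rw [← h.b01, (hev' 0 1).2.1]
    · exact (hev' 0 1).2.2.1.symm.trans (by rw [h.d01, map_zero])
    · exact (hev' 1 0).1.symm.trans (by rw [h.a10, map_zero])
    · rw [← h.b10, (hev' 1 0).2.1]
    · rw [← h.d10, (hev' 1 0).2.2.1]
    · rw [← h.f00, (hev' 0 0).2.2.2.1]
    · rw [← h.f11, (hev' 1 1).2.2.2.1]
    · rw [← h.h00, (hev' 0 0).2.2.2.2.1]
    · rw [← h.h11, (hev' 1 1).2.2.2.2.1]
    · rw [← h.f01, (hev' 0 1).2.2.2.1]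
    · exact (hev' 0 1).2.2.2.2.1.symm.trans (by rw [h.h01, map_zero])
    · exact (hev' 1 0).2.2.2.1.symm.trans (by rw [h.f10, map_zero])
    · rw [← h.h10, (hev' 1 0).2.2.2.2.1]
    · rw [← h.g01, (hev' 0 1).2.2.2.2.2]
    · rw [← h.g10, (hev' 1 0).2.2.2.2.2]
    · rw [← h.g00, map_mul, map_ofNat, (hev' 0 0).2.2.2.2.2]
    · rw [← h.g11, map_mul, map_ofNat, (hev' 1 1).2.2.2.2.2]
  · intro h
    have hN := fun p : {p // p ∈ (𝒮.chart i).source} =>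
      (nullValues_iff 𝒜 i hV hVh e α ζ hα₀ hg' K p.2 (hD p.1 p.2)).2 (h p.1 p.2)
    have hT := isTensor_nullFields 𝒜 i e α ζ hα₀ hg'
    have hK := (𝒮.calculus 𝒜 i).isTensor_coeffs (K.algE i) (K.algF i) (K.algG i)
    have hu := (𝒮.calculus 𝒜 i).tensor_hom 0 (𝒮.potentials i hV hVh 0)
    have hv := (𝒮.calculus 𝒜 i).tensor_hom 0 (𝒮.potentials i hV hVh 1)
    change (𝒮.calculus 𝒜 i).toNull.Tensor 0 (hom 0 _) at hu hv
    generalize nullFields 𝒜 i e α ζ hα₀ hg' = T at *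
    generalize (𝒮.calculus 𝒜 i).coeffs (K.algE i) (K.algF i) (K.algG i) = 𝒦 at *
    generalize hom 0 (𝒮.potentials i hV hVh 0) = u at *
    generalize hom 0 (𝒮.potentials i hV hVh 1) = v at *
    have hΦ := (𝒮.calculus 𝒜 i).toNull.tensor_Φ
    have hR := (𝒮.calculus 𝒜 i).toNull.tensor_R
    have c0 := fun k => (𝒮.calculus 𝒜 i).toNull.tensor_zero (k := k)
    have c2 := (𝒮.calculus 𝒜 i).toNull.tensor_ofNat 2
    have c3 := (𝒮.calculus 𝒜 i).toNull.tensor_ofNat 3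
    have w := @NullCalculus.Tensor.of_weight _ _ _ _ (𝒮.calculus 𝒜 i).toNull
    have huv := hu.sub hv
    have hD : (𝒮.calculus 𝒜 i).toNull.Tensor 0
        (2 * T.g + 3 * (T.P * (𝒮.calculus 𝒜 i).toNull.X (u + v)
          + T.Q * (𝒮.calculus 𝒜 i).toNull.Y (u + v)) + T.al * (u + v)) :=
      ((w (c2.mul hT.g) (by norm_num)).add (w (c3.mul ((w (hT.P.mul (hu.add hv).X)
        (by norm_num : _ = (0 : ℤ))).add (w (hT.Q.mul (hu.add hv).Y) (by norm_num)))) (by norm_num))).add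
        (w (hT.al.mul (hu.add hv)) (by norm_num))
    have hD' : (𝒮.calculus 𝒜 i).toNull.Tensor 0
        ((𝒮.calculus 𝒜 i).toNull.X T.t₁ - T.P * (𝒮.calculus 𝒜 i).toNull.X u
          - 3 * T.P * (𝒮.calculus 𝒜 i).toNull.X v + 2 * (𝒮.calculus 𝒜 i).toNull.Φ * T.b
          - 2 * T.Q * (𝒮.calculus 𝒜 i).toNull.Y v + T.al * (u - v)) :=
      (((((w hT.t₁.X (by norm_num)).sub (w (hT.P.mul hu.X) (by norm_num))).sub
        (w ((c3.mul hT.P).mul hv.X) (by norm_num))).add (w ((c2.mul hΦ).mul hT.b) (by norm_num))).sub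
        (w ((c2.mul hT.Q).mul hv.Y) (by norm_num))).add (w (hT.al.mul huv) (by norm_num))
    have e00 : NullCalculus.entryWeight 0 0 = 0 := rfl
    have e01 : NullCalculus.entryWeight 0 1 = -2 := rfl
    have e10 : NullCalculus.entryWeight 1 0 = 2 := rfl
    have e11 : NullCalculus.entryWeight 1 1 = 0 := rfl
    constructor
    · exact (w (hK.a 0 0) rfl).ext hT.a fun p => (hev p 0 0).1.trans (hN p).a00
    · exact (w (hK.a 1 1) rfl).ext hT.a fun p => (hev p 1 1).1.trans (hN p).a11
    · exact (w (hK.b 0 0) rfl).ext hT.b fun p => (hev p 0 0).2.1.trans (hN p).b00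
    · exact (w (hK.b 1 1) rfl).ext hT.b fun p => (hev p 1 1).2.1.trans (hN p).b11
    · exact (w (hK.d 0 0) rfl).ext hT.d fun p => (hev p 0 0).2.2.1.trans (hN p).d00
    · exact (w (hK.d 1 1) rfl).ext hT.d fun p => (hev p 1 1).2.2.1.trans (hN p).d11
    · exact (w (hK.a 0 1) rfl).ext (w (c2.mul hT.P) (by rfl)) fun p =>
        (hev p 0 1).1.trans (hN p).a01
    · exact (w (hK.b 0 1) rfl).ext hT.Q fun p => (hev p 0 1).2.1.trans (hN p).b01
    · exact (hK.d 0 1).ext (c0 _) fun p =>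
        ((hev p 0 1).2.2.1.trans (hN p).d01).trans (map_zero _).symm
    · exact (hK.a 1 0).ext (c0 _) fun p =>
        ((hev p 1 0).1.trans (hN p).a10).trans (map_zero _).symm
    · exact (w (hK.b 1 0) rfl).ext hT.P fun p => (hev p 1 0).2.1.trans (hN p).b10
    · exact (w (hK.d 1 0) rfl).ext (w (c2.mul hT.Q) (by rfl)) fun p =>
        (hev p 1 0).2.2.1.trans (hN p).d10
    · exact (w (hK.f 0 0) rfl).ext ((hT.t₁.add (w hT.a.X (by rfl))).add
        (w (hT.P.mul huv) (by rfl))) fun p => (hev p 0 0).2.2.2.1.trans (hN p).f00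
    · exact (w (hK.f 1 1) rfl).ext (hT.t₁.sub (w (hT.P.mul huv) (by rfl))) fun p =>
        (hev p 1 1).2.2.2.1.trans (hN p).f11
    · exact (w (hK.h 0 0) rfl).ext (hT.t₂.add (w (hT.Q.mul huv) (by rfl))) fun p =>
        (hev p 0 0).2.2.2.2.1.trans (hN p).h00
    · exact (w (hK.h 1 1) rfl).ext ((hT.t₂.add (w hT.d.Y (by rfl))).sub
        (w (hT.Q.mul huv) (by rfl))) fun p => (hev p 1 1).2.2.2.2.1.trans (hN p).h11
    · exact (w (hK.f 0 1) rfl).ext (hT.al.add (w hT.P.X (by rfl))) fun p =>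
        (hev p 0 1).2.2.2.1.trans (hN p).f01
    · exact (hK.h 0 1).ext (c0 _) fun p =>
        ((hev p 0 1).2.2.2.2.1.trans (hN p).h01).trans (map_zero _).symm
    · exact (hK.f 1 0).ext (c0 _) fun p =>
        ((hev p 1 0).2.2.2.1.trans (hN p).f10).trans (map_zero _).symm
    · exact (w (hK.h 1 0) rfl).ext (hT.al.sub (w hT.P.X (by rfl))) fun p =>
        (hev p 1 0).2.2.2.2.1.trans (hN p).h10
    · exact (w (hK.g 0 1) e01).ext ((((w (hΦ.neg.mul hT.Q) (by rfl)).sub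
        (w (hR.mul hT.Q) (by rfl))).add (w ((c2.mul hT.b).mul hv.X) (by rfl))).add
        (w ((c2.mul hT.d).mul hv.Y) (by rfl))) fun p =>
        (hev p 0 1).2.2.2.2.2.trans (hN p).g01
    · exact (w (hK.g 1 0) e10).ext ((((w (hΦ.mul hT.P) (by rfl)).sub
        (w (hR.mul hT.P) (by rfl))).add (w ((c2.mul hT.a).mul hu.X) (by rfl))).add
        (w ((c2.mul hT.b).mul hu.Y) (by rfl))) fun p =>
        (hev p 1 0).2.2.2.2.2.trans (hN p).g10
    · exact (w (c2.mul (hK.g 0 0)) (by rw [e00]; rfl)).ext (hD.add hD') fun p => by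
        rw [map_mul, map_ofNat]
        exact (congrArg (2 * ·) (hev p 0 0).2.2.2.2.2).trans (hN p).g00
    · exact (w (c2.mul (hK.g 1 1)) (by rw [e11]; rfl)).ext (hD.sub hD') fun p => by
        rw [map_mul, map_ofNat]
        exact (congrArg (2 * ·) (hev p 1 1).2.2.2.2.2).trans (hN p).g11

end SpinManifold

/-! ### The integrability conditions -/

namespace FrameCalculus

variable {σ : Signature} {C : Type*} [CommRing C] [Algebra ℂ C] {ι : Type*}
  (𝓕 : FrameCalculus σ C ι)

/-- `∇_a v^b`. -/
def nabla1 (a : Fin 2) (v : Fin 2 → C) (b : Fin 2) : C :=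
  𝓕.δ a (v b) + ∑ d, 𝓕.conn b d a * v d

/-- `∇_a T^{bc}`. -/
def nabla2 (a : Fin 2) (T : Fin 2 → Fin 2 → C) (b c : Fin 2) : C :=
  𝓕.δ a (T b c) + ∑ d, (𝓕.conn b d a * T d c + 𝓕.conn c d a * T b d)

/-- `∇_a U^{bcd}`. -/
def nabla3 (a : Fin 2) (U : Fin 2 → Fin 2 → Fin 2 → C) (b c d : Fin 2) : C :=
  𝓕.δ a (U b c d) + ∑ k, (𝓕.conn b k a * U k c d + 𝓕.conn c k a * U b k d
    + 𝓕.conn d k a * U b c k)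

/-- `∇^c v^a + ∇^a v^c`. -/
def deformation (v : Fin 2 → C) (c a : Fin 2) : C :=
  σ.sgn c • 𝓕.nabla1 c v a + σ.sgn a • 𝓕.nabla1 a v c

set_option maxHeartbeats 4000000 in
/-- The derivative of the curvature along a vector field in terms of its deformation tensor. -/
theorem sum_mul_δ_curl (v : Fin 2 → C) :
    ∑ a, v a * 𝓕.δ a ((2 : ℂ) • 𝓕.curl 𝓕.W) =
      σ.det • (∑ c, ∑ b, ∑ d, ∑ a, (σ.epsMixed c d * eps a b) •
        𝓕.nabla3 c (fun b' d' a' => σ.sgn b' • 𝓕.nabla2 b' (𝓕.deformation v) d' a') b d a)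
      - 𝓕.curl 𝓕.W * ∑ c, ∑ a, σ.eta c a • 𝓕.deformation v c a := by
  -- Used as a rewriting rule, the torsion relation puts iterated frame derivatives in a fixed
  -- order. In each signature the claim is then an identity in a commutative ring.
  have ht : ∀ f, 𝓕.δ 0 (𝓕.δ 1 f) = 𝓕.δ 1 (𝓕.δ 0 f)
      + (σ.sgn 1 • (𝓕.W 0 * 𝓕.δ 0 f) + σ.sgn 0 • (𝓕.W 1 * 𝓕.δ 1 f)) := fun f => by
    rw [← 𝓕.torsion f]; ring
  have e00 : eps 0 0 = 0 := rfl
  have e01 : eps 0 1 = 1 := rfl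
  have e10 : eps 1 0 = -1 := rfl
  have e11 : eps 1 1 = 0 := rfl
  simp only [Fin.sum_univ_two, Signature.epsMixed, Signature.eta, Signature.det, e00, e01, e10, e11,
    nabla3, nabla2, deformation, nabla1, conn, curl, Fin.isValue, if_true,
    if_neg (zero_ne_one (α := Fin 2)), if_neg (one_ne_zero (α := Fin 2)), Matrix.of_apply,
    Matrix.cons_val', Matrix.cons_val_zero, Matrix.cons_val_one, Matrix.cons_val_fin_one,
    mul_zero, zero_mul, zero_smul, add_zero, zero_add, mul_one]
  rcases sgn_eq σ 0 with h0 | h0 <;> rcases sgn_eq σ 1 with h1 | h1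
  all_goals
    simp only [h0, h1, one_smul, neg_smul, smul_neg, mul_one, one_mul, neg_mul, mul_neg, neg_neg,
      neg_zero, two_smul] at ht ⊢
    simp only [map_add, map_sub, map_neg, Derivation.leibniz, smul_eq_mul, ht]
    ring

end FrameCalculus

namespace SpinManifold

open FrameCalculus

variable {M : Type*} [TopologicalSpace M] [ChartedSpace Plane M] [IsManifold (𝓡 2) ∞ M]
  {σ : Signature} {γ : DiracMatrices σ} {ι : Type*} {𝒮 : SpinManifold M γ ι}
  {q : ℝ} (𝒜 : 𝒮.Potential q) (i : ι)

theorem grad_congr {f g : M → ℂ} (h : ∀ r ∈ (𝒮.chart i).source, f r = g r) (a : Fin 2) {p : M}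
    (hp : p ∈ (𝒮.chart i).source) : 𝒮.grad i a f p = 𝒮.grad i a g p := by
  simp only [grad, pd_congr h _ hp]

theorem nablaCo_congr {v w : Fin 2 → M → ℂ} (h : ∀ r ∈ (𝒮.chart i).source, ∀ a, v a r = w a r)
    (a b : Fin 2) {p : M} (hp : p ∈ (𝒮.chart i).source) :
    𝒮.nablaCo i a v b p = 𝒮.nablaCo i a w b p := by
  simp only [nablaCo, grad_congr i (fun r hr => h r hr b) a hp, h p hp]

/-- The gradient of a function is curl-free. -/
theorem sum_epsUp_mul_nablaCo {q : ℝ} (𝒜 : 𝒮.Potential q) (i : ι) {f : M → ℂ} (hf : ContMDiff (𝓡 2) 𝓘(ℝ, ℂ) ∞ f) {w : Fin 2 → M → ℂ}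
    (h : ∀ r ∈ (𝒮.chart i).source, ∀ a, 𝒮.grad i a f r = w a r) {p : M}
    (hp : p ∈ (𝒮.chart i).source) : ∑ b, ∑ c, σ.epsUp b c * 𝒮.nablaCo i b w c p = 0 := by
  have e : ∀ b c, 𝒮.nablaCo i b w c p = 𝒮.hess i b c f p := fun b c =>
    (nablaCo_congr i h b c hp).symm
  simp only [e, Fin.sum_univ_two, Signature.epsUp, eps_00, eps_01, eps_10, eps_11,
    hess_symm 𝒜 i hp hf]
  ring

theorem smoothIn_fieldStrength : SmoothIn (𝒮.chart i) (𝒮.fieldStrength 𝒜 i) :=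
  SmoothIn.ofReal (SmoothIn.sum fun μ _ => SmoothIn.sum fun ν _ =>
    ((𝒮.smoothIn_frame i 0 μ).mul (𝒮.smoothIn_frame i 1 ν)).mul
      (((((𝒮.smoothIn_iff i).2 (𝒜.A_smooth i ν))).pd μ).sub
        (((𝒮.smoothIn_iff i).2 (𝒜.A_smooth i μ)).pd ν)))

/-- The curl of `F ε_{cd} α^d` is up to sign the divergence of `F α^d`, and a Killing vector is
divergence-free, so only `α^c ∇_c F` survives beside the curl of `e_c{}^d ∇_d V`. -/
theorem mul_sum_grad_fieldStrength {V : M → ℂ} (hV : ContMDiff (𝓡 2) 𝓘(ℝ, ℂ) ∞ V)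
    (e : 𝒮.SymTensorField) (α : 𝒮.VectorField) {p : M} (hp : p ∈ (𝒮.chart i).source)
    (hα : ∀ a b, (1 / 2) * (𝒮.nabla1Up i a (α.val i) b p + 𝒮.nabla1Up i b (α.val i) a p) = 0)
    (hω : ∑ b, ∑ c, σ.epsUp b c * 𝒮.nablaCo i b (𝒮.omega 𝒜 V e α i) c p = 0) :
    q * ∑ c, α.val i c p * 𝒮.grad i c (𝒮.fieldStrength 𝒜 i) p =
      -(σ.det * ∑ a, ∑ c, σ.epsUp a c *
        𝒮.nablaCo i c (fun d r => ∑ b, σ.sgn d * e.val i d b r * 𝒮.grad i b V r) a p) := by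
  have hF := rep_toAlg (smoothIn_fieldStrength 𝒜 i)
  -- The covector `e_d{}^b ∇_b V` is kept opaque: it occurs identically on both sides and its
  -- derivatives need not be expanded.
  obtain ⟨Y, hY⟩ : ∃ Y : Fin 2 → 𝒮.Alg i, ∀ d,
      Rep (𝒮.chart i) (fun r => ∑ b, σ.sgn d * e.val i d b r * 𝒮.grad i b V r) (Y d) :=
    ⟨_, fun d => Rep.sum fun b _ => (Rep.smul (rep_toAlg ((𝒮.smoothIn_iff i).2 (e.smooth i d b)))
      _).mul (Rep.grad 𝒮 𝒜 i (rep_toAlg ((𝒮.smoothIn_iff i).2 hV.contMDiffOn)) b)⟩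
  have hR : ∀ c, Rep (𝒮.chart i) (𝒮.omega 𝒜 V e α i c) ((2 * Complex.I) •
      ((∑ d, ((q : ℂ) • (smoothIn_fieldStrength 𝒜 i).toAlg) * algebraMap ℂ _ (eps c d) * α.alg i d)
      + Y c)) := fun c =>
    Rep.smul (Rep.add (Rep.sum fun d _ => ((hF.smul q).mul fun _ _ => rfl).mul
      (rep_toAlg ((𝒮.smoothIn_iff i).2 (α.smooth i d)))) (hY c)) _
  have hg := fun b c => ((Rep.grad 𝒮 𝒜 i (hR c) b).ev hp).symm
  have hgY := fun b c => ((Rep.grad 𝒮 𝒜 i (hY c) b).ev hp).symm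
  have hgF := fun a => (Rep.grad 𝒮 𝒜 i hF a).ev hp
  have hω' := fun c => ((hR c).ev hp).symm
  have hY' := fun c => ((hY c).ev hp).symm
  have hF' := hF.ev hp
  have h00 := hα 0 0
  have h01 := hα 0 1
  have h11 := hα 1 1
  obtain ⟨c0, c1, c2, c3⟩ := 𝒮.conn_eq 𝒜 i 0 hp
  obtain ⟨d0, d1, d2, d3⟩ := 𝒮.conn_eq 𝒜 i 1 hp
  simp only [Fin.sum_univ_two] at hgY hY'
  simp only [nablaCo, hg, hgY, hω', hY', Fin.sum_univ_two, c0, c1, c2, c3, d0, d1, d2, d3,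
    Derivation.map_smul, map_add, map_smul, Derivation.leibniz, smul_eq_mul, map_mul,
    Derivation.map_algebraMap, AlgHom.commutes, hgF, evAlg_δ_alg, evAlg_alg, hF',
    eps_00, eps_01, eps_10, eps_11, Signature.epsUp, map_one, map_neg, map_zero, nabla1Up, nabla1,
    Signature.det] at hω h00 h01 h11 ⊢
  generalize evAlg ⟨p, hp⟩ (Y 0) = Y0 at *
  clear hg hgY hgF hω' hY' hF' hα c0 c1 c2 c3 d0 d1 d2 d3 hR hY
  rcases FrameCalculus.sgn_eq σ 0 with s0 | s0 <;> rcases FrameCalculus.sgn_eq σ 1 with s1 | s1 <;>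
    simp only [s0, s1] at hω h00 h01 h11 ⊢ <;>
    linear_combination (norm := (simp only [s0, s1]; ring_nf; simp only [Complex.I_sq]; ring))
      σ.sgn 0 * σ.sgn 1 * Complex.I / 2 * hω
        - q * 𝒮.fieldStrength 𝒜 i p * (σ.sgn 0 * h00 + σ.sgn 1 * h11)

end SpinManifold

namespace SpinManifold

open FrameCalculus

variable {M : Type*} [TopologicalSpace M] [ChartedSpace Plane M] [IsManifold (𝓡 2) ∞ M]
  {σ : Signature} {γ : DiracMatrices σ} {ι : Type*} {𝒮 : SpinManifold M γ ι}
  {q : ℝ} (𝒜 : 𝒮.Potential q) {i : ι}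

theorem rep_nabla1 {v : Fin 2 → M → ℂ} {v' : Fin 2 → 𝒮.Alg i}
    (h : ∀ b, Rep (𝒮.chart i) (v b) (v' b)) (a b : Fin 2) :
    Rep (𝒮.chart i) (𝒮.nabla1 i a v b) ((𝒮.calculus 𝒜 i).nabla1 a v' b) :=
  (Rep.grad 𝒮 𝒜 i (h b) a).add (Rep.sum fun d _ => (rep_conn 𝒜 b d a).mul (h d))

theorem rep_nabla2 {T : Fin 2 → Fin 2 → M → ℂ} {T' : Fin 2 → Fin 2 → 𝒮.Alg i}
    (h : ∀ b c, Rep (𝒮.chart i) (T b c) (T' b c)) (a b c : Fin 2) :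
    Rep (𝒮.chart i) (𝒮.nabla2 i a T b c) ((𝒮.calculus 𝒜 i).nabla2 a T' b c) :=
  (Rep.grad 𝒮 𝒜 i (h b c) a).add (Rep.sum fun d _ =>
    ((rep_conn 𝒜 b d a).mul (h d c)).add ((rep_conn 𝒜 c d a).mul (h b d)))

theorem rep_nabla3 {U : Fin 2 → Fin 2 → Fin 2 → M → ℂ} {U' : Fin 2 → Fin 2 → Fin 2 → 𝒮.Alg i}
    (h : ∀ b c d, Rep (𝒮.chart i) (U b c d) (U' b c d)) (a b c d : Fin 2) :
    Rep (𝒮.chart i) (𝒮.nabla3 i a U b c d) ((𝒮.calculus 𝒜 i).nabla3 a U' b c d) :=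
  (Rep.grad 𝒮 𝒜 i (h b c d) a).add (Rep.sum fun k _ =>
    (((rep_conn 𝒜 b k a).mul (h k c d)).add ((rep_conn 𝒜 c k a).mul (h b k d))).add
      ((rep_conn 𝒜 d k a).mul (h b c k)))

/-- The algebraic identity `sum_mul_δ_curl` read on functions. `L` needs to agree with the
deformation tensor of `ζ` on the chart domain only, which allows `Λ^{ca}` to be substituted. -/
theorem sum_mul_grad_scalarCurv {q : ℝ} (𝒜 : 𝒮.Potential q) (ζ : 𝒮.VectorField) {L : Fin 2 → Fin 2 → M → ℂ}
    (hL : ∀ p ∈ (𝒮.chart i).source, ∀ c a,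
      𝒮.nabla1Up i c (ζ.val i) a p + 𝒮.nabla1Up i a (ζ.val i) c p = L c a p)
    {p : M} (hp : p ∈ (𝒮.chart i).source) :
    ∑ a, ζ.val i a p * 𝒮.grad i a (𝒮.scalarCurv i) p =
      σ.det * (∑ c, ∑ b, ∑ d, ∑ a,
        𝒮.nabla3 i c (fun b' d' a' => 𝒮.nabla2Up i b' L d' a') b d a p *
          σ.epsMixed c d * eps a b)
      - 𝒮.scalarCurv i p / 2 * ∑ c, ∑ a, σ.eta c a * L c a p := by
  have hζ : ∀ b, Rep (𝒮.chart i) (ζ.val i b) (ζ.alg i b) := fun b => rep_toAlg _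
  have hL' : ∀ c a, Rep (𝒮.chart i) (L c a) ((𝒮.calculus 𝒜 i).deformation (ζ.alg i) c a) :=
    fun c a p hp => by
      rw [← hL p hp]
      exact ((rep_nabla1 𝒜 hζ c a).smul (σ.sgn c)).add ((rep_nabla1 𝒜 hζ a c).smul (σ.sgn a)) p hp
  have h3 := fun c b d a => (rep_nabla3 𝒜 (fun b d a => (rep_nabla2 𝒜 hL' b d a).smul (σ.sgn b))
    c b d a).ev hp
  have hR := fun a => (Rep.grad 𝒮 𝒜 i (rep_scalarCurv 𝒜 i) a).ev hp
  have h := congrArg (evAlg ⟨p, hp⟩) ((𝒮.calculus 𝒜 i).sum_mul_δ_curl (ζ.alg i))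
  simp only [map_sub, map_sum, map_mul, map_smul, hR, smul_eq_mul, fun c a => (hL' c a).ev hp,
    evAlg_curl_W, evAlg_alg] at h
  rw [h]
  congr 2
  refine Finset.sum_congr rfl fun c _ => Finset.sum_congr rfl fun b _ =>
    Finset.sum_congr rfl fun d _ => Finset.sum_congr rfl fun a _ => ?_
  rw [h3, mul_comm, mul_assoc]
  rfl

variable {V Vh : M → ℂ} {e : 𝒮.SymTensorField} {α ζ : 𝒮.VectorField} {α₀ g' : M → ℂ}

/-- The integrability conditions follow from the determining equations and the last two of them. -/
theorem integrabilityConditions (hV : ContMDiff (𝓡 2) 𝓘(ℝ, ℂ) ∞ V)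
    (hα₀ : ContMDiff (𝓡 2) 𝓘(ℝ, ℂ) ∞ α₀) (hg' : ContMDiff (𝓡 2) 𝓘(ℝ, ℂ) ∞ g')
    (hD : ∀ i, ∀ p ∈ 𝒮.dom i, LocalDetermining 𝒜 i V e α ζ α₀ p)
    (hF : ∀ i, ∀ p ∈ 𝒮.dom i, LocalFinal 𝒜 i V Vh e α ζ g' p) :
    𝒮.IntegrabilityConditions 𝒜 V Vh e α ζ where
  curl_omega i _ hp := sum_epsUp_mul_nablaCo 𝒜 i hα₀ (fun r hr => (hD i r hr).grad_α₀) hp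
  grad_F i p hp := mul_sum_grad_fieldStrength 𝒜 i hV e α hp (hD i p hp).killing_vector
    (sum_epsUp_mul_nablaCo 𝒜 i hα₀ (fun r hr => (hD i r hr).grad_α₀) hp)
  curl_Lambda i _ hp := sum_epsUp_mul_nablaCo 𝒜 i hg' (fun r hr => (hF i r hr).grad_g') hp
  grad_R i _ hp := sum_mul_grad_scalarCurv 𝒜 ζ
    (fun r hr c a => mul_left_cancel₀ (by norm_num) ((hD i r hr).sym_grad_ζ c a)) hp
  grad_V i p hp := (hF i p hp).grad_V
  grad_Vh i p hp := (hF i p hp).grad_Vh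

end SpinManifold

/-! ### Changes of trivialisation -/

theorem differentiableAt_transition {M : Type*} [TopologicalSpace M] [ChartedSpace Plane M]
    [IsManifold (𝓡 2) ∞ M] {φ χ : OpenPartialHomeomorph M Plane}
    (hφ : φ ∈ IsManifold.maximalAtlas (𝓡 2) ∞ M) (hχ : χ ∈ IsManifold.maximalAtlas (𝓡 2) ∞ M)
    {p : M} (hp : p ∈ φ.source) (hp' : p ∈ χ.source) :
    DifferentiableAt ℝ (fun x => χ (φ.symm x)) (φ p) := by
  have h1 := (contMDiffOn_of_mem_maximalAtlas hχ).contMDiffAt (χ.open_source.mem_nhds hp')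
  have h2 := (contMDiffOn_symm_of_mem_maximalAtlas hφ).contMDiffAt
    (φ.open_target.mem_nhds (φ.map_source hp))
  rw [← φ.left_inv hp] at h1
  exact (contMDiffAt_iff_contDiffAt.1 (h1.comp (φ p) h2)).differentiableAt (by simp)

/-- The chain rule for a change of coordinates. -/
theorem pd_eq_sum_jac {M : Type*} [TopologicalSpace M] [ChartedSpace Plane M]
    [IsManifold (𝓡 2) ∞ M] {φ χ : OpenPartialHomeomorph M Plane}
    (hφ : φ ∈ IsManifold.maximalAtlas (𝓡 2) ∞ M) (hχ : χ ∈ IsManifold.maximalAtlas (𝓡 2) ∞ M)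
    {f : M → ℂ} (hf : SmoothIn χ f) (ν : Fin 2) {p : M} (hp : p ∈ φ.source) (hp' : p ∈ χ.source) :
    pd φ ν f p = ∑ μ, (jac φ χ μ ν p : ℂ) * pd χ μ f p := by
  have hd := differentiableAt_transition hφ hχ hp hp'
  have h : (fun x => f (φ.symm x)) =ᶠ[nhds (φ p)] fun x => (f ∘ χ.symm) (χ (φ.symm x)) := by
    have hc := (φ.continuousAt_symm (φ.map_source hp)).preimage_mem_nhds
      (χ.open_source.mem_nhds (by rwa [φ.left_inv hp]))
    filter_upwards [hc] with x hx
    simp [χ.left_inv hx]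
  have hf' : DifferentiableAt ℝ (f ∘ χ.symm) (χ (φ.symm (φ p))) := by
    rw [φ.left_inv hp]; exact hf.differentiableAt hp'
  have hj : ∀ μ, jac φ χ μ ν p =
      (fderiv ℝ (fun x => χ (φ.symm x)) (φ p) (EuclideanSpace.single ν 1)) μ := by
    intro μ
    have := (EuclideanSpace.proj (𝕜 := ℝ) μ : Plane →L[ℝ] ℝ).hasFDerivAt.comp (φ p) hd.hasFDerivAt
    exact congrArg (fun l : Plane →L[ℝ] ℝ => l (EuclideanSpace.single ν 1)) this.fderiv
  rw [pd, h.fderiv_eq]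
  change fderiv ℝ ((f ∘ χ.symm) ∘ fun x => χ (φ.symm x)) (φ p) _ = _
  rw [fderiv_comp (φ p) hf' hd, φ.left_inv hp]
  simp only [hj]
  generalize fderiv ℝ (fun x => χ (φ.symm x)) (φ p) = l
  rw [ContinuousLinearMap.comp_apply]
  generalize l (EuclideanSpace.single ν 1) = w
  have hw : w = ∑ μ, w μ • EuclideanSpace.single μ (1 : ℝ) := by
    ext k
    fin_cases k <;> simp [Fin.sum_univ_two]
  conv_lhs => rw [hw, map_sum]
  refine Finset.sum_congr rfl fun μ _ => ?_
  rw [map_smul, Complex.real_smul]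
  rfl

namespace SpinManifold

variable {M : Type*} [TopologicalSpace M] [ChartedSpace Plane M]
  {σ : Signature} {γ : DiracMatrices σ} {ι : Type*} {𝒮 : SpinManifold M γ ι} {i j : ι}

theorem spinT_mul_spinT {p : M} (hp : p ∈ 𝒮.dom i ∩ 𝒮.dom j) :
    𝒮.spinT i j p * 𝒮.spinT j i p = 1 := by
  rw [𝒮.spinT_cocycle i j i p ⟨hp, hp.1⟩, 𝒮.spinT_self i p hp.1]

theorem sum_rot_low {p : M} (hp : p ∈ 𝒮.dom i ∩ 𝒮.dom j) (a : Fin 2) :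
    ∑ b, (𝒮.rot i j p a b : ℂ) • γ.low b = 𝒮.spinT j i p * γ.low a * 𝒮.spinT i j p := by
  rw [← 𝒮.rot_spec i j p hp a, Matrix.inv_eq_right_inv (spinT_mul_spinT hp)]

/-- Conjugation by `S` preserves the Clifford relations. Expanding the anticommutator of two
conjugated Dirac matrices and comparing one diagonal entry shows that `ℓ` preserves `η`. -/
theorem sum_rot_mul_rot {p : M} (hp : p ∈ 𝒮.dom i ∩ 𝒮.dom j) (a b : Fin 2) :
    ∑ c, σ.sgn c * (𝒮.rot i j p a c : ℂ) * (𝒮.rot i j p b c : ℂ) = σ.eta a b := by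
  have h := congrArg₂ (· + ·) (congrArg₂ (· * ·) (sum_rot_low hp a) (sum_rot_low hp b))
    (congrArg₂ (· * ·) (sum_rot_low hp b) (sum_rot_low hp a))
  have h1 := spinT_mul_spinT hp
  have h2 := spinT_mul_spinT (𝒮 := 𝒮) (i := j) (j := i) hp.symm
  have e : ∀ A B, 𝒮.spinT j i p * A * 𝒮.spinT i j p * (𝒮.spinT j i p * B * 𝒮.spinT i j p) =
      𝒮.spinT j i p * (A * B) * 𝒮.spinT i j p := fun A B => by
    simp only [mul_assoc]
    rw [← mul_assoc (𝒮.spinT i j p), h1, one_mul]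
  simp only [e] at h
  rw [← add_mul, ← mul_add, γ.clifford, Matrix.mul_smul, mul_one, Matrix.smul_mul, h2] at h
  have c00 := γ.clifford 0 0
  have c01 := γ.clifford 0 1
  have c11 := γ.clifford 1 1
  have h' := congrFun (congrFun h 0) 0
  have c00' := congrFun (congrFun c00 0) 0
  have c01' := congrFun (congrFun c01 0) 0
  have c11' := congrFun (congrFun c11 0) 0
  simp [Signature.eta, Matrix.mul_apply] at c00' c01' c11'
  simp [Fin.sum_univ_two, Matrix.mul_apply] at h' ⊢
  generalize γ.low 0 = A at *
  generalize γ.low 1 = B at *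
  generalize (𝒮.rot i j p a 0 : ℂ) = a0 at *
  generalize (𝒮.rot i j p a 1 : ℂ) = a1 at *
  generalize (𝒮.rot i j p b 0 : ℂ) = b0 at *
  generalize (𝒮.rot i j p b 1 : ℂ) = b1 at *
  linear_combination h' / 2 - a0 * b0 / 2 * c00' - (a0 * b1 + a1 * b0) / 2 * c01'
    - a1 * b1 / 2 * c11'

/-- The orthogonality of rows exhibits a right inverse of `ℓ`; a right inverse of a square matrix is
a left inverse, which is the orthogonality of columns. -/
theorem sum_sgn_rot_mul_rot {p : M} (hp : p ∈ 𝒮.dom i ∩ 𝒮.dom j) (b c : Fin 2) :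
    ∑ a, σ.sgn a * (𝒮.rot i j p a b : ℂ) * (𝒮.rot i j p a c : ℂ) = σ.eta b c := by
  have h : (Matrix.of fun a b => (𝒮.rot i j p a b : ℂ)) *
      (Matrix.of fun b a => σ.sgn b * (𝒮.rot i j p a b : ℂ) * σ.sgn a) = 1 := by
    ext a b
    have h := sum_rot_mul_rot hp a b
    simp only [Matrix.mul_apply, Matrix.of_apply, Matrix.one_apply, Signature.eta,
      Fin.sum_univ_two] at h ⊢
    have hb := σ.sgn_mul_self b
    have := congrArg (· * σ.sgn b) h
    split_ifs at this ⊢ with hab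
    · subst hab; simp only [hb] at this; rw [← this]; ring
    · simp only [zero_mul] at this; rw [← this]; ring
  have h' := congrArg (fun A : Matrix (Fin 2) (Fin 2) ℂ => A b c) (mul_eq_one_comm.1 h)
  have hb := σ.sgn_mul_self b
  simp only [Matrix.mul_apply, Matrix.of_apply, Matrix.one_apply, Signature.eta,
      Fin.sum_univ_two] at h' ⊢
  have := congrArg (σ.sgn b * ·) h'
  split_ifs at this ⊢ with hab
  · simp only [mul_one] at this; rw [← this]
    linear_combination -(σ.sgn 0 * (𝒮.rot i j p 0 b : ℂ) * (𝒮.rot i j p 0 c : ℂ)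
      + σ.sgn 1 * (𝒮.rot i j p 1 b : ℂ) * (𝒮.rot i j p 1 c : ℂ)) * hb
  · simp only [mul_zero] at this; rw [← this]
    linear_combination -(σ.sgn 0 * (𝒮.rot i j p 0 b : ℂ) * (𝒮.rot i j p 0 c : ℂ)
      + σ.sgn 1 * (𝒮.rot i j p 1 b : ℂ) * (𝒮.rot i j p 1 c : ℂ)) * hb

/-- The transformation law of the gradient. -/
theorem grad_trans [IsManifold (𝓡 2) ∞ M] {f : M → ℂ} (hf : SmoothIn (𝒮.chart i) f)
    {p : M} (hp : p ∈ 𝒮.dom i ∩ 𝒮.dom j) (a : Fin 2) :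
    𝒮.grad i a f p = ∑ b, (𝒮.rot i j p a b : ℂ) * 𝒮.grad j b f p := by
  simp only [grad, 𝒮.frame_trans i j p hp, pd_eq_sum_jac (𝒮.chart_mem j) (𝒮.chart_mem i) hf _
    hp.2 hp.1, Fin.sum_univ_two]
  push_cast
  ring

end SpinManifold

/-! ### The tensor fields of a second order operator -/

namespace SpinManifold

variable {M : Type*} [TopologicalSpace M] [ChartedSpace Plane M]
  {σ : Signature} {γ : DiracMatrices σ} {ι : Type*} {𝒮 : SpinManifold M γ ι} {i j : ι}

theorem exists_contMDiff_of_local {f : ι → M → ℂ}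
    (hf : ∀ i, ContMDiffOn (𝓡 2) 𝓘(ℝ, ℂ) ∞ (f i) (𝒮.dom i))
    (h : ∀ i j, ∀ p ∈ 𝒮.dom i ∩ 𝒮.dom j, f i p = f j p) :
    ∃ g : M → ℂ, ContMDiff (𝓡 2) 𝓘(ℝ, ℂ) ∞ g ∧ ∀ i, ∀ p ∈ 𝒮.dom i, g p = f i p := by
  choose k hk using 𝒮.cover
  have hg : ∀ i, ∀ p ∈ 𝒮.dom i, f (k p) p = f i p := fun i p hp => h _ _ p ⟨hk p, hp⟩
  refine ⟨fun p => f (k p) p, fun p => ?_, hg⟩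
  have ho := (𝒮.chart (k p)).open_source.mem_nhds (hk p)
  exact ((hf (k p)).contMDiffAt ho).congr_of_eventuallyEq (Filter.mem_of_superset ho (hg (k p)))

theorem eq_spinT_mul {p : M} (hp : p ∈ 𝒮.dom i ∩ 𝒮.dom j) {A B : Matrix (Fin 2) (Fin 2) ℂ}
    (h : 𝒮.spinT i j p * A = B * 𝒮.spinT i j p) : A = 𝒮.spinT j i p * B * 𝒮.spinT i j p := by
  rw [mul_assoc, ← h, ← mul_assoc, spinT_mul_spinT hp.symm, one_mul]

theorem trace_spinT_mul {p : M} (hp : p ∈ 𝒮.dom i ∩ 𝒮.dom j) (A : Matrix (Fin 2) (Fin 2) ℂ) :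
    (𝒮.spinT j i p * A * 𝒮.spinT i j p).trace = A.trace := by
  rw [Matrix.trace_mul_comm, ← mul_assoc, spinT_mul_spinT hp, one_mul]

/-- The trace is invariant under conjugation, while conjugating `γ_b` rotates its index by `ℓ`.
Hence traces of `γ_b` against the coefficients of an operator are tensors. -/
theorem trace_low_mul {p : M} (hp : p ∈ 𝒮.dom i ∩ 𝒮.dom j) (b : Fin 2)
    (A : Matrix (Fin 2) (Fin 2) ℂ) : (γ.low b * A).trace =
      ∑ d, (𝒮.rot i j p b d : ℂ) * (γ.low d * (𝒮.spinT j i p * A * 𝒮.spinT i j p)).trace := by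
  have h : ∑ d, (𝒮.rot i j p b d : ℂ) * (γ.low d * (𝒮.spinT j i p * A * 𝒮.spinT i j p)).trace =
      ((∑ d, (𝒮.rot i j p b d : ℂ) • γ.low d) *
        (𝒮.spinT j i p * A * 𝒮.spinT i j p)).trace := by
    simp only [Finset.sum_mul, Matrix.trace_sum, Matrix.smul_mul, Matrix.trace_smul, smul_eq_mul]
  rw [h, sum_rot_low hp, ← trace_spinT_mul hp (γ.low b * A)]
  congr 1
  simp only [mul_assoc]
  rw [← mul_assoc (𝒮.spinT i j p) (𝒮.spinT j i p), spinT_mul_spinT hp, one_mul]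

/-- The scalar product of a vector field and the gradient of a function is invariant. -/
theorem sum_mul_grad_trans [IsManifold (𝓡 2) ∞ M] (v : 𝒮.VectorField) {f : M → ℂ}
    (hf : ContMDiff (𝓡 2) 𝓘(ℝ, ℂ) ∞ f) {p : M} (hp : p ∈ 𝒮.dom i ∩ 𝒮.dom j) :
    ∑ a, v.val i a p * 𝒮.grad i a f p = ∑ a, v.val j a p * 𝒮.grad j a f p := by
  simp only [grad_trans ((𝒮.smoothIn_iff i).2 hf.contMDiffOn) hp, v.trans i j p hp,
    Fin.sum_univ_two]
  ring

section

variable [IsManifold (𝓡 2) ∞ M]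

theorem smoothIn_trace_mul {A : M → Matrix (Fin 2) (Fin 2) ℂ}
    (hA : ∀ k l, ContMDiffOn (𝓡 2) 𝓘(ℝ, ℂ) ∞ (fun p => A p k l) (𝒮.dom i))
    (B : Matrix (Fin 2) (Fin 2) ℂ) : SmoothIn (𝒮.chart i) fun p => (B * A p).trace :=
  SmoothIn.sum fun k _ => SmoothIn.sum (s := Finset.univ) (f := fun l p => B k l * A p l k)
    fun l _ => (SmoothIn.const (B k l)).mul ((𝒮.smoothIn_iff i).2 (hA l k))

theorem smoothIn_trace {A : M → Matrix (Fin 2) (Fin 2) ℂ}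
    (hA : ∀ k l, ContMDiffOn (𝓡 2) 𝓘(ℝ, ℂ) ∞ (fun p => A p k l) (𝒮.dom i)) :
    SmoothIn (𝒮.chart i) fun p => (A p).trace :=
  SmoothIn.sum fun k _ => (𝒮.smoothIn_iff i).2 (hA k k)

theorem smoothIn_grad {f : M → ℂ} (hf : SmoothIn (𝒮.chart i) f) (a : Fin 2) :
    SmoothIn (𝒮.chart i) (𝒮.grad i a f) :=
  SmoothIn.sum fun μ _ => (𝒮.smoothIn_frame i a μ).ofReal.mul (hf.pd μ)

namespace Operator2

/-- The tensor field `e^{ab} = ½ tr 𝔼^{ab}`. -/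
def symTensor (K : 𝒮.Operator2) : 𝒮.SymTensorField where
  val i a b p := 1 / 2 * (K.E i a b p).trace
  smooth i a b := (𝒮.smoothIn_iff i).1 ((SmoothIn.const _).mul (smoothIn_trace (K.E_smooth i a b)))
  symm i a b p hp := by rw [K.E_symm i a b p hp]
  trans i j p hp c d := by
    rw [eq_spinT_mul hp (K.E_trans i j p hp c d), trace_spinT_mul hp]
    simp only [Matrix.trace_add, Matrix.trace_smul, Fin.sum_univ_two, smul_eq_mul]
    ring

/-- The vector field `α^a = ⅙ tr (γ_b 𝔼^{ab})`. -/
def vector (K : 𝒮.Operator2) : 𝒮.VectorField where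
  -- For `𝔼^{ab} = e^{ab} 𝕀 + α^a γ^b + α^b γ^a` the contraction gives `4 α^a + 2 α^a`, hence the
  -- factor `1/6`.
  val i a p := 1 / 6 * ∑ b, (γ.low b * K.E i a b p).trace
  smooth i a := (𝒮.smoothIn_iff i).1 ((SmoothIn.const _).mul (SmoothIn.sum fun b _ =>
    smoothIn_trace_mul (K.E_smooth i a b) _))
  trans i j p hp c := by
    simp only [fun d => eq_spinT_mul hp (K.E_trans i j p hp c d),
      fun a b => trace_low_mul hp b (K.E i a b p)]
    simp only [Fin.sum_univ_two, Matrix.mul_add, Matrix.add_mul, Matrix.mul_smul, Matrix.smul_mul,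
      Matrix.trace_add, Matrix.trace_smul, smul_eq_mul]
    ring

/-- The trace `e^a{}_a`. -/
def traceTensor (K : 𝒮.Operator2) (i : ι) (p : M) : ℂ := ∑ a, σ.sgn a * K.symTensor.val i a a p

theorem smoothIn_traceTensor (K : 𝒮.Operator2) (i : ι) :
    SmoothIn (𝒮.chart i) (K.traceTensor i) :=
  SmoothIn.sum fun a _ => (SmoothIn.const _).mul
    ((𝒮.smoothIn_iff i).2 (K.symTensor.smooth i a a))

theorem traceTensor_trans (K : 𝒮.Operator2) {p : M} (hp : p ∈ 𝒮.dom i ∩ 𝒮.dom j) :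
    K.traceTensor i p = K.traceTensor j p := by
  have h := fun a b => sum_rot_mul_rot hp a b
  simp only [traceTensor, K.symTensor.trans i j p hp, Fin.sum_univ_two, Signature.eta] at h ⊢
  have h00 := h 0 0
  have h01 := h 0 1
  have h11 := h 1 1
  simp at h00 h01 h11
  linear_combination -K.symTensor.val i 0 0 p * h00 - K.symTensor.val i 0 1 p * h01
    - K.symTensor.val i 1 0 p * h01 - K.symTensor.val i 1 1 p * h11

theorem exists_traceTensor (K : 𝒮.Operator2) : ∃ f : M → ℂ, ContMDiff (𝓡 2) 𝓘(ℝ, ℂ) ∞ f ∧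
    ∀ i, ∀ p ∈ 𝒮.dom i, f p = K.traceTensor i p :=
  exists_contMDiff_of_local (fun i => (𝒮.smoothIn_iff i).1 (K.smoothIn_traceTensor i))
    fun _ _ _ hp => K.traceTensor_trans hp

/-- The vector field `ζ^a = ½ tr 𝔽^a + ½ ∇^a e^b{}_b`. -/
def vector' (K : 𝒮.Operator2) : 𝒮.VectorField where
  -- Half the trace of `𝔽^a` is `ζ^a + ∇_b e^{ab}`. For a Killing tensor the divergence equals `-½
  -- ∇^a e^b{}_b`, and the gradient of a globally defined trace is easier to transform than a
  -- divergence.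
  val i a p := 1 / 2 * (K.F i a p).trace + 1 / 2 * (σ.sgn a * 𝒮.grad i a (K.traceTensor i) p)
  smooth i a := (𝒮.smoothIn_iff i).1 (((SmoothIn.const _).mul (smoothIn_trace (K.F_smooth i a))).add
    ((SmoothIn.const _).mul ((SmoothIn.const _).mul (smoothIn_grad (K.smoothIn_traceTensor i) a))))
  trans i j p hp c := by
    -- The local traces coincide only on chart domains, so the gradients in the two charts are
    -- compared through one global smooth function.
    obtain ⟨f, hf, hf'⟩ := K.exists_traceTensor
    have hi := fun a => grad_congr i (fun r hr => (hf' i r hr).symm) a hp.1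
    have hj := fun a => grad_congr j (fun r hr => (hf' j r hr).symm) a hp.2
    rw [eq_spinT_mul hp (K.F_trans i j p hp c), trace_spinT_mul hp, hj]
    have h := fun b => sum_sgn_rot_mul_rot hp c b
    simp only [hi, grad_trans ((𝒮.smoothIn_iff i).2 hf.contMDiffOn) hp]
    simp only [Matrix.trace_add, Matrix.trace_smul, Fin.sum_univ_two, smul_eq_mul,
      Signature.eta] at h ⊢
    have h0 := h 0
    have h1 := h 1
    fin_cases c <;> simp at h0 h1 ⊢
    · linear_combination -𝒮.grad j 0 f p / 2 * h0 - 𝒮.grad j 1 f p / 2 * h1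
    · linear_combination -𝒮.grad j 0 f p / 2 * h0 - 𝒮.grad j 1 f p / 2 * h1

/-- There is a function `α = ¼ tr (γ_a 𝔽^a)`. -/
theorem exists_function (K : 𝒮.Operator2) : ∃ f : M → ℂ, ContMDiff (𝓡 2) 𝓘(ℝ, ℂ) ∞ f ∧
    ∀ i, ∀ p ∈ 𝒮.dom i, f p = 1 / 4 * ∑ a, (γ.low a * K.F i a p).trace := by
  -- The contraction of `γ_a` with `𝔽^a` gives `4 α` plus a multiple of the divergence of `α^a`,
  -- which is zero for a Killing vector.
  refine exists_contMDiff_of_local (fun i => (𝒮.smoothIn_iff i).1 ((SmoothIn.const _).mul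
    (SmoothIn.sum fun a _ => smoothIn_trace_mul (K.F_smooth i a) _))) fun i j p hp => ?_
  simp only [fun c => eq_spinT_mul hp (K.F_trans i j p hp c),
    fun a => trace_low_mul hp a (K.F i a p)]
  simp only [Fin.sum_univ_two, Matrix.mul_add, Matrix.add_mul, Matrix.mul_smul, Matrix.smul_mul,
    Matrix.trace_add, Matrix.trace_smul, smul_eq_mul]
  ring

/-- There is a function `g' = ½ tr 𝔾 - 3 i α^a ∇_a V - i α V`. -/
theorem exists_function' (K : 𝒮.Operator2) {V α₀ : M → ℂ} (hV : ContMDiff (𝓡 2) 𝓘(ℝ, ℂ) ∞ V)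
    (hα₀ : ContMDiff (𝓡 2) 𝓘(ℝ, ℂ) ∞ α₀) : ∃ f : M → ℂ, ContMDiff (𝓡 2) 𝓘(ℝ, ℂ) ∞ f ∧
    ∀ i, ∀ p ∈ 𝒮.dom i, f p = 1 / 2 * (K.G i p).trace
      - 3 * Complex.I * ∑ a, K.vector.val i a p * 𝒮.grad i a V p - Complex.I * α₀ p * V p := by
  refine exists_contMDiff_of_local (fun i => (𝒮.smoothIn_iff i).1 ?_) fun i j p hp => ?_
  · have h := fun a => (𝒮.smoothIn_iff i).2 (K.vector.smooth i a)
    have hV' := (𝒮.smoothIn_iff i).2 (hV.contMDiffOn (s := 𝒮.dom i))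
    exact (((SmoothIn.const _).mul (smoothIn_trace (K.G_smooth i))).sub ((SmoothIn.const _).mul
      (SmoothIn.sum fun a _ => (h a).mul (smoothIn_grad hV' a)))).sub (((SmoothIn.const _).mul
        ((𝒮.smoothIn_iff i).2 hα₀.contMDiffOn)).mul hV')
  · rw [sum_mul_grad_trans K.vector hV hp, eq_spinT_mul hp (K.G_trans i j p hp),
      trace_spinT_mul hp]

end Operator2

end

end SpinManifold

/-! ### The trace fields in null components, and the equivalence. -/

theorem DiracMatrices.trace_eq_toNormal {σ : Signature} (γ : DiracMatrices σ)
    (A : Matrix (Fin 2) (Fin 2) ℂ) : A.trace = γ.toNormal A 0 0 + γ.toNormal A 1 1 := by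
  have h : (γ.conj⁻¹ * A * γ.conj).trace = A.trace := by
    rw [Matrix.trace_mul_comm, ← mul_assoc, γ.conj_mul_inv, one_mul]
  rw [← h, Matrix.trace_fin_two]
  rfl

/-- In normal form the Dirac matrices are off-diagonal, so the contraction selects the two
off-diagonal entries, each with the null component of complementary weight. The factor `2` is `⟨X,
Y⟩`. -/
theorem DiracMatrices.trace_low_mul_eq_toNormal {σ : Signature} (γ : DiracMatrices σ)
    (A : Fin 2 → Matrix (Fin 2) (Fin 2) ℂ) : ∑ a, (γ.low a * A a).trace =
      2 * (σ.nullComp 1 (fun a => γ.toNormal (A a) 1 0)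
        + σ.nullComp 0 (fun a => γ.toNormal (A a) 0 1)) := by
  have h : ∀ a X, (γ.low a * X).trace = (σ.normalGamma a * (γ.conj⁻¹ * X * γ.conj)).trace := by
    intro a X
    rw [← mul_assoc, ← mul_assoc, ← γ.inv_conj_mul_low, Matrix.trace_mul_comm _ γ.conj, ← mul_assoc,
      ← mul_assoc, γ.conj_mul_inv, one_mul]
  have h0 : ∀ X, (σ.normalGamma 0 * X).trace = X 1 0 + σ.sgn 0 * X 0 1 := fun X => by
    rw [Matrix.trace_fin_two, Matrix.mul_apply, Matrix.mul_apply]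
    simp [Signature.normalGamma]
  have h1 : ∀ X, (σ.normalGamma 1 * X).trace =
      σ.nullRoot * X 1 0 - σ.nullRoot * σ.sgn 0 * X 0 1 := fun X => by
    rw [Matrix.trace_fin_two, Matrix.mul_apply, Matrix.mul_apply]
    simp [Signature.normalGamma, sub_eq_add_neg]
  rw [Fin.sum_univ_two, h, h, h0, h1]
  simp only [DiracMatrices.toNormal, Signature.nullComp, Matrix.cons_val_zero, Matrix.cons_val_one]
  ring

theorem Signature.sum_nullComp_mul (σ : Signature) (v w : Fin 2 → ℂ) :
    σ.nullComp 0 v * (σ.sgn 0 * w 0 + σ.sgn 1 * σ.nullRoot * w 1)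
      + σ.nullComp 1 v * (w 0 - σ.sgn 0 * σ.sgn 1 * σ.nullRoot * w 1) = ∑ a, v a * w a := by
  have h0 := σ.sgn_mul_self 0
  have h1 := σ.sgn_mul_self 1
  have hc := σ.nullRoot_mul_self
  simp only [Signature.nullComp, Matrix.cons_val_zero, Matrix.cons_val_one, Fin.sum_univ_two]
  grind

namespace SpinManifold

open FrameCalculus

variable {M : Type*} [TopologicalSpace M] [ChartedSpace Plane M] [IsManifold (𝓡 2) ∞ M]
  {σ : Signature} {γ : DiracMatrices σ} {ι : Type*} {𝒮 : SpinManifold M γ ι}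
  {q : ℝ} (𝒜 : 𝒮.Potential q) (i : ι)

variable {V Vh : M → ℂ} (hV : ContMDiff (𝓡 2) 𝓘(ℝ, ℂ) ∞ V)
  (hVh : ContMDiff (𝓡 2) 𝓘(ℝ, ℂ) ∞ Vh)
  {α₀ g' : M → ℂ} (hα₀ : ContMDiff (𝓡 2) 𝓘(ℝ, ℂ) ∞ α₀) (hg' : ContMDiff (𝓡 2) 𝓘(ℝ, ℂ) ∞ g')

/-- The trace of a symmetric tensor is four times its mixed null component, since `X` and `Y` are
null with `⟨X, Y⟩ = 2`. -/
theorem evAlg_δ_compXY_symTensor (K : 𝒮.Operator2) {p : M} (hp : p ∈ (𝒮.chart i).source)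
    (a : Fin 2) :
    evAlg ⟨p, hp⟩ ((𝒮.calculus 𝒜 i).δ a ((𝒮.calculus 𝒜 i).compXY (K.symTensor.alg i))) =
      1 / 4 * 𝒮.grad i a (K.traceTensor i) p := by
  have hc := σ.nullRoot_mul_self
  have h : Rep (𝒮.chart i) (K.traceTensor i)
      ((4 : ℂ) • (𝒮.calculus 𝒜 i).compXY (K.symTensor.alg i)) := rep_of_ev fun p hp => by
    have h0 := σ.sgn_mul_self 0
    have hs := K.symTensor.symm i 0 1 p hp
    simp only [Operator2.traceTensor, compXY, compX, compY, map_smul, map_sub, map_add,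
      smul_eq_mul, calculus_c, evAlg_tensorAlg, Fin.sum_univ_two, hs]
    grind
  have h' := (Rep.grad 𝒮 𝒜 i h a).ev hp
  rw [Derivation.map_smul, map_smul, smul_eq_mul] at h'
  rw [← h']
  ring

/-- Whenever the coefficients have the explicit form with some null fields `T`, these are recovered
by the trace formulas, so the local algebraic solution consists of components of global fields. `Yb`
and `Xb` are needed for `ζ^a` to convert the divergence of `e^{ab}` into the gradient of its trace.
-/
theorem nullFields_eq (K : 𝒮.Operator2)
    (h0 : ∀ p ∈ 𝒮.dom i, α₀ p = 1 / 4 * ∑ a, (γ.low a * K.F i a p).trace)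
    (h1 : ∀ p ∈ 𝒮.dom i, g' p = 1 / 2 * (K.G i p).trace
      - 3 * Complex.I * ∑ a, K.vector.val i a p * 𝒮.grad i a V p - Complex.I * α₀ p * V p)
    {T : NullCalculus.Fields (Graded (𝒮.Alg i))} (hT : T.IsTensor (𝒮.calculus 𝒜 i).toNull)
    (hE : (𝒮.calculus 𝒜 i).toNull.Explicit
      ((𝒮.calculus 𝒜 i).coeffs (K.algE i) (K.algF i) (K.algG i))
      (hom 0 (𝒮.potentials i hV hVh 0)) (hom 0 (𝒮.potentials i hV hVh 1)) T)
    (hD : (𝒮.calculus 𝒜 i).toNull.Determining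
      (hom 0 (𝒮.potentials i hV hVh 0)) (hom 0 (𝒮.potentials i hV hVh 1)) T) :
    nullFields 𝒜 i K.symTensor K.vector K.vector' hα₀ hg' = T := by
  have hN := isTensor_nullFields 𝒜 i K.symTensor K.vector K.vector' hα₀ hg'
  have hE₀ : ∀ a b p, K.symTensor.val i a b p =
      1 / 2 * (γ.toNormal (K.E i a b p) 0 0 + γ.toNormal (K.E i a b p) 1 1) := fun a b p => by
    rw [← γ.trace_eq_toNormal]; rfl
  have ea : (nullFields 𝒜 i K.symTensor K.vector K.vector' hα₀ hg').a = T.a := by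
    refine hN.a.ext hT.a fun ⟨p, hp⟩ => ?_
    have e0 := (gradedEv_coeffs 𝒜 i K hp 0 0).1
    have e1 := (gradedEv_coeffs 𝒜 i K hp 1 1).1
    rw [hE.a00] at e0
    rw [hE.a11] at e1
    simp only [toNull_ev, nullFields, gradedEv_hom_evAlg, compXX, evAlg_compX, evAlg_tensorAlg, hE₀]
    simp only [Signature.nullComp, Matrix.cons_val_zero, Matrix.cons_val_one] at e0 e1 ⊢
    linear_combination (-e0 - e1) / 2
  have eb : (nullFields 𝒜 i K.symTensor K.vector K.vector' hα₀ hg').b = T.b := by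
    refine hN.b.ext hT.b fun ⟨p, hp⟩ => ?_
    have e0 := (gradedEv_coeffs 𝒜 i K hp 0 0).2.1
    have e1 := (gradedEv_coeffs 𝒜 i K hp 1 1).2.1
    rw [hE.b00] at e0
    rw [hE.b11] at e1
    simp only [toNull_ev, nullFields, gradedEv_hom_evAlg, compXY, evAlg_compX, evAlg_compY,
      evAlg_tensorAlg, hE₀]
    simp only [Signature.nullComp, Matrix.cons_val_zero, Matrix.cons_val_one] at e0 e1 ⊢
    linear_combination (-e0 - e1) / 2
  have ed : (nullFields 𝒜 i K.symTensor K.vector K.vector' hα₀ hg').d = T.d := by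
    refine hN.d.ext hT.d fun ⟨p, hp⟩ => ?_
    have e0 := (gradedEv_coeffs 𝒜 i K hp 0 0).2.2.1
    have e1 := (gradedEv_coeffs 𝒜 i K hp 1 1).2.2.1
    rw [hE.d00] at e0
    rw [hE.d11] at e1
    simp only [toNull_ev, nullFields, gradedEv_hom_evAlg, compYY, evAlg_compX, evAlg_compY,
      evAlg_tensorAlg, hE₀]
    simp only [Signature.nullComp, Matrix.cons_val_zero, Matrix.cons_val_one] at e0 e1 ⊢
    linear_combination (-e0 - e1) / 2
  have hα : ∀ a p, K.vector.val i a p = 1 / 6 * (2 *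
      (σ.nullComp 1 (fun b => γ.toNormal (K.E i a b p) 1 0)
        + σ.nullComp 0 (fun b => γ.toNormal (K.E i a b p) 0 1))) := fun a p => by
    rw [← γ.trace_low_mul_eq_toNormal]; rfl
  have eP : (nullFields 𝒜 i K.symTensor K.vector K.vector' hα₀ hg').P = T.P := by
    refine hN.P.ext hT.P fun ⟨p, hp⟩ => ?_
    have e0 := (gradedEv_coeffs 𝒜 i K hp 1 0).2.1
    have e1 := (gradedEv_coeffs 𝒜 i K hp 0 1).1
    rw [hE.b10] at e0
    rw [hE.a01, map_mul, map_ofNat] at e1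
    simp only [toNull_ev, nullFields, gradedEv_hom_evAlg, evAlg_compX, evAlg_compY,
      evAlg_alg, hα]
    simp only [Signature.nullComp, Matrix.cons_val_zero, Matrix.cons_val_one] at e0 e1 ⊢
    linear_combination (-e0 - e1) / 3
  have eQ : (nullFields 𝒜 i K.symTensor K.vector K.vector' hα₀ hg').Q = T.Q := by
    refine hN.Q.ext hT.Q fun ⟨p, hp⟩ => ?_
    have e0 := (gradedEv_coeffs 𝒜 i K hp 1 0).2.2.1
    have e1 := (gradedEv_coeffs 𝒜 i K hp 0 1).2.1
    have hs : ∀ k l, γ.toNormal (K.E i 1 0 p) k l = γ.toNormal (K.E i 0 1 p) k l := fun k l => by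
      rw [K.E_symm i 1 0 p hp]
    rw [hE.d10, map_mul, map_ofNat] at e0
    rw [hE.b01] at e1
    simp only [toNull_ev, nullFields, gradedEv_hom_evAlg, evAlg_compX, evAlg_compY,
      evAlg_alg, hα]
    simp only [Signature.nullComp, Matrix.cons_val_zero, Matrix.cons_val_one, hs] at e0 e1 ⊢
    linear_combination (-e0 - e1) / 3
  have hζ : ∀ a p, K.vector'.val i a p =
      1 / 2 * (γ.toNormal (K.F i a p) 0 0 + γ.toNormal (K.F i a p) 1 1)
        + 1 / 2 * (σ.sgn a * 𝒮.grad i a (K.traceTensor i) p) := fun a p => by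
    rw [← γ.trace_eq_toNormal]; rfl
  have hs0 := σ.sgn_mul_self 0
  have hc := σ.nullRoot_mul_self
  have et₁ : (nullFields 𝒜 i K.symTensor K.vector K.vector' hα₀ hg').t₁ = T.t₁ := by
    refine hN.t₁.ext hT.t₁ fun ⟨p, hp⟩ => ?_
    have e0 := (gradedEv_coeffs 𝒜 i K hp 0 0).2.2.2.1
    have e1 := (gradedEv_coeffs 𝒜 i K hp 1 1).2.2.2.1
    -- This Killing equation replaces `X T.a`, which enters the trace of `𝔽` through `f00`, by the
    -- gradient of `e^b{}_b`.
    have e2 := congrArg ((𝒮.calculus 𝒜 i).gradedEv ⟨p, hp⟩) hD.Yb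
    rw [hE.f00] at e0
    rw [hE.f11] at e1
    rw [← eb, nullFields, map_add, map_mul, map_ofNat, gradedEv_Y_hom] at e2
    simp only [covDeriv_apply, Prod.fst_zero, Prod.snd_zero, Int.cast_zero, zero_mul, zero_smul,
      add_zero, sub_zero, calculus_ev, evAlg_δ_compXY_symTensor, map_zero, calculus_c] at e2
    simp only [toNull_ev, nullFields, gradedEv_hom_evAlg, evAlg_compX, evAlg_compY,
      evAlg_alg, hζ]
    simp only [Signature.nullComp, Matrix.cons_val_zero, Matrix.cons_val_one, map_add, map_sub,
      map_mul] at e0 e1 e2 ⊢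
    linear_combination (-e0 - e1 + e2) / 2 + 1 / 4 * 𝒮.grad i 0 (K.traceTensor i) p * hs0
  have et₂ : (nullFields 𝒜 i K.symTensor K.vector K.vector' hα₀ hg').t₂ = T.t₂ := by
    refine hN.t₂.ext hT.t₂ fun ⟨p, hp⟩ => ?_
    have e0 := (gradedEv_coeffs 𝒜 i K hp 0 0).2.2.2.2.1
    have e1 := (gradedEv_coeffs 𝒜 i K hp 1 1).2.2.2.2.1
    have e2 := congrArg ((𝒮.calculus 𝒜 i).gradedEv ⟨p, hp⟩) hD.Xb
    rw [hE.h00] at e0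
    rw [hE.h11] at e1
    rw [← eb, nullFields, map_add, map_mul, map_ofNat, gradedEv_X_hom] at e2
    simp only [covDeriv_apply, Prod.fst_zero, Prod.snd_zero, Int.cast_zero, zero_mul, zero_smul,
      add_zero, sub_zero, calculus_ev, evAlg_δ_compXY_symTensor, map_zero, calculus_c] at e2
    simp only [toNull_ev, nullFields, gradedEv_hom_evAlg, evAlg_compX, evAlg_compY,
      evAlg_alg, hζ]
    simp only [Signature.nullComp, Matrix.cons_val_zero, Matrix.cons_val_one, map_add, map_sub,
      map_mul] at e0 e1 e2 ⊢
    linear_combination (-e0 - e1 + e2) / 2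
  have eal : (nullFields 𝒜 i K.symTensor K.vector K.vector' hα₀ hg').al = T.al := by
    refine hN.al.ext hT.al fun ⟨p, hp⟩ => ?_
    have e0 := (gradedEv_coeffs 𝒜 i K hp 1 0).2.2.2.2.1
    have e1 := (gradedEv_coeffs 𝒜 i K hp 0 1).2.2.2.1
    rw [hE.h10, map_sub] at e0
    rw [hE.f01, map_add] at e1
    simp only [toNull_ev, nullFields, gradedEv_hom_evAlg, evAlg_funAlg]
    rw [h0 p hp, γ.trace_low_mul_eq_toNormal, ← e0, ← e1]
    ring
  have eg : (nullFields 𝒜 i K.symTensor K.vector K.vector' hα₀ hg').g = T.g := by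
    refine hN.g.ext hT.g fun ⟨p, hp⟩ => ?_
    have e0 := (gradedEv_coeffs 𝒜 i K hp 0 0).2.2.2.2.2
    have e1 := (gradedEv_coeffs 𝒜 i K hp 1 1).2.2.2.2.2
    have e2 := congrArg ((𝒮.calculus 𝒜 i).gradedEv ⟨p, hp⟩) (congrArg₂ (· + ·) hE.g00 hE.g11)
    rw [hom_potentials_add, ← eP, ← eQ, ← eal] at e2
    simp only [nullFields, map_add, map_sub, map_mul, map_ofNat, gradedEv_X_hom, gradedEv_Y_hom,
      e0, e1, Derivation.map_smul, map_smul, calculus_ev, evAlg_covDeriv_funAlg, calculus_c,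
      gradedEv_hom_evAlg, evAlg_compX, evAlg_compY, evAlg_alg, evAlg_funAlg, smul_eq_mul] at e2
    simp only [toNull_ev, nullFields, gradedEv_hom_evAlg, evAlg_funAlg]
    rw [h1 p hp, γ.trace_eq_toNormal, Fin.sum_univ_two]
    have e3 := σ.sum_nullComp_mul (fun a => K.vector.val i a p) fun a => 𝒮.grad i a V p
    rw [Fin.sum_univ_two] at e3
    linear_combination e2 / 4 + 3 * Complex.I * e3
  cases T
  exact NullCalculus.Fields.mk.injEq .. ▸ ⟨ea, eb, ed, eP, eQ, et₁, et₂, eal, eg⟩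

variable {i}

theorem isSymmetryOperator_iff_exists [T2Space M] (K : 𝒮.Operator2)
    (hV : ContMDiff (𝓡 2) 𝓘(ℝ, ℂ) ∞ V) (hVh : ContMDiff (𝓡 2) 𝓘(ℝ, ℂ) ∞ Vh) :
    K.IsSymmetryOperator 𝒜 V Vh ↔
      ∃ (e : 𝒮.SymTensorField) (α ζ : 𝒮.VectorField) (α₀ g' : M → ℂ),
        ContMDiff (𝓡 2) 𝓘(ℝ, ℂ) ∞ α₀ ∧ ContMDiff (𝓡 2) 𝓘(ℝ, ℂ) ∞ g' ∧
        𝒮.HasExplicitForm 𝒜 V Vh K e α ζ α₀ g' ∧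
        𝒮.DeterminingEquations 𝒜 V Vh e α ζ α₀ g' ∧
        𝒮.IntegrabilityConditions 𝒜 V Vh e α ζ := by
  have hK := fun i => (𝒮.calculus 𝒜 i).isTensor_coeffs (K.algE i) (K.algF i) (K.algG i)
  have hu := fun i => (𝒮.calculus 𝒜 i).tensor_hom 0 (𝒮.potentials i hV hVh 0)
  have hv := fun i => (𝒮.calculus 𝒜 i).tensor_hom 0 (𝒮.potentials i hV hVh 1)
  rw [isSymmetryOperator_iff 𝒜 K hV hVh]
  constructor
  · intro h
    obtain ⟨α₀, hα₀, h0⟩ := K.exists_function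
    obtain ⟨g', hg', h1⟩ := K.exists_function' hV hα₀
    have hT := fun i => (hK i).fields (hu i) (hv i)
    have hE := fun i => NullCalculus.explicit_of_commutatorCoeff_eq_zero (hK i) (hu i) (hv i) (h i)
    -- The same global trace fields serve in every chart, so the algebraic conclusions can be
    -- transferred to them chart by chart.
    have hN := fun i => nullFields_eq 𝒜 i hV hVh hα₀ hg' K (h0 i) (h1 i) (hT i) (hE i).1 (hE i).2.1
    simp only [← hN] at hE
    have hD := fun i => (determining_nullFields_iff 𝒜 i hV hVh _ _ _ hα₀ hg').1 (hE i).2.1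
    have hX := fun i => (explicit_nullFields_iff 𝒜 i hV hVh _ _ _ hα₀ hg' K (hD i)).1 (hE i).1
    have hF := fun i => (final_nullFields_iff 𝒜 i hV hVh _ _ _ hα₀ hg' (hD i)).1 (hE i).2.2
    exact ⟨K.symTensor, K.vector, K.vector', α₀, g', hα₀, hg',
      ⟨fun i p hp => (hX i p hp).E_eq, fun i p hp => (hX i p hp).F_eq,
        fun i p hp => (hX i p hp).G_eq⟩,
      ⟨fun i p hp => (hD i p hp).killing_tensor, fun i p hp => (hD i p hp).killing_vector,
        fun i p hp => (hD i p hp).grad_α₀, fun i p hp => (hD i p hp).sym_grad_ζ,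
        fun i p hp => (hF i p hp).grad_g'⟩,
      integrabilityConditions 𝒜 hV hα₀ hg' hD hF⟩
  · rintro ⟨e, α, ζ, α₀, g', hα₀, hg', hX, hD, hI⟩ i
    have hD' : ∀ p ∈ 𝒮.dom i, LocalDetermining 𝒜 i V e α ζ α₀ p := fun p hp =>
      ⟨hD.killing_tensor i p hp, hD.killing_vector i p hp, hD.grad_α₀ i p hp, hD.sym_grad_ζ i p hp⟩
    -- Of the integrability conditions only those on `ζ^a ∇_a V` and `ζ^a ∇_a V̂` enter here; the
    -- others are consequences.
    exact NullCalculus.commutatorCoeff_eq_zero (isTensor_nullFields 𝒜 i e α ζ hα₀ hg') (hu i) (hv i)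
      ((explicit_nullFields_iff 𝒜 i hV hVh e α ζ hα₀ hg' K hD').2 fun p hp =>
        ⟨hX.E_eq i p hp, hX.F_eq i p hp, hX.G_eq i p hp⟩)
      ((determining_nullFields_iff 𝒜 i hV hVh e α ζ hα₀ hg').2 hD')
      ((final_nullFields_iff 𝒜 i hV hVh e α ζ hα₀ hg' hD').2 fun p hp =>
        ⟨hD.grad_g' i p hp, hI.grad_V i p hp, hI.grad_Vh i p hp⟩)

end SpinManifold

end SpinSurface

end

theorem mainTheorem1 {M : Type*} [TopologicalSpace M] [T2Space M] [ParacompactSpace M]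
    [ConnectedSpace M] [ChartedSpace SpinSurface.Plane M] [IsManifold (𝓡 2) ∞ M]
    {σ : SpinSurface.Signature} {γ : SpinSurface.DiracMatrices σ} {ι : Type*}
    (𝒮 : SpinSurface.SpinManifold M γ ι) {q : ℝ} (𝒜 : 𝒮.Potential q)
    (V Vh : M → ℂ) (hV : ContMDiff (𝓡 2) 𝓘(ℝ, ℂ) ∞ V) (hVh : ContMDiff (𝓡 2) 𝓘(ℝ, ℂ) ∞ Vh)
    (K : 𝒮.Operator2) :
    K.IsSymmetryOperator 𝒜 V Vh ↔
      ∃ (e : 𝒮.SymTensorField) (α ζ : 𝒮.VectorField) (α₀ g' : M → ℂ),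
        ContMDiff (𝓡 2) 𝓘(ℝ, ℂ) ∞ α₀ ∧ ContMDiff (𝓡 2) 𝓘(ℝ, ℂ) ∞ g' ∧
        𝒮.HasExplicitForm 𝒜 V Vh K e α ζ α₀ g' ∧
        𝒮.DeterminingEquations 𝒜 V Vh e α ζ α₀ g' ∧
        𝒮.IntegrabilityConditions 𝒜 V Vh e α ζ := SpinSurface.SpinManifold.isSymmetryOperator_iff_exists 𝒜 K hV hVh
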